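/- Let $n\ge 1$ and let $Q(n)=\left\{\begin{pmatrix}A&B\\B&A\end{pmatrix}: A,B\in M_n(\mathbb C)\right\}$ be the queer Lie superalgebra ($B=0$: even, $A=0$: odd) with the supercommutator as bracket. It has the even basis $e_{i,j}$ ($A=E_{ij}$, $B=0$) and the odd basis $f_{i,j}$ ($A=0$, $B=E_{ij}$); give $e_{i,j}$ and $f_{i,j}$ degree $2(j-i)$, and let $\mathfrak m$ be the sum of the components of negative degree. Let $\chi$ be the even regular nilpotent functional $\chi(x)=\operatorname{otr}\big(x\sum_{i=1}^{n-1}f_{i,i+1}\big)$, where $\operatorname{otr}\begin{pmatrix}A&B\\B&A\end{pmatrix}=\operatorname{tr}B$. Let $U=U(Q(n))$ be the enveloping superalgebra, $I_\chi$ the left ideal of $U$ generated by all $a-\chi(a)$ with $a\in\mathfrak m$, $\pi:U\to Q_\chi=U/I_\chi$ the projection, and $W_\chi=\operatorname{End}_U(Q_\chi)^{\mathrm{op}}$ the finite $W$-algebra. It is identified, by $w\mapsto w(\pi(1))$, with the space of all $\pi(y)$ such that $(a-\chi(a))y\in I_\chi$ for all $a\in\mathfrak m$, with product $\pi(y_1)\pi(y_2)=\pi(y_1y_2)$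 and with the $\mathbb Z/2$-grading induced from $U$. Define $e^{(m)}_{i,j},f^{(m)}_{i,j}\in U$ by $e^{(1)}_{i,j}=e_{i,j}$, $f^{(1)}_{i,j}=f_{i,j}$ and, for $m\ge2$, $$e_{i,j}^{(m)}=\sum_{k=1}^n e_{i,k}e_{k,j}^{(m-1)}+(-1)^{m+1}\sum_{k=1}^n f_{i,k}f_{k,j}^{(m-1)},\qquad f_{i,j}^{(m)}=\sum_{k=1}^n e_{i,k}f_{k,j}^{(m-1)}+(-1)^{m+1}\sum_{k=1}^n f_{i,k}e_{k,j}^{(m-1)}.$$ The elements $\pi(e_{n,1}^{(m)})$ and $\pi(f_{n,1}^{(m)})$ lie in $W_\chi$. Writing $[\cdot,\cdot]$ for the supercommutator, put, for all integers $k,i\ge0$, $$\Phi_0=\pi(f_{n,1}^{(n)}),\qquad \Phi_{k+1}=\tfrac12\big[\pi(e_{n,1}^{(n+1)}),\Phi_k\big],\qquad z_i=\begin{cases}[\Phi_0,\Phi_i]=\Phi_0\Phi_i+\Phi_i\Phi_0,& i\text{ even},\\ \pi(e_{n,1}^{(n+i)}),& i\text{ odd}.\end{cases}$$ **Theorem.**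 All $z_i$ are even and all $\Phi_k$ are odd elements of $W_\chi$, and: 1. $z_0,\dots,z_{n-1}$ are algebraically independent in $W_\chi$, that is, there is an injective homomorphism of $\mathbb C$-algebras $\mathbb C[X_0,\dots,X_{n-1}]\to W_\chi$ with $X_i\mapsto z_i$. 2. $z_0,\dots,z_{n-1},\Phi_0,\dots,\Phi_{n-1}$ generate the algebra $W_\chi$. 3. $z_iz_j=z_jz_i$ for all $i,j\ge0$. 4. For all $m,p\ge0$ the commutator $[\Phi_m,\Phi_p]=\Phi_m\Phi_p+\Phi_p\Phi_m$ equals $(-1)^m z_{m+p}$ if $m+p$ is even and $0$ if $m+p$ is odd. It lies in the center of $W_\chi$, and it is the image under $\pi$ of an even element of the center of $U(Q(n))$. -/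

import Mathlib

namespace QueerW

open Matrix

noncomputable section

/-! ### The queer Lie superalgebra -/

/-- The underlying space of `Q(n)`: block matrices with equal diagonal blocks and equal off-diagonal
blocks. It is closed under the matrix product, from which the superbracket is made. -/
def queer (n : ℕ) : Subalgebra ℂ (Matrix (Fin n ⊕ Fin n) (Fin n ⊕ Fin n) ℂ) where
  carrier := {M | ∃ A B : Matrix (Fin n) (Fin n) ℂ, M = fromBlocks A B B A}
  mul_mem' := by
    rintro _ _ ⟨A, B, rfl⟩ ⟨C, D, rfl⟩
    refine ⟨A * C + B * D, A * D + B * C, ?_⟩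
    rw [fromBlocks_multiply, add_comm (B * C), add_comm (B * D) (A * C)]
  add_mem' := by
    rintro _ _ ⟨A, B, rfl⟩ ⟨C, D, rfl⟩
    exact ⟨A + C, B + D, fromBlocks_add _ _ _ _ _ _ _ _⟩
  algebraMap_mem' := fun r => by
    refine ⟨algebraMap ℂ _ r, 0, ?_⟩
    ext (i | i) (j | j) <;> simp [Matrix.algebraMap_matrix_apply]

/-- The element of `Q(n)` with diagonal block `A` and off-diagonal block `B`. -/
def blocks {n : ℕ} (A B : Matrix (Fin n) (Fin n) ℂ) : queer n :=
  ⟨fromBlocks A B B A, A, B, rfl⟩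

/-- The homogeneous component of `Q(n)` of parity `p`. -/
def queerPart (n : ℕ) (p : ZMod 2) : Set (queer n) :=
  if p = 0 then {x | ∃ A, x = blocks A 0} else {x | ∃ B, x = blocks 0 B}

/-- The even basis element `e_{i,j}`. -/
def qe {n : ℕ} (i j : Fin n) : queer n := blocks (Matrix.single i j 1) 0

/-- The odd basis element `f_{i,j}`. -/
def qf {n : ℕ} (i j : Fin n) : queer n := blocks 0 (Matrix.single i j 1)

/-- The odd trace: the trace of the off-diagonal block. -/
def otr {n : ℕ} : queer n →ₗ[ℂ] ℂ where
  toFun x := (x : Matrix (Fin n ⊕ Fin n) (Fin n ⊕ Fin n) ℂ).toBlocks₁₂.trace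
  map_add' x y := by simp [Matrix.trace, Matrix.toBlocks₁₂, Finset.sum_add_distrib]
  map_smul' c x := by simp [Matrix.trace, Matrix.toBlocks₁₂, Finset.mul_sum]

/-- The odd element `E = f_{1,2} + ⋯ + f_{n-1,n}`. -/
def qE (n : ℕ) : queer n :=
  ∑ i : Fin n, ∑ j : Fin n, if (i : ℕ) + 1 = (j : ℕ) then qf i j else 0

/-- The even regular nilpotent functional `χ(x) = (x | E) = otr (x E)`. -/
def chi (n : ℕ) : queer n →ₗ[ℂ] ℂ := otr ∘ₗ LinearMap.mulRight ℂ (qE n)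

/-- The component of degree `k` in the Dynkin grading: `e_{i,j}` and `f_{i,j}` have degree
`2(j - i)`. -/
def queerDeg (n : ℕ) (k : ℤ) : Submodule ℂ (queer n) :=
  Submodule.span ℂ {x | ∃ i j : Fin n, 2 * ((j : ℤ) - (i : ℤ)) = k ∧ (x = qe i j ∨ x = qf i j)}

/-- The nilpotent subalgebra `𝔪`, the sum of the components of degree `-2, -4, …`. -/
def nilp (n : ℕ) : Submodule ℂ (queer n) := ⨆ j : ℕ, queerDeg n (-2 * ((j : ℤ) + 1))

/-! ### The universal enveloping superalgebra -/

/-- The sign `(-1)^{pq}`. -/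
def sgn (p q : ZMod 2) : ℂ := (-1) ^ (p.val * q.val)

/-- The relations `x y - (-1)^{|x||y|} y x = [x, y]` for homogeneous `x`, `y` in `Q(n)`, where
`[x, y]` is the supercommutator of matrices. -/
inductive EnvRel (n : ℕ) : TensorAlgebra ℂ (queer n) → TensorAlgebra ℂ (queer n) → Prop
  | bracket (p q : ZMod 2) (x y : queer n) (hx : x ∈ queerPart n p) (hy : y ∈ queerPart n q) :
      EnvRel n
        (TensorAlgebra.ι ℂ x * TensorAlgebra.ι ℂ y
          - sgn p q • (TensorAlgebra.ι ℂ y * TensorAlgebra.ι ℂ x))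
        (TensorAlgebra.ι ℂ (x * y - sgn p q • (y * x)))

/-- The universal enveloping superalgebra `U(Q(n))`. -/
def Env (n : ℕ) : Type := RingQuot (EnvRel n)

instance (n : ℕ) : Ring (Env n) := inferInstanceAs (Ring (RingQuot (EnvRel n)))

instance (n : ℕ) : Algebra ℂ (Env n) := inferInstanceAs (Algebra ℂ (RingQuot (EnvRel n)))

/-- The quotient map from the tensor algebra to `U(Q(n))`. -/
def envMk (n : ℕ) : TensorAlgebra ℂ (queer n) →ₐ[ℂ] Env n := RingQuot.mkAlgHom ℂ (EnvRel n)

/-- The canonical map `Q(n) → U(Q(n))`. -/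
def envι (n : ℕ) : queer n →ₗ[ℂ] Env n :=
  (envMk n).toLinearMap ∘ₗ TensorAlgebra.ι ℂ

/-- The homogeneous component of `U(Q(n))` of parity `p`: the span of the products of homogeneous
elements of `Q(n)` whose parities add up to `p`. -/
def envPart (n : ℕ) (p : ZMod 2) : Submodule ℂ (Env n) :=
  Submodule.span ℂ {u | ∃ l : List (ZMod 2 × queer n), (∀ t ∈ l, t.2 ∈ queerPart n t.1) ∧
    (l.map Prod.fst).sum = p ∧ u = (l.map fun t => envι n t.2).prod}

/-- Sergeev's elements, as the pair `(e_{i,j}^{(m)}, f_{i,j}^{(m)})`. The recursion is started at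
`e_{i,j}^{(0)} = δ_{i,j}`, `f_{i,j}^{(0)} = 0`, so that `e_{i,j}^{(1)} = e_{i,j}` and
`f_{i,j}^{(1)} = f_{i,j}`. -/
def sergeev (n : ℕ) : ℕ → Fin n → Fin n → Env n × Env n
  | 0, i, j => (if i = j then 1 else 0, 0)
  | m + 1, i, j =>
    (∑ k, envι n (qe i k) * (sergeev n m k j).1
        + (-1 : ℂ) ^ m • ∑ k, envι n (qf i k) * (sergeev n m k j).2,
      ∑ k, envι n (qe i k) * (sergeev n m k j).2
        + (-1 : ℂ) ^ m • ∑ k, envι n (qf i k) * (sergeev n m k j).1)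

/-- `e_{i,j}^{(m)}` -/
def sE {n : ℕ} (m : ℕ) (i j : Fin n) : Env n := (sergeev n m i j).1

/-- `f_{i,j}^{(m)}` -/
def sF {n : ℕ} (m : ℕ) (i j : Fin n) : Env n := (sergeev n m i j).2

/-! ### The finite W-algebra -/

/-- The left ideal `I_χ` generated by `a - χ(a)`, `a ∈ 𝔪`. -/
def whitIdeal (n : ℕ) : Submodule (Env n) (Env n) :=
  Submodule.span (Env n)
    {u | ∃ a ∈ nilp n, u = envι n a - algebraMap ℂ (Env n) (chi n a)}

/-- The generalized Whittaker module `Q_χ = U(Q(n)) / I_χ`. -/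
abbrev Whit (n : ℕ) : Type := Env n ⧸ whitIdeal n

/-- The projection `π : U(Q(n)) → U(Q(n)) / I_χ`. -/
def proj (n : ℕ) : Env n →ₗ[Env n] Whit n := (whitIdeal n).mkQ

/-- The finite W-algebra `W_χ = End_{U(Q(n))}(Q_χ)ᵒᵖ`. -/
abbrev W (n : ℕ) : Type := (Module.End (Env n) (Whit n))ᵐᵒᵖ

/-- The identification of `W_χ` with the subspace of `𝔪`-invariants of `Q_χ`: an endomorphism goes
to its value at the generator `π(1)`. -/
def toWhit {n : ℕ} (w : W n) : Whit n := w.unop (proj n 1)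

/-- The endomorphism `π(u) ↦ π(u y)`, that is, the element `π(y)` of `W_χ`, for `y` with
`(a - χ(a)) y ∈ I_χ` for all `a ∈ 𝔪`. -/
def ofInvariant {n : ℕ} (y : Env n)
    (hy : ∀ a ∈ nilp n, (envι n a - algebraMap ℂ (Env n) (chi n a)) * y ∈ whitIdeal n) : W n :=
  MulOpposite.op ((whitIdeal n).mapQ (whitIdeal n) (LinearMap.toSpanSingleton (Env n) (Env n) y) (by
    rw [whitIdeal, Submodule.span_le]
    rintro _ ⟨a, ha, rfl⟩
    exact hy a ha))

theorem toWhit_ofInvariant {n : ℕ} (y : Env n)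
    (hy : ∀ a ∈ nilp n, (envι n a - algebraMap ℂ (Env n) (chi n a)) * y ∈ whitIdeal n) :
    toWhit (ofInvariant y hy) = proj n y := by
  simp [toWhit, ofInvariant, proj]

/-- `w ∈ W_χ` is homogeneous of parity `p`, for the ℤ/2-grading induced from `U(Q(n))`. -/
def HasParity {n : ℕ} (p : ZMod 2) (w : W n) : Prop :=
  ∃ y ∈ envPart n p, toWhit w = proj n y

/-! ### The elements of the W-algebra given by Sergeev's elements -/

theorem qe_even {n : ℕ} (i j : Fin n) : qe i j ∈ queerPart n 0 := by
  simp only [queerPart, if_true]; exact ⟨_, rfl⟩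

theorem qf_odd {n : ℕ} (i j : Fin n) : qf i j ∈ queerPart n 1 := by
  simp only [queerPart, one_ne_zero, if_false]; exact ⟨_, rfl⟩

theorem env_bracket {n : ℕ} (p q : ZMod 2) (x y : queer n) (hx : x ∈ queerPart n p)
    (hy : y ∈ queerPart n q) :
    envι n x * envι n y - sgn p q • (envι n y * envι n x)
      = envι n (x * y - sgn p q • (y * x)) := by
  have h : envMk n _ = envMk n _ := RingQuot.mkAlgHom_rel ℂ (EnvRel.bracket p q x y hx hy)
  rw [map_sub, map_mul, map_smul, map_mul] at h
  exact h

theorem blocks_mul {n : ℕ} (A B C D : Matrix (Fin n) (Fin n) ℂ) :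
    blocks A B * blocks C D = blocks (A * C + B * D) (A * D + B * C) := by
  apply Subtype.ext
  simp [blocks, fromBlocks_multiply, add_comm]

theorem blocks_add {n : ℕ} (A B C D : Matrix (Fin n) (Fin n) ℂ) :
    blocks A B + blocks C D = blocks (A + C) (B + D) := by
  apply Subtype.ext
  simp [blocks, fromBlocks_add]

theorem blocks_zero {n : ℕ} : blocks (0 : Matrix (Fin n) (Fin n) ℂ) 0 = 0 := by
  apply Subtype.ext
  simp [blocks]

theorem qe_mul_qe {n : ℕ} (i j k l : Fin n) :
    qe i j * qe k l = if j = k then qe i l else 0 := by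
  by_cases h : j = k
  · subst h; simp [qe, blocks_mul]
  · simp [qe, blocks_mul, h, blocks_zero]

theorem qe_mul_qf {n : ℕ} (i j k l : Fin n) :
    qe i j * qf k l = if j = k then qf i l else 0 := by
  by_cases h : j = k
  · subst h; simp [qe, qf, blocks_mul]
  · simp [qe, qf, blocks_mul, h, blocks_zero]

theorem qf_mul_qe {n : ℕ} (i j k l : Fin n) :
    qf i j * qe k l = if j = k then qf i l else 0 := by
  by_cases h : j = k
  · subst h; simp [qe, qf, blocks_mul]
  · simp [qe, qf, blocks_mul, h, blocks_zero]

theorem qf_mul_qf {n : ℕ} (i j k l : Fin n) :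
    qf i j * qf k l = if j = k then qe i l else 0 := by
  by_cases h : j = k
  · subst h; simp [qe, qf, blocks_mul]
  · simp [qf, blocks_mul, h, blocks_zero]

theorem sgn_zero_left (q : ZMod 2) : sgn 0 q = 1 := by simp [sgn]

theorem sgn_zero_right (p : ZMod 2) : sgn p 0 = 1 := by simp [sgn]

theorem sgn_one_one : sgn 1 1 = -1 := by simp [sgn, ZMod.val_one]

theorem env_ee {n : ℕ} (i j k a : Fin n) : envι n (qe i j) * envι n (qe k a)
    = envι n (qe k a) * envι n (qe i j) + (if j = k then envι n (qe i a) else 0)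
      - (if a = i then envι n (qe k j) else 0) := by
  have h := env_bracket 0 0 _ _ (qe_even i j) (qe_even k a)
  rw [sgn_zero_left, one_smul, one_smul, qe_mul_qe, qe_mul_qe, map_sub, apply_ite (envι n),
    apply_ite (envι n), map_zero, sub_eq_iff_eq_add] at h
  rw [h]; abel

theorem env_ef {n : ℕ} (i j k a : Fin n) : envι n (qe i j) * envι n (qf k a)
    = envι n (qf k a) * envι n (qe i j) + (if j = k then envι n (qf i a) else 0)
      - (if a = i then envι n (qf k j) else 0) := by
  have h := env_bracket 0 1 _ _ (qe_even i j) (qf_odd k a)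
  rw [sgn_zero_left, one_smul, one_smul, qe_mul_qf, qf_mul_qe, map_sub, apply_ite (envι n),
    apply_ite (envι n), map_zero, sub_eq_iff_eq_add] at h
  rw [h]; abel

theorem env_fe {n : ℕ} (i j k a : Fin n) : envι n (qf i j) * envι n (qe k a)
    = envι n (qe k a) * envι n (qf i j) + (if j = k then envι n (qf i a) else 0)
      - (if a = i then envι n (qf k j) else 0) := by
  have h := env_bracket 1 0 _ _ (qf_odd i j) (qe_even k a)
  rw [sgn_zero_right, one_smul, one_smul, qe_mul_qf, qf_mul_qe, map_sub, apply_ite (envι n),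
    apply_ite (envι n), map_zero, sub_eq_iff_eq_add] at h
  rw [h]; abel

theorem env_ff {n : ℕ} (i j k a : Fin n) : envι n (qf i j) * envι n (qf k a)
    = -(envι n (qf k a) * envι n (qf i j)) + (if j = k then envι n (qe i a) else 0)
      + (if a = i then envι n (qe k j) else 0) := by
  have h := env_bracket 1 1 _ _ (qf_odd i j) (qf_odd k a)
  rw [sgn_one_one, neg_one_smul, neg_one_smul, qf_mul_qf, qf_mul_qf, sub_neg_eq_add,
    sub_neg_eq_add, map_add, apply_ite (envι n), apply_ite (envι n), map_zero,
    ← eq_sub_iff_add_eq] at h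
  rw [h]; abel

theorem sE_succ {n : ℕ} (m : ℕ) (k l : Fin n) : sE (m + 1) k l
    = ∑ a, envι n (qe k a) * sE m a l + (-1 : ℂ) ^ m • ∑ a, envι n (qf k a) * sF m a l := rfl

theorem sF_succ {n : ℕ} (m : ℕ) (k l : Fin n) : sF (m + 1) k l
    = ∑ a, envι n (qe k a) * sF m a l + (-1 : ℂ) ^ m • ∑ a, envι n (qf k a) * sE m a l := rfl

/-- Supercommutators of `e_{i,j}`, `f_{i,j}` with Sergeev's elements, for `i ≠ l`. -/
theorem sergeev_bracket {n : ℕ} (m : ℕ) (i j l : Fin n) (hil : i ≠ l) : ∀ k : Fin n,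
    (envι n (qe i j) * sE m k l
      = sE m k l * envι n (qe i j) + if j = k then sE m i l else 0) ∧
    (envι n (qe i j) * sF m k l
      = sF m k l * envι n (qe i j) + if j = k then sF m i l else 0) ∧
    (envι n (qf i j) * sE m k l
      = sE m k l * envι n (qf i j) + if j = k then (-1 : ℂ) ^ (m + 1) • sF m i l else 0) ∧
    (envι n (qf i j) * sF m k l
      = -(sF m k l * envι n (qf i j)) + if j = k then (-1 : ℂ) ^ (m + 1) • sE m i l else 0) := by
  induction m with
  | zero =>
    intro k
    have h1 : ∀ k : Fin n, sE 0 k l = if k = l then 1 else 0 := fun _ => rfl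
    have h2 : ∀ k : Fin n, sF 0 k l = 0 := fun _ => rfl
    simp [h1, h2, hil]
  | succ m ih =>
    intro k
    have h1 := fun a => (ih a).1
    have h2 := fun a => (ih a).2.1
    have h3 := fun a => (ih a).2.2.1
    have h4 := fun a => (ih a).2.2.2
    have hs : ((-1 : ℂ) ^ m) * (-1) ^ m = 1 := by rw [← mul_pow]; simp
    refine ⟨?_, ?_, ?_, ?_⟩
    · have A : ∀ a, envι n (qe i j) * (envι n (qe k a) * sE m a l)
          = envι n (qe k a) * sE m a l * envι n (qe i j)
            + (if j = a then envι n (qe k a) * sE m i l else 0)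
            + (if j = k then envι n (qe i a) * sE m a l else 0)
            - (if a = i then envι n (qe k j) * sE m a l else 0) := by
        intro a
        rw [← mul_assoc, env_ee, sub_mul, add_mul, mul_assoc, h1, mul_add]
        simp only [mul_ite, ite_mul, mul_zero, zero_mul, mul_assoc]
      have B : ∀ a, envι n (qe i j) * (envι n (qf k a) * sF m a l)
          = envι n (qf k a) * sF m a l * envι n (qe i j)
            + (if j = a then envι n (qf k a) * sF m i l else 0)
            + (if j = k then envι n (qf i a) * sF m a l else 0)
            - (if a = i then envι n (qf k j) * sF m a l else 0) := by
        intro a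
        rw [← mul_assoc, env_ef, sub_mul, add_mul, mul_assoc, h2, mul_add]
        simp only [mul_ite, ite_mul, mul_zero, zero_mul, mul_assoc]
      simp only [sE_succ, mul_add, add_mul, mul_smul_comm, smul_mul_assoc, Finset.mul_sum,
        Finset.sum_mul, A, B, Finset.sum_add_distrib, Finset.sum_sub_distrib]
      by_cases hjk : j = k <;> simp [hjk] <;> module
    · have A : ∀ a, envι n (qe i j) * (envι n (qe k a) * sF m a l)
          = envι n (qe k a) * sF m a l * envι n (qe i j)
            + (if j = a then envι n (qe k a) * sF m i l else 0)
            + (if j = k then envι n (qe i a) * sF m a l else 0)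
            - (if a = i then envι n (qe k j) * sF m a l else 0) := by
        intro a
        rw [← mul_assoc, env_ee, sub_mul, add_mul, mul_assoc, h2, mul_add]
        simp only [mul_ite, ite_mul, mul_zero, zero_mul, mul_assoc]
      have B : ∀ a, envι n (qe i j) * (envι n (qf k a) * sE m a l)
          = envι n (qf k a) * sE m a l * envι n (qe i j)
            + (if j = a then envι n (qf k a) * sE m i l else 0)
            + (if j = k then envι n (qf i a) * sE m a l else 0)
            - (if a = i then envι n (qf k j) * sE m a l else 0) := by
        intro a
        rw [← mul_assoc, env_ef, sub_mul, add_mul, mul_assoc, h1, mul_add]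
        simp only [mul_ite, ite_mul, mul_zero, zero_mul, mul_assoc]
      simp only [sF_succ, mul_add, add_mul, mul_smul_comm, smul_mul_assoc, Finset.mul_sum,
        Finset.sum_mul, A, B, Finset.sum_add_distrib, Finset.sum_sub_distrib]
      by_cases hjk : j = k <;> simp [hjk] <;> module
    · have A : ∀ a, envι n (qf i j) * (envι n (qe k a) * sE m a l)
          = envι n (qe k a) * sE m a l * envι n (qf i j)
            + (if j = a then (-1 : ℂ) ^ (m + 1) • (envι n (qe k a) * sF m i l) else 0)
            + (if j = k then envι n (qf i a) * sE m a l else 0)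
            - (if a = i then envι n (qf k j) * sE m a l else 0) := by
        intro a
        rw [← mul_assoc, env_fe, sub_mul, add_mul, mul_assoc, h3, mul_add]
        simp only [mul_ite, ite_mul, mul_zero, zero_mul, mul_assoc, mul_smul_comm]
      have B : ∀ a, envι n (qf i j) * (envι n (qf k a) * sF m a l)
          = envι n (qf k a) * sF m a l * envι n (qf i j)
            - (if j = a then (-1 : ℂ) ^ (m + 1) • (envι n (qf k a) * sE m i l) else 0)
            + (if j = k then envι n (qe i a) * sF m a l else 0)
            + (if a = i then envι n (qe k j) * sF m a l else 0) := by
        intro a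
        rw [← mul_assoc, env_ff, add_mul, add_mul, neg_mul, mul_assoc, h4, mul_add, mul_neg,
          neg_add, neg_neg]
        simp only [mul_ite, ite_mul, mul_zero, zero_mul, mul_assoc, mul_smul_comm, sub_eq_add_neg]
      simp only [sE_succ, sF_succ, mul_add, add_mul, mul_smul_comm, smul_mul_assoc, Finset.mul_sum,
        Finset.sum_mul, A, B, Finset.sum_add_distrib, Finset.sum_sub_distrib]
      by_cases hjk : j = k <;> simp [hjk, pow_succ, smul_smul, smul_add, hs] <;> module
    · have A : ∀ a, envι n (qf i j) * (envι n (qe k a) * sF m a l)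
          = -(envι n (qe k a) * sF m a l * envι n (qf i j))
            + (if j = a then (-1 : ℂ) ^ (m + 1) • (envι n (qe k a) * sE m i l) else 0)
            + (if j = k then envι n (qf i a) * sF m a l else 0)
            - (if a = i then envι n (qf k j) * sF m a l else 0) := by
        intro a
        rw [← mul_assoc, env_fe, sub_mul, add_mul, mul_assoc, h4, mul_add, mul_neg]
        simp only [mul_ite, ite_mul, mul_zero, zero_mul, mul_assoc, mul_smul_comm]
      have B : ∀ a, envι n (qf i j) * (envι n (qf k a) * sE m a l)
          = -(envι n (qf k a) * sE m a l * envι n (qf i j))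
            - (if j = a then (-1 : ℂ) ^ (m + 1) • (envι n (qf k a) * sF m i l) else 0)
            + (if j = k then envι n (qe i a) * sE m a l else 0)
            + (if a = i then envι n (qe k j) * sE m a l else 0) := by
        intro a
        rw [← mul_assoc, env_ff, add_mul, add_mul, neg_mul, mul_assoc, h3, mul_add, neg_add]
        simp only [mul_ite, ite_mul, mul_zero, zero_mul, mul_assoc, mul_smul_comm, sub_eq_add_neg]
      simp only [sE_succ, sF_succ, mul_add, add_mul, mul_smul_comm, smul_mul_assoc, Finset.mul_sum,
        Finset.sum_mul, A, B, Finset.sum_add_distrib, Finset.sum_sub_distrib,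
        Finset.sum_neg_distrib]
      by_cases hjk : j = k <;> simp [hjk, pow_succ, smul_smul, smul_add, hs] <;> module

theorem chi_qf {n : ℕ} (i j : Fin n) : chi n (qf i j) = 0 := by
  have h : ∃ A, qf i j * qE n = blocks A 0 := by
    have hB : ∃ B, qE n = blocks 0 B := by
      have key : ∀ B : Fin n → Matrix (Fin n) (Fin n) ℂ, ∀ s : Finset (Fin n),
          ∑ a ∈ s, blocks 0 (B a) = blocks 0 (∑ a ∈ s, B a) := by
        intro B s
        induction s using Finset.induction_on with
        | empty => simp [blocks_zero]
        | insert a s ha ih => rw [Finset.sum_insert ha, Finset.sum_insert ha, ih, blocks_add,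
            add_zero]
      refine ⟨∑ a : Fin n, ∑ b : Fin n,
        if (a : ℕ) + 1 = (b : ℕ) then Matrix.single a b 1 else 0, ?_⟩
      rw [qE, ← key]
      refine Finset.sum_congr rfl fun a _ => ?_
      rw [← key]
      refine Finset.sum_congr rfl fun b _ => ?_
      split_ifs
      · rfl
      · exact blocks_zero.symm
    obtain ⟨B, hB⟩ := hB
    exact ⟨Matrix.single i j 1 * B, by rw [hB, qf, blocks_mul]; simp⟩
  obtain ⟨A, hA⟩ := h
  change otr (qf i j * qE n) = 0
  rw [hA]
  change (fromBlocks A 0 0 A).toBlocks₁₂.trace = 0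
  simp

/-- The first index. -/
def fstIdx (n : ℕ) [NeZero n] : Fin n := ⟨0, NeZero.pos n⟩

/-- The last index. -/
def lastIdx (n : ℕ) [NeZero n] : Fin n := ⟨n - 1, Nat.sub_one_lt (NeZero.ne n)⟩

/-- To check `𝔪`-invariance, it is enough to treat `e_{i,j}` and `f_{i,j}` with `i > j`. -/
theorem invariant_of_basis {n : ℕ} (y : Env n)
    (he : ∀ i j : Fin n, j < i →
      (envι n (qe i j) - algebraMap ℂ (Env n) (chi n (qe i j))) * y ∈ whitIdeal n)
    (hf : ∀ i j : Fin n, j < i →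
      (envι n (qf i j) - algebraMap ℂ (Env n) (chi n (qf i j))) * y ∈ whitIdeal n) :
    ∀ a ∈ nilp n, (envι n a - algebraMap ℂ (Env n) (chi n a)) * y ∈ whitIdeal n := by
  let T : queer n →ₗ[ℂ] Env n :=
    LinearMap.mulRight ℂ y ∘ₗ (envι n - (Algebra.linearMap ℂ (Env n)) ∘ₗ chi n)
  have hT : nilp n ≤ ((whitIdeal n).restrictScalars ℂ).comap T := by
    refine iSup_le fun k => ?_
    rw [queerDeg, Submodule.span_le]
    rintro x ⟨i, j, hij, rfl | rfl⟩
    · exact he i j (by rw [Fin.lt_def]; omega)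
    · exact hf i j (by rw [Fin.lt_def]; omega)
  intro a ha
  exact hT ha

theorem mem_nilp {n : ℕ} (i j : Fin n) (h : j < i) : qe i j ∈ nilp n ∧ qf i j ∈ nilp n := by
  have hk : 2 * ((j : ℤ) - (i : ℤ)) = -2 * (((i : ℕ) - (j : ℕ) - 1 : ℕ) + 1) := by
    rw [Fin.lt_def] at h; omega
  exact ⟨Submodule.mem_iSup_of_mem _ (Submodule.subset_span ⟨i, j, hk, Or.inl rfl⟩),
    Submodule.mem_iSup_of_mem _ (Submodule.subset_span ⟨i, j, hk, Or.inr rfl⟩)⟩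

theorem mul_mem_whitIdeal {n : ℕ} (y : Env n) (a : queer n) (ha : a ∈ nilp n) :
    y * (envι n a - algebraMap ℂ (Env n) (chi n a)) ∈ whitIdeal n :=
  (whitIdeal n).smul_mem y (Submodule.subset_span ⟨a, ha, rfl⟩)

theorem sE_invariant (n : ℕ) [NeZero n] (m : ℕ) : ∀ a ∈ nilp n,
    (envι n a - algebraMap ℂ (Env n) (chi n a)) * sE m (lastIdx n) (fstIdx n)
      ∈ whitIdeal n := by
  refine invariant_of_basis _ (fun i j hij => ?_) (fun i j hij => ?_)
  all_goals
    have h0 : i ≠ fstIdx n := by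
      rintro rfl; exact absurd hij (by simp [fstIdx])
    have h1 : j ≠ lastIdx n := by
      rintro rfl; have := i.2; simp only [Fin.lt_def, lastIdx] at hij; omega
    obtain ⟨b1, b2, b3, b4⟩ := sergeev_bracket m i j (fstIdx n) h0 (lastIdx n)
  · have := mul_mem_whitIdeal (sE m (lastIdx n) (fstIdx n)) _ (mem_nilp i j hij).1
    rw [if_neg h1, add_zero] at b1
    rwa [mul_sub, ← b1, ← Algebra.commutes, ← sub_mul] at this
  · have := mul_mem_whitIdeal (sE m (lastIdx n) (fstIdx n)) _ (mem_nilp i j hij).2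
    rw [if_neg h1, add_zero] at b3
    rwa [mul_sub, ← b3, ← Algebra.commutes, ← sub_mul] at this

theorem sF_invariant (n : ℕ) [NeZero n] (m : ℕ) : ∀ a ∈ nilp n,
    (envι n a - algebraMap ℂ (Env n) (chi n a)) * sF m (lastIdx n) (fstIdx n)
      ∈ whitIdeal n := by
  refine invariant_of_basis _ (fun i j hij => ?_) (fun i j hij => ?_)
  all_goals
    have h0 : i ≠ fstIdx n := by
      rintro rfl; exact absurd hij (by simp [fstIdx])
    have h1 : j ≠ lastIdx n := by
      rintro rfl; have := i.2; simp only [Fin.lt_def, lastIdx] at hij; omega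
    obtain ⟨b1, b2, b3, b4⟩ := sergeev_bracket m i j (fstIdx n) h0 (lastIdx n)
  · have := mul_mem_whitIdeal (sF m (lastIdx n) (fstIdx n)) _ (mem_nilp i j hij).1
    rw [if_neg h1, add_zero] at b2
    rwa [mul_sub, ← b2, ← Algebra.commutes, ← sub_mul] at this
  · have := (whitIdeal n).neg_mem
      (mul_mem_whitIdeal (sF m (lastIdx n) (fstIdx n)) _ (mem_nilp i j hij).2)
    rw [if_neg h1, add_zero] at b4
    rw [chi_qf, map_zero, sub_zero] at this ⊢
    rwa [b4]

/-- The element `π(e_{n,1}^{(m)})` of `W_χ`. -/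
def wE (n : ℕ) [NeZero n] (m : ℕ) : W n :=
  ofInvariant (sE m (lastIdx n) (fstIdx n)) (sE_invariant n m)

/-- The element `π(f_{n,1}^{(m)})` of `W_χ`. -/
def wF (n : ℕ) [NeZero n] (m : ℕ) : W n :=
  ofInvariant (sF m (lastIdx n) (fstIdx n)) (sF_invariant n m)

/-- The odd elements `Φ_0 = π(f_{n,1}^{(n)})`, `Φ_{k+1} = ½ [π(e_{n,1}^{(n+1)}), Φ_k]` of `W_χ`. -/
def Phi (n : ℕ) [NeZero n] : ℕ → W n
  | 0 => wF n n
  | k + 1 => (1 / 2 : ℂ) • (wE n (n + 1) * Phi n k - Phi n k * wE n (n + 1))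

/-- The even elements `z_i` of `W_χ`: the supercommutator `[Φ_0, Φ_i]` of two odd elements for
even `i`, and `π(e_{n,1}^{(n+i)})` for odd `i`. -/
def zElt (n : ℕ) [NeZero n] (i : ℕ) : W n :=
  if Even i then Phi n 0 * Phi n i + Phi n i * Phi n 0 else wE n (n + i)

end

end QueerW

open QueerW

namespace QueerW

open Matrix

noncomputable section

/-! The algebra `W_χ` is bounded from above by generators and from below by a homomorphism to a
Clifford algebra; the two bounds meet, and the relations are then read off in the Clifford algebra.

Upper bound. In the Kazhdan filtration `e_{i,j}` and `f_{i,j}` have degree `j - i + 1`, and a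
supercommutator costs one degree. The module `U / I_χ` is spanned by words in entries of the first
column of Sergeev's matrices, compatibly with the filtration (`kaz_le_colSpan`). For `j < i` the
operator `a - χ(a)`, with `a = e_{i,j}` or `f_{i,j}`, acts on these words to leading order as the
derivative with respect to one column entry in row `j`, because its bracket with that entry is `±1`
up to lower terms. An invariant vector therefore has a leading part free of these entries, so that
only the last row remains, and `W_χ` is spanned by words in `π(e_{n,1}^{(m)})`, `π(f_{n,1}^{(m)})`
with `n ≤ m < 2n` (`wFil_le_wordSpan`). The commutator formulas within one column (`sG_comm_sE`,
`sG_comm_sF`) show that `Φ_k` has leading term `f_{n,1}^{(n+k)}` and `z_i` has leading term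
`e_{n,1}^{(n+i)}`, up to a factor `2`. This gives generation. Since the graded algebra is
supercommutative, the ordered monomials `z^α Φ^β` without repeated `Φ` span.

Lower bound. A Poincaré–Birkhoff–Witt basis, whose independence comes from an oscillator
representation, makes the Harish-Chandra projection available. The projection is multiplicative on
invariants and gives `hcW`, with values in operators on an exterior algebra over `ℂ[x_1, …, x_n]`,
among them Clifford generators `ξ_i` with `ξ_i² = x_i`. There `Φ_k` becomes `∑_j φ_{k,j} ξ_j` with
`φ_{0,j} = 1` and `φ_{k+1,j} = ∑_i sgn(i - j) x_i φ_{k,i}`. The leading terms of the `z_i` are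
algebraically independent because they generate all elementary symmetric functions, and the products
of the `Φ_k` are independent because `det (φ_{k,j})` is nonzero. Hence the ordered monomials form a
basis and `hcW` is injective.

Relations. The matrix `sgn(i - j)` is skew, so `[Φ_m, Φ_p]` maps to the scalar `2 (-1)^m ∑_i x_i
φ_{m+p,i}`, which vanishes for odd `m + p`; scalars are central. For odd `i` the image of `z_i` need
not be a scalar, and commutativity is instead proved inside `U` (`sE_commute`). The generating
function of the sums `∑_i x_i φ_{k,i}` is determined by `∏ (1 - x_i X) / (1 + x_i X)`, so these sums
are polynomials in the odd power sums. Another product formula obtains the odd power sums from the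
images of the central elements `∑_k e_{k,k}^{(2r+1)}` (`odd_psum_mem_of_recursion`), and injectivity
of `hcW` turns this equality of images into an equality in `W_χ`. -/

/-! ### Supercommutators of Sergeev's elements in `U(Q(n))` -/

theorem sergeev_bracket_full {n : ℕ} (m : ℕ) (i j l : Fin n) : ∀ k : Fin n,
    (envι n (qe i j) * sE m k l = sE m k l * envι n (qe i j)
      + (if j = k then sE m i l else 0) - (if i = l then sE m k j else 0)) ∧
    (envι n (qe i j) * sF m k l = sF m k l * envι n (qe i j)
      + (if j = k then sF m i l else 0) - (if i = l then sF m k j else 0)) ∧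
    (envι n (qf i j) * sE m k l = sE m k l * envι n (qf i j)
      + (if j = k then (-1 : ℂ) ^ (m + 1) • sF m i l else 0) - (if i = l then sF m k j else 0)) ∧
    (envι n (qf i j) * sF m k l = -(sF m k l * envι n (qf i j))
      + (if j = k then (-1 : ℂ) ^ (m + 1) • sE m i l else 0)
      + (if i = l then sE m k j else 0)) := by
  induction m with
  | zero =>
    intro k
    have h1 : ∀ k l : Fin n, sE 0 k l = if k = l then 1 else 0 := fun _ _ => rfl
    have h2 : ∀ k l : Fin n, sF 0 k l = 0 := fun _ _ => rfl
    by_cases h : j = k <;> by_cases h' : i = l <;> simp [h1, h2, h, h', eq_comm]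
  | succ m ih =>
    intro k
    have h1 := fun a => (ih a).1
    have h2 := fun a => (ih a).2.1
    have h3 := fun a => (ih a).2.2.1
    have h4 := fun a => (ih a).2.2.2
    refine ⟨?_, ?_, ?_, ?_⟩
    · have A : ∀ a, envι n (qe i j) * (envι n (qe k a) * sE m a l)
          = envι n (qe k a) * sE m a l * envι n (qe i j)
            + (if j = a then envι n (qe k a) * sE m i l else 0)
            - (if i = l then envι n (qe k a) * sE m a j else 0)
            + (if j = k then envι n (qe i a) * sE m a l else 0)
            - (if a = i then envι n (qe k j) * sE m a l else 0) := by
        intro a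
        rw [← mul_assoc, env_ee, sub_mul, add_mul, mul_assoc, h1, mul_sub, mul_add]
        simp only [mul_ite, ite_mul, mul_zero, zero_mul, mul_assoc]
      have B : ∀ a, envι n (qe i j) * (envι n (qf k a) * sF m a l)
          = envι n (qf k a) * sF m a l * envι n (qe i j)
            + (if j = a then envι n (qf k a) * sF m i l else 0)
            - (if i = l then envι n (qf k a) * sF m a j else 0)
            + (if j = k then envι n (qf i a) * sF m a l else 0)
            - (if a = i then envι n (qf k j) * sF m a l else 0) := by
        intro a
        rw [← mul_assoc, env_ef, sub_mul, add_mul, mul_assoc, h2, mul_sub, mul_add]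
        simp only [mul_ite, ite_mul, mul_zero, zero_mul, mul_assoc]
      -- After summation over the middle index `a`, the terms with `a = j` and those with `a = i`
      -- are the same product with opposite signs, so only the two boundary terms survive. The other
      -- three cases work in the same way.
      simp only [sE_succ, mul_add, add_mul, mul_smul_comm, smul_mul_assoc, Finset.mul_sum,
        Finset.sum_mul, A, B, Finset.sum_add_distrib, Finset.sum_sub_distrib]
      by_cases hjk : j = k <;> by_cases hil : i = l <;> simp [hjk, hil] <;> module
    · have A : ∀ a, envι n (qe i j) * (envι n (qe k a) * sF m a l)
          = envι n (qe k a) * sF m a l * envι n (qe i j)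
            + (if j = a then envι n (qe k a) * sF m i l else 0)
            - (if i = l then envι n (qe k a) * sF m a j else 0)
            + (if j = k then envι n (qe i a) * sF m a l else 0)
            - (if a = i then envι n (qe k j) * sF m a l else 0) := by
        intro a
        rw [← mul_assoc, env_ee, sub_mul, add_mul, mul_assoc, h2, mul_sub, mul_add]
        simp only [mul_ite, ite_mul, mul_zero, zero_mul, mul_assoc]
      have B : ∀ a, envι n (qe i j) * (envι n (qf k a) * sE m a l)
          = envι n (qf k a) * sE m a l * envι n (qe i j)
            + (if j = a then envι n (qf k a) * sE m i l else 0)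
            - (if i = l then envι n (qf k a) * sE m a j else 0)
            + (if j = k then envι n (qf i a) * sE m a l else 0)
            - (if a = i then envι n (qf k j) * sE m a l else 0) := by
        intro a
        rw [← mul_assoc, env_ef, sub_mul, add_mul, mul_assoc, h1, mul_sub, mul_add]
        simp only [mul_ite, ite_mul, mul_zero, zero_mul, mul_assoc]
      simp only [sF_succ, mul_add, add_mul, mul_smul_comm, smul_mul_assoc, Finset.mul_sum,
        Finset.sum_mul, A, B, Finset.sum_add_distrib, Finset.sum_sub_distrib]
      by_cases hjk : j = k <;> by_cases hil : i = l <;> simp [hjk, hil] <;> module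
    · have A : ∀ a, envι n (qf i j) * (envι n (qe k a) * sE m a l)
          = envι n (qe k a) * sE m a l * envι n (qf i j)
            + (if j = a then (-1 : ℂ) ^ (m + 1) • (envι n (qe k a) * sF m i l) else 0)
            - (if i = l then envι n (qe k a) * sF m a j else 0)
            + (if j = k then envι n (qf i a) * sE m a l else 0)
            - (if a = i then envι n (qf k j) * sE m a l else 0) := by
        intro a
        rw [← mul_assoc, env_fe, sub_mul, add_mul, mul_assoc, h3, mul_sub, mul_add]
        simp only [mul_ite, ite_mul, mul_zero, zero_mul, mul_assoc, mul_smul_comm]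
      have B : ∀ a, envι n (qf i j) * (envι n (qf k a) * sF m a l)
          = envι n (qf k a) * sF m a l * envι n (qf i j)
            - (if j = a then (-1 : ℂ) ^ (m + 1) • (envι n (qf k a) * sE m i l) else 0)
            - (if i = l then envι n (qf k a) * sE m a j else 0)
            + (if j = k then envι n (qe i a) * sF m a l else 0)
            + (if a = i then envι n (qe k j) * sF m a l else 0) := by
        intro a
        rw [← mul_assoc, env_ff, add_mul, add_mul, neg_mul, mul_assoc, h4, mul_add, mul_add,
          mul_neg, neg_add, neg_add, neg_neg]
        simp only [mul_ite, ite_mul, mul_zero, zero_mul, mul_assoc, mul_smul_comm, sub_eq_add_neg]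
      simp only [sE_succ, sF_succ, mul_add, add_mul, mul_smul_comm, smul_mul_assoc, Finset.mul_sum,
        Finset.sum_mul, A, B, Finset.sum_add_distrib, Finset.sum_sub_distrib]
      rcases neg_one_pow_eq_or ℂ m with hm | hm <;> by_cases hjk : j = k <;>
        by_cases hil : i = l <;> simp [hjk, hil, pow_succ, hm] <;> module
    · have A : ∀ a, envι n (qf i j) * (envι n (qe k a) * sF m a l)
          = -(envι n (qe k a) * sF m a l * envι n (qf i j))
            + (if j = a then (-1 : ℂ) ^ (m + 1) • (envι n (qe k a) * sE m i l) else 0)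
            + (if i = l then envι n (qe k a) * sE m a j else 0)
            + (if j = k then envι n (qf i a) * sF m a l else 0)
            - (if a = i then envι n (qf k j) * sF m a l else 0) := by
        intro a
        rw [← mul_assoc, env_fe, sub_mul, add_mul, mul_assoc, h4, mul_add, mul_add, mul_neg]
        simp only [mul_ite, ite_mul, mul_zero, zero_mul, mul_assoc, mul_smul_comm]
      have B : ∀ a, envι n (qf i j) * (envι n (qf k a) * sE m a l)
          = -(envι n (qf k a) * sE m a l * envι n (qf i j))
            - (if j = a then (-1 : ℂ) ^ (m + 1) • (envι n (qf k a) * sF m i l) else 0)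
            + (if i = l then envι n (qf k a) * sF m a j else 0)
            + (if j = k then envι n (qe i a) * sE m a l else 0)
            + (if a = i then envι n (qe k j) * sE m a l else 0) := by
        intro a
        rw [← mul_assoc, env_ff, add_mul, add_mul, neg_mul, mul_assoc, h3, mul_sub, mul_add,
          neg_sub, sub_eq_add_neg, neg_add]
        simp only [mul_ite, ite_mul, mul_zero, zero_mul, mul_assoc, mul_smul_comm]
        abel
      simp only [sE_succ, sF_succ, mul_add, add_mul, mul_smul_comm, smul_mul_assoc, Finset.mul_sum,
        Finset.sum_mul, A, B, Finset.sum_add_distrib, Finset.sum_sub_distrib,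
        Finset.sum_neg_distrib]
      rcases neg_one_pow_eq_or ℂ m with hm | hm <;> by_cases hjk : j = k <;>
        by_cases hil : i = l <;> simp [hjk, hil, pow_succ, hm] <;> module

/-- `e_{i,j} ± f_{i,j}` -/
def gen {n : ℕ} (t : ℕ) (i j : Fin n) : Env n := envι n (qe i j) + (-1 : ℂ) ^ t • envι n (qf i j)

/-- `e_{i,j}^{(m)} ± f_{i,j}^{(m)}` -/
def sG {n : ℕ} (t m : ℕ) (i j : Fin n) : Env n := sE m i j + (-1 : ℂ) ^ t • sF m i j

theorem sG_zero {n : ℕ} (t : ℕ) (i j : Fin n) : sG t 0 i j = if i = j then 1 else 0 := by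
  have h1 : sE 0 i j = if i = j then 1 else 0 := rfl
  have h2 : sF 0 i j = 0 := rfl
  simp [sG, h1, h2]

theorem sG_congr {n : ℕ} {t t' : ℕ} (h : t % 2 = t' % 2) (m : ℕ) (i j : Fin n) :
    sG t m i j = sG t' m i j := by
  rw [sG, sG, neg_one_pow_eq_pow_mod_two, h, ← neg_one_pow_eq_pow_mod_two]

theorem gen_congr {n : ℕ} {t t' : ℕ} (h : t % 2 = t' % 2) (i j : Fin n) :
    gen t i j = gen t' i j := by
  rw [gen, gen, neg_one_pow_eq_pow_mod_two, h, ← neg_one_pow_eq_pow_mod_two]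

/-- Adding and subtracting the two recursions decouples them: `e^{(m)} ± f^{(m)}` is a product of
`m` matrices `e ± f` with alternating signs, and `t` is the sign exponent of the rightmost factor.
-/
theorem sG_succ {n : ℕ} (t m : ℕ) (i j : Fin n) :
    sG t (m + 1) i j = ∑ a, gen (t + m) i a * sG t m a j := by
  simp only [sG, gen, sE_succ, sF_succ, add_mul, mul_add, smul_mul_assoc, mul_smul_comm,
    Finset.sum_add_distrib, ← Finset.smul_sum, pow_add]
  rcases neg_one_pow_eq_or ℂ t with h | h <;> simp only [h] <;> module

/-- Concatenation of two alternating products. The left block starts after `b` factors, which shifts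
its sign exponent by `b`. -/
theorem sG_mul {n : ℕ} (t b : ℕ) (j : Fin n) : ∀ (a : ℕ) (i : Fin n),
    ∑ k, sG (t + b) a i k * sG t b k j = sG t (a + b) i j := by
  intro a
  induction a with
  | zero => intro i; simp [sG_zero]
  | succ a ih =>
    intro i
    rw [add_right_comm, sG_succ]
    simp only [← ih, sG_succ (t + b) a, Finset.sum_mul, Finset.mul_sum]
    rw [Finset.sum_comm]
    refine Finset.sum_congr rfl fun x _ => Finset.sum_congr rfl fun y _ => ?_
    rw [mul_assoc, add_assoc t b a, add_comm b a]

theorem gen_bracket_sE {n : ℕ} (s p : ℕ) (i a k l : Fin n) :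
    gen s i a * sE p k l - sE p k l * gen s i a
      = (if a = k then sG (s + p + 1) p i l else 0) - if i = l then sG s p k a else 0 := by
  obtain ⟨h1, -, h3, -⟩ := sergeev_bracket_full p i a l k
  simp only [gen, sG, add_mul, mul_add, smul_mul_assoc, mul_smul_comm, h1, h3]
  by_cases hjk : a = k <;> by_cases hil : i = l <;> simp [hjk, hil, pow_add] <;> module

/-- Moving past the odd element `f^{(p)}` changes the sign of the odd part of the generator, hence
the exponent `s + 1` on the right. -/
theorem gen_bracket_sF {n : ℕ} (s p : ℕ) (i a k l : Fin n) :
    gen s i a * sF p k l - sF p k l * gen (s + 1) i a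
      = (if a = k then (-1 : ℂ) ^ (s + p + 1) • sG (s + p + 1) p i l else 0)
        + if i = l then (-1 : ℂ) ^ s • sG (s + 1) p k a else 0 := by
  obtain ⟨-, h2, -, h4⟩ := sergeev_bracket_full p i a l k
  simp only [gen, sG, add_mul, mul_add, smul_mul_assoc, mul_smul_comm, h2, h4]
  rcases neg_one_pow_eq_or ℂ s with h | h <;> rcases neg_one_pow_eq_or ℂ p with h' | h' <;>
    by_cases hjk : a = k <;> by_cases hil : i = l <;> simp [hjk, hil, pow_add, h, h'] <;> module

/-- Commutators of Sergeev's elements of one column. -/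
theorem sG_comm_sE {n : ℕ} (t p : ℕ) (k c : Fin n) : ∀ (m : ℕ) (i : Fin n),
    sG t m i c * sE p k c - sE p k c * sG t m i c
      = ∑ r ∈ Finset.range m, (sG (t + p + m + r) (r + p) i c * sG t (m - 1 - r) k c
          - sG (t + m + r) r i c * sG t (p + (m - 1 - r)) k c) := by
  intro m
  induction m with
  | zero => intro i; by_cases h : i = c <;> simp [sG_zero, h]
  | succ m ih =>
    intro i
    have h1 : sG t (m + 1) i c * sE p k c - sE p k c * sG t (m + 1) i c
        = ∑ a, (gen (t + m) i a * (sG t m a c * sE p k c - sE p k c * sG t m a c)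
          + (gen (t + m) i a * sE p k c - sE p k c * gen (t + m) i a) * sG t m a c) := by
      rw [sG_succ, Finset.sum_mul, Finset.mul_sum, ← Finset.sum_sub_distrib]
      refine Finset.sum_congr rfl fun a _ => ?_
      noncomm_ring
    -- Leibniz rule: the brackets with the remaining `m` factors give the terms shifted to `r + 1`,
    -- and the bracket with the leftmost factor gives the new term `r = 0`.
    rw [h1, Finset.sum_add_distrib, Finset.sum_range_succ']
    congr 1
    · simp only [ih, Finset.mul_sum]
      rw [Finset.sum_comm]
      refine Finset.sum_congr rfl fun r hr => ?_
      rw [Finset.mem_range] at hr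
      have e1 : r + 1 + p = (r + p) + 1 := by ring
      have e2 : m + 1 - 1 - (r + 1) = m - 1 - r := by omega
      rw [e1, e2, sG_succ, sG_succ _ r, Finset.sum_mul, Finset.sum_mul,
        ← Finset.sum_sub_distrib]
      refine Finset.sum_congr rfl fun a _ => ?_
      rw [gen_congr (t := t + p + (m + 1) + (r + 1) + (r + p)) (t' := t + m) (by omega),
        gen_congr (t := t + (m + 1) + (r + 1) + r) (t' := t + m) (by omega),
        sG_congr (t := t + p + (m + 1) + (r + 1)) (t' := t + p + m + r) (by omega),
        sG_congr (t := t + (m + 1) + (r + 1)) (t' := t + m + r) (by omega)]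
      noncomm_ring
    · simp only [gen_bracket_sE, sub_mul, ite_mul, zero_mul, Finset.sum_sub_distrib]
      rw [Finset.sum_ite_eq' Finset.univ k, if_pos (Finset.mem_univ k),
        sG_congr (t := t + p + (m + 1) + 0) (t' := t + m + p + 1) (by omega), zero_add]
      congr 1
      -- For `i = c` the sum over `a` concatenates to a full product by `sG_mul`; for `i ≠ c` both
      -- sides vanish. This matches `sG _ 0 i c`, which is the Kronecker delta.
      by_cases h : i = c
      · simpa [h, sG_zero] using sG_mul t m c p k
      · simp [h, sG_zero]

/-- The Leibniz argument of `sG_comm_sE`, with the sign twist of `gen_bracket_sF` at every factor.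
-/
theorem sG_comm_sF {n : ℕ} (t p : ℕ) (k c : Fin n) : ∀ (m : ℕ) (i : Fin n),
    sG t m i c * sF p k c - sF p k c * sG (t + 1) m i c
      = ∑ r ∈ Finset.range m, ((-1 : ℂ) ^ (t + m + r + p) •
            (sG (t + m + r + p) (r + p) i c * sG (t + 1) (m - 1 - r) k c)
          - (-1 : ℂ) ^ (t + m + r) • (sG (t + m + r) r i c * sG (t + 1) (p + (m - 1 - r)) k c)) := by
  intro m
  induction m with
  | zero => intro i; by_cases h : i = c <;> simp [sG_zero, h]
  | succ m ih =>
    intro i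
    have h1 : sG t (m + 1) i c * sF p k c - sF p k c * sG (t + 1) (m + 1) i c
        = ∑ a, (gen (t + m) i a * (sG t m a c * sF p k c - sF p k c * sG (t + 1) m a c)
          + (gen (t + m) i a * sF p k c - sF p k c * gen (t + m + 1) i a)
            * sG (t + 1) m a c) := by
      rw [sG_succ, sG_succ, Finset.sum_mul, Finset.mul_sum, ← Finset.sum_sub_distrib]
      refine Finset.sum_congr rfl fun a _ => ?_
      rw [add_right_comm t 1 m]
      noncomm_ring
    rw [h1, Finset.sum_add_distrib, Finset.sum_range_succ']
    congr 1
    · simp only [ih, Finset.mul_sum]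
      rw [Finset.sum_comm]
      refine Finset.sum_congr rfl fun r hr => ?_
      rw [Finset.mem_range] at hr
      have e1 : r + 1 + p = (r + p) + 1 := by ring
      have e2 : m + 1 - 1 - (r + 1) = m - 1 - r := by omega
      have e3 : (-1 : ℂ) ^ (t + (m + 1) + (r + 1) + p) = (-1) ^ (t + m + r + p) := by
        rw [show t + (m + 1) + (r + 1) + p = (t + m + r + p) + 2 by ring, pow_add]; simp
      have e4 : (-1 : ℂ) ^ (t + (m + 1) + (r + 1)) = (-1) ^ (t + m + r) := by
        rw [show t + (m + 1) + (r + 1) = (t + m + r) + 2 by ring, pow_add]; simp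
      rw [e1, e2, e3, e4, sG_succ, sG_succ _ r, Finset.sum_mul, Finset.sum_mul,
        Finset.smul_sum, Finset.smul_sum, ← Finset.sum_sub_distrib]
      refine Finset.sum_congr rfl fun a _ => ?_
      rw [gen_congr (t := t + (m + 1) + (r + 1) + p + (r + p)) (t' := t + m) (by omega),
        gen_congr (t := t + (m + 1) + (r + 1) + r) (t' := t + m) (by omega),
        sG_congr (t := t + (m + 1) + (r + 1) + p) (t' := t + m + r + p) (by omega),
        sG_congr (t := t + (m + 1) + (r + 1)) (t' := t + m + r) (by omega)]
      rw [mul_sub, mul_smul_comm, mul_smul_comm, mul_assoc, mul_assoc]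
    · simp only [gen_bracket_sF, add_mul, ite_mul, zero_mul, Finset.sum_add_distrib,
        smul_mul_assoc]
      rw [Finset.sum_ite_eq' Finset.univ k, if_pos (Finset.mem_univ k), zero_add, sub_eq_add_neg]
      congr 1
      · rw [show t + (m + 1) + 0 + p = t + m + p + 1 by ring]; rfl
      · by_cases h : i = c
        · have := sG_mul (t + 1) m c p k
          rw [add_right_comm] at this
          simp only [h, if_true, ← Finset.smul_sum, this, sG_zero, one_mul]
          simp [pow_succ, ← add_assoc]
        · simp [h, sG_zero]

/-- The sums of `sG_comm_sE` for `(m + 2, p)` and `(m, p + 2)` agree after a shift of the summation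
index, so the difference telescopes to boundary terms. -/
theorem sG_comm_step {n : ℕ} (t m p : ℕ) (i c : Fin n) :
    (sG t (m + 2) i c * sE p i c - sE p i c * sG t (m + 2) i c)
      - (sG t m i c * sE (p + 2) i c - sE (p + 2) i c * sG t m i c)
      = sG (t + p + m) p i c * sG t (m + 1) i c + sG (t + p + m + 1) (p + 1) i c * sG t m i c
        - sG t m i c * sG t (p + 1) i c - sG (t + 1) (m + 1) i c * sG t p i c := by
  rw [sG_comm_sE, sG_comm_sE, Finset.sum_sub_distrib, Finset.sum_sub_distrib,
    Finset.sum_range_succ', Finset.sum_range_succ',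
    Finset.sum_range_succ (fun r => sG (t + (m + 2) + r) r i c * _),
    Finset.sum_range_succ (fun r => sG (t + (m + 2) + r) r i c * _)]
  have h1 : ∀ r ∈ Finset.range m, sG (t + p + (m + 2) + (r + 1 + 1)) (r + 1 + 1 + p) i c
      * sG t (m + 2 - 1 - (r + 1 + 1)) i c
      = sG (t + (p + 2) + m + r) (r + (p + 2)) i c * sG t (m - 1 - r) i c := by
    intro r _
    rw [sG_congr (t := t + p + (m + 2) + (r + 1 + 1)) (t' := t + (p + 2) + m + r) (by omega),
      show r + 1 + 1 + p = r + (p + 2) by ring, show m + 2 - 1 - (r + 1 + 1) = m - 1 - r by omega]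
  have h2 : ∀ r ∈ Finset.range m, sG (t + (m + 2) + r) r i c * sG t (p + (m + 2 - 1 - r)) i c
      = sG (t + m + r) r i c * sG t (p + 2 + (m - 1 - r)) i c := by
    intro r hr
    rw [Finset.mem_range] at hr
    rw [sG_congr (t := t + (m + 2) + r) (t' := t + m + r) (by omega),
      show p + (m + 2 - 1 - r) = p + 2 + (m - 1 - r) by omega]
  rw [Finset.sum_congr rfl h1, Finset.sum_congr rfl h2]
  rw [sG_congr (t := t + p + (m + 2) + (0 + 1)) (t' := t + p + m + 1) (by omega),
    sG_congr (t := t + p + (m + 2) + 0) (t' := t + p + m) (by omega),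
    sG_congr (t := t + (m + 2) + m) (t' := t) (by omega),
    sG_congr (t := t + (m + 2) + (m + 1)) (t' := t + 1) (by omega)]
  rw [show m + 2 - 1 - (0 + 1) = m by omega, show m + 2 - 1 - 0 = m + 1 by omega,
    show p + (m + 2 - 1 - m) = p + 1 by omega, show p + (m + 2 - 1 - (m + 1)) = p by omega,
    show 0 + 1 + p = p + 1 by ring, show 0 + p = p by ring]
  abel

/-- The average of `sG_comm_step` over the two signs isolates the even part. For odd `m + p` the
boundary terms combine into ordinary commutators, of which the `e` part is antisymmetric and the `f`
part symmetric under exchange of `m` and `p`. -/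
theorem sE_comm_step {n : ℕ} (m p : ℕ) (h : Odd (m + p)) (i c : Fin n) :
    (sE (m + 2) i c * sE p i c - sE p i c * sE (m + 2) i c)
      - (sE m i c * sE (p + 2) i c - sE (p + 2) i c * sE m i c)
      = (sE p i c * sE (m + 1) i c - sE (m + 1) i c * sE p i c)
        + (sE (p + 1) i c * sE m i c - sE m i c * sE (p + 1) i c)
        - (sF p i c * sF (m + 1) i c - sF (m + 1) i c * sF p i c)
        + (sF (p + 1) i c * sF m i c - sF m i c * sF (p + 1) i c) := by
  have h0 := sG_comm_step 0 m p i c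
  have h1 := sG_comm_step 1 m p i c
  have e : ∀ t, (-1 : ℂ) ^ (t + p + m) = - (-1) ^ t := by
    intro t; rw [add_assoc, add_comm p, pow_add, h.neg_one_pow]; ring
  have e' : ∀ t, (-1 : ℂ) ^ (t + p + m + 1) = (-1) ^ t := by
    intro t; rw [pow_succ, e]; ring
  have e0 : (-1 : ℂ) ^ (p + m) = -1 := by simpa using e 0
  simp only [sG, e, e', e0, pow_zero, zero_add, one_smul, neg_smul, add_mul, mul_add,
    mul_neg, neg_mul, neg_neg, pow_succ, mul_one] at h0 h1
  have h2 : (2 : ℂ)⁻¹ • (2 : ℂ) • ((sE (m + 2) i c * sE p i c - sE p i c * sE (m + 2) i c)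
      - (sE m i c * sE (p + 2) i c - sE (p + 2) i c * sE m i c)) = (2 : ℂ)⁻¹ • (2 : ℂ) •
      ((sE p i c * sE (m + 1) i c - sE (m + 1) i c * sE p i c)
        + (sE (p + 1) i c * sE m i c - sE m i c * sE (p + 1) i c)
        - (sF p i c * sF (m + 1) i c - sF (m + 1) i c * sF p i c)
        + (sF (p + 1) i c * sF m i c - sF m i c * sF (p + 1) i c)) := by
    congr 1
    linear_combination (norm := module) h0 + h1
  simpa [smul_smul] using h2

/-- `e_{i,c}^{(m)}` and `e_{i,c}^{(p)}` commute if `m + p` is even. -/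
theorem sE_commute {n : ℕ} (i c : Fin n) : ∀ m p : ℕ, Even (m + p) →
    sE m i c * sE p i c = sE p i c * sE m i c := by
  intro m
  induction m with
  | zero =>
    intro p _
    have h1 : sE 0 i c = if i = c then 1 else 0 := rfl
    rw [h1]
    split_ifs <;> simp
  | succ m ih =>
    intro p hp
    have ho : Odd (m + p) := by
      rw [← Nat.not_even_iff_odd]; intro h
      rw [show m + 1 + p = m + p + 1 by ring, Nat.even_add_one] at hp
      exact hp h
    -- The left side and the `f` terms are symmetric in `m` and `p`, the `e` terms antisymmetric.
    -- Subtracting the two instances leaves `[e^{(m+1)}, e^{(p)}] = -[e^{(m)}, e^{(p+1)}]`, and the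
    -- right side vanishes by induction.
    have h1 := sE_comm_step m p ho i c
    have h2 := sE_comm_step p m (by rwa [add_comm]) i c
    have h3 := ih (p + 1) (by rwa [← add_assoc, add_right_comm])
    have h4 : (2 : ℂ) • (sE (m + 1) i c * sE p i c - sE p i c * sE (m + 1) i c) = 0 := by
      rw [sub_eq_zero_of_eq h3.symm] at h1
      rw [sub_eq_zero_of_eq h3] at h2
      linear_combination (norm := module) h1 - h2
    exact sub_eq_zero.1 ((smul_eq_zero_iff_right two_ne_zero).1 h4)

section

/-! ### Spans of words -/

/-- The span of the vectors `v a₁ ⋯ v aᵣ • x` with `aᵢ ∈ Λ` and `deg a₁ + ⋯ + deg aᵣ ≤ d`. -/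
def wordSpan {R M α : Type*} [Ring R] [Algebra ℂ R] [AddCommGroup M] [Module R M] [Module ℂ M]
    (v : α → R) (deg : α → ℤ) (x : M) (Λ : Set α) (d : ℤ) : Submodule ℂ M :=
  Submodule.span ℂ {q | ∃ l : List α, (∀ a ∈ l, a ∈ Λ) ∧ (l.map deg).sum ≤ d ∧
    q = (l.map v).prod • x}

section wordSpan

variable {R M α : Type*} [Ring R] [Algebra ℂ R] [AddCommGroup M] [Module R M] [Module ℂ M]
  {v : α → R} {deg : α → ℤ} {x : M} {Λ Λ' : Set α}

theorem mem_wordSpan (l : List α) (hl : ∀ a ∈ l, a ∈ Λ) {d : ℤ} (hd : (l.map deg).sum ≤ d) :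
    (l.map v).prod • x ∈ wordSpan v deg x Λ d :=
  Submodule.subset_span ⟨l, hl, hd, rfl⟩

theorem wordSpan_mono (hΛ : Λ ⊆ Λ') {d d' : ℤ} (hd : d ≤ d') :
    wordSpan v deg x Λ d ≤ wordSpan v deg x Λ' d' := by
  refine Submodule.span_mono ?_
  rintro q ⟨l, h1, h2, h3⟩
  exact ⟨l, fun a ha => hΛ (h1 a ha), h2.trans hd, h3⟩

theorem self_mem_wordSpan {d : ℤ} (hd : 0 ≤ d) : x ∈ wordSpan v deg x Λ d := by
  simpa using mem_wordSpan (v := v) (deg := deg) (x := x) (Λ := Λ) [] (by simp) (by simpa using hd)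

/-- Boundedness from below, which starts the later inductions on the degree. -/
theorem wordSpan_neg (hpos : ∀ a ∈ Λ, 0 ≤ deg a) {d : ℤ} (hd : d < 0) :
    wordSpan v deg x Λ d = ⊥ := by
  rw [wordSpan, Submodule.span_eq_bot]
  rintro q ⟨l, h1, h2, -⟩
  have : 0 ≤ (l.map deg).sum := List.sum_nonneg (by simpa using fun a ha => hpos a (h1 a ha))
  omega

theorem smul_mem_wordSpan [IsScalarTower ℂ R M] [SMulCommClass ℂ R M] {a : α} (ha : a ∈ Λ)
    {q : M} {d : ℤ} (hq : q ∈ wordSpan v deg x Λ d) :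
    v a • q ∈ wordSpan v deg x Λ (deg a + d) := by
  induction hq using Submodule.span_induction with
  | mem q h =>
    obtain ⟨l, h1, h2, rfl⟩ := h
    rw [← mul_smul]
    have := mem_wordSpan (v := v) (deg := deg) (x := x) (Λ := Λ) (a :: l)
      (by simpa using ⟨ha, h1⟩) (d := deg a + d) (by simpa using h2)
    simpa using this
  | zero => simp
  | add p q _ _ hp hq => rw [smul_add]; exact add_mem hp hq
  | smul c q _ hq => rw [smul_comm]; exact Submodule.smul_mem _ _ hq

end wordSpan

/-! ### The Kazhdan filtration -/

/-- `e_{i,j}` or `f_{i,j}` in `U(Q(n))`, according to the parity `x.1`. -/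
def letter {n : ℕ} (x : Bool × Fin n × Fin n) : Env n :=
  envι n (if x.1 then qf x.2.1 x.2.2 else qe x.2.1 x.2.2)

/-- The value of `χ` on `e_{i,j}` or `f_{i,j}`. -/
def letterChi {n : ℕ} (x : Bool × Fin n × Fin n) : ℂ :=
  if x.1 = false ∧ (x.2.2 : ℕ) + 1 = x.2.1 then 1 else 0

/-- The Kazhdan degree of `e_{i,j}` and `f_{i,j}`. -/
def letterDeg {n : ℕ} (x : Bool × Fin n × Fin n) : ℤ := (x.2.2 : ℤ) - (x.2.1 : ℤ) + 1

/-- The sign in the commutation of elements of the parities `b` and `b'`. -/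
def bsgn (b b' : Bool) : ℂ := if b && b' then -1 else 1

theorem letter_mul {n : ℕ} (b b' : Bool) (i j k a : Fin n) :
    letter (b, i, j) * letter (b', k, a) = bsgn b b' • (letter (b', k, a) * letter (b, i, j))
      + (if j = k then letter (b ^^ b', i, a) else 0)
      - bsgn b b' • (if a = i then letter (b ^^ b', k, j) else 0) := by
  cases b <;> cases b'
  · simpa [letter, bsgn] using env_ee i j k a
  · simpa [letter, bsgn] using env_ef i j k a
  · simpa [letter, bsgn] using env_fe i j k a
  · have h := env_ff i j k a
    by_cases h1 : j = k <;> by_cases h2 : a = i <;> simpa [letter, bsgn, h1, h2] using h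

theorem blocks_sum {n : ℕ} {ι : Type*} (s : Finset ι) (A B : ι → Matrix (Fin n) (Fin n) ℂ) :
    ∑ i ∈ s, blocks (A i) (B i) = blocks (∑ i ∈ s, A i) (∑ i ∈ s, B i) := by
  classical
  induction s using Finset.induction_on with
  | empty => simp [blocks_zero]
  | insert a s ha ih => rw [Finset.sum_insert ha, Finset.sum_insert ha, Finset.sum_insert ha, ih,
      blocks_add]

theorem chi_qe {n : ℕ} (i j : Fin n) : chi n (qe i j) = if (j : ℕ) + 1 = i then 1 else 0 := by
  have h1 : ∀ k l : Fin n, otr (qf k l) = if k = l then 1 else 0 := by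
    intro k l
    change ((Matrix.fromBlocks (0 : Matrix (Fin n) (Fin n) ℂ) (Matrix.single k l 1)
      (Matrix.single k l 1) 0).toBlocks₁₂).trace = _
    rw [Matrix.toBlocks_fromBlocks₁₂]
    split_ifs with h
    · subst h; simp
    · exact Matrix.trace_single_eq_of_ne _ _ _ h
  change otr (qe i j * qE n) = _
  have h2 : ∀ a b : Fin n, qe i j * (if (a : ℕ) + 1 = b then qf a b else 0)
      = if j = a then (if (a : ℕ) + 1 = b then qf i b else 0) else 0 := by
    intro a b
    split_ifs with h h' h' <;> simp [qe_mul_qf, h']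
  simp only [qE, Finset.mul_sum, h2]
  simp only [map_sum, apply_ite otr, map_zero, h1]
  rw [Finset.sum_comm]
  simp only [Finset.sum_ite_eq, Finset.mem_univ, if_true]
  by_cases h : (j : ℕ) + 1 = i
  · rw [if_pos h, Finset.sum_eq_single i] <;> simp +contextual [h, eq_comm]
  · rw [if_neg h]
    refine Finset.sum_eq_zero fun b _ => ?_
    split_ifs with h1 h2
    · exact absurd (h2 ▸ h1) h
    · rfl
    · rfl

theorem chi_letter {n : ℕ} (x : Bool × Fin n × Fin n) :
    chi n (if x.1 then qf x.2.1 x.2.2 else qe x.2.1 x.2.2) = letterChi x := by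
  obtain ⟨b, i, j⟩ := x
  cases b <;> simp [letterChi, chi_qe, chi_qf]

/-- The generator `π(1)` of `U / I_χ`. -/
abbrev whitOne (n : ℕ) : Whit n := proj n 1

theorem proj_eq {n : ℕ} (u : Env n) : proj n u = u • whitOne n := by
  rw [whitOne, ← map_smul, smul_eq_mul, mul_one]

/-- `a - χ(a)` for `a = e_{i,j}`, `f_{i,j}`. -/
def shiftLetter {n : ℕ} (x : Bool × Fin n × Fin n) : Env n :=
  letter x - algebraMap ℂ (Env n) (letterChi x)

theorem shiftLetter_smul_whitOne {n : ℕ} (x : Bool × Fin n × Fin n) (hx : x.2.2 < x.2.1) :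
    shiftLetter x • whitOne n = 0 := by
  rw [← proj_eq, proj, Submodule.mkQ_apply, Submodule.Quotient.mk_eq_zero]
  refine Submodule.subset_span ⟨_, ?_, by rw [shiftLetter, letter, ← chi_letter]⟩
  have := mem_nilp x.2.1 x.2.2 hx
  cases x.1
  · exact this.1
  · exact this.2

/-- The step of the Kazhdan filtration of `U / I_χ`. -/
def kaz (n : ℕ) (d : ℤ) : Submodule ℂ (Whit n) :=
  wordSpan (letter (n := n)) letterDeg (whitOne n) {x | x.2.1 ≤ x.2.2} d

theorem kaz_mono {n : ℕ} {d d' : ℤ} (h : d ≤ d') : kaz n d ≤ kaz n d' :=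
  wordSpan_mono subset_rfl h

theorem kaz_neg {n : ℕ} {d : ℤ} (h : d < 0) : kaz n d = ⊥ := by
  refine wordSpan_neg (fun a ha => ?_) h
  have : (a.2.1 : ℕ) ≤ a.2.2 := ha
  rw [letterDeg]; omega

theorem whitOne_mem_kaz {n : ℕ} {d : ℤ} (h : 0 ≤ d) : whitOne n ∈ kaz n d := self_mem_wordSpan h

theorem letter_smul_mem_kaz {n : ℕ} {x : Bool × Fin n × Fin n} (hx : x.2.1 ≤ x.2.2) {q : Whit n}
    {d : ℤ} (hq : q ∈ kaz n d) : letter x • q ∈ kaz n (letterDeg x + d) :=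
  smul_mem_wordSpan (v := letter (n := n)) (deg := letterDeg) (x := whitOne n)
    (Λ := {x : Bool × Fin n × Fin n | x.2.1 ≤ x.2.2}) (a := x) hx hq

theorem word_mem_kaz {n : ℕ} (l : List (Bool × Fin n × Fin n)) (hl : ∀ a ∈ l, a.2.1 ≤ a.2.2) :
    (l.map letter).prod • whitOne n ∈ kaz n (l.map letterDeg).sum :=
  mem_wordSpan l hl le_rfl

theorem letterChi_deg {n : ℕ} {x : Bool × Fin n × Fin n} (h : letterChi x ≠ 0) :
    letterDeg x = 0 := by
  rw [letterChi] at h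
  split_ifs at h with h'
  · rw [letterDeg]; omega
  · exact absurd rfl h

/-- From `(j - i + 1) + (a - j + 1) = (a - i + 1) + 1`, a commutator of two letters has degree one
less than their product. A lowering letter is moved through the word until its shifted form kills
`π(1)`, so only commutators remain, which accounts for the extra `-1`. The two bounds are proved
together because a commutator can be a letter of any kind; the shifted bound implies the plain one
because `χ` is nonzero only on letters of degree `0`. -/
theorem letter_word_mem {n : ℕ} (l : List (Bool × Fin n × Fin n)) (hl : ∀ a ∈ l, a.2.1 ≤ a.2.2) :
    ∀ x : Bool × Fin n × Fin n,
    letter x • (l.map letter).prod • whitOne n ∈ kaz n ((l.map letterDeg).sum + letterDeg x) ∧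
    (x.2.2 < x.2.1 → shiftLetter x • (l.map letter).prod • whitOne n
      ∈ kaz n ((l.map letterDeg).sum + letterDeg x - 1)) := by
  have key : ∀ l : List (Bool × Fin n × Fin n), (∀ a ∈ l, a.2.1 ≤ a.2.2) →
      ∀ x : Bool × Fin n × Fin n, (x.2.2 < x.2.1 → shiftLetter x • (l.map letter).prod • whitOne n
        ∈ kaz n ((l.map letterDeg).sum + letterDeg x - 1)) →
      letter x • (l.map letter).prod • whitOne n ∈ kaz n ((l.map letterDeg).sum + letterDeg x) := by
    intro l hl x hx
    rcases lt_or_ge x.2.2 x.2.1 with h | h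
    · have e : letter x = shiftLetter x + letterChi x • (1 : Env n) := by
        rw [shiftLetter, Algebra.algebraMap_eq_smul_one]; abel
      rw [e, add_smul]
      refine add_mem (kaz_mono (by omega) (hx h)) ?_
      rw [smul_assoc, one_smul]
      by_cases h0 : letterChi x = 0
      · rw [h0, zero_smul]; exact zero_mem _
      · refine Submodule.smul_mem _ _ ?_
        rw [letterChi_deg h0, add_zero]
        exact word_mem_kaz l hl
    · rw [add_comm]
      exact letter_smul_mem_kaz h (word_mem_kaz l hl)
  induction l with
  | nil =>
    intro x
    have : x.2.2 < x.2.1 → shiftLetter x • (([] : List (Bool × Fin n × Fin n)).map letter).prod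
        • whitOne n ∈ kaz n ((([] : List (Bool × Fin n × Fin n)).map letterDeg).sum
          + letterDeg x - 1) := by
      intro h
      simp only [List.map_nil, List.prod_nil, one_smul, shiftLetter_smul_whitOne x h]
      exact zero_mem _
    exact ⟨key _ hl x this, this⟩
  | cons y w ih =>
    intro x
    have hw : ∀ a ∈ w, a.2.1 ≤ a.2.2 := fun a ha => hl a (List.mem_cons_of_mem _ ha)
    have hy : y.2.1 ≤ y.2.2 := hl y List.mem_cons_self
    have ih := ih hw
    have main : x.2.2 < x.2.1 → shiftLetter x • ((y :: w).map letter).prod • whitOne n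
        ∈ kaz n (((y :: w).map letterDeg).sum + letterDeg x - 1) := by
      intro hx
      obtain ⟨b, i, j⟩ := x
      obtain ⟨b', k, a⟩ := y
      have e : shiftLetter (b, i, j) * letter (b', k, a)
          = bsgn b b' • (letter (b', k, a) * shiftLetter (b, i, j))
            + (if j = k then letter (b ^^ b', i, a) else 0)
            - bsgn b b' • (if a = i then letter (b ^^ b', k, j) else 0) := by
        rw [shiftLetter, sub_mul, letter_mul, mul_sub, smul_sub, ← Algebra.commutes]
        -- `χ` is even: it vanishes for `b = true`, and the sign is `1` for `b = false`.
        have : letterChi (b, i, j) = bsgn b b' * letterChi (b, i, j) := by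
          cases b <;> cases b' <;> simp [letterChi, bsgn]
        have : algebraMap ℂ (Env n) (letterChi (b, i, j)) * letter (b', k, a)
            = bsgn b b' • (algebraMap ℂ (Env n) (letterChi (b, i, j)) * letter (b', k, a)) := by
          rw [Algebra.algebraMap_eq_smul_one, smul_mul_assoc, smul_smul, ← this]
        rw [← this]; abel
      simp only [List.map_cons, List.prod_cons, List.sum_cons]
      rw [mul_smul, ← mul_smul, e, sub_smul, add_smul]
      refine sub_mem (add_mem ?_ ?_) ?_
      · rw [smul_assoc, mul_smul]
        refine Submodule.smul_mem _ _ ?_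
        have := letter_smul_mem_kaz hy ((ih (b, i, j)).2 hx)
        exact kaz_mono (by omega) this
      · split_ifs with h
        · subst h
          refine kaz_mono ?_ (ih (b ^^ b', i, a)).1
          simp only [letterDeg]; omega
        · rw [zero_smul]; exact zero_mem _
      · split_ifs with h
        · subst h
          rw [smul_assoc]
          refine Submodule.smul_mem _ _ (kaz_mono ?_ (ih (b ^^ b', k, j)).1)
          simp only [letterDeg]; omega
        · rw [smul_zero, zero_smul]; exact zero_mem _
    exact ⟨key _ hl x main, main⟩

/-- The elements of `U(Q(n))` that raise the Kazhdan degree on `U / I_χ` by at most `d`. -/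
def kazOp (n : ℕ) (d : ℤ) : Submodule ℂ (Env n) where
  carrier := {u | ∀ c : ℤ, ∀ q ∈ kaz n c, u • q ∈ kaz n (c + d)}
  zero_mem' := fun c q _ => by rw [zero_smul]; exact zero_mem _
  add_mem' := fun hu hv c q hq => by rw [add_smul]; exact add_mem (hu c q hq) (hv c q hq)
  smul_mem' := fun z u hu c q hq => by
    rw [smul_assoc]; exact Submodule.smul_mem _ _ (hu c q hq)

theorem kazOp_mono {n : ℕ} {d d' : ℤ} (h : d ≤ d') : kazOp n d ≤ kazOp n d' :=
  fun _ hu c q hq => kaz_mono (by omega) (hu c q hq)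

theorem kazOp_mul {n : ℕ} {d d' : ℤ} {u v : Env n} (hu : u ∈ kazOp n d) (hv : v ∈ kazOp n d') :
    u * v ∈ kazOp n (d + d') := fun c q hq => by
  rw [mul_smul]
  exact kaz_mono (by omega) (hu _ _ (hv _ _ hq))

theorem one_mem_kazOp {n : ℕ} {d : ℤ} (h : 0 ≤ d) : (1 : Env n) ∈ kazOp n d := fun c q hq => by
  rw [one_smul]
  exact kaz_mono (by omega) hq

theorem kazOp_smul {n : ℕ} {d c e : ℤ} {u : Env n} {q : Whit n} (hu : u ∈ kazOp n d)
    (hq : q ∈ kaz n c) (h : c + d ≤ e) : u • q ∈ kaz n e := kaz_mono h (hu c q hq)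

theorem mem_kazOp_of_word {n : ℕ} {u : Env n} {d : ℤ}
    (h : ∀ l : List (Bool × Fin n × Fin n), (∀ a ∈ l, a.2.1 ≤ a.2.2) →
      u • (l.map letter).prod • whitOne n ∈ kaz n ((l.map letterDeg).sum + d)) :
    u ∈ kazOp n d := by
  intro c q hq
  induction hq using Submodule.span_induction with
  | mem q hq =>
    obtain ⟨l, h1, h2, rfl⟩ := hq
    exact kaz_mono (by omega) (h l h1)
  | zero => rw [smul_zero]; exact zero_mem _
  | add p q _ _ hp hq => rw [smul_add]; exact add_mem hp hq
  | smul c q _ hq => rw [smul_comm]; exact Submodule.smul_mem _ _ hq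

theorem letter_mem_kazOp {n : ℕ} (x : Bool × Fin n × Fin n) : letter x ∈ kazOp n (letterDeg x) :=
  mem_kazOp_of_word fun l hl => (letter_word_mem l hl x).1

theorem shiftLetter_mem_kazOp {n : ℕ} (x : Bool × Fin n × Fin n) (hx : x.2.2 < x.2.1) :
    shiftLetter x ∈ kazOp n (letterDeg x - 1) :=
  mem_kazOp_of_word fun l hl => by
    rw [← add_sub_assoc]; exact (letter_word_mem l hl x).2 hx

theorem qe_eq_letter {n : ℕ} (i j : Fin n) : envι n (qe i j) = letter (false, i, j) := rfl

theorem qf_eq_letter {n : ℕ} (i j : Fin n) : envι n (qf i j) = letter (true, i, j) := rfl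

/-- The element is a sum of products of `m` letters along paths from `k` to `l`; the degrees `a' - a
+ 1` of the steps telescope to `l - k + m`. -/
theorem sergeev_mem_kazOp {n : ℕ} (m : ℕ) (l : Fin n) : ∀ k : Fin n,
    sE m k l ∈ kazOp n ((l : ℤ) - k + m) ∧ sF m k l ∈ kazOp n ((l : ℤ) - k + m) := by
  induction m with
  | zero =>
    intro k
    have h1 : sE 0 k l = if k = l then 1 else 0 := rfl
    have h2 : sF 0 k l = 0 := rfl
    rw [h1, h2]
    refine ⟨?_, zero_mem _⟩
    split_ifs with h
    · subst h; exact one_mem_kazOp (by simp)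
    · exact zero_mem _
  | succ m ih =>
    intro k
    have key : ∀ (b : Bool) (a : Fin n) (u : Env n), u ∈ kazOp n ((l : ℤ) - a + m) →
        letter (b, k, a) * u ∈ kazOp n ((l : ℤ) - k + (m + 1 : ℕ)) := by
      intro b a u hu
      refine kazOp_mono ?_ (kazOp_mul (letter_mem_kazOp (b, k, a)) hu)
      simp only [letterDeg]; push_cast; omega
    rw [sE_succ, sF_succ]
    exact ⟨add_mem (sum_mem fun a _ => key false a _ (ih a).1)
        (Submodule.smul_mem _ _ (sum_mem fun a _ => key true a _ (ih a).2)),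
      add_mem (sum_mem fun a _ => key false a _ (ih a).2)
        (Submodule.smul_mem _ _ (sum_mem fun a _ => key true a _ (ih a).1))⟩

end

section

/-! ### The first column of Sergeev's matrices -/

/-- To leading order a lowering letter acts by its value under `χ`, which is `1` exactly on the
letters `e_{a+1,a}`. In the recursion of the first column this turns the lower summands into the
single entry one row higher. -/
theorem letter_mul_sub_mem {n : ℕ} {a k : Fin n} (h : a < k) (b : Bool) {u : Env n} {d : ℤ}
    (hu : u ∈ kazOp n (d - a)) :
    letter (b, k, a) * u - (if b = false ∧ (a : ℕ) + 1 = k then u else 0) ∈ kazOp n (d - k) := by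
  have h1 := kazOp_mul (shiftLetter_mem_kazOp (b, k, a) h) hu
  have h2 : letter (b, k, a) * u - (if b = false ∧ (a : ℕ) + 1 = k then u else 0)
      = shiftLetter (b, k, a) * u := by
    rw [shiftLetter, sub_mul, Algebra.algebraMap_eq_smul_one, smul_one_mul, letterChi]
    simp only [ite_smul, one_smul, zero_smul]
  rw [h2]
  exact kazOp_mono (by simp only [letterDeg]; omega) h1

variable {n : ℕ} [NeZero n]

/-- The element `e_{k,1}^{(m)}` or `f_{k,1}^{(m)}`. -/
def colLetter (x : Bool × Fin n × ℕ) : Env n :=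
  if x.1 then sF x.2.2 x.2.1 (fstIdx n) else sE x.2.2 x.2.1 (fstIdx n)

/-- The Kazhdan degree of `e_{k,1}^{(m)}` and `f_{k,1}^{(m)}`. -/
def colDeg (x : Bool × Fin n × ℕ) : ℤ := (x.2.2 : ℤ) - x.2.1

theorem colLetter_mem_kazOp (x : Bool × Fin n × ℕ) : colLetter x ∈ kazOp n (colDeg x) := by
  obtain ⟨b, k, m⟩ := x
  have := sergeev_mem_kazOp m (fstIdx n) k
  have h0 : ((fstIdx n : ℕ) : ℤ) = 0 := rfl
  rw [h0, zero_sub, neg_add_eq_sub] at this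
  cases b
  · exact this.1
  · exact this.2

theorem colLetter_succ (b : Bool) (k : Fin n) (m : ℕ) : colLetter (b, k, m + 1)
    = ∑ a, (letter (false, k, a) * colLetter (b, a, m)
      + (-1 : ℂ) ^ m • (letter (true, k, a) * colLetter (!b, a, m))) := by
  rw [Finset.sum_add_distrib, ← Finset.smul_sum]
  cases b
  · exact sE_succ _ _ _
  · exact sF_succ _ _ _

/-- In nonpositive degree the only way to avoid a loss of degree is to descend through the letters
`e_{a+1,a}`, each of which acts as `χ = 1`. The full descent is the even case `m = j`, counting rows
from `0`; every other contribution drops by one. -/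
theorem colLetter_low (m : ℕ) : ∀ (b : Bool) (j : Fin n), m ≤ j →
    colLetter (b, j, m) - (if b = false ∧ m = j then 1 else 0) ∈ kazOp n ((m : ℤ) - j - 1) := by
  induction m with
  | zero =>
    intro b j _
    have h1 : sE 0 j (fstIdx n) = if j = fstIdx n then 1 else 0 := rfl
    have h2 : sF 0 j (fstIdx n) = 0 := rfl
    have h3 : (0 = (j : ℕ)) ↔ j = fstIdx n := by rw [Fin.ext_iff]; exact eq_comm
    cases b <;> simp [colLetter, h1, h2, h3]
  | succ m ih =>
    intro b j hj
    rw [colLetter_succ]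
    -- The constant `1` is attributed to the summand `a = m`, with `a + 1 = j`, so that the estimate
    -- can be made for each `a` separately.
    have e : (if b = false ∧ m + 1 = (j : ℕ) then (1 : Env n) else 0)
        = ∑ a : Fin n, if b = false ∧ m = (a : ℕ) ∧ (a : ℕ) + 1 = j then 1 else 0 := by
      split_ifs with h
      · rw [Finset.sum_eq_single ⟨m, by omega⟩]
        · simp [h]
        · intro a _ ha
          rw [if_neg]
          rintro ⟨-, h1, -⟩
          exact ha (Fin.ext h1.symm)
        · simp
      · refine (Finset.sum_eq_zero fun a _ => if_neg ?_).symm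
        rintro ⟨h1, h2, h3⟩
        exact h ⟨h1, by omega⟩
    rw [e, ← Finset.sum_sub_distrib]
    refine sum_mem fun a _ => ?_
    rcases lt_or_ge a j with h | h
    · have h1 := letter_mul_sub_mem (d := m) h false (colLetter_mem_kazOp (b, a, m))
      have h2 := letter_mul_sub_mem (d := m) h true (colLetter_mem_kazOp (!b, a, m))
      simp only [true_and, Bool.true_eq_false, false_and, if_false, sub_zero] at h1 h2
      have h3 : (if (a : ℕ) + 1 = j then colLetter (b, a, m) else 0)
          - (if b = false ∧ m = (a : ℕ) ∧ (a : ℕ) + 1 = j then 1 else 0) ∈ kazOp n ((m : ℤ) - j) := by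
        by_cases h4 : (a : ℕ) + 1 = j
        · have := ih b a (by omega)
          simp only [h4, and_true, if_true]
          exact kazOp_mono (by omega) this
        · simp [h4]
      have h4 := add_mem (add_mem h1 (Submodule.smul_mem _ ((-1 : ℂ) ^ m) h2)) h3
      refine kazOp_mono (d := (m : ℤ) - j) (by push_cast; omega) ?_
      convert h4 using 1
      abel
    · rw [if_neg (by rintro ⟨-, h1, h2⟩; have h : (j : ℕ) ≤ a := h; omega), sub_zero]
      have h : (j : ℕ) ≤ a := h
      have key : ∀ b b', letter (b', j, a) * colLetter (b, a, m)
          ∈ kazOp n (((m + 1 : ℕ) : ℤ) - j - 1) := by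
        intro b b'
        have h1 := ih b a (by omega)
        rw [if_neg (by omega), sub_zero] at h1
        refine kazOp_mono ?_ (kazOp_mul (letter_mem_kazOp (b', j, a)) h1)
        simp only [letterDeg]; push_cast; omega
      exact add_mem (key _ _) (Submodule.smul_mem _ _ (key _ _))

theorem colLetter_diag (j : Fin n) : colLetter (false, j, j) - 1 ∈ kazOp n (-1) := by
  simpa using colLetter_low j false j le_rfl

theorem colLetter_true_low (m : ℕ) (j : Fin n) (h : m ≤ j) :
    colLetter (true, j, m) ∈ kazOp n ((m : ℤ) - j - 1) := by
  simpa using colLetter_low m true j h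

theorem colLetter_lt (m : ℕ) (b : Bool) (j : Fin n) (h : m < j) :
    colLetter (b, j, m) ∈ kazOp n ((m : ℤ) - j - 1) := by
  simpa [h.ne] using colLetter_low m b j h.le

/-- The letters `e_{k,1}^{(m)}`, `f_{k,1}^{(m)}`, whose words span `U / I_χ`. -/
def colSet (n : ℕ) [NeZero n] : Set (Bool × Fin n × ℕ) :=
  {x | (x.2.1 = lastIdx n ∧ n ≤ x.2.2 ∧ x.2.2 < 2 * n) ∨
    (x.2.1 ≠ lastIdx n ∧ (x.2.1 : ℕ) < x.2.2 ∧ x.2.2 < n)}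

/-- The span of the words of degree at most `d` in a set of letters of the first column. -/
def colSpan (Λ : Set (Bool × Fin n × ℕ)) (d : ℤ) : Submodule ℂ (Whit n) :=
  wordSpan (colLetter (n := n)) colDeg (whitOne n) Λ d

theorem colSpan_mono {Λ Λ' : Set (Bool × Fin n × ℕ)} (hΛ : Λ ⊆ Λ') {d d' : ℤ} (hd : d ≤ d') :
    colSpan Λ d ≤ colSpan Λ' d' := wordSpan_mono hΛ hd

theorem colLetter_smul_mem {Λ : Set (Bool × Fin n × ℕ)} {x : Bool × Fin n × ℕ} (hx : x ∈ Λ)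
    {q : Whit n} {d : ℤ} (hq : q ∈ colSpan Λ d) :
    colLetter x • q ∈ colSpan Λ (colDeg x + d) :=
  smul_mem_wordSpan (v := colLetter (n := n)) (deg := colDeg) (x := whitOne n) hx hq

theorem colWord_mem_kaz (l : List (Bool × Fin n × ℕ)) {q : Whit n} {d : ℤ} (hq : q ∈ kaz n d) :
    (l.map colLetter).prod • q ∈ kaz n ((l.map colDeg).sum + d) := by
  induction l with
  | nil => simpa using hq
  | cons x l ih =>
    simp only [List.map_cons, List.prod_cons, List.sum_cons, mul_smul]
    exact kazOp_smul (colLetter_mem_kazOp x) ih (by omega)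

theorem colSpan_le_kaz (Λ : Set (Bool × Fin n × ℕ)) (d : ℤ) : colSpan Λ d ≤ kaz n d := by
  rw [colSpan, wordSpan, Submodule.span_le]
  rintro q ⟨l, -, h, rfl⟩
  exact kaz_mono (by omega) (colWord_mem_kaz l (whitOne_mem_kaz le_rfl))

/-- The elements of `U(Q(n))` mapping `kaz n (d - s)` into the span of the words of degree at most
`d` in the first column. -/
def colGood (n : ℕ) [NeZero n] (d s : ℤ) : Submodule ℂ (Env n) where
  carrier := {u | ∀ q ∈ kaz n (d - s), u • q ∈ colSpan (colSet n) d}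
  zero_mem' := fun q _ => by rw [zero_smul]; exact zero_mem _
  add_mem' := fun hu hv q hq => by rw [add_smul]; exact add_mem (hu q hq) (hv q hq)
  smul_mem' := fun z u hu q hq => by rw [smul_assoc]; exact Submodule.smul_mem _ _ (hu q hq)

/-- In degree `s`, the recursion shows that consecutive column entries `(k - 1, k - 1 + s)` and `(k,
k + s)` differ by `±` the letter `(k, k + s - 1)`, modulo terms handled by induction. Either an
entry belongs to `colSet`, or the letter in the next row would leave the matrix, and the entry then
agrees with the one below it. Hence all entries of degree `s` are good, and so is each letter, as a
difference of two of them. -/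
theorem letter_mem_colGood {d : ℤ} (ihd : ∀ c < d, kaz n c ≤ colSpan (colSet n) c) (s : ℕ)
    (hs : 1 ≤ s) : ∀ (b : Bool) (k a : Fin n), (k : ℕ) + s = a + 1 →
      letter (b, k, a) ∈ colGood n d s := by
  induction s using Nat.strong_induction_on with
  | _ s ih =>
  -- Operators of degree less than `s` are absorbed by the induction on `d`.
  have hop : kazOp n ((s : ℤ) - 1) ≤ colGood n d s := fun u hu q hq =>
    colSpan_mono subset_rfl (show d - 1 ≤ d by omega)
      (ihd (d - 1) (by omega) (kazOp_smul hu hq (by omega)))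
  -- the recursion of the first column modulo lower terms
  have hrec : ∀ (b : Bool) (k : Fin n) (m : ℕ), m + 1 = (k : ℕ) + s → ∀ a : Fin n,
      letter (false, k, a) * colLetter (b, a, m)
        + (-1 : ℂ) ^ m • (letter (true, k, a) * colLetter (!b, a, m))
        - (if (a : ℕ) + 1 = k then colLetter (b, a, m) else 0)
        - (if (a : ℕ) = m then (if b then (-1 : ℂ) ^ m else 1) • letter (b, k, a) else 0)
        ∈ colGood n d s := by
    intro b k m hm a
    rcases lt_or_ge a k with h | h
    · have h1 := letter_mul_sub_mem (d := m) h false (colLetter_mem_kazOp (b, a, m))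
      have h2 := letter_mul_sub_mem (d := m) h true (colLetter_mem_kazOp (!b, a, m))
      simp only [true_and, Bool.true_eq_false, false_and, if_false, sub_zero] at h1 h2
      have h3 := add_mem h1 (Submodule.smul_mem _ ((-1 : ℂ) ^ m) h2)
      rw [Fin.lt_def] at h
      rw [if_neg (show ¬ (a : ℕ) = m by omega), sub_zero]
      refine hop (kazOp_mono (d := (m : ℤ) - k) (by omega) ?_)
      convert h3 using 1
      abel
    · have h : (k : ℕ) ≤ a := h
      rw [if_neg (show ¬ (a : ℕ) + 1 = k by omega), sub_zero]
      -- For `a < m` the letter has degree less than `s` and the induction on `s` applies. For `a =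
      -- m` the column entry is `1` plus lower terms and leaves the bare letter. For `a > m` the
      -- column entry already drops in degree.
      rcases lt_trichotomy (a : ℕ) m with h' | h' | h'
      · rw [if_neg h'.ne, sub_zero]
        have key : ∀ b b', letter (b', k, a) * colLetter (b, a, m) ∈ colGood n d s := by
          intro b b' q hq
          rw [mul_smul]
          have h1 := ih ((a : ℕ) + 1 - k) (by omega) (by omega) b' k a (by omega)
          refine h1 _ (kazOp_smul (colLetter_mem_kazOp (b, a, m)) hq ?_)
          simp only [colDeg]; omega
        exact add_mem (key _ _) (Submodule.smul_mem _ _ (key _ _))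
      · subst h'
        rw [if_pos rfl]
        have h1 : ∀ b', letter (b', k, a) * (colLetter (false, a, a) - 1) ∈ colGood n d s := by
          intro b'
          refine hop (kazOp_mono ?_ (kazOp_mul (letter_mem_kazOp (b', k, a)) (colLetter_diag a)))
          simp only [letterDeg]; omega
        have h2 : ∀ b', letter (b', k, a) * colLetter (true, a, a) ∈ colGood n d s := by
          intro b'
          refine hop (kazOp_mono ?_ (kazOp_mul (letter_mem_kazOp (b', k, a))
            (colLetter_true_low a a le_rfl)))
          simp only [letterDeg]; omega
        cases b
        · have h3 := add_mem (h1 false) (Submodule.smul_mem _ ((-1 : ℂ) ^ (a : ℕ)) (h2 true))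
          simp only [Bool.not_false, Bool.false_eq_true, if_false, one_smul]
          convert h3 using 1
          noncomm_ring
        · have h3 := add_mem (h2 false) (Submodule.smul_mem _ ((-1 : ℂ) ^ (a : ℕ)) (h1 true))
          simp only [Bool.not_true, if_true]
          convert h3 using 1
          rw [mul_sub, mul_one, smul_sub]
          abel
      · rw [if_neg h'.ne', sub_zero]
        have key : ∀ b b', letter (b', k, a) * colLetter (b, a, m) ∈ colGood n d s := by
          intro b b'
          refine hop (kazOp_mono ?_ (kazOp_mul (letter_mem_kazOp (b', k, a))
            (colLetter_lt m b a h')))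
          simp only [letterDeg]; omega
        exact add_mem (key _ _) (Submodule.smul_mem _ _ (key _ _))
  have hrec' : ∀ (b : Bool) (k : Fin n) (m : ℕ), m + 1 = (k : ℕ) + s →
      colLetter (b, k, m + 1) - (∑ a : Fin n, if (a : ℕ) + 1 = k then colLetter (b, a, m) else 0)
        - (∑ a : Fin n, if (a : ℕ) = m then (if b then (-1 : ℂ) ^ m else 1) • letter (b, k, a)
          else 0) ∈ colGood n d s := by
    intro b k m hm
    rw [colLetter_succ, ← Finset.sum_sub_distrib, ← Finset.sum_sub_distrib]
    exact sum_mem fun a _ => hrec b k m hm a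
  have hallowed : ∀ (b : Bool) (k : Fin n), (b, k, (k : ℕ) + s) ∈ colSet n →
      colLetter (b, k, (k : ℕ) + s) ∈ colGood n d s := by
    intro b k hk q hq
    have h1 := ihd _ (by omega) hq
    have h2 := colLetter_smul_mem hk h1
    refine colSpan_mono subset_rfl ?_ h2
    simp only [colDeg]; push_cast; omega
  intro b k a hka
  have hsn : s ≤ n := by have := a.2; omega
  -- Induction on the distance `r` to the last row, whose entries all lie in `colSet`.
  have hcol : ∀ (r : ℕ) (k : Fin n), (k : ℕ) + r + 1 = n →
      colLetter (b, k, (k : ℕ) + s) ∈ colGood n d s := by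
    intro r
    induction r with
    | zero =>
      intro k hk
      refine hallowed b k (Or.inl ⟨Fin.ext ?_, ?_, ?_⟩)
      · change (k : ℕ) = n - 1; omega
      · change n ≤ (k : ℕ) + s; omega
      · change (k : ℕ) + s < 2 * n; omega
    | succ r ihr =>
      intro k hk
      by_cases h : (k : ℕ) + s < n
      · refine hallowed b k (Or.inr ⟨?_, ?_, h⟩)
        · rintro h'
          have : (k : ℕ) = n - 1 := congrArg Fin.val h'
          omega
        · change (k : ℕ) < (k : ℕ) + s; omega
      -- The recursion in row `k + 1` would involve the letter in column `k + s ≥ n`, which does not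
      -- exist; entries `k` and `k + 1` therefore agree modulo good terms.
      · have h1 := ihr ⟨k + 1, by omega⟩ (by simp only; omega)
        have h2 := hrec' b ⟨k + 1, by omega⟩ (k + s) (by simp only; omega)
        rw [Finset.sum_eq_single k, if_pos rfl, Finset.sum_eq_zero (s := Finset.univ)
          (f := fun a : Fin n => if (a : ℕ) = k + s then _ else _), sub_zero] at h2
        · have e : (k : ℕ) + s + 1 = k + 1 + s := by ring
          rw [e] at h2
          simp only at h1
          have := sub_mem h1 h2
          rwa [sub_sub_cancel] at this
        · intro a _
          have := a.2
          exact if_neg (by omega)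
        · intro a _ ha
          refine if_neg fun h' => ha (Fin.ext ?_)
          simp only at h'
          omega
        · simp
  have hcol' : ∀ k : Fin n, colLetter (b, k, (k : ℕ) + s) ∈ colGood n d s :=
    fun k => hcol (n - 1 - k) k (by have := k.2; omega)
  have h1 := hrec' b k a hka.symm
  have h2 : (∑ a' : Fin n, if (a' : ℕ) + 1 = k then colLetter (b, a', (a : ℕ)) else 0)
      ∈ colGood n d s := by
    refine sum_mem fun a' _ => ?_
    split_ifs with h
    · have := hcol' a'
      rwa [show (a' : ℕ) + s = a by omega] at this
    · exact zero_mem _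
  have h3 : colLetter (b, k, (a : ℕ) + 1) ∈ colGood n d s := by rw [← hka]; exact hcol' k
  have e2 : (∑ a' : Fin n, if (a' : ℕ) = a then
      (if b then (-1 : ℂ) ^ (a : ℕ) else 1) • letter (b, k, a') else 0)
      = (if b then (-1 : ℂ) ^ (a : ℕ) else 1) • letter (b, k, a) := by
    simp only [← Fin.ext_iff, Finset.sum_ite_eq', Finset.mem_univ, if_true]
  rw [e2] at h1
  -- What remains is the letter, with the sign `(-1)^a` in the odd case, which is removed by
  -- multiplying with it again.
  have h4 := sub_mem (sub_mem h3 h2) h1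
  rw [sub_sub_cancel] at h4
  cases b
  · simpa using h4
  · have h5 := Submodule.smul_mem _ ((-1 : ℂ) ^ (a : ℕ)) h4
    rw [if_pos rfl, smul_smul, ← mul_pow] at h5
    simpa using h5

/-- `U / I_χ` is spanned by words in the first column, compatibly with the Kazhdan filtration. -/
theorem kaz_le_colSpan (d : ℤ) : kaz n d ≤ colSpan (colSet n) d := by
  have key : ∀ N : ℕ, ∀ d : ℤ, d < N → kaz n d ≤ colSpan (colSet n) d := by
    intro N
    induction N with
    | zero =>
      intro d hd
      rw [kaz_neg (by simpa using hd)]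
      exact bot_le
    | succ N ih =>
      intro d hd
      have ihd : ∀ c < d, kaz n c ≤ colSpan (colSet n) c := fun c hc => ih c (by push_cast at hd; omega)
      rw [kaz, wordSpan, Submodule.span_le]
      rintro q ⟨l, h1, h2, rfl⟩
      cases l with
      | nil =>
        have h2 : 0 ≤ d := by simpa using h2
        rw [List.map_nil, List.prod_nil, one_smul]
        exact self_mem_wordSpan h2
      | cons x l =>
        simp only [List.map_cons, List.prod_cons, mul_smul]
        simp only [List.map_cons, List.sum_cons] at h2
        have hx : (x.2.1 : ℕ) ≤ x.2.2 := h1 x List.mem_cons_self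
        refine letter_mem_colGood ihd ((x.2.2 : ℕ) + 1 - x.2.1) (by omega) x.1 x.2.1 x.2.2
          (by omega) _ (kaz_mono ?_ (word_mem_kaz l fun a ha => h1 a (List.mem_cons_of_mem _ ha)))
        simp only [letterDeg] at h2
        omega
  exact key (d.toNat + 1) d (by push_cast; omega)

end

section

/-! ### Generation of the W-algebra by the last row of the first column -/

section removal

variable {n : ℕ}

/-- If `Δ` acts, up to terms of lower degree, as a derivative with respect to `t`, then a vector
`∑ tᵏ fₖ` killed by `Δ` up to lower terms is `f₀` up to lower terms. -/
theorem pow_smul_mem_kaz {t Δ : Env n} {r : ℤ} {A : ℤ → Submodule ℂ (Whit n)}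
    (ht : t ∈ kazOp n r) (hΔ : Δ ∈ kazOp n (-r))
    (h0 : ∀ e : ℤ, ∀ q ∈ A e, Δ • q ∈ kaz n (e - r - 1)) {c : ℕ → ℂ}
    (hc : ∀ k, c k = 0 → t ^ (k + 1) ∈ kazOp n ((k + 1) * r - 1))
    (hA : ∀ e, A e ≤ kaz n e)
    (h1 : ∀ (k : ℕ) (e : ℤ), ∀ q ∈ A e,
      Δ • t ^ (k + 1) • q - c k • t ^ k • q ∈ kaz n (e + k * r - 1)) :
    ∀ (N : ℕ) (d : ℤ) (f : ℕ → Whit n), (∀ k : ℕ, f k ∈ A (d - k * r)) →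
      Δ • ∑ k ∈ Finset.range N, t ^ k • f k ∈ kaz n (d - r - 1) →
      ∀ k, k + 1 < N → t ^ (k + 1) • f (k + 1) ∈ kaz n (d - 1) := by
  intro N
  induction N with
  | zero => intro d f _ _ k hk; omega
  | succ N ih =>
    intro d f hf hsum k hk
    -- Applying `Δ` turns `∑ tᵏ fₖ` into the shorter sum `∑ tᵏ (cₖ fₖ₊₁)` up to lower terms, to
    -- which the induction hypothesis applies.
    have hg : ∀ k : ℕ, c k • f (k + 1) ∈ A ((d - r) - k * r) := fun k => by
      have := Submodule.smul_mem _ (c k) (hf (k + 1))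
      rwa [show d - ((k + 1 : ℕ) : ℤ) * r = d - r - k * r by push_cast; ring] at this
    have hsum' : ∑ k ∈ Finset.range N, t ^ k • c k • f (k + 1) ∈ kaz n (d - r - 1) := by
      rw [Finset.sum_range_succ', smul_add, Finset.smul_sum, pow_zero, one_smul] at hsum
      have e0 := h0 _ _ (hf 0)
      rw [Nat.cast_zero, zero_mul, sub_zero] at e0
      have e1 := (Submodule.add_mem_iff_left _ e0).1 hsum
      have e2 : ∑ k ∈ Finset.range N, (Δ • t ^ (k + 1) • f (k + 1) - c k • t ^ k • f (k + 1))
          ∈ kaz n (d - r - 1) := by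
        refine sum_mem fun k _ => kaz_mono ?_ (h1 k _ _ (hf (k + 1)))
        push_cast; linarith
      have e3 := sub_mem e1 e2
      rw [Finset.sum_sub_distrib, sub_sub_cancel] at e3
      simpa only [smul_comm (t ^ _) (c _)] using e3
    have hlow := ih (d - r) (fun k => c k • f (k + 1)) hg
      (kazOp_smul hΔ hsum' (by linarith))
    have hall : ∀ k < N, t ^ k • c k • f (k + 1) ∈ kaz n (d - r - 1) := by
      intro k hk
      rcases k with _ | k
      · obtain ⟨M, rfl⟩ : ∃ M, N = M + 1 := ⟨N - 1, by omega⟩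
        rw [Finset.sum_range_succ'] at hsum'
        refine (Submodule.add_mem_iff_right _ ?_).1 hsum'
        exact sum_mem fun k hk => hlow k (by rw [Finset.mem_range] at hk; omega)
      · exact hlow k hk
    -- A vanishing coefficient occurs for odd `t`, where the power `t ^ (k + 1)` itself drops in
    -- degree; otherwise one divides by it.
    by_cases hck : c k = 0
    · refine kazOp_smul (hc k hck) (hA _ (hf (k + 1))) ?_
      push_cast; linarith
    · have := kazOp_smul ht (hall k (by omega)) (e := d - 1) (by linarith)
      rw [smul_comm (t ^ k) (c k), smul_comm t (c k), ← mul_smul, ← pow_succ'] at this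
      simpa [smul_smul, inv_mul_cancel₀ hck] using Submodule.smul_mem _ (c k)⁻¹ this

end removal

variable {n : ℕ} [NeZero n]

theorem sG_mem_kazOp (t m : ℕ) (k : Fin n) : sG t m k (fstIdx n) ∈ kazOp n ((m : ℤ) - k) :=
  add_mem (colLetter_mem_kazOp (false, k, m))
    (Submodule.smul_mem _ _ (colLetter_mem_kazOp (true, k, m)))

/-- In every term of `sG_comm_sE` and `sG_comm_sF` the upper indices add up to `m + p - 1`, one less
than in the product. The four parity cases are half sums and half differences over the two signs. -/
theorem colLetter_comm (x y : Bool × Fin n × ℕ) :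
    colLetter x * colLetter y - bsgn x.1 y.1 • (colLetter y * colLetter x)
      ∈ kazOp n (colDeg x + colDeg y - 1) := by
  obtain ⟨b, i, m⟩ := x
  obtain ⟨b', k, p⟩ := y
  have hE : ∀ t, sG t m i (fstIdx n) * sE p k (fstIdx n) - sE p k (fstIdx n) * sG t m i (fstIdx n)
      ∈ kazOp n ((m : ℤ) - i + (p - k) - 1) := by
    intro t
    rw [sG_comm_sE]
    refine sum_mem fun r hr => ?_
    rw [Finset.mem_range] at hr
    refine sub_mem (kazOp_mono ?_ (kazOp_mul (sG_mem_kazOp _ _ _) (sG_mem_kazOp _ _ _)))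
      (kazOp_mono ?_ (kazOp_mul (sG_mem_kazOp _ _ _) (sG_mem_kazOp _ _ _))) <;>
    · push_cast [Nat.sub_sub, Nat.cast_sub (show 1 + r ≤ m by omega)]; omega
  have hF : ∀ t, sG t m i (fstIdx n) * sF p k (fstIdx n)
      - sF p k (fstIdx n) * sG (t + 1) m i (fstIdx n)
      ∈ kazOp n ((m : ℤ) - i + (p - k) - 1) := by
    intro t
    rw [sG_comm_sF]
    refine sum_mem fun r hr => ?_
    rw [Finset.mem_range] at hr
    refine sub_mem (Submodule.smul_mem _ _
        (kazOp_mono ?_ (kazOp_mul (sG_mem_kazOp _ _ _) (sG_mem_kazOp _ _ _))))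
      (Submodule.smul_mem _ _
        (kazOp_mono ?_ (kazOp_mul (sG_mem_kazOp _ _ _) (sG_mem_kazOp _ _ _)))) <;>
    · push_cast [Nat.sub_sub, Nat.cast_sub (show 1 + r ≤ m by omega)]; omega
  simp only [colDeg]
  cases b <;> cases b' <;> simp only [colLetter, bsgn]
  · convert Submodule.smul_mem _ (1 / 2 : ℂ) (add_mem (hE 0) (hE 1)) using 1
    simp [sG, add_mul, mul_add]; module
  · convert Submodule.smul_mem _ (1 / 2 : ℂ) (add_mem (hF 0) (hF 1)) using 1
    simp [sG, add_mul, mul_add]; module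
  · convert Submodule.smul_mem _ (1 / 2 : ℂ) (sub_mem (hE 0) (hE 1)) using 1
    simp [sG, add_mul, mul_add]; module
  · convert Submodule.smul_mem _ (1 / 2 : ℂ) (sub_mem (hF 0) (hF 1)) using 1
    simp [sG, add_mul, mul_add]; module

/-- Action of `e_{m,j}`, `f_{m,j}` with `m > j` on the first column. -/
theorem shiftLetter_colLetter (b b' : Bool) (i j k : Fin n) (hij : j < i) (m : ℕ) :
    shiftLetter (b, i, j) * colLetter (b', k, m)
      = bsgn b b' • (colLetter (b', k, m) * shiftLetter (b, i, j))
        + if j = k then (if b then (-1 : ℂ) ^ (m + 1) else 1) • colLetter (b ^^ b', i, m)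
          else 0 := by
  have hi : i ≠ fstIdx n := by
    rintro rfl
    exact absurd hij (by simp [fstIdx])
  obtain ⟨h1, h2, h3, h4⟩ := sergeev_bracket m i j (fstIdx n) hi k
  have h : letter (b, i, j) * colLetter (b', k, m)
      = bsgn b b' • (colLetter (b', k, m) * letter (b, i, j))
        + if j = k then (if b then (-1 : ℂ) ^ (m + 1) else 1) • colLetter (b ^^ b', i, m)
          else 0 := by
    cases b <;> cases b'
    · simpa [letter, colLetter, bsgn] using h1
    · simpa [letter, colLetter, bsgn] using h2
    · simpa [letter, colLetter, bsgn] using h3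
    · simpa [letter, colLetter, bsgn] using h4
  have e : letterChi (b, i, j) = bsgn b b' * letterChi (b, i, j) := by
    cases b <;> cases b' <;> simp [letterChi, bsgn]
  rw [shiftLetter, sub_mul, h, mul_sub, smul_sub, ← Algebra.commutes,
    Algebra.algebraMap_eq_smul_one, smul_mul_assoc, one_mul, smul_smul, ← e]
  abel

/-- Writing `Δ` for the shifted letter and `t` for the column entry, `Δ t = t Δ + e_{i,1}^{(i)}` and
the last term is `1` up to lower degree (rows counted from `0`). Thus `Δ` differentiates powers of
`t`, as in a Weyl algebra. -/
theorem shiftLetter_pow_even {i j : Fin n} (hij : j < i) {e : ℤ} {q : Whit n}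
    (hq : q ∈ kaz n e) (h : shiftLetter (false, i, j) • q ∈ kaz n (e - ((i : ℤ) - j) - 1)) (k : ℕ) :
    shiftLetter (false, i, j) • colLetter (false, j, (i : ℕ)) ^ (k + 1) • q
      - ((k : ℂ) + 1) • colLetter (false, j, (i : ℕ)) ^ k • q
      ∈ kaz n (e + k * ((i : ℤ) - j) - 1) := by
  have key : ∀ p : Whit n, shiftLetter (false, i, j) • colLetter (false, j, (i : ℕ)) • p
      = colLetter (false, j, (i : ℕ)) • shiftLetter (false, i, j) • p
        + ((colLetter (false, i, (i : ℕ)) - 1) • p + p) := by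
    intro p
    have h1 := shiftLetter_colLetter false false i j j hij i
    simp only [if_true, Bool.false_eq_true, if_false, one_smul, bsgn, Bool.and_self,
      Bool.xor_self] at h1
    rw [← mul_smul, h1, add_smul, mul_smul, sub_smul, one_smul, sub_add_cancel]
  have hp : ∀ k : ℕ, colLetter (false, j, (i : ℕ)) ^ k • q ∈ kaz n (e + k * ((i : ℤ) - j)) := by
    intro k
    induction k with
    | zero => simpa using hq
    | succ k ih =>
      rw [pow_succ', mul_smul]
      refine kazOp_smul (colLetter_mem_kazOp _) ih ?_
      simp only [colDeg]; push_cast; linarith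
  induction k with
  | zero =>
    rw [pow_one, key]
    simp only [Nat.cast_zero, zero_add, one_smul, pow_zero]
    rw [← add_assoc, add_sub_cancel_right]
    refine add_mem (kazOp_smul (colLetter_mem_kazOp _) h ?_)
      (kazOp_smul (colLetter_diag i) hq (by linarith))
    simp only [colDeg]; linarith
  | succ k ih =>
    rw [pow_succ', mul_smul, key]
    have h1 := kazOp_smul (colLetter_mem_kazOp (false, j, (i : ℕ))) ih
      (e := e + ((k + 1 : ℕ) : ℤ) * ((i : ℤ) - j) - 1)
      (by simp only [colDeg]; push_cast; linarith)
    have h2 := kazOp_smul (colLetter_diag i) (hp (k + 1))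
      (e := e + ((k + 1 : ℕ) : ℤ) * ((i : ℤ) - j) - 1) (by linarith)
    convert add_mem h1 h2 using 1
    rw [smul_sub, smul_comm (colLetter (false, j, (i : ℕ))) ((k : ℂ) + 1), ← mul_smul
      (colLetter (false, j, (i : ℕ))) (colLetter (false, j, (i : ℕ)) ^ k), ← pow_succ']
    push_cast
    generalize shiftLetter (false, i, j) • colLetter (false, j, (i : ℕ)) ^ (k + 1) • q = v
    generalize colLetter (false, j, (i : ℕ)) ^ (k + 1) • q = w
    generalize (colLetter (false, i, (i : ℕ)) - 1) • w = w'
    generalize colLetter (false, j, (i : ℕ)) • v = v'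
    module

/-- Twice the square of an odd element is its supercommutator with itself. -/
theorem sq_mem_kazOp (j : Fin n) (m : ℕ) :
    colLetter (true, j, m) ^ 2 ∈ kazOp n (2 * ((m : ℤ) - j) - 1) := by
  have h := colLetter_comm (n := n) (true, j, m) (true, j, m)
  simp only [bsgn, Bool.and_self, if_true, neg_smul, one_smul, sub_neg_eq_add, colDeg] at h
  have h2 := Submodule.smul_mem _ (1 / 2 : ℂ) h
  rw [show 2 * ((m : ℤ) - j) - 1 = (m : ℤ) - j + (m - j) - 1 by ring, pow_two]
  convert h2 using 1
  module

theorem pow_mem_kazOp (x : Bool × Fin n × ℕ) (k : ℕ) :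
    colLetter x ^ k ∈ kazOp n (k * colDeg x) := by
  induction k with
  | zero => simpa using one_mem_kazOp le_rfl
  | succ k ih =>
    rw [pow_succ]
    refine kazOp_mono ?_ (kazOp_mul ih (colLetter_mem_kazOp x))
    push_cast; linarith

theorem pow_mem_kazOp_odd (j : Fin n) (m k : ℕ) :
    colLetter (true, j, m) ^ (k + 2) ∈ kazOp n ((k + 2) * ((m : ℤ) - j) - 1) := by
  rw [pow_add]
  refine kazOp_mono ?_ (kazOp_mul (pow_mem_kazOp _ _) (sq_mem_kazOp j m))
  simp only [colDeg]; linarith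

/-- The hypothesis on `Λ` is what makes the letters of `Λ` constants for the derivation. A bracket
with a letter in another row vanishes; in row `j` it is an entry `(i, m)` with `m < i`, or with `m =
i` and odd parity, and both drop in degree. -/
theorem shiftLetter_smul_colSpan {b : Bool} {i j : Fin n} (hij : j < i)
    {Λ : Set (Bool × Fin n × ℕ)}
    (hΛ : ∀ y ∈ Λ, y.2.1 = j → y.2.2 ≤ i ∧ y ≠ (b, j, (i : ℕ))) {e : ℤ} {q : Whit n}
    (hq : q ∈ colSpan Λ e) : shiftLetter (b, i, j) • q ∈ kaz n (e - ((i : ℤ) - j) - 1) := by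
  have key : ∀ l : List (Bool × Fin n × ℕ), (∀ a ∈ l, a ∈ Λ) →
      shiftLetter (b, i, j) • (l.map colLetter).prod • whitOne n
        ∈ kaz n ((l.map colDeg).sum - ((i : ℤ) - j) - 1) := by
    intro l
    induction l with
    | nil =>
      intro _
      rw [List.map_nil, List.map_nil, List.prod_nil, one_smul, shiftLetter_smul_whitOne _ hij]
      exact zero_mem _
    | cons y l ih =>
      intro hl
      obtain ⟨b', k, m⟩ := y
      have hy := hΛ _ (hl _ List.mem_cons_self)
      have ih := ih fun a ha => hl a (List.mem_cons_of_mem _ ha)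
      have hw := colWord_mem_kaz l (whitOne_mem_kaz (n := n) le_rfl)
      rw [List.map_cons, List.map_cons, List.prod_cons, List.sum_cons, mul_smul, ← mul_smul,
        shiftLetter_colLetter b b' i j k hij m, add_smul, smul_assoc, mul_smul]
      refine add_mem (Submodule.smul_mem _ _ (kazOp_smul (colLetter_mem_kazOp _) ih ?_)) ?_
      · simp only [colDeg]; linarith
      · by_cases h : j = k
        · subst h
          rw [if_pos rfl]
          obtain ⟨h1, h2⟩ := hy rfl
          have h1 : m ≤ i := h1
          have h3 : colLetter (b ^^ b', i, m) ∈ kazOp n ((m : ℤ) - i - 1) := by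
            rcases h1.lt_or_eq with h1 | h1
            · exact colLetter_lt m _ i h1
            · have : (b ^^ b') = true := by
                by_contra h4
                refine h2 ?_
                rw [h1]
                have : b' = b := by revert h4; cases b <;> cases b' <;> simp
                rw [this]
              rw [this]
              exact colLetter_true_low m i h1.le
          rw [smul_assoc]
          refine Submodule.smul_mem _ _ (kazOp_smul h3 hw ?_)
          simp only [colDeg]; linarith
        · rw [if_neg h, zero_smul]; exact zero_mem _
  induction hq using Submodule.span_induction with
  | mem q hq =>
    obtain ⟨l, h1, h2, rfl⟩ := hq
    exact kaz_mono (by linarith) (key l h1)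
  | zero => rw [smul_zero]; exact zero_mem _
  | add p q _ _ hp hq => rw [smul_add]; exact add_mem hp hq
  | smul c q _ hq => rw [smul_comm]; exact Submodule.smul_mem _ _ hq

theorem colLetter_pow_comm (x y : Bool × Fin n × ℕ) (k : ℕ) :
    colLetter y * colLetter x ^ k - bsgn y.1 x.1 ^ k • (colLetter x ^ k * colLetter y)
      ∈ kazOp n (colDeg y + k * colDeg x - 1) := by
  induction k with
  | zero => simp
  | succ k ih =>
    have h1 := kazOp_mul ih (colLetter_mem_kazOp x)
    have h2 := kazOp_mul (pow_mem_kazOp x k) (colLetter_comm y x)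
    have h3 := Submodule.smul_mem _ (bsgn y.1 x.1 ^ k) h2
    have e : (k + 1 : ℕ) * colDeg x = k * colDeg x + colDeg x := by push_cast; ring
    rw [show colDeg y + k * colDeg x - 1 + colDeg x = colDeg y + (k + 1 : ℕ) * colDeg x - 1 by
      rw [e]; ring] at h1
    rw [show k * colDeg x + (colDeg y + colDeg x - 1) = colDeg y + (k + 1 : ℕ) * colDeg x - 1 by
      rw [e]; ring] at h3
    convert add_mem h1 h3 using 1
    simp only [pow_succ, sub_mul, mul_sub, smul_sub, smul_mul_assoc, mul_smul_comm, smul_smul,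
      mul_assoc]
    abel

/-- The span of `tᵏ q` with `q` a word in `Λ`, up to terms of lower degree. -/
def colExp (t : Bool × Fin n × ℕ) (Λ : Set (Bool × Fin n × ℕ)) (d : ℤ) : Submodule ℂ (Whit n) :=
  kaz n (d - 1) ⊔ ⨆ k : ℕ, (colSpan Λ (d - k * colDeg t)).map
    (Algebra.lsmul ℂ ℂ (Whit n) (colLetter t ^ k))

theorem mem_colExp {t : Bool × Fin n × ℕ} {Λ : Set (Bool × Fin n × ℕ)} {d : ℤ} (k : ℕ)
    {q : Whit n} (hq : q ∈ colSpan Λ (d - k * colDeg t)) :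
    colLetter t ^ k • q ∈ colExp t Λ d :=
  (le_sup_right : _ ≤ colExp t Λ d) (Submodule.mem_iSup_of_mem k ⟨q, hq, rfl⟩)

theorem colLetter_smul_mem_colExp {t y : Bool × Fin n × ℕ} {Λ : Set (Bool × Fin n × ℕ)}
    (hy : y ∈ insert t Λ) {d : ℤ} {q : Whit n} (hq : q ∈ colExp t Λ d) :
    colLetter y • q ∈ colExp t Λ (colDeg y + d) := by
  have hlow : ∀ p ∈ kaz n (colDeg y + d - 1), p ∈ colExp t Λ (colDeg y + d) := fun p hp =>
    (le_sup_left : _ ≤ colExp t Λ (colDeg y + d)) hp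
  obtain ⟨a, ha, b, hb, rfl⟩ := Submodule.mem_sup.1 hq
  rw [smul_add]
  refine add_mem (hlow _ (kazOp_smul (colLetter_mem_kazOp y) ha (by linarith))) ?_
  clear hq
  induction hb using Submodule.iSup_induction' with
  | mem k p hp =>
    obtain ⟨p, hp, rfl⟩ := hp
    change colLetter y • colLetter t ^ k • p ∈ _
    rcases hy with rfl | hy
    · rw [← mul_smul, ← pow_succ']
      refine mem_colExp _ ?_
      rwa [show colDeg y + d - (k + 1 : ℕ) * colDeg y = d - k * colDeg y by push_cast; ring]
    · have h1 := colLetter_smul_mem hy hp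
      have h2 := mem_colExp (t := t) (Λ := Λ) (d := colDeg y + d) k
        (q := bsgn y.1 t.1 ^ k • colLetter y • p) (Submodule.smul_mem _ _ (by
          rwa [← add_sub_assoc] at h1))
      have h3 := hlow _ (kazOp_smul (colLetter_pow_comm t y k) (colSpan_le_kaz _ _ hp)
        (by linarith))
      convert add_mem h3 h2 using 1
      rw [sub_smul, smul_assoc, mul_smul, mul_smul, smul_comm (bsgn y.1 t.1 ^ k), sub_add_cancel]
  | zero => rw [smul_zero]; exact zero_mem _
  | add p q _ _ hp hq =>
    rw [smul_add]
    exact add_mem hp hq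

/-- Supercommutativity up to lower degree allows all occurrences of `t` to be collected on the left.
-/
theorem colSpan_insert_le (t : Bool × Fin n × ℕ) (Λ : Set (Bool × Fin n × ℕ)) (d : ℤ) :
    colSpan (insert t Λ) d ≤ colExp t Λ d := by
  have key : ∀ l : List (Bool × Fin n × ℕ), (∀ a ∈ l, a ∈ insert t Λ) → ∀ d : ℤ,
      (l.map colDeg).sum ≤ d → (l.map colLetter).prod • whitOne n ∈ colExp t Λ d := by
    intro l
    induction l with
    | nil =>
      intro _ d hd
      have hd : 0 ≤ d := by simpa using hd
      have := mem_colExp (t := t) (Λ := Λ) (d := d) 0 (q := whitOne n)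
        (self_mem_wordSpan (by simpa using hd))
      simpa using this
    | cons y l ih =>
      intro hl d hd
      rw [List.map_cons, List.sum_cons] at hd
      rw [List.map_cons, List.prod_cons, mul_smul]
      have h1 := ih (fun a ha => hl a (List.mem_cons_of_mem _ ha)) (d - colDeg y) (by linarith)
      have h2 := colLetter_smul_mem_colExp (hl y List.mem_cons_self) h1
      rwa [add_sub_cancel] at h2
  rw [colSpan, wordSpan, Submodule.span_le]
  rintro q ⟨l, h1, h2, rfl⟩
  exact key l h1 d h2

/-- In the expansion `∑ tᵏ gₖ` plus lower terms, the shifted letter acts as the derivative with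
respect to `t`, so if it kills the vector, all terms with `k ≥ 1` are of lower degree. -/
theorem colSpan_remove {b : Bool} {i j : Fin n} (hij : j < i) {Λ : Set (Bool × Fin n × ℕ)}
    (hΛ : ∀ y ∈ Λ, y.2.1 = j → y.2.2 ≤ i ∧ y ≠ (b, j, (i : ℕ))) {d : ℤ} {q : Whit n}
    (hq : q ∈ colSpan (insert (b, j, (i : ℕ)) Λ) d ⊔ kaz n (d - 1))
    (hΔ : shiftLetter (b, i, j) • q = 0) : q ∈ colSpan Λ d ⊔ kaz n (d - 1) := by
  set t : Bool × Fin n × ℕ := (b, j, (i : ℕ)) with ht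
  have hr : colDeg t = (i : ℤ) - j := rfl
  have hΔop : shiftLetter (b, i, j) ∈ kazOp n (-colDeg t) :=
    kazOp_mono (by simp only [letterDeg, hr]; linarith) (shiftLetter_mem_kazOp (b, i, j) hij)
  have hq : q ∈ colExp t Λ d := (sup_le (colSpan_insert_le t Λ d) le_sup_left) hq
  obtain ⟨a, ha, p, hp, rfl⟩ := Submodule.mem_sup.1 hq
  obtain ⟨f, hf, rfl⟩ := (Submodule.mem_iSup_iff_exists_finsupp _ _).1 hp
  choose g hg hgf using hf
  have hgf : ∀ k, colLetter t ^ k • g k = f k := hgf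
  obtain ⟨N, hN⟩ : ∃ N, f.support ⊆ Finset.range (N + 1) := by
    obtain ⟨N, hN⟩ := f.support.bddAbove
    exact ⟨N, fun k hk => Finset.mem_range.2 (Nat.lt_succ_of_le (hN hk))⟩
  have hsum : (f.sum fun _ x => x) = ∑ k ∈ Finset.range (N + 1), colLetter t ^ k • g k := by
    rw [Finsupp.sum_of_support_subset _ hN _ (by simp)]
    exact Finset.sum_congr rfl fun k _ => (hgf k).symm
  have h0 : ∀ e : ℤ, ∀ q ∈ colSpan Λ e, shiftLetter (b, i, j) • q ∈ kaz n (e - colDeg t - 1) :=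
    fun e q hq => by rw [hr]; exact shiftLetter_smul_colSpan hij hΛ hq
  rw [hsum] at hΔ ⊢
  have h1 : shiftLetter (b, i, j) • ∑ k ∈ Finset.range (N + 1), colLetter t ^ k • g k
      ∈ kaz n (d - colDeg t - 1) := by
    rw [smul_add, add_comm] at hΔ
    rw [eq_neg_of_add_eq_zero_left hΔ]
    exact neg_mem (kazOp_smul hΔop ha (by linarith))
  have h2 : ∀ k, k + 1 < N + 1 → colLetter t ^ (k + 1) • g (k + 1) ∈ kaz n (d - 1) := by
    cases b with
    | false =>
      refine pow_smul_mem_kaz (A := colSpan Λ) (c := fun k => (k : ℂ) + 1) (colLetter_mem_kazOp t)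
        hΔop h0 ?_ (colSpan_le_kaz Λ) ?_ _ d g hg h1
      · intro k hk
        exact absurd hk (Nat.cast_add_one_ne_zero k)
      · intro k e q hq
        have := shiftLetter_pow_even hij (colSpan_le_kaz _ _ hq) (h0 e q hq) k
        exact this
    | true =>
      -- For odd `t` only the first power matters, since `t²` has lower degree. The value
      -- `(-1)^(i+1)` is the sign in the bracket of `f_{i,j}` with Sergeev's elements.
      refine pow_smul_mem_kaz (A := colSpan Λ)
        (c := fun k => if k = 0 then (-1 : ℂ) ^ ((i : ℕ) + 1) else 0) (colLetter_mem_kazOp t)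
        hΔop h0 ?_ (colSpan_le_kaz Λ) ?_ _ d g hg h1
      · intro k hk
        obtain ⟨k, rfl⟩ : ∃ m, k = m + 1 := ⟨k - 1, by
          rcases k with _ | k
          · simp at hk
          · rfl⟩
        refine kazOp_mono (le_of_eq ?_) (pow_mem_kazOp_odd j i k)
        rw [hr]; push_cast; ring
      · intro k e q hq
        rcases k with _ | k
        · have h := shiftLetter_colLetter true true i j j hij i
          simp only [if_true, bsgn, Bool.and_self, Bool.xor_self] at h
          rw [if_pos rfl, zero_add, pow_one, pow_zero, one_smul, ← mul_smul, ht, h, add_smul,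
            smul_assoc, smul_assoc, neg_one_smul, mul_smul, add_sub_assoc (-(_ : Whit n)),
            ← smul_sub ((-1 : ℂ) ^ ((i : ℕ) + 1))]
          refine add_mem (neg_mem (kazOp_smul (colLetter_mem_kazOp t) (h0 e q hq) ?_)) ?_
          · rw [← ht]; push_cast; linarith
          · refine Submodule.smul_mem _ _ ?_
            rw [← ht]
            have := kazOp_smul (colLetter_diag i) (colSpan_le_kaz _ _ hq)
              (e := e + ((0 : ℕ) : ℤ) * colDeg t - 1) (by push_cast; linarith)
            rwa [sub_smul, one_smul] at this
        · rw [if_neg (Nat.succ_ne_zero k), zero_smul, sub_zero]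
          refine kazOp_smul hΔop (kazOp_smul (pow_mem_kazOp_odd j i k) (colSpan_le_kaz _ _ hq)
            le_rfl) ?_
          rw [hr]; push_cast; linarith
  rw [Finset.sum_range_succ', pow_zero, one_smul, ← add_assoc, add_comm]
  refine Submodule.add_mem_sup ?_ (add_mem ha (sum_mem fun k hk => h2 k ?_))
  · simpa using hg 0
  · rw [Finset.mem_range] at hk; omega

/-- The letters of the last row. -/
def lastSet (n : ℕ) [NeZero n] : Set (Bool × Fin n × ℕ) :=
  {x | x.2.1 = lastIdx n ∧ n ≤ x.2.2 ∧ x.2.2 < 2 * n}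

theorem invariant_mem_colSpan {d : ℤ} {q : Whit n} (hq : q ∈ kaz n d)
    (h : ∀ x : Bool × Fin n × Fin n, x.2.2 < x.2.1 → shiftLetter x • q = 0) :
    q ∈ colSpan (lastSet n) d ⊔ kaz n (d - 1) := by
  classical
  have key : ∀ S : Finset (Bool × Fin n × ℕ), (∀ x ∈ S, (x.2.1 : ℕ) < x.2.2 ∧ x.2.2 < n) →
      q ∈ colSpan (lastSet n ∪ S) d ⊔ kaz n (d - 1) →
      q ∈ colSpan (lastSet n) d ⊔ kaz n (d - 1) := by
    intro S
    -- Letters are removed in order of decreasing upper index `m`. When `(b, j, m)` is removed, all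
    -- remaining letters of row `j` have upper index at most `m`, as `colSpan_remove` requires.
    induction S using Finset.induction_on_max_value (fun x : Bool × Fin n × ℕ => x.2.2) with
    | empty => intro _ h; simpa using h
    | insert t S ht hmax ih =>
      intro hS hq
      obtain ⟨b, j, m⟩ := t
      obtain ⟨hjm, hmn⟩ := hS _ (Finset.mem_insert_self _ _)
      refine ih (fun x hx => hS x (Finset.mem_insert_of_mem hx)) ?_
      refine colSpan_remove (b := b) (i := ⟨m, hmn⟩) (j := j) hjm ?_ ?_ (h _ hjm)
      · rintro y (hy | hy) rfl
        · have h1 : (y.2.1 : ℕ) = n - 1 := congrArg Fin.val hy.1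
          simp only at hjm hmn
          omega
        · exact ⟨hmax y hy, fun h' => ht (h' ▸ hy)⟩
      · rwa [Finset.coe_insert, Set.union_insert] at hq
  refine key ((Finset.univ ×ˢ Finset.univ ×ˢ Finset.range n).filter
    fun x => (x.2.1 : ℕ) < x.2.2) (fun x hx => ?_) ?_
  · simp only [Finset.mem_filter, Finset.mem_product, Finset.mem_range] at hx
    exact ⟨hx.2, hx.1.2.2⟩
  · refine Submodule.mem_sup_left (colSpan_mono ?_ le_rfl (kaz_le_colSpan d hq))
    rintro x (hx | ⟨-, h1, h2⟩)
    · exact Or.inl hx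
    · refine Or.inr ?_
      simp [h1, h2]

/-! ### The filtered W-algebra -/

/-- `toWhit` as a linear map. -/
def toWhitL (n : ℕ) : W n →ₗ[ℂ] Whit n where
  toFun := toWhit
  map_add' _ _ := rfl
  map_smul' _ _ := rfl

theorem toWhitL_apply {n : ℕ} (w : W n) : toWhitL n w = toWhit w := rfl

/-- An endomorphism of the cyclic module `U / I_χ` is determined by its value at the generator. -/
theorem toWhit_injective (n : ℕ) : Function.Injective (toWhit (n := n)) := by
  intro w w' h
  refine MulOpposite.unop_injective (LinearMap.ext fun q => ?_)
  obtain ⟨u, rfl⟩ := Submodule.mkQ_surjective (whitIdeal n) q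
  change w.unop (proj n u) = w'.unop (proj n u)
  rw [proj_eq, map_smul, map_smul]
  exact congrArg (u • ·) h

theorem toWhit_mul {n : ℕ} {y : Env n} {w : W n} (hw : toWhit w = y • whitOne n) (w' : W n) :
    toWhit (w * w') = y • toWhit w' := by
  change w'.unop (w.unop (whitOne n)) = y • w'.unop (whitOne n)
  rw [← map_smul]
  exact congrArg _ hw

theorem toWhit_one (n : ℕ) : toWhit (1 : W n) = whitOne n := rfl

theorem shiftLetter_smul_toWhit {n : ℕ} (w : W n) (x : Bool × Fin n × Fin n)
    (hx : x.2.2 < x.2.1) : shiftLetter x • toWhit w = 0 := by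
  change shiftLetter x • w.unop (whitOne n) = 0
  rw [← map_smul, shiftLetter_smul_whitOne x hx, map_zero]

theorem exists_mem_kaz {n : ℕ} (q : Whit n) : ∃ d : ℤ, q ∈ kaz n d := by
  obtain ⟨u, rfl⟩ := Submodule.mkQ_surjective (whitIdeal n) q
  change ∃ d, proj n u ∈ kaz n d
  have hadd : ∀ u v : Env n, (∃ d, u ∈ kazOp n d) → (∃ d, v ∈ kazOp n d) →
      ∃ d, u + v ∈ kazOp n d := by
    rintro u v ⟨d, hd⟩ ⟨d', hd'⟩
    exact ⟨max d d', add_mem (kazOp_mono (le_max_left _ _) hd) (kazOp_mono (le_max_right _ _) hd')⟩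
  have key : ∃ d, u ∈ kazOp n d := by
    obtain ⟨a, rfl⟩ : ∃ a, envMk n a = u := RingQuot.mkAlgHom_surjective ℂ (EnvRel n) u
    induction a using TensorAlgebra.induction with
    | algebraMap r =>
      refine ⟨0, ?_⟩
      rw [AlgHom.commutes, Algebra.algebraMap_eq_smul_one]
      exact Submodule.smul_mem _ _ (one_mem_kazOp le_rfl)
    | ι x =>
      obtain ⟨A, B, hx⟩ := x.2
      have hx' : x = ∑ i, ∑ j, (A i j • qe i j + B i j • qf i j) := by
        have h1 : ∀ (c : ℂ) (i j : Fin n), c • qe i j = blocks (Matrix.single i j c) 0 := by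
          intro c i j
          apply Subtype.ext
          change c • fromBlocks _ _ _ _ = _
          simp [fromBlocks_smul, blocks]
        have h2 : ∀ (c : ℂ) (i j : Fin n), c • qf i j = blocks 0 (Matrix.single i j c) := by
          intro c i j
          apply Subtype.ext
          change c • fromBlocks _ _ _ _ = _
          simp [fromBlocks_smul, blocks]
        simp only [h1, h2, blocks_add, blocks_sum, add_zero, zero_add]
        rw [← Matrix.matrix_eq_sum_single, ← Matrix.matrix_eq_sum_single]
        exact Subtype.ext hx
      have hl : envι n x = ∑ i, ∑ j,
          (A i j • letter (false, i, j) + B i j • letter (true, i, j)) := by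
        conv_lhs => rw [hx']
        simp only [map_sum, map_add, map_smul]
        rfl
      refine ⟨n, ?_⟩
      change envι n x ∈ _
      rw [hl]
      refine sum_mem fun i _ => sum_mem fun j _ => add_mem
        (Submodule.smul_mem _ _ (kazOp_mono ?_ (letter_mem_kazOp _)))
        (Submodule.smul_mem _ _ (kazOp_mono ?_ (letter_mem_kazOp _))) <;>
      · simp only [letterDeg]; omega
    | mul a b ha hb =>
      obtain ⟨d, hd⟩ := ha
      obtain ⟨d', hd'⟩ := hb
      exact ⟨d + d', by rw [map_mul]; exact kazOp_mul hd hd'⟩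
    | add a b ha hb => rw [map_add]; exact hadd _ _ ha hb
  obtain ⟨d, hd⟩ := key
  exact ⟨d, by rw [proj_eq]; exact kazOp_smul hd (whitOne_mem_kaz le_rfl) (by omega)⟩

/-- The Kazhdan filtration of the W-algebra. -/
def wFil (n : ℕ) (d : ℤ) : Submodule ℂ (W n) := (kaz n d).comap (toWhitL n)

theorem mem_wFil {n : ℕ} {d : ℤ} {w : W n} : w ∈ wFil n d ↔ toWhit w ∈ kaz n d := Iff.rfl

/-- The elements `π(e_{n,1}^{(m)})`, `π(f_{n,1}^{(m)})`, according to the parity `x.1`. -/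
def wLetter (x : Bool × ℕ) : W n := if x.1 then wF n x.2 else wE n x.2

/-- The degree of `π(e_{n,1}^{(m)})`, `π(f_{n,1}^{(m)})`. -/
def wDeg (n : ℕ) (x : Bool × ℕ) : ℤ := (x.2 : ℤ) - (n - 1)

theorem toWhit_wLetter (x : Bool × ℕ) :
    toWhit (wLetter (n := n) x) = colLetter (x.1, lastIdx n, x.2) • whitOne n := by
  obtain ⟨b, m⟩ := x
  rw [← proj_eq]
  cases b
  · exact toWhit_ofInvariant _ (sE_invariant n m)
  · exact toWhit_ofInvariant _ (sF_invariant n m)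

theorem colDeg_last (x : Bool × ℕ) : colDeg (x.1, lastIdx n, x.2) = wDeg n x := by
  have h0 := NeZero.pos n
  have h1 : ((lastIdx n : ℕ) : ℤ) = n - 1 := by
    have : (lastIdx n : ℕ) = n - 1 := rfl
    omega
  rw [colDeg, wDeg, h1]

theorem toWhit_wWord (l : List (Bool × ℕ)) : toWhit (l.map (wLetter (n := n))).prod
    = ((l.map fun x => (x.1, lastIdx n, x.2)).map colLetter).prod • whitOne n := by
  induction l with
  | nil => simp [toWhit_one]
  | cons x l ih =>
    rw [List.map_cons, List.map_cons, List.map_cons, List.prod_cons, List.prod_cons,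
      toWhit_mul (toWhit_wLetter x), ih, mul_smul]

/-- The W-algebra is spanned by the words in `π(e_{n,1}^{(m)})`, `π(f_{n,1}^{(m)})` with
`n ≤ m < 2 n`, compatibly with the filtrations. -/
theorem wFil_le_wordSpan (d : ℤ) : wFil n d ≤
    wordSpan (wLetter (n := n)) (wDeg n) (1 : W n) {x | n ≤ x.2 ∧ x.2 < 2 * n} d := by
  have key : ∀ N : ℕ, ∀ d : ℤ, d < N → wFil n d ≤
      wordSpan (wLetter (n := n)) (wDeg n) (1 : W n) {x | n ≤ x.2 ∧ x.2 < 2 * n} d := by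
    intro N
    induction N with
    | zero =>
      intro d hd w hw
      rw [mem_wFil, kaz_neg (by simpa using hd), Submodule.mem_bot] at hw
      rw [toWhit_injective n (hw.trans (map_zero (toWhitL n)).symm : toWhit w = toWhit 0)]
      exact zero_mem _
    | succ N ih =>
      intro d hd w hw
      obtain ⟨p, hp, r, hr, h⟩ := Submodule.mem_sup.1
        (invariant_mem_colSpan (mem_wFil.1 hw) (shiftLetter_smul_toWhit w))
      obtain ⟨v, hv, rfl⟩ : ∃ v ∈ wordSpan (wLetter (n := n)) (wDeg n) (1 : W n)
          {x | n ≤ x.2 ∧ x.2 < 2 * n} d, toWhitL n v = p := by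
        suffices h : colSpan (lastSet n) d ≤ (wordSpan (wLetter (n := n)) (wDeg n) (1 : W n)
          {x | n ≤ x.2 ∧ x.2 < 2 * n} d).map (toWhitL n) from h hp
        rw [colSpan, wordSpan, Submodule.span_le]
        rintro q ⟨l, h1, h2, rfl⟩
        have e : l = (l.map fun x => (x.1, x.2.2)).map fun x => (x.1, lastIdx n, x.2) := by
          rw [List.map_map]
          refine (List.map_id l).symm.trans (List.map_congr_left fun x hx => ?_)
          obtain ⟨b, k, m⟩ := x
          have := (h1 _ hx).1
          simp only at this
          simp [this]
        refine ⟨_, mem_wordSpan (l.map fun x => (x.1, x.2.2)) ?_ (d := d) ?_, ?_⟩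
        · intro a ha
          obtain ⟨x, hx, rfl⟩ := List.mem_map.1 ha
          exact (h1 x hx).2
        · rw [e, List.map_map] at h2
          have : (colDeg ∘ fun x : Bool × ℕ => (x.1, lastIdx n, x.2)) = wDeg n :=
            funext fun x => colDeg_last x
          rwa [this] at h2
        · rw [smul_eq_mul, mul_one, toWhitL_apply, toWhit_wWord, ← e]
      -- The leading part consists of words in the last row, which lift to elements of `W_χ`. The
      -- remainder is therefore again in `W_χ`, of lower degree, and the induction continues there.
      have h3 : w - v ∈ wFil n (d - 1) := by
        rw [mem_wFil, ← toWhitL_apply, map_sub, toWhitL_apply w, ← h, add_sub_cancel_left]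
        exact hr
      rw [← sub_add_cancel w v]
      exact add_mem (wordSpan_mono subset_rfl (by linarith)
        (ih (d - 1) (by push_cast at hd; linarith) h3)) hv
  exact key (d.toNat + 1) d (by push_cast; omega)

theorem exists_mem_wFil {n : ℕ} (w : W n) : ∃ d, w ∈ wFil n d := exists_mem_kaz _

end

section

/-! ### Relations in the W-algebra -/

theorem neg_one_smul_W {n : ℕ} (w : W n) : (-1 : ℂ) • w = -w := neg_one_smul ℂ w

variable {n : ℕ} [NeZero n]

/-- The element `π(e_{n,1}^{(n-1+s)})` or `π(f_{n,1}^{(n-1+s)})`, of Kazhdan degree `s`. -/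
def wGen (b : Bool) (s : ℕ) : W n := wLetter (b, n - 1 + s)

theorem wDeg_add (b : Bool) (s : ℕ) : wDeg n (b, n - 1 + s) = s := by
  have := NeZero.pos n
  simp only [wDeg]; push_cast [Nat.cast_sub (show 1 ≤ n from this)]; ring

/-- The correction terms of `colLetter_low` have negative degree, and on `π(1)` they vanish exactly
because the filtration is zero there. -/
theorem wLetter_low (b : Bool) (m : ℕ) (h : m ≤ n - 1) :
    wLetter (n := n) (b, m) = if b = false ∧ m = n - 1 then 1 else 0 := by
  have h1 := colLetter_low m b (lastIdx n) h
  have h2 := kazOp_smul h1 (whitOne_mem_kaz (n := n) le_rfl) le_rfl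
  have h3 : ((lastIdx n : ℕ) : ℤ) = ((n - 1 : ℕ) : ℤ) := rfl
  rw [h3, kaz_neg (by omega), Submodule.mem_bot, sub_smul, sub_eq_zero] at h2
  refine toWhit_injective n ?_
  rw [toWhit_wLetter, h2]
  have h4 : (lastIdx n : ℕ) = n - 1 := rfl
  rw [h4]
  split_ifs
  · rw [one_smul, toWhit_one]
  · rw [zero_smul]; rfl

theorem wGen_false_zero : wGen (n := n) false 0 = 1 := by
  simp [wGen, wLetter_low]

theorem wGen_true_zero : wGen (n := n) true 0 = 0 := by
  simp [wGen, wLetter_low]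

/-- The element of `W_χ` given by `e_{n,1}^{(n-1+s)} + (-1)^t f_{n,1}^{(n-1+s)}`. -/
def wG (t s : ℕ) : W n := wGen false s + (-1 : ℂ) ^ t • wGen true s

theorem wG_congr {t t' : ℕ} (h : t % 2 = t' % 2) (s : ℕ) : wG (n := n) t s = wG t' s := by
  rw [wG, wG, neg_one_pow_eq_pow_mod_two, h, ← neg_one_pow_eq_pow_mod_two]

/-- The element of `W_χ` given by `e_{n,1}^{(m)} + (-1)^t f_{n,1}^{(m)}`. -/
def wGl (t m : ℕ) : W n := wLetter (false, m) + (-1 : ℂ) ^ t • wLetter (true, m)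

theorem wGl_low (t m : ℕ) (h : m < n - 1) : wGl (n := n) t m = 0 := by
  rw [wGl, wLetter_low _ _ h.le, wLetter_low _ _ h.le]
  simp [h.ne]

theorem toWhit_wGl (t m : ℕ) :
    toWhit (wGl (n := n) t m) = sG t m (lastIdx n) (fstIdx n) • whitOne n := by
  rw [← toWhitL_apply, wGl, map_add, map_smul, toWhitL_apply, toWhitL_apply, toWhit_wLetter,
    toWhit_wLetter, ← smul_assoc, ← add_smul]
  rfl

theorem wGl_comm_E (t m p : ℕ) :
    wGl (n := n) t m * wLetter (false, p) - wLetter (false, p) * wGl t m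
      = ∑ r ∈ Finset.range m, (wGl (t + p + m + r) (r + p) * wGl t (m - 1 - r)
          - wGl (t + m + r) r * wGl t (p + (m - 1 - r))) := by
  refine toWhit_injective n ?_
  have hE : toWhit (wLetter (n := n) (false, p)) = sE p (lastIdx n) (fstIdx n) • whitOne n :=
    toWhit_wLetter _
  simp only [← toWhitL_apply, map_sub, map_sum]
  simp only [toWhitL_apply, toWhit_mul (toWhit_wGl _ _), toWhit_mul hE, toWhit_wGl, hE,
    ← mul_smul, ← sub_smul, ← Finset.sum_smul, sG_comm_sE]

theorem wGl_comm_F (t m p : ℕ) :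
    wGl (n := n) t m * wLetter (true, p) - wLetter (true, p) * wGl (t + 1) m
      = ∑ r ∈ Finset.range m, ((-1 : ℂ) ^ (t + m + r + p) •
            (wGl (t + m + r + p) (r + p) * wGl (t + 1) (m - 1 - r))
          - (-1 : ℂ) ^ (t + m + r) • (wGl (t + m + r) r * wGl (t + 1) (p + (m - 1 - r)))) := by
  refine toWhit_injective n ?_
  have hE : toWhit (wLetter (n := n) (true, p)) = sF p (lastIdx n) (fstIdx n) • whitOne n :=
    toWhit_wLetter _
  simp only [← toWhitL_apply, map_sub, map_sum, map_smul]
  simp only [toWhitL_apply, toWhit_mul (toWhit_wGl _ _), toWhit_mul hE, toWhit_wGl, hE,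
    ← mul_smul, ← smul_assoc, ← sub_smul, ← Finset.sum_smul, sG_comm_sF]

theorem wGl_add (t s : ℕ) : wGl (n := n) t (n - 1 + s) = wG t s := rfl

/-- By `wLetter_low`, entries with upper index below `n - 1` are zero. This kills the last `n - 1`
terms of one sum and the first `n - 1` of the other, so the relations take a form that does not
involve `n`. -/
theorem wG_comm_E (t s q : ℕ) :
    wG (n := n) t s * wGen false q - wGen false q * wG t s
      = ∑ r ∈ Finset.range s, (wG (t + q + s + r) (r + q) * wG t (s - 1 - r)
          - wG (t + s + r) r * wG t (q + (s - 1 - r))) := by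
  have h := wGl_comm_E (n := n) t (n - 1 + s) (n - 1 + q)
  rw [wGl_add] at h
  rw [wGen, h, Finset.sum_sub_distrib, Finset.sum_sub_distrib]
  congr 1
  · rw [add_comm (n - 1) s, Finset.sum_range_add, add_eq_left.2]
    · refine Finset.sum_congr rfl fun r hr => ?_
      rw [Finset.mem_range] at hr
      rw [show s + (n - 1) - 1 - r = n - 1 + (s - 1 - r) by omega,
        show r + (n - 1 + q) = n - 1 + (r + q) by omega, wGl_add, wGl_add]
      congr 1
      exact wG_congr (by omega) _
    · refine Finset.sum_eq_zero fun r hr => ?_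
      rw [Finset.mem_range] at hr
      rw [wGl_low t (s + (n - 1) - 1 - (s + r)) (by omega), mul_zero]
  · rw [Finset.sum_range_add, add_eq_right.2]
    · refine Finset.sum_congr rfl fun r hr => ?_
      rw [Finset.mem_range] at hr
      rw [show n - 1 + q + (n - 1 + s - 1 - (n - 1 + r)) = n - 1 + (q + (s - 1 - r)) by omega,
        wGl_add, wGl_add]
      congr 1
      exact wG_congr (by omega) _
    · refine Finset.sum_eq_zero fun r hr => ?_
      rw [Finset.mem_range] at hr
      rw [wGl_low _ r hr, zero_mul]

theorem wG_comm_F (t s q : ℕ) :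
    wG (n := n) t s * wGen true q - wGen true q * wG (t + 1) s
      = ∑ r ∈ Finset.range s, ((-1 : ℂ) ^ (t + s + r + q) •
            (wG (t + s + r + q) (r + q) * wG (t + 1) (s - 1 - r))
          - (-1 : ℂ) ^ (t + s + r) • (wG (t + s + r) r * wG (t + 1) (q + (s - 1 - r)))) := by
  have h := wGl_comm_F (n := n) t (n - 1 + s) (n - 1 + q)
  have hs : ∀ {a b : ℕ}, a % 2 = b % 2 → (-1 : ℂ) ^ a = (-1) ^ b := fun h => by
    rw [neg_one_pow_eq_pow_mod_two, h, ← neg_one_pow_eq_pow_mod_two]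
  rw [wGl_add, wGl_add] at h
  rw [wGen, h, Finset.sum_sub_distrib, Finset.sum_sub_distrib]
  congr 1
  · rw [add_comm (n - 1) s, Finset.sum_range_add, add_eq_left.2]
    · refine Finset.sum_congr rfl fun r hr => ?_
      rw [Finset.mem_range] at hr
      rw [show s + (n - 1) - 1 - r = n - 1 + (s - 1 - r) by omega,
        show r + (n - 1 + q) = n - 1 + (r + q) by omega, wGl_add, wGl_add]
      congr 1
      · exact hs (by omega)
      · congr 1
        exact wG_congr (by omega) _
    · refine Finset.sum_eq_zero fun r hr => ?_
      rw [Finset.mem_range] at hr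
      rw [wGl_low (t + 1) (s + (n - 1) - 1 - (s + r)) (by omega), mul_zero, smul_zero]
  · rw [Finset.sum_range_add, add_eq_right.2]
    · refine Finset.sum_congr rfl fun r hr => ?_
      rw [Finset.mem_range] at hr
      rw [show n - 1 + q + (n - 1 + s - 1 - (n - 1 + r)) = n - 1 + (q + (s - 1 - r)) by omega,
        wGl_add, wGl_add]
      congr 1
      · exact hs (by omega)
      · congr 1
        exact wG_congr (by omega) _
    · refine Finset.sum_eq_zero fun r hr => ?_
      rw [Finset.mem_range] at hr
      rw [wGl_low _ r hr, zero_mul, smul_zero]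

theorem wGen_one_comm_E (q : ℕ) :
    wGen (n := n) false 1 * wGen false q = wGen false q * wGen false 1 ∧
    wGen (n := n) true 1 * wGen false q - wGen false q * wGen true 1
      = (-1 - (-1 : ℂ) ^ q) • wGen true q := by
  have h0 := wG_comm_E (n := n) 0 1 q
  have h1 := wG_comm_E (n := n) 1 1 q
  simp only [Finset.sum_range_one, wG, wGen_false_zero, wGen_true_zero, Nat.sub_self, add_zero,
    zero_add, zero_mul, mul_zero, smul_zero, mul_one, one_mul, pow_zero, pow_one, pow_add, neg_mul, neg_neg,
    mul_add, add_mul, smul_mul_assoc, mul_smul_comm] at h0 h1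
  constructor
  · linear_combination (norm := module) (1 / 2 : ℂ) • h0 + (1 / 2 : ℂ) • h1
  · linear_combination (norm := module) (1 / 2 : ℂ) • h0 - (1 / 2 : ℂ) • h1

theorem wGen_one_comm_F (q : ℕ) :
    wGen (n := n) false 1 * wGen true q = wGen true q * wGen false 1 ∧
    wGen (n := n) true 1 * wGen true q + wGen true q * wGen true 1
      = (1 - (-1 : ℂ) ^ q) • wGen false q := by
  have h0 := wG_comm_F (n := n) 0 1 q
  have h1 := wG_comm_F (n := n) 1 1 q
  have hs : ((-1 : ℂ) ^ q) * (-1) ^ q = 1 := by rw [← mul_pow]; simp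
  simp only [Finset.sum_range_one, wG, wGen_false_zero, wGen_true_zero, Nat.sub_self, add_zero,
    zero_add, zero_mul, mul_zero, smul_zero, mul_one, one_mul, pow_zero, pow_one, pow_add, neg_mul, neg_neg,
    mul_add, add_mul, smul_mul_assoc, mul_smul_comm, smul_add, smul_smul, hs, mul_neg] at h0 h1
  constructor
  · linear_combination (norm := module) (1 / 2 : ℂ) • h0 + (1 / 2 : ℂ) • h1
  · linear_combination (norm := module) (1 / 2 : ℂ) • h0 - (1 / 2 : ℂ) • h1

theorem wGen_two_comm_E (q : ℕ) :
    wGen (n := n) false 2 * wGen false q - wGen false q * wGen false 2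
      = (-1 : ℂ) ^ q • (wGen true q * wGen true 1) + wGen true 1 * wGen true q := by
  have h0 := wG_comm_E (n := n) 0 2 q
  have h1 := wG_comm_E (n := n) 1 2 q
  have h2 := (wGen_one_comm_E (n := n) q).1
  have h2' := (wGen_one_comm_F (n := n) q).1
  have h3 : (-1 : ℂ) ^ 3 = -1 := by norm_num
  simp only [Finset.sum_range_succ, Finset.sum_range_zero, wG, wGen_false_zero, wGen_true_zero,
    Nat.sub_self, add_zero, Nat.reduceSub, Nat.reduceAdd, even_two, Even.neg_pow, one_pow,
    zero_add, zero_mul, mul_zero, smul_zero, mul_one, one_mul, pow_zero, pow_one, pow_add, neg_mul, neg_neg,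
    mul_add, add_mul, smul_mul_assoc, mul_smul_comm, smul_add, smul_smul, mul_neg, h2, h2', h3,
    add_comm 1 q] at h0 h1
  linear_combination (norm := module) (1 / 2 : ℂ) • h0 + (1 / 2 : ℂ) • h1

/-- The bracket with `e_{n,1}^{(n+1)}` raises the index of the odd generators by one, with
coefficient `2`. This explains the factor `½` in the definition of `Φ_{k+1}`. -/
theorem wGen_two_comm_F (q : ℕ) :
    wGen (n := n) false 2 * wGen true q - wGen true q * wGen false 2
      = (2 : ℂ) • wGen true (q + 1) - (-1 : ℂ) ^ q • (wGen false q * wGen true 1)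
        - wGen true 1 * wGen false q := by
  have h0 := wG_comm_F (n := n) 0 2 q
  have h1 := wG_comm_F (n := n) 1 2 q
  have h2 := (wGen_one_comm_F (n := n) q).1
  have hs : ((-1 : ℂ) ^ q) * (-1) ^ q = 1 := by rw [← mul_pow]; simp
  have h3 : (-1 : ℂ) ^ 3 = -1 := by norm_num
  simp only [Finset.sum_range_succ, Finset.sum_range_zero, wG, wGen_false_zero, wGen_true_zero,
    Nat.sub_self, add_zero, Nat.reduceSub, Nat.reduceAdd, even_two, Even.neg_pow, one_pow,
    zero_add, zero_mul, mul_zero, smul_zero, mul_one, one_mul, pow_zero, pow_one, pow_add, neg_mul, neg_neg,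
    mul_add, add_mul, smul_mul_assoc, mul_smul_comm, smul_add, smul_smul, mul_neg, h2, hs, h3, one_smul, neg_smul,
    add_comm 1 q] at h0 h1
  linear_combination (norm := module) (1 / 2 : ℂ) • h0 + (1 / 2 : ℂ) • h1

/-! ### Words with parity -/

/-- The span of the words of degree at most `d` and parity `b` in the generators of degree less
than `s`. -/
def wPar (n : ℕ) [NeZero n] (s : ℕ) (d : ℤ) (b : Bool) : Submodule ℂ (W n) :=
  Submodule.span ℂ {w | ∃ l : List (Bool × ℕ), (∀ x ∈ l, 1 ≤ x.2 ∧ x.2 < s) ∧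
    (l.map fun x => (x.2 : ℤ)).sum ≤ d ∧ (l.map Prod.fst).foldr xor false = b ∧
    w = (l.map fun x => wGen x.1 x.2).prod}

theorem wPar_mono {s s' : ℕ} (hs : s ≤ s') {d d' : ℤ} (hd : d ≤ d') (b : Bool) :
    wPar n s d b ≤ wPar n s' d' b := by
  refine Submodule.span_mono ?_
  rintro w ⟨l, h1, h2, h3, h4⟩
  exact ⟨l, fun x hx => ⟨(h1 x hx).1, (h1 x hx).2.trans_le hs⟩, h2.trans hd, h3, h4⟩

theorem wGen_mem_wPar {b : Bool} {q s : ℕ} (hq : 1 ≤ q) (hs : q < s) :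
    wGen b q ∈ wPar n s q b :=
  Submodule.subset_span ⟨[(b, q)], by simpa using ⟨hq, hs⟩, by simp, by simp, by simp⟩

theorem wPar_mul {s : ℕ} {d d' : ℤ} {b b' : Bool} {v w : W n} (hv : v ∈ wPar n s d b)
    (hw : w ∈ wPar n s d' b') : v * w ∈ wPar n s (d + d') (b ^^ b') := by
  induction hv using Submodule.span_induction with
  | mem v hv =>
    obtain ⟨l, h1, h2, h3, rfl⟩ := hv
    induction hw using Submodule.span_induction with
    | mem w hw =>
      obtain ⟨l', h1', h2', h3', rfl⟩ := hw
      refine Submodule.subset_span ⟨l ++ l', ?_, ?_, ?_, by simp⟩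
      · intro x hx
        rcases List.mem_append.1 hx with hx | hx
        · exact h1 x hx
        · exact h1' x hx
      · rw [List.map_append, List.sum_append]; linarith
      · rw [← h3, ← h3']
        clear h1 h2 h3
        induction l with
        | nil => simp
        | cons x l ih =>
          rw [List.cons_append, List.map_cons, List.map_cons, List.foldr_cons, List.foldr_cons, ih,
            Bool.xor_assoc]
    | zero => rw [mul_zero]; exact zero_mem _
    | add v w _ _ h h' => rw [mul_add]; exact add_mem h h'
    | smul c w _ h => rw [mul_smul_comm]; exact Submodule.smul_mem _ _ h
  | zero => rw [zero_mul]; exact zero_mem _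
  | add v w _ _ h h' => rw [add_mul]; exact add_mem h h'
  | smul c w _ h => rw [smul_mul_assoc]; exact Submodule.smul_mem _ _ h

theorem wLetter_mul_mem_wFil {x : Bool × ℕ} {w : W n} {d : ℤ} (hw : w ∈ wFil n d) :
    wLetter x * w ∈ wFil n (wDeg n x + d) := by
  rw [mem_wFil, toWhit_mul (toWhit_wLetter x)]
  refine kazOp_smul (colLetter_mem_kazOp _) hw ?_
  rw [colDeg_last]; linarith

theorem wFil_mono {n : ℕ} {d d' : ℤ} (h : d ≤ d') : wFil n d ≤ wFil n d' :=
  Submodule.comap_mono (kaz_mono h)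

theorem wFil_mul {v w : W n} {d d' : ℤ} (hv : v ∈ wFil n d) (hw : w ∈ wFil n d') :
    v * w ∈ wFil n (d + d') := by
  replace hv := wFil_le_wordSpan d hv
  induction hv using Submodule.span_induction with
  | mem v hv =>
    obtain ⟨l, -, h2, rfl⟩ := hv
    refine wFil_mono (add_le_add_left h2 d') ?_
    clear h2
    induction l with
    | nil => simpa using hw
    | cons x l ih =>
      rw [List.map_cons, List.map_cons, List.prod_cons, List.sum_cons, smul_eq_mul, mul_one,
        mul_assoc, add_assoc]
      rw [smul_eq_mul, mul_one] at ih
      exact wLetter_mul_mem_wFil ih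
  | zero => rw [zero_mul]; exact zero_mem _
  | add v w _ _ h h' => rw [add_mul]; exact add_mem h h'
  | smul c w _ h => rw [smul_mul_assoc]; exact Submodule.smul_mem _ _ h

theorem one_mem_wFil {n : ℕ} : (1 : W n) ∈ wFil n 0 := whitOne_mem_kaz le_rfl

theorem wGen_mem_wFil (b : Bool) (q : ℕ) : wGen (n := n) b q ∈ wFil n q := by
  have := wLetter_mul_mem_wFil (n := n) (x := (b, n - 1 + q)) one_mem_wFil
  rwa [mul_one, add_zero, wDeg_add] at this

theorem wPar_le_wFil (s : ℕ) (d : ℤ) (b : Bool) : wPar n s d b ≤ wFil n d := by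
  rw [wPar, Submodule.span_le]
  rintro w ⟨l, -, h2, -, rfl⟩
  refine wFil_mono h2 ?_
  clear h2
  induction l with
  | nil => exact one_mem_wFil
  | cons x l ih =>
    rw [List.map_cons, List.map_cons, List.prod_cons, List.sum_cons]
    exact wFil_mul (wGen_mem_wFil _ _) ih

theorem bsgn_mul_self (b b' : Bool) : bsgn b b' * bsgn b b' = 1 := by
  cases b <;> cases b' <;> simp [bsgn]

theorem bsgn_comm (b b' : Bool) : bsgn b b' = bsgn b' b := by
  cases b <;> cases b' <;> rfl

/-- A superderivation `[u, ·]` is controlled by its values on generators. -/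
theorem superbracket_mem {T : ℤ → Bool → Submodule ℂ (W n)} {u : W n} {b₀ : Bool} {e : ℤ} {s : ℕ}
    (hT : Monotone T)
    (hl : ∀ (b : Bool) (q : ℕ) (d : ℤ) (c : Bool) (v : W n), 1 ≤ q → q < s → v ∈ T d c →
      wGen b q * v ∈ T (q + d) (b ^^ c))
    (hr : ∀ (d d' : ℤ) (b c : Bool) (v w : W n), w ∈ wPar n s d b → v ∈ T d' c →
      v * w ∈ T (d' + d) (c ^^ b))
    (h : ∀ (b : Bool) (q : ℕ), 1 ≤ q → q < s →
      u * wGen b q - bsgn b₀ b • (wGen b q * u) ∈ T (q + e) (b₀ ^^ b))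
    {d : ℤ} {b : Bool} {w : W n} (hw : w ∈ wPar n s d b) :
    u * w - bsgn b₀ b • (w * u) ∈ T (d + e) (b₀ ^^ b) := by
  induction hw using Submodule.span_induction with
  | mem w hw =>
    obtain ⟨l, h1, h2, rfl, rfl⟩ := hw
    refine hT (add_le_add_left h2 e) _ ?_
    clear h2
    induction l with
    | nil => cases b₀ <;> simp [bsgn]
    | cons x l ih =>
      have ih := ih fun a ha => h1 a (List.mem_cons_of_mem _ ha)
      obtain ⟨hx1, hx2⟩ := h1 x List.mem_cons_self
      have hl' : (l.map fun x => wGen (n := n) x.1 x.2).prod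
          ∈ wPar n s (l.map fun x => (x.2 : ℤ)).sum ((l.map Prod.fst).foldr xor false) :=
        Submodule.subset_span ⟨l, fun a ha => h1 a (List.mem_cons_of_mem _ ha), le_rfl, rfl, rfl⟩
      have e1 := hr _ _ _ _ _ _ hl' (h x.1 x.2 hx1 hx2)
      have e2 := hl x.1 x.2 _ _ _ hx1 hx2 ih
      simp only [List.map_cons, List.prod_cons, List.sum_cons, List.foldr_cons]
      generalize (l.map fun x => wGen (n := n) x.1 x.2).prod = p at *
      generalize (l.map Prod.fst).foldr xor false = c at *
      have e3 : bsgn b₀ (x.1 ^^ c) = bsgn b₀ x.1 * bsgn b₀ c := by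
        cases b₀ <;> cases x.1 <;> cases c <;> simp [bsgn]
      rw [show (x.1 ^^ (b₀ ^^ c)) = (b₀ ^^ (x.1 ^^ c)) by
        cases b₀ <;> cases x.1 <;> cases c <;> rfl] at e2
      rw [show ((b₀ ^^ x.1) ^^ c) = (b₀ ^^ (x.1 ^^ c)) by
        cases b₀ <;> cases x.1 <;> cases c <;> rfl] at e1
      have e1' := hT (le_of_eq (by ring : _ = (x.2 : ℤ) +
        (l.map fun x => (x.2 : ℤ)).sum + e)) _ e1
      have e2' := hT (le_of_eq (by ring : _ = (x.2 : ℤ) +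
        (l.map fun x => (x.2 : ℤ)).sum + e)) _ e2
      -- Super-Leibniz rule: the bracket with the first letter, times the rest, plus a sign times
      -- the first letter, times the bracket with the rest.
      convert add_mem e1' (Submodule.smul_mem _ (bsgn b₀ x.1) e2') using 1
      rw [e3]
      simp only [sub_mul, mul_sub, smul_mul_assoc, mul_smul_comm, smul_sub, smul_smul, mul_assoc]
      abel
  | zero => simp
  | add v w _ _ h h' =>
    rw [mul_add, add_mul, smul_add, add_sub_add_comm]
    exact add_mem h h'
  | smul c w _ h =>
    rw [mul_smul_comm, smul_mul_assoc, smul_comm, ← smul_sub]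
    exact Submodule.smul_mem _ _ h

theorem superbracket_mem_wPar {u : W n} {b₀ : Bool} {e : ℤ} {s s' : ℕ} (hs : s ≤ s')
    (h : ∀ (b : Bool) (q : ℕ), 1 ≤ q → q < s →
      u * wGen b q - bsgn b₀ b • (wGen b q * u) ∈ wPar n s' (q + e) (b₀ ^^ b))
    {d : ℤ} {b : Bool} {w : W n} (hw : w ∈ wPar n s d b) :
    u * w - bsgn b₀ b • (w * u) ∈ wPar n s' (d + e) (b₀ ^^ b) :=
  superbracket_mem (T := wPar n s') (fun _ _ hd _ => wPar_mono le_rfl hd _)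
    (fun _ _ _ _ _ hq hq' hv => wPar_mul (wGen_mem_wPar hq (hq'.trans_le hs)) hv)
    (fun _ _ _ _ _ _ hw hv => wPar_mul hv (wPar_mono hs le_rfl _ hw)) h hw

theorem superbracket_mem_wFil {u : W n} {b₀ : Bool} {e : ℤ} {s : ℕ}
    (h : ∀ (b : Bool) (q : ℕ), 1 ≤ q → q < s →
      u * wGen b q - bsgn b₀ b • (wGen b q * u) ∈ wFil n (q + e))
    {d : ℤ} {b : Bool} {w : W n} (hw : w ∈ wPar n s d b) :
    u * w - bsgn b₀ b • (w * u) ∈ wFil n (d + e) :=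
  superbracket_mem (T := fun d _ => wFil n d) (fun _ _ hd _ => wFil_mono hd)
    (fun _ _ _ _ _ _ _ hv => wFil_mul (wGen_mem_wFil _ _) hv)
    (fun _ _ _ _ _ _ hw hv => wFil_mul hv (wPar_le_wFil _ _ _ hw)) h hw

theorem wGen_comm (b b' : Bool) (q q' : ℕ) :
    wGen b q * wGen b' q' - bsgn b b' • (wGen b' q' * wGen b q) ∈ wFil n (q' + (q - 1)) := by
  rw [mem_wFil, ← toWhitL_apply, map_sub, map_smul, toWhitL_apply, toWhitL_apply, wGen, wGen,
    toWhit_mul (toWhit_wLetter _), toWhit_mul (toWhit_wLetter _), toWhit_wLetter, toWhit_wLetter,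
    ← mul_smul, ← mul_smul, ← smul_assoc, ← sub_smul]
  refine kazOp_smul (colLetter_comm _ _) (whitOne_mem_kaz le_rfl) ?_
  rw [colDeg_last (b, n - 1 + q), colDeg_last (b', n - 1 + q'), wDeg_add, wDeg_add]
  linarith

/-- The associated graded algebra is supercommutative. -/
theorem wPar_comm {s s' : ℕ} {d d' : ℤ} {b b' : Bool} {v w : W n} (hv : v ∈ wPar n s d b)
    (hw : w ∈ wPar n s' d' b') : v * w - bsgn b b' • (w * v) ∈ wFil n (d + d' - 1) := by
  -- The derivation argument is used twice: first with a generator as the fixed element and `w` as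
  -- the word, then, after a flip, with `w` fixed and `v` as the word.
  have h1 : ∀ (c : Bool) (q : ℕ), wGen c q * w - bsgn c b' • (w * wGen c q)
      ∈ wFil n (d' + (q - 1)) := fun c q =>
    superbracket_mem_wFil (fun c' q' _ _ => wGen_comm c c' q q') hw
  have hflip : ∀ (x y : W n) (a c : Bool) (e : ℤ), x * y - bsgn a c • (y * x) ∈ wFil n e →
      y * x - bsgn c a • (x * y) ∈ wFil n e := by
    intro x y a c e h
    have h2 := Submodule.smul_mem _ (-bsgn a c) h
    rw [smul_sub, smul_smul, neg_mul, bsgn_mul_self] at h2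
    rw [bsgn_comm c a]
    convert h2 using 1
    module
  refine hflip w v b' b _ ?_
  have := superbracket_mem_wFil (u := w) (b₀ := b') (e := d' - 1) (fun c q _ _ => wFil_mono
    (by linarith) (hflip _ _ _ _ _ (h1 c q))) hv
  rwa [← add_sub_assoc] at this

/-! ### The elements `Φ_k` and `z_i` -/

theorem Phi_zero : Phi n 0 = wGen true 1 := by
  have : n - 1 + 1 = n := Nat.succ_pred_eq_of_pos (NeZero.pos n)
  rw [wGen, this]; rfl

theorem Phi_succ (k : ℕ) : Phi n (k + 1)
    = (1 / 2 : ℂ) • (wGen false 2 * Phi n k - Phi n k * wGen false 2) := by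
  have : n - 1 + 2 = n + 1 := by have := NeZero.pos n; omega
  rw [wGen, this]; rfl

theorem zElt_even {i : ℕ} (h : Even i) :
    zElt n i = Phi n 0 * Phi n i + Phi n i * Phi n 0 := if_pos h

theorem zElt_odd {i : ℕ} (h : ¬ Even i) : zElt n i = wGen false (i + 1) := by
  have : n - 1 + (i + 1) = n + i := by have := NeZero.pos n; omega
  rw [wGen, this, zElt, if_neg h]; rfl

theorem two_superbracket_mem {s : ℕ} {d : ℤ} {b : Bool} {w : W n} (hw : w ∈ wPar n s d b) :
    wGen false 2 * w - w * wGen false 2 ∈ wPar n (s + 1) (d + 1) b := by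
  have key := superbracket_mem_wPar (u := wGen (n := n) false 2) (b₀ := false) (e := 1)
    (s := s) (s' := s + 1) (Nat.le_succ s) ?_ hw
  · simpa [bsgn] using key
  · intro c q hq hqs
    have hg : ∀ b : Bool, wGen (n := n) b q ∈ wPar n (s + 1) q b := fun b =>
      wGen_mem_wPar hq (by omega)
    have h1 : wGen (n := n) true 1 ∈ wPar n (s + 1) 1 true := by
      simpa using wGen_mem_wPar (n := n) (b := true) (q := 1) (s := s + 1) le_rfl (by omega)
    have h2 : ∀ b : Bool, wGen (n := n) true 1 * wGen b q ∈ wPar n (s + 1) (q + 1) (true ^^ b) :=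
      fun b => wPar_mono le_rfl (by linarith) _ (wPar_mul h1 (hg b))
    have h3 : ∀ b : Bool, wGen (n := n) b q * wGen true 1 ∈ wPar n (s + 1) (q + 1) (b ^^ true) :=
      fun b => wPar_mul (hg b) h1
    cases c
    · simp only [bsgn, Bool.and_false, Bool.false_eq_true, if_false, one_smul, wGen_two_comm_E]
      exact add_mem (Submodule.smul_mem _ _ (h3 true)) (h2 true)
    · simp only [bsgn, Bool.false_and, Bool.false_eq_true, if_false, one_smul, wGen_two_comm_F]
      refine sub_mem (sub_mem (Submodule.smul_mem _ _ ?_) (Submodule.smul_mem _ _ (h3 false)))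
        (h2 false)
      have := wGen_mem_wPar (n := n) (b := true) (q := q + 1) (s := s + 1) (by omega) (by omega)
      simpa using this

/-- By induction, `½ [e_{n,1}^{(n+1)}, ·]` sends the leading generator to the next one; what it
adds, and the bracket of the earlier remainder, involve only generators of smaller index. -/
theorem Phi_sub_mem (p : ℕ) : Phi n p - wGen true (p + 1) ∈ wPar n (p + 1) (p + 1) true := by
  induction p with
  | zero => rw [Phi_zero, sub_self]; exact zero_mem _
  | succ p ih =>
    have h1 := two_superbracket_mem ih
    have h2 := wGen_two_comm_F (n := n) (p + 1)
    have h3 : wGen (n := n) true 1 ∈ wPar n (p + 2) 1 true := by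
      simpa using wGen_mem_wPar (n := n) (b := true) (q := 1) (s := p + 2) le_rfl (by omega)
    have h4 : wGen (n := n) false (p + 1) ∈ wPar n (p + 2) (p + 1) false := by
      simpa using wGen_mem_wPar (n := n) (b := false) (q := p + 1) (s := p + 2) (by omega)
        (by omega)
    have h5 := wPar_mul h3 h4
    have h6 := wPar_mul h4 h3
    have e : Phi n (p + 1) - wGen true (p + 1 + 1)
        = (1 / 2 : ℂ) • (wGen false 2 * (Phi n p - wGen true (p + 1))
            - (Phi n p - wGen true (p + 1)) * wGen false 2)
          + ((-(1 / 2) * (-1 : ℂ) ^ (p + 1)) • (wGen false (p + 1) * wGen true 1)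
            + (-(1 / 2) : ℂ) • (wGen true 1 * wGen false (p + 1))) := by
      rw [Phi_succ, mul_sub, sub_mul]
      linear_combination (norm := module) (1 / 2 : ℂ) • h2
    rw [e]
    push_cast
    refine add_mem (Submodule.smul_mem _ _ h1) (add_mem (Submodule.smul_mem _ _ h6)
      (Submodule.smul_mem _ _ (wPar_mono le_rfl (by linarith) _ h5)))

/-- The bracket of the odd generators of degrees `1` and `i + 1` is `(1 - (-1)^(i+1))` times the
even generator of degree `i + 1`: twice it for even `i` and zero for odd `i`. Odd `z_i` therefore
cannot be obtained in this way. -/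
theorem zElt_sub_mem {i : ℕ} (h : Even i) :
    zElt n i - (2 : ℂ) • wGen false (i + 1) ∈ wPar n (i + 1) (i + 1) false := by
  have h1 : wGen true 1 * (Phi n i - wGen true (i + 1)) + (Phi n i - wGen true (i + 1))
      * wGen true 1 ∈ wPar n (i + 1) (i + 1) false := by
    have key := superbracket_mem_wPar (u := wGen (n := n) true 1) (b₀ := true) (e := 0)
      (s := i + 1) (s' := i + 1) le_rfl ?_ (Phi_sub_mem (n := n) i)
    · simpa [bsgn, neg_one_smul_W] using key
    · intro c q hq hqs
      cases c
      · simp only [bsgn, Bool.and_false, Bool.false_eq_true, if_false, one_smul,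
          (wGen_one_comm_E q).2, add_zero]
        exact Submodule.smul_mem _ _ (wGen_mem_wPar hq hqs)
      · simp only [bsgn, Bool.and_self, if_true, neg_one_smul_W, sub_neg_eq_add,
          (wGen_one_comm_F q).2, add_zero]
        exact Submodule.smul_mem _ _ (wGen_mem_wPar hq hqs)
  have h2 := (wGen_one_comm_F (n := n) (i + 1)).2
  rw [(Even.add_one h).neg_one_pow] at h2
  rw [zElt_even h, Phi_zero]
  convert h1 using 1
  rw [mul_sub, sub_mul]
  linear_combination (norm := module) h2

/-- The generators `z_i` and `Φ_i`, according to the parity `x.1`. -/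
def gGen (x : Bool × Fin n) : W n := if x.1 then Phi n x.2 else zElt n x.2

/-- The Kazhdan degree of `z_i` and `Φ_i`. -/
def gDeg (x : Bool × Fin n) : ℤ := ((x.2 : ℕ) : ℤ) + 1

theorem gGen_mem_wPar (x : Bool × Fin n) :
    gGen x ∈ wPar n ((x.2 : ℕ) + 2) (gDeg x) x.1 := by
  obtain ⟨b, i⟩ := x
  have hg : ∀ b, wGen (n := n) b ((i : ℕ) + 1) ∈ wPar n ((i : ℕ) + 2) (((i : ℕ) : ℤ) + 1) b := by
    intro b
    simpa using wGen_mem_wPar (n := n) (b := b) (q := (i : ℕ) + 1) (s := (i : ℕ) + 2) (by omega)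
      (by omega)
  simp only [gGen, gDeg]
  cases b
  · by_cases h : Even (i : ℕ)
    · have := add_mem (wPar_mono (Nat.le_succ _) le_rfl _ (zElt_sub_mem (n := n) h))
        (Submodule.smul_mem _ (2 : ℂ) (hg false))
      rwa [sub_add_cancel] at this
    · simp only [Bool.false_eq_true, if_false, zElt_odd h]
      exact hg false
  · have := add_mem (wPar_mono (Nat.le_succ _) le_rfl _ (Phi_sub_mem (n := n) i)) (hg true)
    rwa [sub_add_cancel] at this

theorem gGen_comm (x y : Bool × Fin n) :
    gGen x * gGen y - bsgn x.1 y.1 • (gGen y * gGen x) ∈ wFil n (gDeg x + gDeg y - 1) :=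
  wPar_comm (gGen_mem_wPar x) (gGen_mem_wPar y)

theorem gGen_mem_wFil (x : Bool × Fin n) : gGen x ∈ wFil n (gDeg x) :=
  wPar_le_wFil _ _ _ (gGen_mem_wPar x)

/-- The span of the words of degree at most `d` in the `z_i`, `Φ_i` with `i < n`. -/
def gSpan (n : ℕ) [NeZero n] (d : ℤ) : Submodule ℂ (W n) :=
  wordSpan (gGen (n := n)) gDeg (1 : W n) Set.univ d

theorem gSpan_mono {d d' : ℤ} (h : d ≤ d') : gSpan n d ≤ gSpan n d' :=
  wordSpan_mono subset_rfl h

theorem gSpan_mul {v w : W n} {d d' : ℤ} (hv : v ∈ gSpan n d) (hw : w ∈ gSpan n d') :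
    v * w ∈ gSpan n (d + d') := by
  induction hv using Submodule.span_induction with
  | mem v hv =>
    obtain ⟨l, -, h2, rfl⟩ := hv
    refine gSpan_mono (add_le_add_left h2 d') ?_
    clear h2
    induction l with
    | nil => simpa using hw
    | cons x l ih =>
      rw [List.map_cons, List.map_cons, List.prod_cons, List.sum_cons, smul_eq_mul, mul_one,
        mul_assoc, add_assoc]
      rw [smul_eq_mul, mul_one] at ih
      exact smul_mem_wordSpan (Set.mem_univ x) ih
  | zero => rw [zero_mul]; exact zero_mem _
  | add v w _ _ h h' => rw [add_mul]; exact add_mem h h'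
  | smul c w _ h => rw [smul_mul_assoc]; exact Submodule.smul_mem _ _ h

theorem gGen_mem_gSpan (x : Bool × Fin n) : gGen x ∈ gSpan n (gDeg x) := by
  have := mem_wordSpan (v := gGen (n := n)) (deg := gDeg) (x := (1 : W n)) (Λ := Set.univ)
    [x] (by simp) (d := gDeg x) (by simp)
  rwa [List.map_singleton, List.prod_singleton, smul_eq_mul, mul_one] at this

theorem wPar_le_gSpan {s : ℕ} (h : ∀ (b : Bool) (q : ℕ), 1 ≤ q → q < s →
    wGen (n := n) b q ∈ gSpan n q) (d : ℤ) (b : Bool) : wPar n s d b ≤ gSpan n d := by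
  rw [wPar, Submodule.span_le]
  rintro w ⟨l, h1, h2, -, rfl⟩
  refine gSpan_mono h2 ?_
  clear h2
  induction l with
  | nil => exact self_mem_wordSpan (by simp)
  | cons x l ih =>
    rw [List.map_cons, List.map_cons, List.prod_cons, List.sum_cons]
    have hx := h1 x List.mem_cons_self
    exact gSpan_mul (h _ _ hx.1 hx.2) (ih fun a ha => h1 a (List.mem_cons_of_mem _ ha))

/-- The passage from the generators `π(e)`, `π(f)` to `z`, `Φ` is triangular with diagonal entries
`1` or `2`, hence is inverted by strong induction on the degree. -/
theorem wGen_mem_gSpan (s : ℕ) : ∀ b : Bool, 1 ≤ s → s ≤ n → wGen (n := n) b s ∈ gSpan n s := by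
  induction s using Nat.strong_induction_on with
  | _ s ih =>
  intro b h1 h2
  obtain ⟨i, rfl⟩ : ∃ i, s = i + 1 := ⟨s - 1, by omega⟩
  have hle := wPar_le_gSpan (n := n) (s := i + 1) fun b q hq hqs => ih q hqs b hq (by omega)
  have hz := gGen_mem_gSpan (n := n) (false, ⟨i, h2⟩)
  have hp := gGen_mem_gSpan (n := n) (true, ⟨i, h2⟩)
  simp only [gGen, gDeg, Bool.false_eq_true, if_false, if_true] at hz hp
  push_cast
  cases b
  · by_cases h : Even i
    · have := Submodule.smul_mem _ (1 / 2 : ℂ) (sub_mem hz (hle _ _ (zElt_sub_mem h)))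
      rw [sub_sub_cancel, smul_smul] at this
      simpa using this
    · rwa [zElt_odd h] at hz
  · have := sub_mem hp (hle _ _ (Phi_sub_mem i))
    rwa [sub_sub_cancel] at this

theorem wFil_le_gSpan (d : ℤ) : wFil n d ≤ gSpan n d := by
  refine (wFil_le_wordSpan d).trans ?_
  rw [wordSpan, Submodule.span_le]
  rintro w ⟨l, h1, h2, rfl⟩
  refine gSpan_mono h2 ?_
  clear h2
  rw [smul_eq_mul, mul_one]
  induction l with
  | nil => exact self_mem_wordSpan (by simp)
  | cons x l ih =>
    rw [List.map_cons, List.map_cons, List.prod_cons, List.sum_cons]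
    refine gSpan_mul ?_ (ih fun a ha => h1 a (List.mem_cons_of_mem _ ha))
    obtain ⟨b, m⟩ := x
    obtain ⟨hm1, hm2⟩ := h1 _ List.mem_cons_self
    simp only at hm1 hm2
    have h0 := NeZero.pos n
    have := wGen_mem_gSpan (n := n) (m - (n - 1)) b (by omega) (by omega)
    rw [wGen, show n - 1 + (m - (n - 1)) = m by omega] at this
    rwa [show wDeg n (b, m) = ((m - (n - 1) : ℕ) : ℤ) by simp only [wDeg]; omega]

theorem adjoin_gens_eq_top : Algebra.adjoin ℂ (Set.range (fun i : Fin n => zElt n i) ∪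
    Set.range (fun k : Fin n => Phi n k)) = ⊤ := by
  refine Algebra.eq_top_iff.2 fun w => ?_
  obtain ⟨d, hd⟩ := exists_mem_wFil w
  have hd := wFil_le_gSpan d hd
  suffices h : gSpan n d ≤ Subalgebra.toSubmodule (Algebra.adjoin ℂ
    (Set.range (fun i : Fin n => zElt n i) ∪ Set.range (fun k : Fin n => Phi n k))) from h hd
  rw [gSpan, wordSpan, Submodule.span_le]
  rintro v ⟨l, -, -, rfl⟩
  rw [smul_eq_mul, mul_one]
  refine Subalgebra.list_prod_mem _ fun v hv => ?_
  obtain ⟨⟨b, i⟩, -, rfl⟩ := List.mem_map.1 hv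
  cases b
  · exact Algebra.subset_adjoin (Or.inl ⟨i, rfl⟩)
  · exact Algebra.subset_adjoin (Or.inr ⟨i, rfl⟩)

/-! ### Sorted monomials -/

theorem gWord_mem_wFil (l : List (Bool × Fin n)) :
    (l.map gGen).prod ∈ wFil n (l.map gDeg).sum := by
  induction l with
  | nil => exact one_mem_wFil
  | cons x l ih =>
    rw [List.map_cons, List.map_cons, List.prod_cons, List.sum_cons]
    exact wFil_mul (gGen_mem_wFil x) ih

/-- Adjacent letters supercommute modulo lower degree. The scalar is a sign, but its value is never
needed. -/
theorem gWord_perm {l l' : List (Bool × Fin n)} (h : l.Perm l') :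
    ∃ c : ℂ, (l.map gGen).prod - c • (l'.map gGen).prod ∈ wFil n ((l.map gDeg).sum - 1) := by
  induction h with
  | nil => exact ⟨1, by simp⟩
  | cons x h ih =>
    obtain ⟨c, hc⟩ := ih
    refine ⟨c, ?_⟩
    simp only [List.map_cons, List.prod_cons, List.sum_cons]
    rw [← mul_smul_comm, ← mul_sub, add_sub_assoc]
    exact wFil_mul (gGen_mem_wFil x) hc
  | swap x y l =>
    refine ⟨bsgn y.1 x.1, ?_⟩
    simp only [List.map_cons, List.prod_cons, List.sum_cons]
    rw [← mul_assoc, ← mul_assoc, ← smul_mul_assoc, ← sub_mul]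
    exact wFil_mono (by linarith) (wFil_mul (gGen_comm y x) (gWord_mem_wFil l))
  | trans h1 h2 ih1 ih2 =>
    obtain ⟨c1, hc1⟩ := ih1
    obtain ⟨c2, hc2⟩ := ih2
    refine ⟨c1 * c2, ?_⟩
    rw [← (h1.map gDeg).sum_eq] at hc2
    have := add_mem hc1 (Submodule.smul_mem _ c1 hc2)
    rwa [smul_sub, smul_smul, sub_add_sub_cancel] at this

/-- The monomial `z^α Φ^β`. -/
def gMon (α : Multiset (Fin n)) (β : Finset (Fin n)) : W n :=
  ((α.sort (· ≤ ·)).map fun i : Fin n => zElt n i).prod *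
    ((β.sort (· ≤ ·)).map fun k : Fin n => Phi n k).prod

/-- A word is sorted at the price of terms of lower degree. These lie in `W_χ`, so `wFil_le_gSpan`
rewrites them as words of lower degree in the same generators and the induction proceeds. -/
theorem gSpan_le_gMon (d : ℤ) :
    gSpan n d ≤ Submodule.span ℂ (Set.range fun x : Multiset (Fin n) × Finset (Fin n) =>
      gMon x.1 x.2) := by
  have key : ∀ N : ℕ, ∀ d : ℤ, d < N →
    gSpan n d ≤ Submodule.span ℂ (Set.range fun x : Multiset (Fin n) × Finset (Fin n) =>
      gMon x.1 x.2) := by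
    intro N
    induction N with
    | zero =>
      intro d hd
      rw [gSpan, wordSpan_neg (fun a _ => by simp only [gDeg]; omega) (by simpa using hd)]
      exact bot_le
    | succ N ih =>
      intro d hd
      rw [gSpan, wordSpan, Submodule.span_le]
      rintro w ⟨l, -, h2, rfl⟩
      rw [smul_eq_mul, mul_one]
      have hlow : ∀ v ∈ wFil n ((l.map gDeg).sum - 1), v ∈ Submodule.span ℂ
          (Set.range fun x : Multiset (Fin n) × Finset (Fin n) => gMon x.1 x.2) := fun v hv =>
        ih (d - 1) (by push_cast at hd; linarith)
          (gSpan_mono (by linarith) (wFil_le_gSpan _ hv))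
      set α : Multiset (Fin n) := (((l.filter fun x => !x.1).map Prod.snd : List (Fin n)) : Multiset (Fin n)) with hα
      set β : Multiset (Fin n) := (((l.filter fun x => x.1).map Prod.snd : List (Fin n)) : Multiset (Fin n)) with hβ
      have hperm : ∀ (a b : List (Fin n)), (a : Multiset (Fin n)) = α → (b : Multiset (Fin n)) = β →
          l.Perm (a.map (fun i => (false, i)) ++ b.map fun i => (true, i)) := by
        intro a b ha hb
        have ha : a.Perm ((l.filter fun x => !x.1).map Prod.snd) := Multiset.coe_eq_coe.1 ha
        have hb : b.Perm ((l.filter fun x => x.1).map Prod.snd) := Multiset.coe_eq_coe.1 hb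
        have e1 : ((l.filter fun x => !x.1).map Prod.snd).map (fun i => ((false, i) : Bool × Fin n))
            = l.filter fun x => !x.1 := by
          rw [List.map_map]
          refine (List.map_congr_left fun x hx => ?_).trans (List.map_id _)
          have := (List.mem_filter.1 hx).2
          obtain ⟨b, i⟩ := x
          simp only [Bool.not_eq_true'] at this
          simp [this]
        have e2 : ((l.filter fun x => x.1).map Prod.snd).map (fun i => (true, i))
            = l.filter fun x => x.1 := by
          rw [List.map_map]
          refine (List.map_congr_left fun x hx => ?_).trans (List.map_id _)
          have := (List.mem_filter.1 hx).2
          obtain ⟨b, i⟩ := x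
          simp only at this
          simp [this]
        have e3 := (ha.map (fun i => (false, i))).append (hb.map (fun i => (true, i)))
        rw [e1, e2] at e3
        exact ((List.perm_append_comm.trans (List.filter_append_perm (fun x => x.1) l)).symm).trans
          e3.symm
      by_cases hnd : β.Nodup
      · have hp := hperm (α.sort (· ≤ ·)) ((⟨β, hnd⟩ : Finset (Fin n)).sort (· ≤ ·))
          (Multiset.sort_eq _ _) (Multiset.sort_eq _ _)
        obtain ⟨c, hc⟩ := gWord_perm hp
        rw [List.map_append, List.map_map, List.map_map, List.prod_append] at hc
        have := add_mem (hlow _ hc) (Submodule.smul_mem _ c (Submodule.subset_span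
          (Set.mem_range_self (α, (⟨β, hnd⟩ : Finset (Fin n))))))
        simpa [gMon, gGen, Function.comp_def] using this
      -- A repeated `Φ_k` is brought to the front; its square is half a supercommutator and has
      -- lower degree.
      · obtain ⟨k, t, hk⟩ : ∃ (k : Fin n) (t : Multiset (Fin n)), β = k ::ₘ k ::ₘ t := by
          rw [Multiset.nodup_iff_le] at hnd
          push Not at hnd
          obtain ⟨k, hk⟩ := hnd
          obtain ⟨t, ht⟩ := Multiset.le_iff_exists_add.1 hk
          exact ⟨k, t, by rw [ht]; simp⟩
        have hp := hperm (α.sort (· ≤ ·)) (k :: k :: t.toList) (Multiset.sort_eq _ _)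
          (by rw [hk, ← Multiset.cons_coe, ← Multiset.cons_coe, Multiset.coe_toList])
        have hp := hp.trans List.perm_append_comm
        obtain ⟨c, hc⟩ := gWord_perm hp
        have hdeg := (hp.map gDeg).sum_eq
        simp only [List.map_cons, List.cons_append, List.sum_cons, List.prod_cons] at hc hdeg
        have hsq : gGen (true, k) * gGen (true, k) ∈ wFil n (gDeg (true, k) + gDeg (true, k) - 1)
            := by
          have := Submodule.smul_mem _ (1 / 2 : ℂ) (gGen_comm (n := n) (true, k) (true, k))
          simp only [bsgn, Bool.and_self, if_true, neg_one_smul_W, sub_neg_eq_add] at this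
          convert this using 1
          module
        have h3 := wFil_mul hsq (gWord_mem_wFil
          (t.toList.map (fun i => (true, i)) ++ (α.sort (· ≤ ·)).map (fun i => (false, i))))
        rw [mul_assoc] at h3
        have h4 := add_mem hc (Submodule.smul_mem _ c (wFil_mono (by linarith) h3))
        rw [sub_add_cancel] at h4
        exact hlow _ h4
  exact key (d.toNat + 1) d (by push_cast; omega)

theorem span_gMon_eq_top :
    Submodule.span ℂ (Set.range fun x : Multiset (Fin n) × Finset (Fin n) => gMon x.1 x.2) = ⊤ := by
  rw [eq_top_iff]
  intro w _
  obtain ⟨d, hd⟩ := exists_mem_wFil w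
  exact gSpan_le_gMon d (wFil_le_gSpan d hd)

/-- The upper indices `n + i` and `n + j` have even sum, so the Sergeev elements commute already in
`U`. Harish-Chandra images give no shortcut here, since it is not known that they are scalars. -/
theorem zElt_odd_comm {i j : ℕ} (hi : ¬ Even i) (hj : ¬ Even j) :
    zElt n i * zElt n j = zElt n j * zElt n i := by
  rw [zElt_odd hi, zElt_odd hj]
  refine toWhit_injective n ?_
  rw [wGen, wGen, toWhit_mul (toWhit_wLetter _), toWhit_mul (toWhit_wLetter _), toWhit_wLetter,
    toWhit_wLetter, ← mul_smul, ← mul_smul]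
  congr 1
  refine sE_commute _ _ _ _ ?_
  simp only
  rw [Nat.not_even_iff] at hi hj
  rw [Nat.even_iff]
  omega

end

section

/-! ### The universal property of `U(Q(n))` -/

theorem queer_eq_sum {n : ℕ} (A B : Matrix (Fin n) (Fin n) ℂ) :
    blocks A B = ∑ i, ∑ j, (A i j • qe i j + B i j • qf i j) := by
  have h1 : ∀ (c : ℂ) (i j : Fin n), c • qe i j = blocks (Matrix.single i j c) 0 := by
    intro c i j
    apply Subtype.ext
    change c • fromBlocks _ _ _ _ = _
    simp [fromBlocks_smul, blocks]
  have h2 : ∀ (c : ℂ) (i j : Fin n), c • qf i j = blocks 0 (Matrix.single i j c) := by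
    intro c i j
    apply Subtype.ext
    change c • fromBlocks _ _ _ _ = _
    simp [fromBlocks_smul, blocks]
  simp only [h1, h2, blocks_add, blocks_sum, add_zero, zero_add]
  rw [← Matrix.matrix_eq_sum_single, ← Matrix.matrix_eq_sum_single]

/-- The basis element `e_{i,j}` or `f_{i,j}` of `Q(n)`. -/
def qLetter {n : ℕ} (x : Bool × Fin n × Fin n) : queer n :=
  if x.1 then qf x.2.1 x.2.2 else qe x.2.1 x.2.2

theorem qLetter_mul {n : ℕ} (b b' : Bool) (i j k a : Fin n) :
    qLetter (b, i, j) * qLetter (b', k, a) = if j = k then qLetter (b ^^ b', i, a) else 0 := by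
  cases b <;> cases b' <;>
    simp [qLetter, qe_mul_qe, qe_mul_qf, qf_mul_qe, qf_mul_qf]

/-- The parity in `ℤ/2` of a Boolean. -/
def parity (b : Bool) : ZMod 2 := if b then 1 else 0

theorem sgn_parity (b b' : Bool) : sgn (parity b) (parity b') = bsgn b b' := by
  cases b <;> cases b' <;> simp [parity, bsgn, sgn_zero_left, sgn_zero_right, sgn_one_one]

theorem exists_parity (p : ZMod 2) : ∃ b, p = parity b := by
  fin_cases p
  · exact ⟨false, rfl⟩
  · exact ⟨true, rfl⟩

theorem mem_span_qLetter {n : ℕ} {b : Bool} {x : queer n} (hx : x ∈ queerPart n (parity b)) :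
    x ∈ Submodule.span ℂ (Set.range fun y : Fin n × Fin n => qLetter (b, y)) := by
  have h : ∀ (b : Bool) (A : Matrix (Fin n) (Fin n) ℂ), ∑ i, ∑ j, A i j • qLetter (b, i, j)
      ∈ Submodule.span ℂ (Set.range fun y : Fin n × Fin n => qLetter (b, y)) := fun b A =>
    sum_mem fun i _ => sum_mem fun j _ => Submodule.smul_mem _ _
      (Submodule.subset_span ⟨(i, j), rfl⟩)
  cases b
  · simp only [queerPart, parity, Bool.false_eq_true, if_false, if_true] at hx
    obtain ⟨A, rfl⟩ := hx
    rw [queer_eq_sum]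
    simpa [qLetter] using h false A
  · simp only [queerPart, parity, if_true, one_ne_zero, if_false] at hx
    obtain ⟨A, rfl⟩ := hx
    rw [queer_eq_sum]
    simpa [qLetter] using h true A

section envLift

variable {n : ℕ} {A : Type*} [Ring A] [Algebra ℂ A] (g : Bool × Fin n × Fin n → A)

/-- The linear map on `Q(n)` with given values on the basis. -/
def queerLift : queer n →ₗ[ℂ] A where
  toFun x := ∑ i, ∑ j, ((x : Matrix (Fin n ⊕ Fin n) (Fin n ⊕ Fin n) ℂ) (Sum.inl i) (Sum.inl j)
    • g (false, i, j) + (x : Matrix (Fin n ⊕ Fin n) (Fin n ⊕ Fin n) ℂ) (Sum.inl i) (Sum.inr j)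
    • g (true, i, j))
  map_add' x y := by
    simp only [← Finset.sum_add_distrib]
    refine Finset.sum_congr rfl fun i _ => Finset.sum_congr rfl fun j _ => ?_
    simp only [Subalgebra.coe_add, Matrix.add_apply]
    module
  map_smul' c x := by
    simp only [Finset.smul_sum]
    refine Finset.sum_congr rfl fun i _ => Finset.sum_congr rfl fun j _ => ?_
    simp only [Subalgebra.coe_smul, Matrix.smul_apply, RingHom.id_apply, smul_eq_mul]
    module

theorem queerLift_qLetter (x : Bool × Fin n × Fin n) : queerLift g (qLetter x) = g x := by
  obtain ⟨b, i, j⟩ := x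
  have h : ∀ (A B : Matrix (Fin n) (Fin n) ℂ), queerLift g (blocks A B)
      = ∑ i, ∑ j, (A i j • g (false, i, j) + B i j • g (true, i, j)) := fun A B => rfl
  cases b
  · have : qLetter (false, i, j) = blocks (Matrix.single i j 1) 0 := rfl
    rw [this, h, Finset.sum_eq_single i, Finset.sum_eq_single j]
    · simp
    · intro k _ hk; simp [hk.symm]
    · simp
    · intro k _ hk; simp [hk.symm]
    · simp
  · have : qLetter (true, i, j) = blocks 0 (Matrix.single i j 1) := rfl
    rw [this, h, Finset.sum_eq_single i, Finset.sum_eq_single j]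
    · simp
    · intro k _ hk; simp [hk.symm]
    · simp
    · intro k _ hk; simp [hk.symm]
    · simp

variable {g}

theorem queerLift_rel (hg : ∀ (b b' : Bool) (i j k a : Fin n), g (b, i, j) * g (b', k, a)
    = bsgn b b' • (g (b', k, a) * g (b, i, j)) + (if j = k then g (b ^^ b', i, a) else 0)
      - bsgn b b' • (if a = i then g (b ^^ b', k, j) else 0))
    {b b' : Bool} {x y : queer n} (hx : x ∈ queerPart n (parity b))
    (hy : y ∈ queerPart n (parity b')) :
    queerLift g x * queerLift g y - bsgn b b' • (queerLift g y * queerLift g x)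
      = queerLift g (x * y - bsgn b b' • (y * x)) := by
  replace hx := mem_span_qLetter hx
  replace hy := mem_span_qLetter hy
  induction hx using Submodule.span_induction with
  | mem x hx =>
    obtain ⟨⟨i, j⟩, rfl⟩ := hx
    induction hy using Submodule.span_induction with
    | mem y hy =>
      obtain ⟨⟨k, a⟩, rfl⟩ := hy
      have h : ∀ (c : Prop) [Decidable c] (z : queer n),
          queerLift g (if c then z else 0) = if c then queerLift g z else 0 := by
        intro c _ z; split_ifs <;> simp
      simp only [map_sub, map_smul, qLetter_mul, h, queerLift_qLetter]
      rw [hg, Bool.xor_comm b' b]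
      abel
    | zero => simp
    | add y z _ _ h1 h2 =>
      simp only [map_add, mul_add, add_mul, smul_add, map_sub, map_smul] at h1 h2 ⊢
      linear_combination (norm := module) h1 + h2
    | smul c y _ h1 =>
      simp only [map_smul, mul_smul_comm, smul_mul_assoc, map_sub] at h1 ⊢
      rw [smul_comm _ c, smul_comm _ c, ← smul_sub, ← smul_sub, h1]
  | zero => simp
  | add y z _ _ h1 h2 =>
    simp only [map_add, mul_add, add_mul, smul_add, map_sub, map_smul] at h1 h2 ⊢
    linear_combination (norm := module) h1 + h2
  | smul c y _ h1 =>
    simp only [map_smul, mul_smul_comm, smul_mul_assoc, map_sub] at h1 ⊢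
    rw [smul_comm _ c, smul_comm _ c, ← smul_sub, ← smul_sub, h1]

variable (hg : ∀ (b b' : Bool) (i j k a : Fin n), g (b, i, j) * g (b', k, a)
    = bsgn b b' • (g (b', k, a) * g (b, i, j)) + (if j = k then g (b ^^ b', i, a) else 0)
      - bsgn b b' • (if a = i then g (b ^^ b', k, j) else 0))

/-- The algebra homomorphism on `U(Q(n))` with given values on the basis of `Q(n)`. -/
def envLift : Env n →ₐ[ℂ] A :=
  RingQuot.liftAlgHom ℂ ⟨TensorAlgebra.lift ℂ (queerLift g), by
    rintro _ _ ⟨p, q, x, y, hx, hy⟩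
    obtain ⟨b, rfl⟩ := exists_parity p
    obtain ⟨b', rfl⟩ := exists_parity q
    rw [map_sub, map_mul, map_smul, map_mul, TensorAlgebra.lift_ι_apply, TensorAlgebra.lift_ι_apply,
      TensorAlgebra.lift_ι_apply, sgn_parity]
    exact queerLift_rel hg hx hy⟩

theorem envLift_letter (x : Bool × Fin n × Fin n) : envLift hg (letter x) = g x := by
  have h1 : letter x = RingQuot.mkAlgHom ℂ (EnvRel n) (TensorAlgebra.ι ℂ (qLetter x)) := rfl
  rw [h1, envLift]
  erw [RingQuot.liftAlgHom_mkAlgHom_apply]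
  rw [TensorAlgebra.lift_ι_apply, queerLift_qLetter]

end envLift

/-! ### Fermionic operators -/

section fermion

variable {ι R M : Type*} [LinearOrder ι] [CommRing R] [AddCommGroup M] [Module R M]

/-- The sign of `i` with respect to `S`. -/
def fsgn (R : Type*) [CommRing R] (i : ι) (S : Finset ι) : R := (-1) ^ (S.filter (· < i)).card

theorem fsgn_mul_self (i : ι) (S : Finset ι) : fsgn R i S * fsgn R i S = 1 := by
  rw [fsgn, ← mul_pow]; simp

theorem fsgn_insert {i j : ι} {S : Finset ι} (h : j ∉ S) :
    fsgn R i (insert j S) = (if j < i then -1 else 1) * fsgn R i S := by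
  rw [fsgn, fsgn, Finset.filter_insert]
  split_ifs with hj
  · rw [Finset.card_insert_of_notMem (by simp [h]), pow_succ]; ring
  · rw [one_mul]

theorem fsgn_erase {i j : ι} {S : Finset ι} (h : j ∈ S) :
    fsgn R i (S.erase j) = (if j < i then -1 else 1) * fsgn R i S := by
  have := fsgn_insert (R := R) (i := i) (Finset.notMem_erase j S)
  rw [Finset.insert_erase h] at this
  rw [this, ← mul_assoc]
  split_ifs <;> simp

/-- Creation of a fermion. -/
def fcr (R M : Type*) [CommRing R] [AddCommGroup M] [Module R M] (i : ι) :
    (Finset ι → M) →ₗ[R] (Finset ι → M) where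
  toFun f S := if i ∈ S then fsgn R i S • f (S.erase i) else 0
  map_add' f g := by ext S; by_cases h : i ∈ S <;> simp [h]
  map_smul' c f := by ext S; by_cases h : i ∈ S <;> simp [h, smul_comm c]

/-- Annihilation of a fermion. -/
def fan (R M : Type*) [CommRing R] [AddCommGroup M] [Module R M] (i : ι) :
    (Finset ι → M) →ₗ[R] (Finset ι → M) where
  toFun f S := if i ∈ S then 0 else fsgn R i S • f (insert i S)
  map_add' f g := by ext S; by_cases h : i ∈ S <;> simp [h]
  map_smul' c f := by ext S; by_cases h : i ∈ S <;> simp [h, smul_comm c]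

theorem fcr_apply (i : ι) (f : Finset ι → M) (S : Finset ι) :
    fcr R M i f S = if i ∈ S then fsgn R i S • f (S.erase i) else 0 := rfl

theorem fan_apply (i : ι) (f : Finset ι → M) (S : Finset ι) :
    fan R M i f S = if i ∈ S then 0 else fsgn R i S • f (insert i S) := rfl

/-- Canonical anticommutation relations with Jordan–Wigner signs: for `i ≠ j` the presence of the
smaller index changes the sign attached to the larger one and not conversely, so the two orders
differ by `-1`. -/
theorem fcr_fcr (i j : ι) : fcr R M i * fcr R M j + fcr R M j * fcr R M i = 0 := by
  ext f S
  simp only [LinearMap.add_apply, Module.End.mul_apply, Pi.add_apply, fcr_apply, Finset.mem_erase,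
    LinearMap.zero_apply, Pi.zero_apply]
  rcases eq_or_ne i j with rfl | hij
  · simp
  by_cases hi : i ∈ S <;> by_cases hj : j ∈ S <;> simp [hi, hj, hij, hij.symm]
  rw [fsgn_erase hi, fsgn_erase hj, Finset.erase_right_comm, smul_smul, smul_smul, ← add_smul]
  convert zero_smul R _ using 2
  rcases lt_or_gt_of_ne hij with h | h <;> simp [h, h.not_gt, mul_comm]

theorem fan_fan (i j : ι) : fan R M i * fan R M j + fan R M j * fan R M i = 0 := by
  ext f S
  simp only [LinearMap.add_apply, Module.End.mul_apply, Pi.add_apply, fan_apply, Finset.mem_insert,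
    LinearMap.zero_apply, Pi.zero_apply]
  rcases eq_or_ne i j with rfl | hij
  · simp
  by_cases hi : i ∈ S <;> by_cases hj : j ∈ S <;> simp [hi, hj, hij, hij.symm]
  rw [fsgn_insert hi, fsgn_insert hj, Finset.insert_comm, smul_smul, smul_smul, ← add_smul]
  convert zero_smul R _ using 2
  rcases lt_or_gt_of_ne hij with h | h <;> simp [h, h.not_gt, mul_comm]

theorem fan_fcr (i j : ι) :
    fan R M i * fcr R M j + fcr R M j * fan R M i = if i = j then 1 else 0 := by
  ext f S
  simp only [LinearMap.add_apply, Module.End.mul_apply, Pi.add_apply, fan_apply, fcr_apply,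
    Finset.mem_insert, Finset.mem_erase]
  rcases eq_or_ne i j with rfl | hij
  · by_cases hi : i ∈ S
    · simp [hi, smul_smul, fsgn_erase hi, fsgn_mul_self]
    · simp [hi, smul_smul, fsgn_insert hi, fsgn_mul_self]
  · by_cases hi : i ∈ S <;> by_cases hj : j ∈ S <;> simp [hi, hj, hij, hij.symm]
    rw [fsgn_insert hi, fsgn_erase hj, Finset.erase_insert_of_ne hij, smul_smul, smul_smul,
      ← add_smul]
    convert zero_smul R _ using 2
    rcases lt_or_gt_of_ne hij with h | h <;> simp [h, h.not_gt, mul_comm]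

end fermion

/-! ### Sorting words -/

section sorting

variable {A α β : Type*} [Ring A] [Algebra ℂ A] [LinearOrder β]

/-- A word that is sorted with respect to the key `κ`, without repetition of odd letters. -/
def SortedWord (κ : α → β) (par : α → Bool) (l : List α) : Prop :=
  l.Pairwise fun x y => κ x < κ y ∨ x = y ∧ par x = false

/-- The span of the words in `C` of length between `ε` and `N`. -/
def lenSpan (D : α → A) (C : Set α) (ε N : ℕ) : Submodule ℂ A :=
  Submodule.span ℂ {w | ∃ l : List α, (∀ x ∈ l, x ∈ C) ∧ ε ≤ l.length ∧ l.length ≤ N ∧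
    w = (l.map D).prod}

variable {D : α → A} {C : Set α} {ε : ℕ} {par : α → Bool}

theorem mul_mem_lenSpan {x : α} (hx : x ∈ C) {N : ℕ} {w : A} (hw : w ∈ lenSpan D C ε N) :
    D x * w ∈ lenSpan D C ε (N + 1) := by
  induction hw using Submodule.span_induction with
  | mem w hw =>
    obtain ⟨l, h1, h2, h3, rfl⟩ := hw
    exact Submodule.subset_span ⟨x :: l, by simpa using ⟨hx, h1⟩, by simp; omega, by simpa, by simp⟩
  | zero => rw [mul_zero]; exact zero_mem _
  | add v w _ _ h h' => rw [mul_add]; exact add_mem h h'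
  | smul c w _ h => rw [mul_smul_comm]; exact Submodule.smul_mem _ _ h

theorem lenSpan_mul_word (l : List α) (hl : ∀ x ∈ l, x ∈ C) {N : ℕ} {w : A}
    (hw : w ∈ lenSpan D C ε N) : w * (l.map D).prod ∈ lenSpan D C ε (N + l.length) := by
  induction hw using Submodule.span_induction with
  | mem w hw =>
    obtain ⟨l', h1, h2, h3, rfl⟩ := hw
    refine Submodule.subset_span ⟨l' ++ l, ?_, by simp; omega, by simp; omega, by simp⟩
    intro x hx
    rcases List.mem_append.1 hx with hx | hx
    · exact h1 x hx
    · exact hl x hx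
  | zero => rw [zero_mul]; exact zero_mem _
  | add v w _ _ h h' => rw [add_mul]; exact add_mem h h'
  | smul c w _ h => rw [smul_mul_assoc]; exact Submodule.smul_mem _ _ h

theorem lenSpan_mono {N N' : ℕ} (h : N ≤ N') : lenSpan D C ε N ≤ lenSpan D C ε N' := by
  refine Submodule.span_mono ?_
  rintro w ⟨l, h1, h2, h3, h4⟩
  exact ⟨l, h1, h2, h3.trans h, h4⟩

/-- The Poincaré–Birkhoff–Witt reordering: an adjacent transposition costs a shorter word. The lower
bound `ε` on the length is propagated so that `ε = 1` keeps the corrections inside the augmentation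
ideal of a subalgebra. -/
theorem perm_lenSpan (hC : ∀ x ∈ C, ∀ y ∈ C,
      D x * D y - bsgn (par x) (par y) • (D y * D x) ∈ lenSpan D C ε 1)
    {l l' : List α} (h : l.Perm l') (hl : ∀ x ∈ l, x ∈ C) :
    ∃ c : ℂ, (l.map D).prod - c • (l'.map D).prod ∈ lenSpan D C ε (l.length - 1) := by
  induction h with
  | nil => exact ⟨1, by simp⟩
  | @cons x l l' h ih =>
    rcases l with _ | ⟨y, l⟩
    · rw [List.nil_perm.1 h]
      exact ⟨1, by simp⟩
    · obtain ⟨c, hc⟩ := ih fun y hy => hl y (List.mem_cons_of_mem _ hy)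
      refine ⟨c, ?_⟩
      rw [List.map_cons, List.prod_cons, List.map_cons (l := l'), List.prod_cons,
        ← mul_smul_comm, ← mul_sub]
      exact lenSpan_mono (by simp) (mul_mem_lenSpan (hl x List.mem_cons_self) hc)
  | swap x y l =>
    refine ⟨bsgn (par y) (par x), ?_⟩
    have h1 := lenSpan_mul_word l (fun a ha => hl a (by simp [ha]))
      (hC y (hl y (by simp)) x (hl x (by simp)))
    simp only [List.map_cons, List.prod_cons]
    rw [← mul_assoc, ← mul_assoc, ← smul_mul_assoc, ← sub_mul]
    exact lenSpan_mono (by simp; omega) h1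
  | trans h1 h2 ih1 ih2 =>
    obtain ⟨c1, hc1⟩ := ih1 hl
    obtain ⟨c2, hc2⟩ := ih2 fun x hx => hl x (h1.mem_iff.2 hx)
    refine ⟨c1 * c2, ?_⟩
    rw [← h1.length_eq] at hc2
    have := add_mem hc1 (Submodule.smul_mem _ c1 hc2)
    rwa [smul_sub, smul_smul, sub_add_sub_cancel] at this

theorem lenSpan_le_sorted {κ : α → β} (hκ : Function.Injective κ) (hC : ∀ x ∈ C, ∀ y ∈ C,
      D x * D y - bsgn (par x) (par y) • (D y * D x) ∈ lenSpan D C ε 1) (N : ℕ) :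
    lenSpan D C ε N ≤ Submodule.span ℂ {w | ∃ l : List α, (∀ x ∈ l, x ∈ C) ∧ ε ≤ l.length ∧
      SortedWord κ par l ∧ w = (l.map D).prod} := by
  induction N with
  | zero =>
    refine Submodule.span_mono ?_
    rintro w ⟨l, h1, h2, h3, h4⟩
    refine ⟨l, h1, h2, ?_, h4⟩
    rw [List.eq_nil_of_length_eq_zero (by omega : l.length = 0)]
    exact List.Pairwise.nil
  | succ N ih =>
    rw [lenSpan, Submodule.span_le]
    rintro w ⟨l, h1, h2, h3, rfl⟩
    classical
    set l' := l.mergeSort (fun x y => decide (κ x ≤ κ y)) with hl'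
    have hp : l.Perm l' := (List.mergeSort_perm l _).symm
    have hsort : l'.Pairwise fun x y => κ x ≤ κ y := by
      have := List.pairwise_mergeSort (le := fun x y => decide (κ x ≤ κ y))
        (fun a b c => by simpa using le_trans) (fun a b => by simpa using le_total _ _) l
      simpa using this
    by_cases hnd : (l'.filter par).Nodup
    · obtain ⟨c, hc⟩ := perm_lenSpan hC hp h1
      have h4 : SortedWord κ par l' := by
        rw [List.Nodup, List.pairwise_filter] at hnd
        refine (hsort.and hnd).imp ?_
        rintro x y ⟨hxy, hne⟩
        rcases hxy.lt_or_eq with h | h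
        · exact Or.inl h
        · have h := hκ h
          subst h
          refine Or.inr ⟨rfl, ?_⟩
          by_contra hx
          simp only [Bool.not_eq_false] at hx
          exact hne hx hx rfl
      have h5 := add_mem (ih (lenSpan_mono (by omega) hc)) (Submodule.smul_mem _ c
        (Submodule.subset_span ⟨l', fun x hx => h1 x (hp.mem_iff.2 hx), by
          rw [← hp.length_eq]; exact h2, h4, rfl⟩))
      rwa [sub_add_cancel] at h5
    -- Two equal odd letters are moved to the front, where their square is half a bracket and hence
    -- a combination of shorter words.
    · rw [← List.exists_duplicate_iff_not_nodup] at hnd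
      obtain ⟨x, hx⟩ := hnd
      have hxp : par x = true := (List.mem_filter.1 hx.mem).2
      obtain ⟨t, ht⟩ :=
        ((List.duplicate_iff_sublist.1 hx).trans List.filter_sublist).exists_perm_append
      have hp' := hp.trans ht
      obtain ⟨c, hc⟩ := perm_lenSpan hC hp' h1
      have hx1 : x ∈ C := h1 x (hp'.mem_iff.2 (by simp))
      have hsq := Submodule.smul_mem _ (1 / 2 : ℂ) (hC x hx1 x hx1)
      have hsq' : D x * D x ∈ lenSpan D C ε 1 := by
        convert hsq using 1
        simp only [hxp, bsgn, Bool.and_self, if_true]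
        module
      have h4 := lenSpan_mul_word t (fun a ha => h1 a (hp'.mem_iff.2 (by simp [ha]))) hsq'
      have hlen := hp'.length_eq
      simp only [List.length_append, List.length_cons, List.length_nil] at hlen
      have h5 := add_mem hc (Submodule.smul_mem _ c (lenSpan_mono (by omega : 1 + t.length
        ≤ l.length - 1) h4))
      rw [List.map_append, List.prod_append] at h5
      simp only [List.map_cons, List.map_nil, List.prod_cons, List.prod_nil, mul_one,
        sub_add_cancel] at h5
      exact ih (lenSpan_mono (by omega) h5)

theorem sortedWord_unique {κ : α → β} (hκ : Function.Injective κ) [BEq α] [LawfulBEq α] {l l' : List α}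
    (h : SortedWord κ par l) (h' : SortedWord κ par l') (hc : ∀ x, l.count x = l'.count x) :
    l = l' := by
  refine (List.perm_iff_count.2 hc).eq_of_pairwise (le := fun x y => κ x ≤ κ y)
    (fun a b _ _ h1 h2 => hκ (le_antisymm h1 h2)) (h.imp ?_) (h'.imp ?_)
  · rintro x y (h | ⟨rfl, -⟩)
    · exact h.le
    · exact le_rfl
  · rintro x y (h | ⟨rfl, -⟩)
    · exact h.le
    · exact le_rfl

theorem SortedWord.count_le {κ : α → β} [BEq α] [LawfulBEq α] {l : List α}
    (h : SortedWord κ par l) {x : α} (hx : par x = true) : l.count x ≤ 1 := by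
  have h1 : (l.filter par).Nodup := by
    rw [List.Nodup, List.pairwise_filter]
    refine h.imp ?_
    rintro a b (h | ⟨rfl, h⟩) ha hb
    · rintro rfl; exact lt_irrefl _ h
    · rw [h] at ha; simp at ha
  have h2 := List.nodup_iff_count_le_one.1 h1 x
  rwa [List.count_filter hx] at h2

end sorting

end

section

/-! ### The oscillator representation -/

/-- Bilinear expressions in the generators of a super Weyl algebra satisfy the relations of
`Q(n)`. -/
theorem oscillator_rel {n : ℕ} {A : Type*} [Ring A] [Algebra ℂ A] (c d : Bool → Fin n → Fin n → A)
    (hcc : ∀ s t k i l p, c s k i * c t l p = bsgn s t • (c t l p * c s k i))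
    (hdd : ∀ s t k i l p, d s k i * d t l p = bsgn s t • (d t l p * d s k i))
    (hdc : ∀ s t k i l p, d s k i * c t l p = bsgn s t • (c t l p * d s k i)
      + if s = t ∧ k = l ∧ i = p then 1 else 0)
    (b b' : Bool) (i j p a : Fin n) :
    (∑ x : Bool × Fin n, c x.1 x.2 i * d (x.1 ^^ b) x.2 j)
        * (∑ x : Bool × Fin n, c x.1 x.2 p * d (x.1 ^^ b') x.2 a)
      = bsgn b b' • ((∑ x : Bool × Fin n, c x.1 x.2 p * d (x.1 ^^ b') x.2 a)
          * (∑ x : Bool × Fin n, c x.1 x.2 i * d (x.1 ^^ b) x.2 j))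
        + (if j = p then ∑ x : Bool × Fin n, c x.1 x.2 i * d (x.1 ^^ (b ^^ b')) x.2 a else 0)
        - bsgn b b' • (if a = i then
          ∑ x : Bool × Fin n, c x.1 x.2 p * d (x.1 ^^ (b ^^ b')) x.2 j else 0) := by
  -- Moving one bilinear past the other produces the supercommuted product and two single
  -- contractions of a `d` with a `c`. Summed over the hidden index, the contractions are the two
  -- terms of the bracket.
  have key : ∀ s k t l, (c s k i * d (s ^^ b) k j) * (c t l p * d (t ^^ b') l a)
      = bsgn b b' • ((c t l p * d (t ^^ b') l a) * (c s k i * d (s ^^ b) k j))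
        + (if (s ^^ b) = t ∧ k = l ∧ j = p then c s k i * d (t ^^ b') l a else 0)
        - bsgn b b' • (if (t ^^ b') = s ∧ l = k ∧ a = i then c t l p * d (s ^^ b) k j else 0) := by
    intro s k t l
    have e1 : (c s k i * d (s ^^ b) k j) * (c t l p * d (t ^^ b') l a)
        = c s k i * (d (s ^^ b) k j * c t l p) * d (t ^^ b') l a := by noncomm_ring
    have e2 : (c t l p * d (t ^^ b') l a) * (c s k i * d (s ^^ b) k j)
        = c t l p * (d (t ^^ b') l a * c s k i) * d (s ^^ b) k j := by noncomm_ring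
    rw [e1, e2, hdc, hdc]
    have e3 : c s k i * (c t l p * d (s ^^ b) k j) * d (t ^^ b') l a
        = (bsgn s t * bsgn (s ^^ b) (t ^^ b'))
          • (c t l p * (c s k i * d (t ^^ b') l a) * d (s ^^ b) k j) := by
      have : c s k i * (c t l p * d (s ^^ b) k j) * d (t ^^ b') l a
          = (c s k i * c t l p) * (d (s ^^ b) k j * d (t ^^ b') l a) := by noncomm_ring
      rw [this, hcc, hdd, smul_mul_smul_comm]
      congr 1
      noncomm_ring
    have e4 : bsgn (s ^^ b) t * (bsgn s t * bsgn (s ^^ b) (t ^^ b'))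
        = bsgn b b' * bsgn (t ^^ b') s := by
      cases s <;> cases t <;> cases b <;> cases b' <;> simp [bsgn]
    simp only [mul_add, add_mul, mul_smul_comm, smul_mul_assoc, smul_add, smul_smul, e3, e4,
      mul_ite, ite_mul, mul_one, mul_zero, zero_mul]
    abel
  have h1 : ∀ x : Bool × Fin n, (∑ y : Bool × Fin n, if (x.1 ^^ b) = y.1 ∧ x.2 = y.2 ∧ j = p then
      c x.1 x.2 i * d (y.1 ^^ b') y.2 a else 0)
      = if j = p then c x.1 x.2 i * d (x.1 ^^ (b ^^ b')) x.2 a else 0 := by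
    intro x
    rw [Finset.sum_eq_single (x.1 ^^ b, x.2)]
    · simp
    · intro y _ hy
      refine if_neg ?_
      rintro ⟨h1, h2, -⟩
      exact hy (Prod.ext h1.symm h2.symm)
    · simp
  have h2 : ∀ y : Bool × Fin n, (∑ x : Bool × Fin n, if (y.1 ^^ b') = x.1 ∧ y.2 = x.2 ∧ a = i then
      c y.1 y.2 p * d (x.1 ^^ b) x.2 j else 0)
      = if a = i then c y.1 y.2 p * d (y.1 ^^ (b ^^ b')) y.2 j else 0 := by
    intro y
    rw [Finset.sum_eq_single (y.1 ^^ b', y.2)]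
    · simp [Bool.xor_comm b b']
    · intro x _ hx
      refine if_neg ?_
      rintro ⟨h1, h2, -⟩
      exact hx (Prod.ext h1.symm h2.symm)
    · simp
  simp only [Finset.sum_mul_sum, key, Finset.sum_add_distrib, Finset.sum_sub_distrib, h1,
    ← Finset.smul_sum]
  rw [Finset.sum_comm (f := fun (x y : Bool × Fin n) => if (y.1 ^^ b') = x.1 ∧ y.2 = x.2 ∧ a = i
    then c y.1 y.2 p * d (x.1 ^^ b) x.2 j else 0), Finset.sum_comm
    (f := fun (x y : Bool × Fin n) => c y.1 y.2 p * d (y.1 ^^ b') y.2 a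
      * (c x.1 x.2 i * d (x.1 ^^ b) x.2 j))]
  simp only [h2]
  congr 2
  · split_ifs <;> simp
  · split_ifs <;> simp

/-- The space of the oscillator representation: polynomials in `n²` even and `n²` odd variables. -/
abbrev Osc (n : ℕ) : Type :=
  Finset (Fin n ×ₗ Fin n) → MvPolynomial (Fin n ×ₗ Fin n) ℂ

/-- The action of a linear map on coefficients. -/
def oscCoeff {n : ℕ} (T : Module.End ℂ (MvPolynomial (Fin n ×ₗ Fin n) ℂ)) :
    Module.End ℂ (Osc n) where
  toFun f S := T (f S)
  map_add' f g := by ext1 S; simp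
  map_smul' c f := by ext1 S; simp

theorem neg_one_smul_end {n : ℕ} (T : Module.End ℂ (Osc n)) : (-1 : ℂ) • T = -T :=
  neg_one_smul ℂ T

theorem oscCoeff_mul {n : ℕ} (T T' : Module.End ℂ (MvPolynomial (Fin n ×ₗ Fin n) ℂ)) :
    oscCoeff (T * T') = oscCoeff T * oscCoeff T' := rfl

theorem oscCoeff_fcr {n : ℕ} (T : Module.End ℂ (MvPolynomial (Fin n ×ₗ Fin n) ℂ))
    (a : Fin n ×ₗ Fin n) : oscCoeff T * fcr ℂ _ a = fcr ℂ _ a * oscCoeff T := by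
  refine LinearMap.ext fun f => funext fun S => ?_
  change T (fcr ℂ _ a f S) = fcr ℂ _ a (oscCoeff T f) S
  rw [fcr_apply, fcr_apply]
  split_ifs
  · rw [map_smul]; rfl
  · rw [map_zero]

theorem oscCoeff_fan {n : ℕ} (T : Module.End ℂ (MvPolynomial (Fin n ×ₗ Fin n) ℂ))
    (a : Fin n ×ₗ Fin n) : oscCoeff T * fan ℂ _ a = fan ℂ _ a * oscCoeff T := by
  refine LinearMap.ext fun f => funext fun S => ?_
  change T (fan ℂ _ a f S) = fan ℂ _ a (oscCoeff T f) S
  rw [fan_apply, fan_apply]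
  split_ifs
  · rw [map_zero]
  · rw [map_smul]; rfl

/-- Multiplication by a variable. -/
def oscMul {n : ℕ} (a : Fin n ×ₗ Fin n) : Module.End ℂ (MvPolynomial (Fin n ×ₗ Fin n) ℂ) :=
  LinearMap.mulLeft ℂ (MvPolynomial.X a)

/-- Partial derivative. -/
def oscDer {n : ℕ} (a : Fin n ×ₗ Fin n) : Module.End ℂ (MvPolynomial (Fin n ×ₗ Fin n) ℂ) :=
  (MvPolynomial.pderiv a).toLinearMap

theorem oscMul_comm {n : ℕ} (a b : Fin n ×ₗ Fin n) : oscMul a * oscMul b = oscMul b * oscMul a := by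
  refine LinearMap.ext fun p => ?_
  change MvPolynomial.X a * (MvPolynomial.X b * p) = MvPolynomial.X b * (MvPolynomial.X a * p)
  ring

theorem oscDer_comm {n : ℕ} (a b : Fin n ×ₗ Fin n) : oscDer a * oscDer b = oscDer b * oscDer a := by
  refine LinearMap.ext fun p => MvPolynomial.ext _ _ fun m => ?_
  change MvPolynomial.coeff m (MvPolynomial.pderiv a (MvPolynomial.pderiv b p))
    = MvPolynomial.coeff m (MvPolynomial.pderiv b (MvPolynomial.pderiv a p))
  simp only [MvPolynomial.coeff_pderiv]
  rcases eq_or_ne a b with rfl | h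
  · rfl
  · simp [h, h.symm, add_right_comm]
    ring

theorem oscDer_mul {n : ℕ} (a b : Fin n ×ₗ Fin n) :
    oscDer a * oscMul b = oscMul b * oscDer a + if a = b then 1 else 0 := by
  refine LinearMap.ext fun p => ?_
  have h : (oscDer a * oscMul b) p = MvPolynomial.pderiv a (MvPolynomial.X b * p) := rfl
  rw [h, Derivation.leibniz]
  rcases eq_or_ne a b with rfl | hab
  · simp [oscMul, oscDer]
  · simp [oscMul, oscDer, hab, MvPolynomial.pderiv_X_of_ne hab.symm]

/-- The creation operators. -/
def oscC {n : ℕ} (s : Bool) (k i : Fin n) : Module.End ℂ (Osc n) :=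
  if s then fcr ℂ _ (toLex (k, i)) else
    oscCoeff (oscMul (toLex (k, i)) + if k = i then 1 else 0)

/-- The annihilation operators. -/
def oscD {n : ℕ} (s : Bool) (k i : Fin n) : Module.End ℂ (Osc n) :=
  if s then fan ℂ _ (toLex (k, i)) else oscCoeff (oscDer (toLex (k, i)))

theorem oscC_comm {n : ℕ} (s t : Bool) (k i l p : Fin n) :
    oscC s k i * oscC t l p = bsgn s t • (oscC t l p * oscC s k i) := by
  cases s <;> cases t <;> simp only [oscC, bsgn, Bool.false_eq_true, if_false, if_true,
    Bool.and_self, Bool.and_false, Bool.and_true, one_smul]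
  · rw [← oscCoeff_mul, ← oscCoeff_mul]
    congr 1
    simp only [add_mul, mul_add, oscMul_comm (toLex (k, i))]
    split_ifs <;> simp <;> abel
  · exact oscCoeff_fcr _ _
  · exact (oscCoeff_fcr _ _).symm
  · rw [neg_one_smul_end]
    exact eq_neg_of_add_eq_zero_left (fcr_fcr _ _)

theorem oscD_comm {n : ℕ} (s t : Bool) (k i l p : Fin n) :
    oscD s k i * oscD t l p = bsgn s t • (oscD t l p * oscD s k i) := by
  cases s <;> cases t <;> simp only [oscD, bsgn, Bool.false_eq_true, if_false, if_true,
    Bool.and_self, Bool.and_false, Bool.and_true, one_smul]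
  · rw [← oscCoeff_mul, ← oscCoeff_mul, oscDer_comm]
  · exact oscCoeff_fan _ _
  · exact (oscCoeff_fan _ _).symm
  · rw [neg_one_smul_end]
    exact eq_neg_of_add_eq_zero_left (fan_fan _ _)

theorem oscD_oscC {n : ℕ} (s t : Bool) (k i l p : Fin n) :
    oscD s k i * oscC t l p = bsgn s t • (oscC t l p * oscD s k i)
      + if s = t ∧ k = l ∧ i = p then 1 else 0 := by
  have hlex : ∀ a b c d : Fin n, toLex (a, b) = toLex (c, d) ↔ a = c ∧ b = d := by
    intro a b c d
    rw [toLex_inj, Prod.mk.injEq]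
  cases s <;> cases t <;> simp only [oscD, oscC, bsgn, Bool.false_eq_true, if_false, if_true,
    Bool.and_self, Bool.and_false, Bool.and_true, one_smul, true_and, false_and, add_zero,
    Bool.true_eq_false]
  · rw [← oscCoeff_mul, ← oscCoeff_mul, mul_add, oscDer_mul, add_mul]
    simp only [hlex]
    refine LinearMap.ext fun f => funext fun S => ?_
    split_ifs <;> simp [oscCoeff] <;> abel
  · exact oscCoeff_fcr _ _
  · exact (oscCoeff_fan _ _).symm
  · have h := fan_fcr (R := ℂ) (M := MvPolynomial (Fin n ×ₗ Fin n) ℂ) (toLex (k, i)) (toLex (l, p))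
    simp only [hlex] at h
    rw [neg_one_smul_end, ← h]
    abel

/-- The oscillator representation of `U(Q(n))`. -/
def oscRep (n : ℕ) : Env n →ₐ[ℂ] Module.End ℂ (Osc n) :=
  envLift (g := fun y => ∑ x : Bool × Fin n, oscC x.1 x.2 y.2.1 * oscD (x.1 ^^ y.1) x.2 y.2.2)
    fun b b' i j p a => oscillator_rel oscC oscD oscC_comm oscD_comm oscD_oscC b b' i j p a

theorem oscRep_letter {n : ℕ} (y : Bool × Fin n × Fin n) : oscRep n (letter y)
    = ∑ x : Bool × Fin n, oscC x.1 x.2 y.2.1 * oscD (x.1 ^^ y.1) x.2 y.2.2 :=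
  envLift_letter _ _

/-! ### Linear independence of sorted words -/

/-- The elements of degree at least `d`. -/
def oscGe (n d : ℕ) : Submodule ℂ (Osc n) where
  carrier := {f | ∀ S m, S.card + m.degree < d → MvPolynomial.coeff m (f S) = 0}
  zero_mem' := fun S m _ => by simp
  add_mem' := fun hf hg S m h => by simp [hf S m h, hg S m h]
  smul_mem' := fun c f hf S m h => by simp [hf S m h]

theorem oscGe_zero {n : ℕ} (f : Osc n) : f ∈ oscGe n 0 := fun _ _ h => absurd h (Nat.not_lt_zero _)

theorem oscGe_mono {n d d' : ℕ} (h : d ≤ d') : oscGe n d' ≤ oscGe n d :=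
  fun _ hf S m hm => hf S m (hm.trans_le h)

theorem fcr_mem_oscGe {n d : ℕ} (a : Fin n ×ₗ Fin n) {f : Osc n} (hf : f ∈ oscGe n d) :
    fcr ℂ _ a f ∈ oscGe n (d + 1) := by
  intro S m h
  rw [fcr_apply]
  split_ifs with ha
  · rw [MvPolynomial.coeff_smul, hf _ _ (by
      rw [Finset.card_erase_of_mem ha]
      have := Finset.card_pos.2 ⟨a, ha⟩
      omega), smul_zero]
  · simp

theorem oscMul_mem_oscGe {n d : ℕ} (a : Fin n ×ₗ Fin n) {f : Osc n} (hf : f ∈ oscGe n d) :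
    oscCoeff (oscMul a) f ∈ oscGe n (d + 1) := by
  classical
  intro S m h
  change MvPolynomial.coeff m (MvPolynomial.X a * f S) = 0
  rw [MvPolynomial.coeff_X_mul']
  split_ifs with ha
  · refine hf _ _ ?_
    have h1 : Finsupp.single a 1 ≤ m := by
      rw [Finsupp.single_le_iff]
      exact Nat.one_le_iff_ne_zero.2 (Finsupp.mem_support_iff.1 ha)
    have h2 := congrArg Finsupp.degree (tsub_add_cancel_of_le h1)
    rw [map_add, Finsupp.degree_single] at h2
    omega
  · rfl

theorem oscD_mem_oscGe {n d : ℕ} (s : Bool) (k i : Fin n) {f : Osc n} (hf : f ∈ oscGe n (d + 1)) :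
    oscD s k i f ∈ oscGe n d := by
  intro S m h
  cases s
  · change MvPolynomial.coeff m (MvPolynomial.pderiv _ (f S)) = 0
    rw [MvPolynomial.coeff_pderiv, hf _ _ (by
      rw [map_add, Finsupp.degree_single]; omega), zero_mul]
  · change MvPolynomial.coeff m (fan ℂ _ _ f S) = 0
    rw [fan_apply]
    split_ifs with ha
    · simp
    · rw [MvPolynomial.coeff_smul, hf _ _ (by rw [Finset.card_insert_of_notMem ha]; omega),
        smul_zero]

theorem oscD_mem_oscGe' {n d : ℕ} (s : Bool) (k i : Fin n) {f : Osc n} (hf : f ∈ oscGe n d) :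
    oscD s k i f ∈ oscGe n (d - 1) := by
  rcases d with _ | d
  · exact oscGe_zero _
  · exact oscD_mem_oscGe s k i hf

/-- The Kronecker delta in `oscC` centres the coordinates at the identity matrix. A letter thus acts
as a single derivative, which lowers the order of vanishing by one, plus terms `x ∂` which do not
lower it; neither does the scalar `χ`. -/
theorem oscRep_shiftLetter {n d : ℕ} (x : Bool × Fin n × Fin n) {f : Osc n} (hf : f ∈ oscGe n d) :
    oscRep n (shiftLetter x) f - oscD x.1 x.2.1 x.2.2 f ∈ oscGe n d := by
  obtain ⟨b, i, j⟩ := x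
  have key : ∀ k, oscC true k i (oscD (true ^^ b) k j f) ∈ oscGe n d ∧
      oscC false k i (oscD (false ^^ b) k j f) - (if k = i then oscD b k j f else 0)
        ∈ oscGe n d := by
    intro k
    have h1 : ∀ s, oscD s k j f ∈ oscGe n (d - 1) := fun s => oscD_mem_oscGe' s k j hf
    constructor
    · exact oscGe_mono (by omega) (fcr_mem_oscGe _ (h1 _))
    · have : oscC false k i (oscD (false ^^ b) k j f) - (if k = i then oscD b k j f else 0)
          = oscCoeff (oscMul (toLex (k, i))) (oscD b k j f) := by
        rw [Bool.false_xor, sub_eq_iff_eq_add]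
        refine funext fun S => ?_
        split_ifs with h <;> simp [oscC, oscCoeff, h]
      rw [this]
      exact oscGe_mono (by omega) (oscMul_mem_oscGe _ (h1 _))
  have e : oscRep n (shiftLetter (b, i, j)) f - oscD b i j f
      = ∑ k, oscC true k i (oscD (true ^^ b) k j f)
        + ∑ k, (oscC false k i (oscD (false ^^ b) k j f) - if k = i then oscD b k j f else 0)
        - letterChi (b, i, j) • f := by
    rw [shiftLetter, map_sub, oscRep_letter, AlgHom.commutes, Fintype.sum_prod_type,
      Fintype.sum_bool, Finset.sum_sub_distrib, Finset.sum_ite_eq' Finset.univ i,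
      if_pos (Finset.mem_univ _)]
    simp only [LinearMap.sub_apply, LinearMap.add_apply, LinearMap.sum_apply, Module.End.mul_apply,
      Module.algebraMap_end_apply]
    abel
  rw [e]
  exact sub_mem (add_mem (sum_mem fun k _ => (key k).1) (sum_mem fun k _ => (key k).2))
    (Submodule.smul_mem _ _ hf)

/-- The word of annihilation operators. -/
def oscWord {n : ℕ} (l : List (Bool × Fin n × Fin n)) : Module.End ℂ (Osc n) :=
  (l.map fun x => oscD x.1 x.2.1 x.2.2).prod

/-- A word of length `r` lowers the order of vanishing by at most `r`, and its leading part is the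
corresponding word in constant coefficient derivatives. -/
theorem oscRep_word {n : ℕ} (l : List (Bool × Fin n × Fin n)) {d : ℕ} {f : Osc n}
    (hf : f ∈ oscGe n (d + l.length)) :
    oscWord l f ∈ oscGe n d ∧
    oscRep n (l.map shiftLetter).prod f - oscWord l f ∈ oscGe n (d + 1) := by
  induction l generalizing d with
  | nil => simpa [oscWord] using hf
  | cons x l ih =>
    obtain ⟨h1, h2⟩ := ih (d := d + 1) (by rwa [List.length_cons, ← add_assoc, add_right_comm] at hf)
    have e1 : oscWord (x :: l) f = oscD x.1 x.2.1 x.2.2 (oscWord l f) := by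
      simp [oscWord]
    have e2 : oscRep n ((x :: l).map shiftLetter).prod f
        = oscRep n (shiftLetter x) (oscRep n (l.map shiftLetter).prod f) := by
      simp
    rw [e1, e2]
    refine ⟨oscD_mem_oscGe _ _ _ h1, ?_⟩
    have h3 := oscGe_mono (Nat.le_succ _) h2
    have h4 := add_mem h3 h1
    rw [sub_add_cancel] at h4
    have h5 := oscRep_shiftLetter x h4
    have h6 := oscD_mem_oscGe x.1 x.2.1 x.2.2 h2
    rw [map_sub] at h6
    have := add_mem h5 h6
    rwa [sub_add_sub_cancel] at this

/-- A word of derivatives followed by a coefficient extraction reads off one coefficient, that of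
the monomial whose exponents are raised by the multiplicities of the letters. The factor `c`
collects factorials and signs; it is nonzero as long as no odd variable is used twice. -/
theorem oscWord_coeff {n : ℕ} (l : List (Bool × Fin n × Fin n)) (S : Finset (Fin n ×ₗ Fin n))
    (μ : (Fin n ×ₗ Fin n) →₀ ℕ) : ∃ (c : ℂ) (S' : Finset (Fin n ×ₗ Fin n))
      (μ' : (Fin n ×ₗ Fin n) →₀ ℕ),
      (∀ f : Osc n, MvPolynomial.coeff μ (oscWord l f S) = c * MvPolynomial.coeff μ' (f S')) ∧
      (c ≠ 0 → S'.card + μ'.degree = S.card + μ.degree + l.length ∧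
        ∀ a : Fin n × Fin n, μ' (toLex a) = μ (toLex a) + l.count (false, a) ∧
          (if toLex a ∈ S' then 1 else 0) = (if toLex a ∈ S then 1 else 0) + l.count (true, a)) ∧
      ((∀ a : Fin n × Fin n, (if toLex a ∈ S then 1 else 0) + l.count (true, a) ≤ 1) → c ≠ 0) := by
  induction l generalizing S μ with
  | nil => exact ⟨1, S, μ, fun f => by simp [oscWord], fun _ => by simp, fun _ => one_ne_zero⟩
  | cons x l ih =>
    obtain ⟨b, a⟩ := x
    have e1 : ∀ f, oscWord ((b, a) :: l) f = oscD b a.1 a.2 (oscWord l f) := by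
      intro f; simp [oscWord]
    cases b
    · obtain ⟨c, S', μ', h1, h2, h3⟩ := ih S (μ + Finsupp.single (toLex a) 1)
      have h4 : (μ (toLex a) + 1 : ℂ) ≠ 0 := Nat.cast_add_one_ne_zero _
      refine ⟨c * (μ (toLex a) + 1), S', μ', fun f => ?_, fun hc => ?_, fun h => ?_⟩
      · rw [e1]
        change MvPolynomial.coeff μ (MvPolynomial.pderiv (toLex a) (oscWord l f S)) = _
        rw [MvPolynomial.coeff_pderiv, h1]
        ring
      · obtain ⟨h5, h6⟩ := h2 (left_ne_zero_of_mul hc)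
        rw [map_add, Finsupp.degree_single] at h5
        refine ⟨by rw [h5, List.length_cons]; ring, fun a' => ?_⟩
        obtain ⟨h7, h8⟩ := h6 a'
        rw [h7, h8]
        refine ⟨?_, by simp⟩
        rcases eq_or_ne a a' with rfl | ha
        · simp; ring
        · simp [ha]
      · refine mul_ne_zero (h3 fun a' => ?_) h4
        simpa using h a'
    · by_cases ha : toLex a ∈ S
      · refine ⟨0, S, μ, fun f => ?_, fun h => absurd rfl h, fun h => ?_⟩
        · rw [e1]
          change MvPolynomial.coeff μ (fan ℂ _ (toLex a) (oscWord l f) S) = _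
          rw [fan_apply, if_pos ha]
          simp
        · have := h a
          rw [if_pos ha] at this
          simp at this
      · obtain ⟨c, S', μ', h1, h2, h3⟩ := ih (insert (toLex a) S) μ
        have key : ∀ a', (if toLex a' ∈ insert (toLex a) S then 1 else 0) + l.count (true, a')
            = (if toLex a' ∈ S then 1 else 0) + ((true, a) :: l).count (true, a') := by
          intro a'
          rcases eq_or_ne a a' with rfl | h
          · simp [ha]; ring
          · simp [h, h.symm]
        refine ⟨fsgn ℂ (toLex a) S * c, S', μ', fun f => ?_, fun hc => ?_, fun h => ?_⟩
        · rw [e1]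
          change MvPolynomial.coeff μ (fan ℂ _ (toLex a) (oscWord l f) S) = _
          rw [fan_apply, if_neg ha, MvPolynomial.coeff_smul, h1, smul_eq_mul, mul_assoc]
        · obtain ⟨h5, h6⟩ := h2 (right_ne_zero_of_mul hc)
          rw [Finset.card_insert_of_notMem ha] at h5
          refine ⟨by rw [h5, List.length_cons]; ring, fun a' => ?_⟩
          obtain ⟨h7, h8⟩ := h6 a'
          rw [h7, h8, key]
          exact ⟨by simp, rfl⟩
        · refine mul_ne_zero (left_ne_zero_of_mul_eq_one (fsgn_mul_self _ _))
            (h3 fun a' => ?_)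
          rw [key]
          exact h a'

/-- Sorted words in the shifted letters are linearly independent. -/
theorem linearIndependent_sortedWord {n : ℕ} {β : Type*} [LinearOrder β]
    {κ : Bool × Fin n × Fin n → β} (hκ : Function.Injective κ) :
    LinearIndependent ℂ fun l : {l : List (Bool × Fin n × Fin n) // SortedWord κ Prod.fst l} =>
      (l.1.map shiftLetter).prod := by
  classical
  rw [linearIndependent_iff']
  intro s g hg
  by_contra! hne
  -- A longest word in the relation is tested on its dual monomial `f0`. For every word of at most
  -- that length only the derivative part can reach the constant term.
  obtain ⟨l0, hl0, hmax⟩ := Finset.exists_max_image (s.filter fun l => g l ≠ 0)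
    (fun l => l.1.length) (by
      obtain ⟨i, hi, hgi⟩ := hne
      exact ⟨i, Finset.mem_filter.2 ⟨hi, hgi⟩⟩)
  rw [Finset.mem_filter] at hl0
  obtain ⟨c0, S0, μ0, h1, h2, h3⟩ := oscWord_coeff l0.1 ∅ 0
  have hc0 : c0 ≠ 0 := h3 fun a => by simpa using l0.2.count_le (x := (true, a)) rfl
  obtain ⟨h4, h5⟩ := h2 hc0
  let f0 : Osc n := Pi.single S0 (MvPolynomial.monomial μ0 1)
  have hf0 : ∀ S μ, MvPolynomial.coeff μ (f0 S) = if S = S0 ∧ μ0 = μ then 1 else 0 := by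
    intro S μ
    rcases eq_or_ne S S0 with rfl | h
    · simp [f0, MvPolynomial.coeff_monomial]
    · simp [f0, h]
  have hdeg : f0 ∈ oscGe n l0.1.length := by
    intro S m h
    rw [hf0, if_neg]
    rintro ⟨rfl, rfl⟩
    simp at h4
    omega
  have hval : ∀ l ∈ s, g l ≠ 0 → l ≠ l0 →
      MvPolynomial.coeff 0 (oscRep n (l.1.map shiftLetter).prod f0 ∅) = 0 := by
    intro l hl hgl hne
    have hle := hmax l (Finset.mem_filter.2 ⟨hl, hgl⟩)
    have hw := (oscRep_word l.1 (d := l0.1.length - l.1.length) (f := f0)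
      (by rwa [Nat.sub_add_cancel hle])).2 ∅ 0 (by simp)
    rw [Pi.sub_apply, MvPolynomial.coeff_sub, sub_eq_zero] at hw
    rw [hw]
    obtain ⟨c, S', μ', k1, k2, -⟩ := oscWord_coeff l.1 ∅ 0
    rw [k1, hf0]
    by_contra hcon
    obtain ⟨-, k4⟩ := k2 (left_ne_zero_of_mul hcon)
    -- A nonzero contribution forces the same monomial, hence the same multiplicities of letters,
    -- and a sorted word is determined by these.
    obtain ⟨rfl, rfl⟩ : S' = S0 ∧ μ0 = μ' := by
      by_contra hcon2
      rw [if_neg hcon2, mul_zero] at hcon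
      exact hcon rfl
    refine hne (Subtype.ext (sortedWord_unique hκ l.2 l0.2 ?_))
    rintro ⟨b, a⟩
    obtain ⟨m1, m2⟩ := k4 a
    obtain ⟨m3, m4⟩ := h5 a
    cases b
    · rw [m3] at m1; simpa using m1.symm
    · rw [m4] at m2; simpa using m2.symm
  have hval0 : MvPolynomial.coeff 0 (oscRep n (l0.1.map shiftLetter).prod f0 ∅) = c0 := by
    have hw := (oscRep_word l0.1 (d := 0) (f := f0) (by rwa [zero_add])).2 ∅ 0 (by simp)
    rw [Pi.sub_apply, MvPolynomial.coeff_sub, sub_eq_zero] at hw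
    rw [hw, h1, hf0, if_pos ⟨rfl, rfl⟩, mul_one]
  have hsum : MvPolynomial.coeff 0 (oscRep n (∑ l ∈ s, g l • (l.1.map shiftLetter).prod) f0 ∅)
      = g l0 * c0 := by
    rw [map_sum, LinearMap.sum_apply, Finset.sum_apply, MvPolynomial.coeff_sum,
      Finset.sum_eq_single l0]
    · rw [map_smul, LinearMap.smul_apply, Pi.smul_apply, MvPolynomial.coeff_smul, hval0,
        smul_eq_mul]
    · intro l hl hne
      rw [map_smul, LinearMap.smul_apply, Pi.smul_apply, MvPolynomial.coeff_smul]
      by_cases hgl : g l = 0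
      · simp [hgl]
      · rw [hval l hl hgl hne, smul_zero]
    · exact fun h => absurd hl0.1 h
  rw [hg, map_zero] at hsum
  exact mul_ne_zero hl0.2 hc0 (by rw [← hsum]; simp)

end

/-! ### The basis of sorted words -/

/-- The sorting key, for which raising letters come first and lowering letters come last. -/
def wordKey {n : ℕ} (x : Bool × Fin n × Fin n) : ℤ ×ₗ (Fin n ×ₗ Bool) :=
  toLex ((x.2.1 : ℤ) - x.2.2, toLex (x.2.1, x.1))

theorem wordKey_injective (n : ℕ) : Function.Injective (wordKey (n := n)) := by
  rintro ⟨b, i, j⟩ ⟨b', i', j'⟩ h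
  simp only [wordKey, toLex_inj, Prod.mk.injEq] at h
  obtain ⟨h1, rfl, rfl⟩ := h
  have : j = j' := Fin.ext (by omega)
  rw [this]

theorem wordKey_lt {n : ℕ} {x y : Bool × Fin n × Fin n}
    (h : (x.2.1 : ℤ) - x.2.2 < (y.2.1 : ℤ) - y.2.2) : wordKey x < wordKey y :=
  Prod.Lex.toLex_lt_toLex.2 (Or.inl h)

theorem le_of_wordKey_le {n : ℕ} {x y : Bool × Fin n × Fin n} (h : wordKey x ≤ wordKey y) :
    (x.2.1 : ℤ) - x.2.2 ≤ (y.2.1 : ℤ) - y.2.2 := by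
  by_contra! h'
  exact (wordKey_lt h').not_ge h

theorem adjoin_letter_eq_top (n : ℕ) :
    Algebra.adjoin ℂ (Set.range (letter (n := n))) = ⊤ := by
  have h1 : Function.Surjective (envMk n) := RingQuot.mkAlgHom_surjective ℂ (EnvRel n)
  rw [← (AlgHom.range_eq_top _).2 h1, ← Algebra.map_top,
    ← TensorAlgebra.adjoin_range_ι, AlgHom.map_adjoin]
  refine le_antisymm (Algebra.adjoin_le ?_) (Algebra.adjoin_le ?_)
  · rintro _ ⟨x, rfl⟩
    exact Algebra.subset_adjoin ⟨_, ⟨_, rfl⟩, rfl⟩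
  · rintro _ ⟨_, ⟨x, rfl⟩, rfl⟩
    obtain ⟨_, A, B, rfl⟩ := x
    change envι n (blocks A B) ∈ _
    rw [queer_eq_sum]
    simp only [map_sum, map_add, map_smul]
    exact sum_mem fun i _ => sum_mem fun j _ => add_mem
      (Subalgebra.smul_mem _ (Algebra.subset_adjoin (Set.mem_range_self (false, i, j))) _)
      (Subalgebra.smul_mem _ (Algebra.subset_adjoin (Set.mem_range_self (true, i, j))) _)

theorem letter_eq_shiftLetter {n : ℕ} (x : Bool × Fin n × Fin n) :
    letter x = shiftLetter x + letterChi x • (1 : Env n) := by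
  rw [shiftLetter, Algebra.algebraMap_eq_smul_one, sub_add_cancel]

theorem shiftLetter_eq_letter {n : ℕ} {x : Bool × Fin n × Fin n} (h : letterChi x = 0) :
    shiftLetter x = letter x := by
  rw [letter_eq_shiftLetter, h, zero_smul, add_zero]

theorem letterChi_eq_zero {n : ℕ} {x : Bool × Fin n × Fin n} (h : (x.2.2 : ℕ) + 1 ≠ x.2.1) :
    letterChi x = 0 := by
  rw [letterChi, if_neg fun h' => h h'.2]

theorem exists_mem_lenSpan {n : ℕ} (u : Env n) :
    ∃ N, u ∈ lenSpan (shiftLetter (n := n)) Set.univ 0 N := by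
  have hle : Algebra.adjoin ℂ (Set.range (letter (n := n)))
      ≤ Algebra.adjoin ℂ (Set.range (shiftLetter (n := n))) := by
    refine Algebra.adjoin_le ?_
    rintro _ ⟨x, rfl⟩
    rw [letter_eq_shiftLetter]
    exact add_mem (Algebra.subset_adjoin ⟨x, rfl⟩) (Subalgebra.smul_mem _ (one_mem _) _)
  rw [adjoin_letter_eq_top] at hle
  have hu : u ∈ Subalgebra.toSubmodule (Algebra.adjoin ℂ (Set.range (shiftLetter (n := n)))) :=
    hle Algebra.mem_top
  rw [Algebra.adjoin_eq_span] at hu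
  induction hu using Submodule.span_induction with
  | mem u hu =>
    obtain ⟨l, h1, rfl⟩ := Submonoid.exists_list_of_mem_closure hu
    have h2 : ∃ l' : List (Bool × Fin n × Fin n), l'.map shiftLetter = l := by
      clear hu
      induction l with
      | nil => exact ⟨[], rfl⟩
      | cons a l ih =>
        obtain ⟨l', rfl⟩ := ih fun y hy => h1 y (List.mem_cons_of_mem _ hy)
        obtain ⟨x, rfl⟩ := h1 a List.mem_cons_self
        exact ⟨x :: l', rfl⟩
    obtain ⟨l', rfl⟩ := h2
    exact ⟨l'.length, Submodule.subset_span ⟨l', fun _ _ => trivial, Nat.zero_le _, le_rfl, rfl⟩⟩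
  | zero => exact ⟨0, zero_mem _⟩
  | add u v _ _ hu hv =>
    obtain ⟨N, hN⟩ := hu
    obtain ⟨M, hM⟩ := hv
    exact ⟨max N M, add_mem (lenSpan_mono (le_max_left _ _) hN) (lenSpan_mono (le_max_right _ _) hM)⟩
  | smul c u _ hu =>
    obtain ⟨N, hN⟩ := hu
    exact ⟨N, Submodule.smul_mem _ _ hN⟩

theorem shiftLetter_bracket {n : ℕ} (x y : Bool × Fin n × Fin n) :
    shiftLetter x * shiftLetter y - bsgn x.1 y.1 • (shiftLetter y * shiftLetter x)
      = (if x.2.2 = y.2.1 then letter (x.1 ^^ y.1, x.2.1, y.2.2) else 0)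
        - bsgn x.1 y.1 • (if y.2.2 = x.2.1 then letter (y.1 ^^ x.1, y.2.1, x.2.2) else 0) := by
  obtain ⟨b, i, j⟩ := x
  obtain ⟨b', k, a⟩ := y
  have h := letter_mul b b' i j k a
  have h1 : bsgn b b' * letterChi (b, i, j) = letterChi (b, i, j) := by
    cases b <;> cases b' <;> simp [letterChi, bsgn]
  have h2 : bsgn b b' * letterChi (b', k, a) = letterChi (b', k, a) := by
    cases b <;> cases b' <;> simp [letterChi, bsgn]
  have h3 : letterChi (b, i, j) • letter (b', k, a)
      = (bsgn b b' * letterChi (b, i, j)) • letter (b', k, a) := by rw [h1]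
  have h4 : letterChi (b', k, a) • letter (b, i, j)
      = (bsgn b b' * letterChi (b', k, a)) • letter (b, i, j) := by rw [h2]
  have h5 : (letterChi (b, i, j) * letterChi (b', k, a)) • (1 : Env n)
      = (bsgn b b' * letterChi (b, i, j) * letterChi (b', k, a)) • (1 : Env n) := by rw [h1]
  simp only [shiftLetter, Algebra.algebraMap_eq_smul_one, sub_mul, mul_sub, smul_mul_assoc,
    mul_smul_comm, one_mul, mul_one]
  rw [h, Bool.xor_comm b' b]
  linear_combination (norm := module) -h3 - h4 + h5

theorem bracket_mem_lenSpan {n : ℕ} {C : Set (Bool × Fin n × Fin n)} {ε : ℕ}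
    (hC : ∀ x ∈ C, ∀ y ∈ C, x.2.2 = y.2.1 →
      letter (x.1 ^^ y.1, x.2.1, y.2.2) ∈ lenSpan (shiftLetter (n := n)) C ε 1) :
    ∀ x ∈ C, ∀ y ∈ C,
      shiftLetter x * shiftLetter y - bsgn x.1 y.1 • (shiftLetter y * shiftLetter x)
        ∈ lenSpan (shiftLetter (n := n)) C ε 1 := by
  intro x hx y hy
  rw [shiftLetter_bracket]
  refine sub_mem ?_ (Submodule.smul_mem _ _ ?_)
  · split_ifs with h
    · exact hC x hx y hy h
    · exact zero_mem _
  · split_ifs with h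
    · exact hC y hy x hx h
    · exact zero_mem _

theorem shiftLetter_mem_lenSpan {n : ℕ} {C : Set (Bool × Fin n × Fin n)} {ε : ℕ} (hε : ε ≤ 1)
    {x : Bool × Fin n × Fin n} (hx : x ∈ C) :
    shiftLetter x ∈ lenSpan (shiftLetter (n := n)) C ε 1 :=
  Submodule.subset_span ⟨[x], by simpa using hx, hε, le_rfl, by simp⟩

/-- Sorted words in the letters. -/
abbrev SWord (n : ℕ) : Type :=
  {l : List (Bool × Fin n × Fin n) // SortedWord wordKey Prod.fst l}

/-- The element of `U(Q(n))` given by a word. -/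
def wordVal {n : ℕ} (l : List (Bool × Fin n × Fin n)) : Env n := (l.map shiftLetter).prod

theorem span_sortedWord (n : ℕ) :
    ⊤ ≤ Submodule.span ℂ (Set.range fun l : SWord n => wordVal l.1) := by
  intro u _
  obtain ⟨N, hN⟩ := exists_mem_lenSpan u
  refine Submodule.span_mono ?_ (lenSpan_le_sorted (par := Prod.fst) (wordKey_injective n)
    (bracket_mem_lenSpan fun x _ y _ _ => ?_) N hN)
  · rintro _ ⟨l, -, -, h, rfl⟩
    exact ⟨⟨l, h⟩, rfl⟩
  · rw [letter_eq_shiftLetter]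
    exact add_mem (shiftLetter_mem_lenSpan zero_le_one trivial) (Submodule.smul_mem _ _
      (Submodule.subset_span ⟨[], by simp, le_rfl, zero_le_one, by simp⟩))

/-- The Poincaré-Birkhoff-Witt basis. -/
def pbwBasis (n : ℕ) : Module.Basis (SWord n) ℂ (Env n) :=
  Module.Basis.mk (v := fun l : SWord n => wordVal l.1)
    (linearIndependent_sortedWord (wordKey_injective n)) (span_sortedWord n)

theorem pbwBasis_apply {n : ℕ} (l : SWord n) : pbwBasis n l = wordVal l.1 :=
  Module.Basis.mk_apply _ _ _

theorem env_induction {n : ℕ} {P : Submodule ℂ (Env n)} (h : ∀ l : SWord n, wordVal l.1 ∈ P)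
    (u : Env n) : u ∈ P :=
  Submodule.span_le.2 (by rintro _ ⟨l, rfl⟩; exact h l) (span_sortedWord n trivial)

theorem filter_append_of_pairwise {α : Type*} {r : α → α → Prop} {p : α → Bool} {l : List α}
    (h : l.Pairwise r) (hr : ∀ x y, r x y → p y = true → p x = true) :
    l = l.filter p ++ l.filter fun x => !p x := by
  induction l with
  | nil => rfl
  | cons x l ih =>
    rw [List.pairwise_cons] at h
    cases hx : p x
    · have h1 : ∀ y ∈ l, p y = false := by
        intro y hy
        by_contra hy'
        rw [hr x y (h.1 y hy) (by simpa using hy')] at hx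
        exact absurd hx (by simp)
      have h2 : (x :: l).filter p = [] := by
        rw [List.filter_eq_nil_iff]
        rintro y hy
        rcases List.mem_cons.1 hy with rfl | hy
        · simp [hx]
        · simp [h1 y hy]
      have h3 : ((x :: l).filter fun x => !p x) = x :: l := by
        rw [List.filter_eq_self]
        rintro y hy
        rcases List.mem_cons.1 hy with rfl | hy
        · simp [hx]
        · simp [h1 y hy]
      rw [h2, h3, List.nil_append]
    · rw [List.filter_cons_of_pos hx, List.filter_cons_of_neg (by simp [hx]), List.cons_append,
        ← ih h.2]

theorem wordVal_append {n : ℕ} (l l' : List (Bool × Fin n × Fin n)) :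
    wordVal (l ++ l') = wordVal l * wordVal l' := by
  rw [wordVal, List.map_append, List.prod_append]; rfl

theorem wordVal_cons {n : ℕ} (x : Bool × Fin n × Fin n) (l : List (Bool × Fin n × Fin n)) :
    wordVal (x :: l) = shiftLetter x * wordVal l := by
  rw [wordVal, List.map_cons, List.prod_cons]; rfl

theorem wordVal_nil {n : ℕ} : wordVal ([] : List (Bool × Fin n × Fin n)) = 1 := rfl

theorem wordVal_singleton {n : ℕ} (x : Bool × Fin n × Fin n) : wordVal [x] = shiftLetter x := by
  rw [wordVal_cons, wordVal_nil, mul_one]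

theorem le_of_sorted {n : ℕ} {x y : Bool × Fin n × Fin n}
    (h : wordKey x < wordKey y ∨ x = y ∧ x.1 = false) :
    (x.2.1 : ℤ) - x.2.2 ≤ (y.2.1 : ℤ) - y.2.2 := by
  rcases h with h | ⟨rfl, -⟩
  · exact le_of_wordKey_le h.le
  · exact le_rfl

/-- Raising letters come first in the sorting order and are closed under brackets, and `χ` vanishes
on them, so reordering produces no constants. With `ε = 1` every sorted word obtained keeps at least
one raising letter, and the other letters of `l` follow unchanged. -/
theorem raising_mul_word {n : ℕ} {x : Bool × Fin n × Fin n} (hx : x.2.1 < x.2.2) (l : SWord n) :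
    shiftLetter x * wordVal l.1 ∈ Submodule.span ℂ (wordVal '' {l : List (Bool × Fin n × Fin n) |
      SortedWord wordKey Prod.fst l ∧ ∃ y ∈ l, y.2.1 < y.2.2}) := by
  obtain ⟨l, hl⟩ := l
  have hsplit := filter_append_of_pairwise (p := fun y => decide (y.2.1 < y.2.2)) hl (by
    intro y z hyz hz
    have := le_of_sorted hyz
    simp only [decide_eq_true_eq, Fin.lt_def] at hz ⊢
    omega)
  set P := l.filter fun y => decide (y.2.1 < y.2.2)
  set Q := l.filter fun y => !decide (y.2.1 < y.2.2)
  have hP : ∀ y ∈ P, y.2.1 < y.2.2 := fun y hy => by simpa using (List.mem_filter.1 hy).2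
  have hQ : ∀ y ∈ Q, ¬ y.2.1 < y.2.2 := fun y hy => by
    have := (List.mem_filter.1 hy).2
    simpa using this
  have h1 : shiftLetter x * wordVal P ∈ lenSpan (shiftLetter (n := n))
      {y | y.2.1 < y.2.2} 1 (P.length + 1) :=
    Submodule.subset_span ⟨x :: P, by simpa [hx] using fun a b c h => hP (a, b, c) h, by simp, by simp,
      by rw [List.map_cons, List.prod_cons]; rfl⟩
  have h2 := lenSpan_le_sorted (par := Prod.fst) (wordKey_injective n)
    (bracket_mem_lenSpan fun x hx y hy hxy => by
      have hlt : x.2.1 < y.2.2 := by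
        simp only [Set.mem_ofPred_eq] at hx hy
        rw [hxy] at hx
        exact hx.trans hy
      rw [← shiftLetter_eq_letter (letterChi_eq_zero (by
        simp only [Fin.lt_def] at hlt ⊢; omega))]
      exact shiftLetter_mem_lenSpan le_rfl hlt) _ h1
  have h3 : shiftLetter x * wordVal l = (shiftLetter x * wordVal P) * wordVal Q := by
    conv_lhs => rw [hsplit]
    rw [wordVal_append, mul_assoc]
  change shiftLetter x * wordVal l ∈ _
  rw [h3]
  generalize shiftLetter x * wordVal P = w at h2
  clear h1 h3
  induction h2 using Submodule.span_induction with
  | mem w hw =>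
    obtain ⟨l', k1, k2, k3, rfl⟩ := hw
    refine Submodule.subset_span ⟨l' ++ Q, ⟨?_, ?_⟩, wordVal_append _ _⟩
    · refine List.pairwise_append.2 ⟨k3, hl.sublist List.filter_sublist, fun y hy z hz => ?_⟩
      have h1 : y.2.1 < y.2.2 := k1 y hy
      have h2 := hQ z hz
      refine Or.inl (wordKey_lt ?_)
      rw [Fin.lt_def] at h1 h2
      omega
    · obtain ⟨y, hy⟩ := List.exists_mem_of_length_pos k2
      exact ⟨y, List.mem_append_left _ hy, k1 y hy⟩
  | zero => rw [zero_mul]; exact zero_mem _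
  | add p q _ _ hp hq => rw [add_mul]; exact add_mem hp hq
  | smul c q _ hq => rw [smul_mul_assoc]; exact Submodule.smul_mem _ _ hq

/-- The mirror image for lowering letters at the right end. Here no constants appear because `χ` is
a character of `𝔪`: a bracket of two lowering letters lies at least two steps below the diagonal. -/
theorem word_mul_lowering {n : ℕ} {x : Bool × Fin n × Fin n} (hx : x.2.2 < x.2.1) (l : SWord n) :
    wordVal l.1 * shiftLetter x ∈ Submodule.span ℂ (wordVal '' {l : List (Bool × Fin n × Fin n) |
      SortedWord wordKey Prod.fst l ∧ ∃ y ∈ l, y.2.2 < y.2.1}) := by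
  obtain ⟨l, hl⟩ := l
  have hsplit := filter_append_of_pairwise (p := fun y => !decide (y.2.2 < y.2.1)) hl (by
    intro y z hyz hz
    have := le_of_sorted hyz
    simp only [Bool.not_eq_true', decide_eq_false_iff_not, Fin.lt_def] at hz ⊢
    omega)
  simp only [Bool.not_not] at hsplit
  set P := l.filter fun y => decide (y.2.2 < y.2.1)
  set Q := l.filter fun y => !decide (y.2.2 < y.2.1)
  have hP : ∀ y ∈ P, y.2.2 < y.2.1 := fun y hy => by simpa using (List.mem_filter.1 hy).2
  have hQ : ∀ y ∈ Q, ¬ y.2.2 < y.2.1 := fun y hy => by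
    have := (List.mem_filter.1 hy).2
    simpa using this
  have h1 : wordVal P * shiftLetter x ∈ lenSpan (shiftLetter (n := n))
      {y | y.2.2 < y.2.1} 1 (P.length + 1) := by
    refine Submodule.subset_span ⟨P ++ [x], fun y hy => ?_, by simp, by simp, ?_⟩
    · rcases List.mem_append.1 hy with hy | hy
      · exact hP y hy
      · rw [List.mem_singleton.1 hy]; exact hx
    · rw [← wordVal_singleton, ← wordVal_append]; rfl
  have h2 := lenSpan_le_sorted (par := Prod.fst) (wordKey_injective n)
    (bracket_mem_lenSpan fun x hx y hy hxy => by
      simp only [Set.mem_ofPred_eq] at hx hy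
      have hlt : y.2.2 < x.2.1 := by
        rw [hxy] at hx
        exact hy.trans hx
      rw [← shiftLetter_eq_letter (letterChi_eq_zero (by
        rw [hxy] at hx
        simp only [Fin.lt_def] at hx hy ⊢; omega))]
      exact shiftLetter_mem_lenSpan le_rfl hlt) _ h1
  have h3 : wordVal l * shiftLetter x = wordVal Q * (wordVal P * shiftLetter x) := by
    conv_lhs => rw [hsplit]
    rw [wordVal_append, mul_assoc]
  change wordVal l * shiftLetter x ∈ _
  rw [h3]
  generalize wordVal P * shiftLetter x = w at h2
  clear h1 h3
  induction h2 using Submodule.span_induction with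
  | mem w hw =>
    obtain ⟨l', k1, k2, k3, rfl⟩ := hw
    refine Submodule.subset_span ⟨Q ++ l', ⟨?_, ?_⟩, wordVal_append _ _⟩
    · refine List.pairwise_append.2 ⟨hl.sublist List.filter_sublist, k3, fun z hz y hy => ?_⟩
      have h1 : y.2.2 < y.2.1 := k1 y hy
      have h2 := hQ z hz
      refine Or.inl (wordKey_lt ?_)
      rw [Fin.lt_def] at h1 h2
      omega
    · obtain ⟨y, hy⟩ := List.exists_mem_of_length_pos k2
      exact ⟨y, List.mem_append_right _ hy, k1 y hy⟩
  | zero => rw [mul_zero]; exact zero_mem _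
  | add p q _ _ hp hq => rw [mul_add]; exact add_mem hp hq
  | smul c q _ hq => rw [mul_smul_comm]; exact Submodule.smul_mem _ _ hq

/-- The case distinction behind all verifications for the projection: a raising letter in front, a
lowering letter at the end, or diagonal letters only. -/
theorem sortedWord_cases {n : ℕ} (l : SWord n) :
    (∃ x l', l.1 = x :: l' ∧ x.2.1 < x.2.2) ∨ (∃ l' x, l.1 = l' ++ [x] ∧ x.2.2 < x.2.1) ∨
      ∀ x ∈ l.1, x.2.1 = x.2.2 := by
  obtain ⟨l, hl⟩ := l
  by_contra! hcon
  obtain ⟨h1, h2, x, hx, hxne⟩ := hcon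
  rcases lt_or_gt_of_ne hxne with h | h
  · rcases l with _ | ⟨y, l⟩
    · simp at hx
    · have := h1 y l rfl
      rcases List.mem_cons.1 hx with rfl | hx
      · exact this.not_gt h
      · have h3 := le_of_sorted ((List.pairwise_cons.1 hl).1 x hx)
        rw [Fin.lt_def] at h
        rw [Fin.le_def] at this
        omega
  · rcases l.eq_nil_or_concat with rfl | ⟨l', y, rfl⟩
    · simp at hx
    · have := h2 l' y (by simp)
      replace hx : x ∈ l'.concat y := hx
      rw [List.concat_eq_append, List.mem_append, List.mem_singleton] at hx
      rcases hx with hx | rfl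
      · rw [SortedWord, List.concat_eq_append, List.pairwise_append] at hl
        have h3 := le_of_sorted (hl.2.2 x hx y (List.mem_singleton.2 rfl))
        rw [Fin.lt_def] at h
        rw [Fin.le_def] at this
        omega
      · exact this.not_gt h

/-! ### The Harish-Chandra projection -/

theorem anticomm_add_central_mul {A : Type*} [Ring A] (a b c d : A) {x y : A}
    (hx : ∀ t, x * t = t * x) (hy : ∀ t, y * t = t * y) :
    (a + x * b) * (c + y * d) + (c + y * d) * (a + x * b)
      = (a * c + c * a) + x * (b * c + c * b) + y * (d * a + a * d) + x * y * (b * d + d * b) := by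
  have h1 : ∀ t u, t * (x * u) = x * (t * u) := fun t u => by
    rw [← mul_assoc, ← hx, mul_assoc]
  have h2 : ∀ t u, t * (y * u) = y * (t * u) := fun t u => by
    rw [← mul_assoc, ← hy, mul_assoc]
  simp only [add_mul, mul_add, mul_assoc]
  rw [h2 a d, h2 b d, h1 c b, h1 d b, h1 y (d * b)]
  abel

/-- Operators on an exterior algebra over a polynomial ring, among them a Clifford algebra. -/
abbrev Cliff (n : ℕ) : Type :=
  Module.End (MvPolynomial (Fin n) ℂ) (Finset (Fin n) → MvPolynomial (Fin n) ℂ)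

/-- The scalar operators. -/
def cScal (n : ℕ) : MvPolynomial (Fin n) ℂ →ₐ[ℂ] Cliff n :=
  IsScalarTower.toAlgHom ℂ (MvPolynomial (Fin n) ℂ) (Cliff n)

theorem cScal_comm {n : ℕ} (r : MvPolynomial (Fin n) ℂ) (T : Cliff n) :
    cScal n r * T = T * cScal n r := Algebra.commutes r T

theorem cScal_mul {n : ℕ} (r : MvPolynomial (Fin n) ℂ) (T : Cliff n) :
    cScal n r * T = r • T := (Algebra.smul_def r T).symm

/-- The creation operators. -/
def cCr {n : ℕ} (i : Fin n) : Cliff n := fcr (MvPolynomial (Fin n) ℂ) _ i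

/-- The annihilation operators. -/
def cAn {n : ℕ} (i : Fin n) : Cliff n := fan (MvPolynomial (Fin n) ℂ) _ i

/-- The Clifford generators `ξ_i`, with `ξ_i² = x_i`. -/
def cXi {n : ℕ} (i : Fin n) : Cliff n := cCr i + cScal n (MvPolynomial.X i) * cAn i

theorem cXi_anticomm {n : ℕ} (i j : Fin n) : cXi i * cXi j + cXi j * cXi i
    = if i = j then (2 : ℂ) • cScal n (MvPolynomial.X i) else 0 := by
  have h1 : cCr i * cCr j + cCr j * cCr i = 0 := fcr_fcr i j
  have h2 : cAn i * cAn j + cAn j * cAn i = 0 := fan_fan i j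
  have h3 : cAn i * cCr j + cCr j * cAn i = if i = j then 1 else 0 := fan_fcr i j
  have h4 : cAn j * cCr i + cCr i * cAn j = if j = i then 1 else 0 := fan_fcr j i
  have e := anticomm_add_central_mul (cCr i) (cAn i) (cCr j) (cAn j)
    (cScal_comm (MvPolynomial.X i)) (cScal_comm (MvPolynomial.X j))
  change cXi i * cXi j + cXi j * cXi i = _ at e
  rw [e, h1, h2, h3, h4]
  rcases eq_or_ne i j with rfl | h
  · simp [two_smul]
  · simp [h, h.symm]

theorem neg_one_smul_cliff {n : ℕ} (T : Cliff n) : (-1 : ℂ) • T = -T := neg_one_smul ℂ T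

/-- The images of the diagonal letters. -/
def cLetter {n : ℕ} (x : Bool × Fin n × Fin n) : Cliff n :=
  if x.1 then (-1 : ℂ) ^ (x.2.1 : ℕ) • cXi x.2.1 else cScal n (MvPolynomial.X x.2.1)

theorem cXi_mul_self {n : ℕ} (i : Fin n) : cXi i * cXi i = cScal n (MvPolynomial.X i) := by
  have h := cXi_anticomm i i
  rw [if_pos rfl, ← two_smul ℂ] at h
  exact smul_right_injective _ two_ne_zero h

/-- The images satisfy the relations of the diagonal letters. The sign `(-1)^i` in `cLetter` squares
to `1` and does not affect them; it cancels the row-dependent signs in the images of the first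
column. -/
theorem cLetter_bracket {n : ℕ} (x y : Bool × Fin n × Fin n) :
    cLetter x * cLetter y - bsgn x.1 y.1 • (cLetter y * cLetter x)
      = (if x.2.1 = y.2.1 then cLetter (x.1 ^^ y.1, x.2.1, y.2.2) else 0)
        - bsgn x.1 y.1 • (if y.2.1 = x.2.1 then cLetter (y.1 ^^ x.1, y.2.1, x.2.2) else 0) := by
  obtain ⟨b, i, j⟩ := x
  obtain ⟨b', k, a⟩ := y
  cases b <;> cases b' <;> simp only [cLetter, bsgn, Bool.false_eq_true, if_false, if_true,
    Bool.and_self, Bool.and_false, Bool.and_true, one_smul, Bool.xor_self, Bool.xor_false,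
    Bool.false_xor, eq_comm (a := k)]
  · rw [← map_mul, ← map_mul, mul_comm, sub_self]
    split_ifs with h
    · subst h; simp
    · simp
  · rw [cScal_comm, sub_self]
    split_ifs with h
    · subst h; simp
    · simp
  · rw [cScal_comm, sub_self]
    split_ifs with h
    · subst h; simp
    · simp
  · simp only [neg_one_smul_cliff, sub_neg_eq_add]
    have h := cXi_anticomm i k
    rw [smul_mul_smul_comm, smul_mul_smul_comm, mul_comm ((-1 : ℂ) ^ (k : ℕ)), ← smul_add, h]
    split_ifs with h
    · subst h
      rw [← mul_pow, neg_one_mul, neg_neg, one_pow, one_smul, two_smul]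
    · simp

/-- The Harish-Chandra projection: the linear map that kills the sorted words with an off-diagonal
letter. -/
def hc (n : ℕ) : Env n →ₗ[ℂ] Cliff n :=
  (pbwBasis n).constr ℂ fun l =>
    if ∀ x ∈ l.1, x.2.1 = x.2.2 then (l.1.map cLetter).prod else 0

theorem hc_sorted {n : ℕ} {l : List (Bool × Fin n × Fin n)} (h : SortedWord wordKey Prod.fst l) :
    hc n (wordVal l) = if ∀ x ∈ l, x.2.1 = x.2.2 then (l.map cLetter).prod else 0 := by
  have := (pbwBasis n).constr_basis ℂ
    (fun l => if ∀ x ∈ l.1, x.2.1 = x.2.2 then (l.1.map cLetter).prod else 0) ⟨l, h⟩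
  rwa [pbwBasis_apply] at this

/-- Sortedness is removed by carrying out the reordering in `Env n × Cliff n`. The pairs
`(shiftLetter x, cLetter x)` satisfy a common bracket relation, so a product of pairs is a
combination of sorted products, which lie on the graph of `hc`. -/
theorem hc_diag {n : ℕ} (l : List (Bool × Fin n × Fin n)) (h : ∀ x ∈ l, x.2.1 = x.2.2) :
    hc n (wordVal l) = (l.map cLetter).prod := by
  let D : Bool × Fin n × Fin n → Env n × Cliff n := fun x => (shiftLetter x, cLetter x)
  let C : Set (Bool × Fin n × Fin n) := {x | x.2.1 = x.2.2}
  have hprod : ∀ l : List (Bool × Fin n × Fin n), (l.map D).prod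
      = (wordVal l, (l.map cLetter).prod) := by
    intro l
    induction l with
    | nil => rfl
    | cons x l ih => rw [List.map_cons, List.prod_cons, ih, wordVal_cons, List.map_cons,
        List.prod_cons]; rfl
  have h0 : ∀ x ∈ C, shiftLetter x = letter x := fun x hx =>
    shiftLetter_eq_letter (letterChi_eq_zero (by
      have : x.2.1 = x.2.2 := hx
      rw [this]; omega))
  have h1 : ∀ x ∈ C, ∀ y ∈ C, D x * D y - bsgn x.1 y.1 • (D y * D x) ∈ lenSpan D C 1 1 := by
    intro x hx y hy
    have hx' : x.2.1 = x.2.2 := hx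
    have hy' : y.2.1 = y.2.2 := hy
    have e : D x * D y - bsgn x.1 y.1 • (D y * D x)
        = (if x.2.1 = y.2.1 then D (x.1 ^^ y.1, x.2.1, y.2.2) else 0)
          - bsgn x.1 y.1 • (if y.2.1 = x.2.1 then D (y.1 ^^ x.1, y.2.1, x.2.2) else 0) := by
      refine Prod.ext ?_ ?_
      · change shiftLetter x * shiftLetter y - bsgn x.1 y.1 • (shiftLetter y * shiftLetter x) = _
        rw [shiftLetter_bracket, Prod.fst_sub, Prod.smul_fst, apply_ite Prod.fst,
          apply_ite Prod.fst, ← hx', ← hy']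
        congr 1
        · split_ifs with hxy
          · exact (h0 _ (by exact hxy)).symm
          · rfl
        · split_ifs with hxy
          · exact congrArg _ (h0 _ (by exact hxy)).symm
          · rfl
      · change cLetter x * cLetter y - bsgn x.1 y.1 • (cLetter y * cLetter x) = _
        rw [cLetter_bracket, Prod.snd_sub, Prod.smul_snd, apply_ite Prod.snd, apply_ite Prod.snd]
        rfl
    rw [e]
    have hm : ∀ x ∈ C, D x ∈ lenSpan D C 1 1 := fun x hx =>
      Submodule.subset_span ⟨[x], by simpa using hx, le_rfl, le_rfl, by simp⟩
    refine sub_mem ?_ (Submodule.smul_mem _ _ ?_)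
    · split_ifs with hxy
      · exact hm _ (by change x.2.1 = y.2.2; rw [hxy, hy'])
      · exact zero_mem _
    · split_ifs with hxy
      · exact hm _ (by change y.2.1 = x.2.2; rw [hxy, hx'])
      · exact zero_mem _
  have h2 : (l.map D).prod ∈ lenSpan D C 0 l.length :=
    Submodule.subset_span ⟨l, h, Nat.zero_le _, le_rfl, rfl⟩
  have h3 := lenSpan_le_sorted (par := Prod.fst) (wordKey_injective n)
    (fun x hx y hy => (Submodule.span_mono (by
      rintro w ⟨l, k1, k2, k3, k4⟩
      exact ⟨l, k1, Nat.zero_le _, k3, k4⟩)) (h1 x hx y hy)) _ h2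
  have h4 : ∀ w ∈ Submodule.span ℂ {w | ∃ l : List (Bool × Fin n × Fin n), (∀ x ∈ l, x ∈ C) ∧
      0 ≤ l.length ∧ SortedWord wordKey Prod.fst l ∧ w = (l.map D).prod}, hc n w.1 = w.2 := by
    intro w hw
    induction hw using Submodule.span_induction with
    | mem w hw =>
      obtain ⟨l, k1, -, k3, rfl⟩ := hw
      rw [hprod]
      exact (hc_sorted k3).trans (if_pos k1)
    | zero => exact map_zero _
    | add p q _ _ hp hq => rw [Prod.fst_add, Prod.snd_add, map_add, hp, hq]
    | smul c q _ hq => rw [Prod.smul_fst, Prod.smul_snd, map_smul, hq]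
  have := h4 _ h3
  rwa [hprod] at this

theorem hc_raising_mul {n : ℕ} {x : Bool × Fin n × Fin n} (hx : x.2.1 < x.2.2) (u : Env n) :
    hc n (shiftLetter x * u) = 0 := by
  refine env_induction (P := LinearMap.ker (hc n ∘ₗ LinearMap.mulLeft ℂ (shiftLetter x)))
    (fun l => ?_) u
  refine (Submodule.span_le (p := LinearMap.ker (hc n))).2 ?_ (raising_mul_word hx l)
  rintro _ ⟨l', ⟨h1, y, hy, hlt⟩, rfl⟩
  refine (hc_sorted h1).trans (if_neg fun h => ?_)
  exact hlt.ne (h y hy)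

theorem hc_mul_lowering {n : ℕ} {x : Bool × Fin n × Fin n} (hx : x.2.2 < x.2.1) (u : Env n) :
    hc n (u * shiftLetter x) = 0 := by
  refine env_induction (P := LinearMap.ker (hc n ∘ₗ LinearMap.mulRight ℂ (shiftLetter x)))
    (fun l => ?_) u
  refine (Submodule.span_le (p := LinearMap.ker (hc n))).2 ?_ (word_mul_lowering hx l)
  rintro _ ⟨l', ⟨h1, y, hy, hlt⟩, rfl⟩
  refine (hc_sorted h1).trans (if_neg fun h => ?_)
  exact hlt.ne (h y hy).symm

theorem hc_one (n : ℕ) : hc n 1 = 1 := hc_diag [] (by simp)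

/-- A diagonal letter moved past a leading raising letter leaves only multiples of raising letters,
which are killed; a final lowering letter is killed on both sides. -/
theorem hc_diag_mul {n : ℕ} {x : Bool × Fin n × Fin n} (hx : x.2.1 = x.2.2) (u : Env n) :
    hc n (shiftLetter x * u) = cLetter x * hc n u := by
  refine sub_eq_zero.1 (env_induction (P := LinearMap.ker (hc n ∘ₗ LinearMap.mulLeft ℂ (shiftLetter x)
    - LinearMap.mulLeft ℂ (cLetter x) ∘ₗ hc n)) (fun l => sub_eq_zero.2 ?_) u)
  change hc n (shiftLetter x * wordVal l.1) = cLetter x * hc n (wordVal l.1)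
  rcases sortedWord_cases l with ⟨y, l', h1, h2⟩ | ⟨l', y, h1, h2⟩ | h
  · rw [h1, wordVal_cons, hc_raising_mul h2, mul_zero, ← mul_assoc, sub_eq_iff_eq_add.1
      (shiftLetter_bracket x y), add_mul, smul_mul_assoc, mul_assoc, map_add, map_smul,
      hc_raising_mul h2, smul_zero, add_zero, sub_mul, map_sub, smul_mul_assoc, map_smul]
    have h0 : ∀ z : Bool × Fin n × Fin n, z.2.1 < z.2.2 → hc n (letter z * wordVal l') = 0 := by
      intro z hz
      rw [← shiftLetter_eq_letter (letterChi_eq_zero (by rw [Fin.lt_def] at hz; omega)),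
        hc_raising_mul hz]
    rw [ite_mul, ite_mul, apply_ite (hc n), apply_ite (hc n), zero_mul, map_zero]
    split_ifs with k1 k2 k2
    · rw [h0 _ (by rw [hx, k1]; exact h2), h0 _ (by rw [← hx, ← k2]; exact h2)]; simp
    · rw [h0 _ (by rw [hx, k1]; exact h2)]; simp
    · rw [h0 _ (by rw [← hx, ← k2]; exact h2)]; simp
    · simp
  · rw [h1, wordVal_append, wordVal_singleton, hc_mul_lowering h2, ← mul_assoc, hc_mul_lowering h2,
      mul_zero]
  · rw [← wordVal_cons, hc_diag _ (by
      intro y hy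
      rcases List.mem_cons.1 hy with rfl | hy
      · exact hx
      · exact h y hy), hc_diag _ h, List.map_cons, List.prod_cons]

theorem whitIdeal_le {n : ℕ} {J : Submodule (Env n) (Env n)}
    (hJ : ∀ x : Bool × Fin n × Fin n, x.2.2 < x.2.1 → shiftLetter x ∈ J) : whitIdeal n ≤ J := by
  rw [whitIdeal, Submodule.span_le]
  rintro _ ⟨a, ha, rfl⟩
  let T : queer n →ₗ[ℂ] Env n := envι n - (Algebra.linearMap ℂ (Env n)) ∘ₗ chi n
  have hT : nilp n ≤ (J.restrictScalars ℂ).comap T := by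
    refine iSup_le fun k => ?_
    rw [queerDeg, Submodule.span_le]
    rintro x ⟨i, j, hij, rfl | rfl⟩
    · have := hJ (false, i, j) (by rw [Fin.lt_def]; dsimp only; omega)
      rw [shiftLetter, ← chi_letter] at this
      exact this
    · have := hJ (true, i, j) (by rw [Fin.lt_def]; dsimp only; omega)
      rw [shiftLetter, ← chi_letter] at this
      exact this
  exact hT ha

theorem hc_whitIdeal {n : ℕ} {u : Env n} (hu : u ∈ whitIdeal n) : hc n u = 0 := by
  have h : whitIdeal n ≤ Submodule.span (Env n)
      (shiftLetter '' {x : Bool × Fin n × Fin n | x.2.2 < x.2.1}) :=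
    whitIdeal_le fun x hx => Submodule.subset_span ⟨x, hx, rfl⟩
  replace hu := h hu
  have key : ∀ v, hc n (v * u) = 0 := by
    induction hu using Submodule.span_induction with
    | mem u hu =>
      obtain ⟨x, hx, rfl⟩ := hu
      exact hc_mul_lowering hx
    | zero => intro v; rw [mul_zero, map_zero]
    | add u v _ _ hu hv => intro w; rw [mul_add, map_add, hu, hv, add_zero]
    | smul a u _ hu => intro v; rw [smul_eq_mul, ← mul_assoc, hu]
  have := key 1
  rwa [one_mul] at this

/-- The projection is multiplicative when the second factor is an invariant. -/
theorem hc_mul {n : ℕ} (u : Env n) {y : Env n}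
    (hy : ∀ x : Bool × Fin n × Fin n, x.2.2 < x.2.1 → shiftLetter x * y ∈ whitIdeal n) :
    hc n (u * y) = hc n u * hc n y := by
  refine sub_eq_zero.1 (env_induction (P := LinearMap.ker (hc n ∘ₗ LinearMap.mulRight ℂ y
    - LinearMap.mulRight ℂ (hc n y) ∘ₗ hc n)) (fun l => sub_eq_zero.2 ?_) u)
  change hc n (wordVal l.1 * y) = hc n (wordVal l.1) * hc n y
  -- Invariance of `y` is used only when the word ends in a lowering letter: that letter times `y`
  -- lies in `I_χ`, where the projection vanishes.
  rcases sortedWord_cases l with ⟨x, l', h1, h2⟩ | ⟨l', x, h1, h2⟩ | h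
  · rw [h1, wordVal_cons, hc_raising_mul h2, zero_mul, mul_assoc, hc_raising_mul h2]
  · rw [h1, wordVal_append, wordVal_singleton, hc_mul_lowering h2, zero_mul, mul_assoc]
    exact hc_whitIdeal ((whitIdeal n).smul_mem (wordVal l') (hy x h2))
  · rw [hc_diag _ h]
    generalize l.1 = l at h
    induction l with
    | nil => rw [wordVal_nil, one_mul, List.map_nil, List.prod_nil, one_mul]
    | cons x l ih =>
      rw [wordVal_cons, mul_assoc, hc_diag_mul (h x List.mem_cons_self),
        ih fun z hz => h z (List.mem_cons_of_mem _ hz), List.map_cons, List.prod_cons, mul_assoc]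

/-- The projection on `U / I_χ`. -/
def hcWhit {n : ℕ} (q : Whit n) : Cliff n := hc n (Quotient.out q)

theorem hcWhit_proj {n : ℕ} (u : Env n) : hcWhit (proj n u) = hc n u := by
  rw [hcWhit, ← sub_eq_zero, ← map_sub]
  refine hc_whitIdeal ((Submodule.Quotient.eq _).1 ?_)
  exact Quotient.out_eq' (proj n u)

theorem exists_proj {n : ℕ} (q : Whit n) : ∃ u, proj n u = q :=
  Submodule.mkQ_surjective (whitIdeal n) q

/-- The homomorphism from the W-algebra to the Clifford algebra. -/
def hcW (n : ℕ) : W n →ₐ[ℂ] Cliff n :=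
  AlgHom.ofLinearMap
    { toFun := fun w => hcWhit (toWhit w)
      map_add' := fun w w' => by
        obtain ⟨u, hu⟩ := exists_proj (toWhit w)
        obtain ⟨u', hu'⟩ := exists_proj (toWhit w')
        have : toWhit (w + w') = proj n (u + u') := by
          rw [map_add, hu, hu']; exact map_add (toWhitL n) w w'
        rw [this, ← hu, ← hu', hcWhit_proj, hcWhit_proj, hcWhit_proj, map_add]
      map_smul' := fun c w => by
        obtain ⟨u, hu⟩ := exists_proj (toWhit w)
        have : toWhit (c • w) = proj n (c • u) := by
          rw [proj_eq, smul_assoc, ← proj_eq, hu]; exact map_smul (toWhitL n) c w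
        rw [this, ← hu, hcWhit_proj, hcWhit_proj, map_smul]; rfl }
    (by
      change hcWhit (toWhit (1 : W n)) = 1
      rw [toWhit_one, hcWhit_proj, hc_one])
    (fun w w' => by
      change hcWhit (toWhit (w * w')) = hcWhit (toWhit w) * hcWhit (toWhit w')
      obtain ⟨u, hu⟩ := exists_proj (toWhit w)
      obtain ⟨u', hu'⟩ := exists_proj (toWhit w')
      have h1 : toWhit (w * w') = proj n (u * u') := by
        rw [toWhit_mul (by rw [← proj_eq, hu]) w', ← hu', ← map_smul, smul_eq_mul]
      rw [h1, ← hu, ← hu', hcWhit_proj, hcWhit_proj, hcWhit_proj]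
      refine hc_mul u fun x hx => ?_
      have h2 := shiftLetter_smul_toWhit w' x hx
      rw [← hu', ← map_smul, smul_eq_mul] at h2
      exact (Submodule.Quotient.mk_eq_zero _).1 h2)

theorem hcW_eq {n : ℕ} {w : W n} {u : Env n} (h : toWhit w = proj n u) : hcW n w = hc n u := by
  change hcWhit (toWhit w) = _
  rw [h, hcWhit_proj]

/-! ### Harish-Chandra images of Sergeev's elements -/

theorem hc_letter_raising {n : ℕ} (b : Bool) {i j : Fin n} (h : i < j) (u : Env n) :
    hc n (letter (b, i, j) * u) = 0 := by
  rw [← shiftLetter_eq_letter (letterChi_eq_zero (by rw [Fin.lt_def] at h; dsimp only; omega))]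
  exact hc_raising_mul h u

theorem hc_letter_diag {n : ℕ} (b : Bool) (i : Fin n) (u : Env n) :
    hc n (letter (b, i, i) * u) = cLetter (b, i, i) * hc n u := by
  rw [← shiftLetter_eq_letter (letterChi_eq_zero (by dsimp only; omega))]
  exact hc_diag_mul rfl u

theorem hc_mul_letter {n : ℕ} (b : Bool) {i j : Fin n} (h : j < i) (u : Env n) :
    hc n (u * letter (b, i, j)) = letterChi (b, i, j) • hc n u := by
  rw [letter_eq_shiftLetter, mul_add, map_add, hc_mul_lowering h, zero_add, mul_smul_comm, mul_one,
    map_smul]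

theorem neg_one_pow_mul_self (m : ℕ) : (-1 : ℂ) ^ m * (-1) ^ m = 1 := by
  rw [← mul_pow]; simp

/-- In the recursion over the middle index `a`, a raising letter (`a > k`) is killed and a diagonal
one (`a = k`) factors out. A lowering letter (`a < k`) is moved to the right end, where it becomes
its `χ` value and selects `a + 1 = k`; the brackets on the way give the last sum. -/
theorem hc_sergeev_succ {n : ℕ} (m : ℕ) (k l : Fin n) :
    hc n (sE (m + 1) k l) = cScal n (MvPolynomial.X k) * hc n (sE m k l)
      + (-1 : ℂ) ^ (m + k) • (cXi k * hc n (sF m k l))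
      + ∑ a : Fin n, (if (a : ℕ) + 1 = k then hc n (sE m a l) else 0)
      - (if k = l then (1 - (-1 : ℂ) ^ m) • ∑ a : Fin n, (if a < k then hc n (sE m a a) else 0)
          else 0) ∧
    hc n (sF (m + 1) k l) = cScal n (MvPolynomial.X k) * hc n (sF m k l)
      + (-1 : ℂ) ^ (m + k) • (cXi k * hc n (sE m k l))
      + ∑ a : Fin n, (if (a : ℕ) + 1 = k then hc n (sF m a l) else 0)
      - (if k = l then (1 + (-1 : ℂ) ^ m) • ∑ a : Fin n, (if a < k then hc n (sF m a a) else 0)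
          else 0) := by
  have hs := neg_one_pow_mul_self m
  have tE : ∀ a : Fin n, hc n (letter (false, k, a) * sE m a l)
      + (-1 : ℂ) ^ m • hc n (letter (true, k, a) * sF m a l)
      = (if a = k then cScal n (MvPolynomial.X k) * hc n (sE m k l)
          + (-1 : ℂ) ^ (m + k) • (cXi k * hc n (sF m k l)) else 0)
        + (if (a : ℕ) + 1 = k then hc n (sE m a l) else 0)
        - (if k = l then (1 - (-1 : ℂ) ^ m) • (if a < k then hc n (sE m a a) else 0) else 0) := by
    intro a
    rcases lt_trichotomy a k with h | rfl | h
    · obtain ⟨b1, b2, b3, b4⟩ := sergeev_bracket_full m k a l a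
      rw [qe_eq_letter] at b1
      rw [qf_eq_letter] at b4
      rw [b1, b4, if_pos rfl, if_pos rfl, if_neg h.ne, if_pos h]
      simp only [map_add, map_sub, map_neg, hc_mul_letter _ h, map_smul]
      have hchi : letterChi (false, k, a) • hc n (sE m a l)
          = if (a : ℕ) + 1 = k then hc n (sE m a l) else 0 := by
        simp [letterChi]
      have hchi' : letterChi (true, k, a) = 0 := by simp [letterChi]
      rw [hchi, hchi', pow_succ]
      generalize (if (a : ℕ) + 1 = k then hc n (sE m a l) else 0) = Y
      split_ifs with hkl
      · generalize hc n (sE m k l) = Z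
        generalize hc n (sE m a a) = V
        generalize hc n (sF m a l) = V'
        -- The brackets of `e_{k,a}` and of `f_{k,a}` both produce the entry `(k, l)`, with opposite
        -- coefficients because `(-1)^m (-1)^(m+1) = -1`.
        linear_combination (norm := module) (-hs) • Z
      · generalize hc n (sE m k l) = Z
        generalize hc n (sF m a l) = V'
        rw [map_zero]
        linear_combination (norm := module) (-hs) • Z
    · rw [hc_letter_diag, hc_letter_diag, if_pos rfl, if_neg (by omega), if_neg (lt_irrefl _)]
      simp only [cLetter, if_true, Bool.false_eq_true, if_false, smul_zero, ite_self, pow_add,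
        smul_mul_assoc, smul_smul, add_zero, sub_zero]
    · rw [hc_letter_raising _ h, hc_letter_raising _ h, if_neg h.ne', if_neg h.not_gt,
        if_neg (by rw [Fin.lt_def] at h; omega)]
      simp
  have tF : ∀ a : Fin n, hc n (letter (false, k, a) * sF m a l)
      + (-1 : ℂ) ^ m • hc n (letter (true, k, a) * sE m a l)
      = (if a = k then cScal n (MvPolynomial.X k) * hc n (sF m k l)
          + (-1 : ℂ) ^ (m + k) • (cXi k * hc n (sE m k l)) else 0)
        + (if (a : ℕ) + 1 = k then hc n (sF m a l) else 0)
        - (if k = l then (1 + (-1 : ℂ) ^ m) • (if a < k then hc n (sF m a a) else 0) else 0) := by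
    intro a
    rcases lt_trichotomy a k with h | rfl | h
    · obtain ⟨b1, b2, b3, b4⟩ := sergeev_bracket_full m k a l a
      rw [qe_eq_letter] at b2
      rw [qf_eq_letter] at b3
      rw [b2, b3, if_pos rfl, if_pos rfl, if_neg h.ne, if_pos h]
      simp only [map_add, map_sub, hc_mul_letter _ h, map_smul]
      have hchi : letterChi (false, k, a) • hc n (sF m a l)
          = if (a : ℕ) + 1 = k then hc n (sF m a l) else 0 := by
        simp [letterChi]
      have hchi' : letterChi (true, k, a) = 0 := by simp [letterChi]
      rw [hchi, hchi', pow_succ]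
      generalize (if (a : ℕ) + 1 = k then hc n (sF m a l) else 0) = Y
      split_ifs with hkl
      · generalize hc n (sF m k l) = Z
        generalize hc n (sF m a a) = V
        generalize hc n (sE m a l) = V'
        linear_combination (norm := module) (-hs) • Z
      · generalize hc n (sF m k l) = Z
        generalize hc n (sE m a l) = V'
        rw [map_zero]
        linear_combination (norm := module) (-hs) • Z
    · rw [hc_letter_diag, hc_letter_diag, if_pos rfl, if_neg (by omega), if_neg (lt_irrefl _)]
      simp only [cLetter, if_true, Bool.false_eq_true, if_false, smul_zero, ite_self, pow_add,
        smul_mul_assoc, smul_smul, add_zero, sub_zero]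
    · rw [hc_letter_raising _ h, hc_letter_raising _ h, if_neg h.ne', if_neg h.not_gt,
        if_neg (by rw [Fin.lt_def] at h; omega)]
      simp
  have hite : ∀ (c : ℂ) (f : Fin n → Cliff n), ∑ a : Fin n, (if k = l then c • f a else 0)
      = if k = l then c • ∑ a, f a else 0 := by
    intro c f
    split_ifs
    · rw [Finset.smul_sum]
    · exact Finset.sum_const_zero
  constructor
  · rw [sE_succ, map_add, map_smul, map_sum, map_sum, Finset.smul_sum, ← Finset.sum_add_distrib]
    simp only [qe_eq_letter, qf_eq_letter]
    rw [Finset.sum_congr rfl fun a _ => tE a, Finset.sum_sub_distrib, Finset.sum_add_distrib,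
      Finset.sum_ite_eq' Finset.univ k, if_pos (Finset.mem_univ _), hite]
  · rw [sF_succ, map_add, map_smul, map_sum, map_sum, Finset.smul_sum, ← Finset.sum_add_distrib]
    simp only [qe_eq_letter, qf_eq_letter]
    rw [Finset.sum_congr rfl fun a _ => tF a, Finset.sum_sub_distrib, Finset.sum_add_distrib,
      Finset.sum_ite_eq' Finset.univ k, if_pos (Finset.mem_univ _), hite]

theorem hc_sergeev_upper {n : ℕ} (m : ℕ) : ∀ k l : Fin n, k < l →
    hc n (sE m k l) = 0 ∧ hc n (sF m k l) = 0 := by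
  induction m with
  | zero =>
    intro k l h
    have h1 : sE 0 k l = if k = l then 1 else 0 := rfl
    have h2 : sF 0 k l = 0 := rfl
    rw [h1, h2, if_neg h.ne, map_zero]
    exact ⟨rfl, rfl⟩
  | succ m ih =>
    intro k l h
    obtain ⟨h1, h2⟩ := hc_sergeev_succ m k l
    have h3 : ∀ a : Fin n, (a : ℕ) + 1 = k → a < l := fun a ha => by
      rw [Fin.lt_def] at h ⊢; omega
    rw [h1, h2, (ih k l h).1, (ih k l h).2, if_neg h.ne, if_neg h.ne]
    constructor
    · rw [Finset.sum_eq_zero fun a _ => ?_]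
      · simp
      · split_ifs with ha
        · exact (ih a l (h3 a ha)).1
        · rfl
    · rw [Finset.sum_eq_zero fun a _ => ?_]
      · simp
      · split_ifs with ha
        · exact (ih a l (h3 a ha)).2
        · rfl

/-- The Harish-Chandra images of the `e_{k,k}^{(2r)}`. -/
def hcG (n : ℕ) : ℕ → Fin n → MvPolynomial (Fin n) ℂ
  | 0, _ => 1
  | r + 1, k => (MvPolynomial.X k ^ 2 - MvPolynomial.X k) * hcG n r k
      - 2 * ∑ a : Fin n, if a < k then MvPolynomial.X a * hcG n r a else 0

theorem cScal_ite_sum {n : ℕ} (k : Fin n) (f : Fin n → MvPolynomial (Fin n) ℂ) :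
    ∑ a : Fin n, (if a < k then cScal n (f a) else 0)
      = cScal n (∑ a : Fin n, if a < k then f a else 0) := by
  rw [map_sum]
  refine Finset.sum_congr rfl fun a _ => ?_
  split_ifs
  · rfl
  · rw [map_zero]

/-- Upper triangularity removes the subdiagonal term. For even `m` the `e` recursion has no
correction, and for odd `m` the factor is `2`; two steps combine, using `ξ_k² = x_k`, into the
recursion of `hcG`. -/
theorem hc_sergeev_diag {n : ℕ} (r : ℕ) : ∀ k : Fin n,
    (hc n (sE (2 * r) k k) = cScal n (hcG n r k) ∧ hc n (sF (2 * r) k k) = 0) ∧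
    (hc n (sE (2 * r + 1) k k) = cScal n (MvPolynomial.X k * hcG n r k) ∧
      hc n (sF (2 * r + 1) k k) = (-1 : ℂ) ^ (k : ℕ) • (cXi k * cScal n (hcG n r k))) := by
  have hodd : ∀ r, (-1 : ℂ) ^ (2 * r) = 1 := fun r => by rw [pow_mul]; simp
  have hup : ∀ (m : ℕ) (k : Fin n), ∑ a : Fin n, (if (a : ℕ) + 1 = k then hc n (sE m a k) else 0) = 0
      ∧ ∑ a : Fin n, (if (a : ℕ) + 1 = k then hc n (sF m a k) else 0) = 0 := by
    intro m k
    constructor <;>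
    · refine Finset.sum_eq_zero fun a _ => ?_
      split_ifs with ha
      · have := hc_sergeev_upper m a k (by rw [Fin.lt_def]; omega)
        first | exact this.1 | exact this.2
      · rfl
  have step : ∀ r, (∀ k : Fin n, hc n (sE (2 * r) k k) = cScal n (hcG n r k)
      ∧ hc n (sF (2 * r) k k) = 0) → ∀ k : Fin n,
      hc n (sE (2 * r + 1) k k) = cScal n (MvPolynomial.X k * hcG n r k) ∧
      hc n (sF (2 * r + 1) k k) = (-1 : ℂ) ^ (k : ℕ) • (cXi k * cScal n (hcG n r k)) := by
    intro r h k
    obtain ⟨h1, h2⟩ := hc_sergeev_succ (2 * r) k k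
    have h3 : ∀ a : Fin n, hc n (sF (2 * r) a a) = 0 := fun a => (h a).2
    rw [h1, h2, (hup _ k).1, (hup _ k).2, (h k).1, (h k).2, if_pos rfl, if_pos rfl, pow_add, hodd]
    simp [h3]
  induction r with
  | zero =>
    intro k
    have h : ∀ k : Fin n, hc n (sE (2 * 0) k k) = cScal n (hcG n 0 k)
        ∧ hc n (sF (2 * 0) k k) = 0 := by
      intro k
      have h1 : sE (2 * 0) k k = if k = k then 1 else 0 := rfl
      have h2 : sF (2 * 0) k k = 0 := rfl
      rw [h1, h2, if_pos rfl, hc_one, map_zero, hcG, map_one]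
      exact ⟨rfl, rfl⟩
    exact ⟨h k, step 0 h k⟩
  | succ r ih =>
    have h : ∀ k : Fin n, hc n (sE (2 * (r + 1)) k k) = cScal n (hcG n (r + 1) k)
        ∧ hc n (sF (2 * (r + 1)) k k) = 0 := by
      intro k
      obtain ⟨h1, h2⟩ := hc_sergeev_succ (2 * r + 1) k k
      have h3 : ∀ a : Fin n, hc n (sE (2 * r + 1) a a) = cScal n (MvPolynomial.X a * hcG n r a) :=
        fun a => (ih a).2.1
      have h4 : (-1 : ℂ) ^ (2 * r + 1) = -1 := by rw [pow_succ, hodd, one_mul]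
      have h5 : (-1 : ℂ) ^ (2 * r + 1 + (k : ℕ)) * (-1) ^ (k : ℕ) = -1 := by
        rw [pow_add, h4, mul_assoc, neg_one_pow_mul_self, mul_one]
      have e : 2 * (r + 1) = 2 * r + 1 + 1 := by ring
      rw [e, h1, h2, (hup _ k).1, (hup _ k).2, if_pos rfl, if_pos rfl, (ih k).2.2]
      simp only [h3]
      rw [cScal_ite_sum, mul_smul_comm, smul_smul, h5, ← mul_assoc, cXi_mul_self, h4, hcG,
        ← map_mul, ← map_mul, mul_smul_comm, pow_add, h4]
      constructor
      · have h6 : ∀ p : MvPolynomial (Fin n) ℂ, (2 : MvPolynomial (Fin n) ℂ) * p = (2 : ℂ) • p := by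
          intro p; rw [two_mul, two_smul]
        rw [← map_smul, ← map_smul, h6, add_zero, ← map_add, ← map_sub]
        congr 1
        rw [sub_neg_eq_add, one_add_one_eq_two, neg_one_smul]
        ring
      · rw [← mul_assoc, cScal_comm (MvPolynomial.X k) (cXi k), mul_assoc, ← map_mul]
        generalize cXi k * cScal n (MvPolynomial.X k * hcG n r k) = Z
        have h0 : (1 : ℂ) + -1 = 0 := by norm_num
        rw [h0, neg_one_mul, zero_smul]
        module
    exact fun k => ⟨h k, step (r + 1) h k⟩

/-! ### Central elements of `U(Q(n))` -/

theorem hc_sum_sE {n : ℕ} (r : ℕ) : hc n (∑ k : Fin n, sE (2 * r + 1) k k)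
    = cScal n (∑ k : Fin n, MvPolynomial.X k * hcG n r k) := by
  rw [map_sum, map_sum]
  exact Finset.sum_congr rfl fun k _ => (hc_sergeev_diag r k).2.1

/-- After summation over the diagonal the two boundary terms of the bracket cancel. For odd letters
this needs the sign `(-1)^(m+1) = 1`, hence the odd upper index. -/
theorem sum_sE_letter_comm {n : ℕ} (r : ℕ) (x : Bool × Fin n × Fin n) :
    letter x * ∑ k : Fin n, sE (2 * r + 1) k k = (∑ k : Fin n, sE (2 * r + 1) k k) * letter x := by
  obtain ⟨b, i, j⟩ := x
  rw [Finset.mul_sum, Finset.sum_mul]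
  cases b
  · have h := fun k => (sergeev_bracket_full (2 * r + 1) i j k k).1
    simp only [qe_eq_letter] at h
    simp only [h, Finset.sum_add_distrib, Finset.sum_sub_distrib, Finset.sum_ite_eq,
      Finset.mem_univ, if_true]
    abel
  · have h := fun k => (sergeev_bracket_full (2 * r + 1) i j k k).2.2.1
    simp only [qf_eq_letter] at h
    have h4 : (-1 : ℂ) ^ (2 * r + 1 + 1) = 1 := by
      rw [show 2 * r + 1 + 1 = 2 * (r + 1) by ring, pow_mul]; simp
    simp only [h, Finset.sum_add_distrib, Finset.sum_sub_distrib, Finset.sum_ite_eq,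
      Finset.mem_univ, if_true, h4, one_smul]
    abel

theorem mem_center_of_letter {n : ℕ} {u : Env n} (h : ∀ x, letter x * u = u * letter x) :
    u ∈ Subalgebra.center ℂ (Env n) := by
  rw [Subalgebra.mem_center_iff]
  intro v
  have hv : v ∈ Algebra.adjoin ℂ (Set.range (letter (n := n))) := by
    rw [adjoin_letter_eq_top]; exact Algebra.mem_top
  induction hv using Algebra.adjoin_induction with
  | mem v hv =>
    obtain ⟨x, rfl⟩ := hv
    exact h x
  | algebraMap r => exact Algebra.commutes r u
  | add v w _ _ hv hw => rw [add_mul, mul_add, hv, hw]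
  | mul v w _ _ hv hw => rw [mul_assoc, hw, ← mul_assoc, hv, mul_assoc]

theorem sum_sE_mem_center {n : ℕ} (r : ℕ) :
    ∑ k : Fin n, sE (2 * r + 1) k k ∈ Subalgebra.center ℂ (Env n) :=
  mem_center_of_letter (sum_sE_letter_comm r)

/-- The Harish-Chandra images of the entries of the first column. -/
def hcCol (n : ℕ) : ℕ → Fin n → Cliff n × Cliff n
  | 0, _ => (1, 0)
  | s + 1, k => (∑ a : Fin n, if a ≤ k then cScal n (MvPolynomial.X a) * (hcCol n s a).1
        + (-1 : ℂ) ^ s • (cXi a * (hcCol n s a).2) else 0,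
      ∑ a : Fin n, if a ≤ k then cScal n (MvPolynomial.X a) * (hcCol n s a).2
        + (-1 : ℂ) ^ s • (cXi a * (hcCol n s a).1) else 0)

/-! ### Harish-Chandra images of the first column -/

theorem hc_sergeev_low {n : ℕ} [NeZero n] (m : ℕ) : ∀ k : Fin n, m ≤ k →
    hc n (sE m k (fstIdx n)) = (if m = k then 1 else 0) ∧ hc n (sF m k (fstIdx n)) = 0 := by
  induction m with
  | zero =>
    intro k _
    have h1 : sE 0 k (fstIdx n) = if k = fstIdx n then 1 else 0 := rfl
    have h2 : sF 0 k (fstIdx n) = 0 := rfl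
    have h3 : k = fstIdx n ↔ 0 = (k : ℕ) := by rw [Fin.ext_iff]; exact eq_comm
    rw [h1, h2, map_zero]
    refine ⟨?_, rfl⟩
    by_cases h : 0 = (k : ℕ)
    · rw [if_pos h, if_pos (h3.2 h), hc_one]
    · rw [if_neg h, if_neg fun h' => h (h3.1 h'), map_zero]
  | succ m ih =>
    intro k hk
    obtain ⟨h1, h2⟩ := hc_sergeev_succ m k (fstIdx n)
    have hne : k ≠ fstIdx n := by
      rintro rfl; simp [fstIdx] at hk
    obtain ⟨j, hj⟩ : ∃ j : Fin n, (j : ℕ) + 1 = k := ⟨⟨k - 1, by omega⟩, by simp; omega⟩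
    have hj' : ∀ a : Fin n, (a : ℕ) + 1 = k ↔ a = j := fun a => by rw [Fin.ext_iff]; omega
    rw [h1, h2, (ih k (by omega)).1, (ih k (by omega)).2, if_neg hne, if_neg hne]
    simp only [hj', Finset.sum_ite_eq', Finset.mem_univ, if_true]
    rw [(ih j (by omega)).1, (ih j (by omega)).2, if_neg (by omega : ¬ m = (k : ℕ))]
    constructor
    · by_cases h : m + 1 = (k : ℕ)
      · rw [if_pos h, if_pos (by omega)]; simp
      · rw [if_neg h, if_neg (by omega)]; simp
    · simp

/-- Unrolling the subdiagonal term of the recursion down the rows replaces it by a sum over `a ≤ k`.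
The signs of the recursion and of `cLetter` combine to `(-1)^(2k+s) = (-1)^s`. -/
theorem hc_sergeev_col {n : ℕ} [NeZero n] (s : ℕ) : ∀ k : Fin n,
    hc n (sE (k + s) k (fstIdx n)) = (hcCol n s k).1 ∧
    hc n (sF (k + s) k (fstIdx n)) = (hcCol n s k).2 := by
  induction s with
  | zero =>
    intro k
    have := hc_sergeev_low k k le_rfl
    rwa [if_pos rfl] at this
  | succ s ih =>
    have key : ∀ (N : ℕ) (k : Fin n), (k : ℕ) = N →
        hc n (sE (k + (s + 1)) k (fstIdx n)) = (hcCol n (s + 1) k).1 ∧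
        hc n (sF (k + (s + 1)) k (fstIdx n)) = (hcCol n (s + 1) k).2 := by
      intro N
      induction N with
      | zero =>
        intro k hk
        obtain ⟨h1, h2⟩ := hc_sergeev_succ (k + s) k (fstIdx n)
        have hlt : ∀ a : Fin n, ¬ a < k := fun a h => by rw [Fin.lt_def] at h; omega
        have hle : ∀ a : Fin n, a ≤ k ↔ a = k := fun a => by
          rw [Fin.le_def, Fin.ext_iff]; omega
        have hsum : ∀ a : Fin n, ¬ (a : ℕ) + 1 = k := fun a => by omega
        have hs : (-1 : ℂ) ^ ((k : ℕ) + s + k) = (-1) ^ s := by rw [hk]; simp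
        rw [← add_assoc, h1, h2, (ih k).1, (ih k).2, hcCol, hs]
        simp only [hlt, hle, hsum, if_false, Finset.sum_const_zero, smul_zero, ite_self,
          Finset.sum_ite_eq', Finset.mem_univ, if_true, add_zero, sub_zero, and_self]
      | succ N ihN =>
        intro k hk
        obtain ⟨h1, h2⟩ := hc_sergeev_succ (k + s) k (fstIdx n)
        have hne : k ≠ fstIdx n := by
          rintro rfl; simp [fstIdx] at hk
        obtain ⟨j, hj⟩ : ∃ j : Fin n, (j : ℕ) + 1 = k := ⟨⟨k - 1, by omega⟩, by simp; omega⟩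
        have hj' : ∀ a : Fin n, (a : ℕ) + 1 = k ↔ a = j := fun a => by rw [Fin.ext_iff]; omega
        have hs : (-1 : ℂ) ^ ((k : ℕ) + s + k) = (-1) ^ s := by
          rw [show (k : ℕ) + s + k = 2 * k + s by ring, pow_add, pow_mul]; simp
        have hle : ∀ (f : Fin n → Cliff n), ∑ a : Fin n, (if a ≤ k then f a else 0)
            = f k + ∑ a : Fin n, (if a ≤ j then f a else 0) := by
          intro f
          rw [← Finset.sum_ite_eq' Finset.univ k f |>.trans (if_pos (Finset.mem_univ _)),
            ← Finset.sum_add_distrib]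
          refine Finset.sum_congr rfl fun a _ => ?_
          rcases lt_trichotomy a k with h | rfl | h
          · rw [if_pos h.le, if_neg h.ne, if_pos (by rw [Fin.lt_def] at h; rw [Fin.le_def]; omega),
              zero_add]
          · rw [if_pos le_rfl, if_pos rfl, if_neg (by rw [Fin.le_def]; omega), add_zero]
          · rw [if_neg h.not_ge, if_neg h.ne', if_neg (by
              rw [Fin.lt_def] at h; rw [Fin.le_def]; omega), add_zero]
        have hjs : (k : ℕ) + s = j + (s + 1) := by omega
        obtain ⟨i1, i2⟩ := ihN j (by omega)
        rw [← add_assoc, h1, h2, (ih k).1, (ih k).2, if_neg hne, if_neg hne, hs, hcCol]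
        simp only [hj', Finset.sum_ite_eq', Finset.mem_univ, if_true, sub_zero]
        rw [hjs, i1, i2, hle, hle]
        exact ⟨rfl, rfl⟩
    exact fun k => key k k rfl

theorem hcW_wGen {n : ℕ} [NeZero n] (b : Bool) (s : ℕ) : hcW n (wGen b s)
    = if b then (hcCol n s (lastIdx n)).2 else (hcCol n s (lastIdx n)).1 := by
  have h1 := toWhit_wLetter (n := n) (b, n - 1 + s)
  rw [← proj_eq] at h1
  rw [wGen, hcW_eq h1]
  have := hc_sergeev_col (n := n) s (lastIdx n)
  cases b
  · exact this.1
  · exact this.2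

section

/-! ### Power series and symmetric functions -/

section PowerSeries

open PowerSeries

variable {R : Type*} [CommRing R]

/-- The geometric series `1 / (1 - a X)`. -/
def geomSeries (a : R) : R⟦X⟧ := PowerSeries.mk fun j => a ^ j

theorem geomSeries_mul (a : R) : (1 - C a * X) * geomSeries a = 1 := by
  ext j
  rw [sub_mul, one_mul, map_sub, mul_assoc, coeff_C_mul]
  rcases j with _ | j
  · simp [geomSeries]
  · simp [geomSeries, coeff_succ_X_mul, coeff_one, pow_succ']

theorem derivative_geomSeries (a : R) :
    derivative R (geomSeries a) = C a * geomSeries a * geomSeries a := by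
  have h := congrArg (derivative R) (geomSeries_mul a)
  have h0 : derivative R (1 - C a * X) = - C a := by
    rw [map_sub, Derivation.leibniz, derivative_X, derivative_C]
    simp
  rw [Derivation.leibniz, h0, Derivation.map_one_eq_zero, smul_eq_mul, smul_eq_mul] at h
  linear_combination geomSeries a * h - derivative R (geomSeries a) * geomSeries_mul a

theorem sum_lt_succ {M : Type*} [AddCommMonoid M] {n : ℕ} (f : Fin n → M) (j : Fin n) :
    ∑ i : Fin n, (if (i : ℕ) < (j : ℕ) + 1 then f i else 0)
      = (∑ i : Fin n, if (i : ℕ) < j then f i else 0) + f j := by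
  rw [← Finset.sum_ite_eq' Finset.univ j f |>.trans (if_pos (Finset.mem_univ _)),
    ← Finset.sum_add_distrib]
  refine Finset.sum_congr rfl fun a _ => ?_
  rcases lt_trichotomy (a : ℕ) j with h | h | h
  · rw [if_pos (by omega), if_pos h, if_neg (fun h' => by rw [h'] at h; omega), add_zero]
  · rw [if_pos (by omega), if_neg (by omega), if_pos (Fin.ext h), zero_add]
  · rw [if_neg (by omega), if_neg (by omega), if_neg (fun h' => by rw [h'] at h; omega), add_zero]

theorem prod_lt_succ {M : Type*} [CommMonoid M] {n : ℕ} (f : Fin n → M) (j : Fin n) :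
    ∏ i : Fin n, (if (i : ℕ) < (j : ℕ) + 1 then f i else 1)
      = (∏ i : Fin n, if (i : ℕ) < j then f i else 1) * f j := by
  rw [← Finset.prod_ite_eq' Finset.univ j f |>.trans (if_pos (Finset.mem_univ _)),
    ← Finset.prod_mul_distrib]
  refine Finset.prod_congr rfl fun a _ => ?_
  rcases lt_trichotomy (a : ℕ) j with h | h | h
  · rw [if_pos (by omega), if_pos h, if_neg (fun h' => by rw [h'] at h; omega), mul_one]
  · rw [if_pos (by omega), if_neg (by omega), if_pos (Fin.ext h), one_mul]
  · rw [if_neg (by omega), if_neg (by omega), if_neg (fun h' => by rw [h'] at h; omega), mul_one]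

/-- The series `∏ (1 - y_k X) / (1 - w_k X)`. -/
def ratioSeries {n : ℕ} (w y : Fin n → R) : R⟦X⟧ :=
  ∏ k, (1 - C (y k) * X) * geomSeries (w k)

theorem eq_mul_ratioSeries {n : ℕ} {w y : Fin n → R} {V : ℕ → R⟦X⟧}
    (hV : ∀ k : Fin n, V (k + 1) * (1 - C (w k) * X) = V k * (1 - C (y k) * X)) :
    V n = V 0 * ratioSeries w y := by
  have key : ∀ m, m ≤ n → V m * (∏ k : Fin n, if (k : ℕ) < m then 1 - C (w k) * X else 1)
      = V 0 * (∏ k : Fin n, if (k : ℕ) < m then 1 - C (y k) * X else 1) := by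
    intro m
    induction m with
    | zero => intro _; simp
    | succ m ih =>
      intro hm
      have h1 := prod_lt_succ (fun k => 1 - C (w k) * X) (⟨m, hm⟩ : Fin n)
      have h2 := prod_lt_succ (fun k => 1 - C (y k) * X) (⟨m, hm⟩ : Fin n)
      have h3 := hV ⟨m, hm⟩
      dsimp only at h1 h2 h3
      rw [h1, h2, ← mul_assoc (V 0), ← ih (by omega)]
      linear_combination (∏ k : Fin n, if (k : ℕ) < m then 1 - C (w k) * X else 1) * h3
  have h := key n le_rfl
  simp only [Fin.is_lt, if_true] at h
  have h1 : (∏ k : Fin n, (1 - C (w k) * X)) * ∏ k : Fin n, geomSeries (w k) = 1 := by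
    rw [← Finset.prod_mul_distrib]
    exact Finset.prod_eq_one fun k _ => geomSeries_mul _
  rw [ratioSeries, Finset.prod_mul_distrib, ← mul_assoc, ← h, mul_assoc, h1, mul_one]

theorem coeff_zero_ratioSeries {n : ℕ} (w y : Fin n → R) : coeff 0 (ratioSeries w y) = 1 := by
  rw [coeff_zero_eq_constantCoeff_apply, ratioSeries, map_prod]
  refine Finset.prod_eq_one fun k _ => ?_
  rw [map_mul, map_sub, map_one, map_mul, constantCoeff_X, mul_zero, sub_zero, one_mul,
    ← coeff_zero_eq_constantCoeff_apply, geomSeries, coeff_mk, pow_zero]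

/-- The logarithmic derivative of `ratioSeries`. -/
def logSeries {n : ℕ} (w y : Fin n → R) : R⟦X⟧ :=
  PowerSeries.mk fun j => ∑ k, (w k ^ (j + 1) - y k ^ (j + 1))

theorem derivative_ratioSeries {n : ℕ} (w y : Fin n → R) :
    derivative R (ratioSeries w y) = ratioSeries w y * logSeries w y := by
  have h0 : logSeries w y = ∑ k, (C (w k) * geomSeries (w k) - C (y k) * geomSeries (y k)) := by
    ext j
    simp [logSeries, geomSeries, pow_succ']
  rw [h0, ratioSeries]
  have key : ∀ s : Finset (Fin n),
      derivative R (∏ k ∈ s, (1 - C (y k) * X) * geomSeries (w k))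
      = (∏ k ∈ s, (1 - C (y k) * X) * geomSeries (w k))
        * ∑ k ∈ s, (C (w k) * geomSeries (w k) - C (y k) * geomSeries (y k)) := by
    intro s
    induction s using Finset.induction_on with
    | empty => simp
    | insert a s ha ih =>
      rw [Finset.prod_insert ha, Finset.sum_insert ha, Derivation.leibniz, ih, Derivation.leibniz,
        derivative_geomSeries]
      have h1 : derivative R (1 - C (y a) * X) = - C (y a) := by
        rw [map_sub, Derivation.leibniz, derivative_X, derivative_C]
        simp
      rw [h1]
      simp only [smul_eq_mul]
      linear_combination (C (y a) * geomSeries (w a)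
        * (∏ k ∈ s, (1 - C (y k) * X) * geomSeries (w k))) * geomSeries_mul (y a)
  exact key Finset.univ

/-- The sign of `i - j`. -/
def ordSign {n : ℕ} (R : Type*) [CommRing R] (i j : Fin n) : R :=
  if j < i then 1 else if i < j then -1 else 0

theorem ordSign_antisymm {n : ℕ} (i j : Fin n) : ordSign R i j = - ordSign R j i := by
  rcases lt_trichotomy i j with h | rfl | h
  · simp [ordSign, h, h.not_gt]
  · simp [ordSign]
  · simp [ordSign, h, h.not_gt]

/-- The coefficients of `Φ_k` with respect to the Clifford generators. -/
def phiSeq {n : ℕ} (x : Fin n → R) : ℕ → Fin n → R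
  | 0, _ => 1
  | k + 1, j => ∑ i, ordSign R i j * (x i * phiSeq x k i)

/-- The bilinear form `∑ x_i v_i w_i`. -/
def phiForm {n : ℕ} (x v w : Fin n → R) : R := ∑ i, x i * v i * w i

theorem phiForm_symm {n : ℕ} (x v w : Fin n → R) : phiForm x v w = phiForm x w v :=
  Finset.sum_congr rfl fun i _ => by ring

/-- The step `φ_k ↦ φ_{k+1}` is skew-adjoint for this form because `sgn(i - j)` is antisymmetric. -/
theorem phiForm_step {n : ℕ} (x : Fin n → R) (m p : ℕ) :
    phiForm x (phiSeq x (m + 1)) (phiSeq x p) = - phiForm x (phiSeq x m) (phiSeq x (p + 1)) := by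
  simp only [phiForm, phiSeq, Finset.mul_sum, Finset.sum_mul]
  rw [Finset.sum_comm, ← Finset.sum_neg_distrib]
  refine Finset.sum_congr rfl fun i _ => ?_
  rw [← Finset.sum_neg_distrib]
  refine Finset.sum_congr rfl fun j _ => ?_
  rw [ordSign_antisymm i j]
  ring

theorem phiForm_eq {n : ℕ} (x : Fin n → R) (m p : ℕ) :
    phiForm x (phiSeq x m) (phiSeq x p) = (-1) ^ m * phiForm x (phiSeq x 0) (phiSeq x (m + p)) := by
  induction m generalizing p with
  | zero => simp
  | succ m ih => rw [phiForm_step, ih, pow_succ, ← add_assoc, add_right_comm]; ring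

theorem phiForm_zero {n : ℕ} (x v : Fin n → R) : phiForm x (phiSeq x 0) v = ∑ i, x i * v i :=
  Finset.sum_congr rfl fun i _ => by rw [phiSeq, mul_one]

theorem sum_ordSign {n : ℕ} {S : Type*} [CommRing S] (f : Fin n → S) (j : Fin n) :
    ∑ i, ordSign S i j * f i = ∑ i, f i - (∑ i : Fin n, if (i : ℕ) < j then f i else 0)
      - ∑ i : Fin n, if (i : ℕ) < (j : ℕ) + 1 then f i else 0 := by
  rw [← Finset.sum_sub_distrib, ← Finset.sum_sub_distrib]
  refine Finset.sum_congr rfl fun i _ => ?_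
  rcases lt_trichotomy i j with h | rfl | h
  · rw [ordSign, if_neg h.not_gt, if_pos h, if_pos (by rw [Fin.lt_def] at h; omega),
      if_pos (by rw [Fin.lt_def] at h; omega)]
    ring
  · simp [ordSign]
  · rw [ordSign, if_pos h, if_neg (by rw [Fin.lt_def] at h; omega),
      if_neg (by rw [Fin.lt_def] at h; omega)]
    ring

/-- The generating function of the `∑ x_i φ_i`. -/
def phiSum {n : ℕ} (x : Fin n → R) : R⟦X⟧ := PowerSeries.mk fun k => ∑ i, x i * phiSeq x k i

/-- With partial sums `P_j` of `∑ x_i φ_i(X)` and total `S`, the recursion reads `φ_j = 1 + X (S -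
P_j - P_{j+1})`. Hence `V_m = 1 + X (S - 2 P_m)` satisfies `V_{j+1} (1 + x_j X) = V_j (1 - x_j X)`
and telescopes from `1 + X S` to `1 - X S`. -/
theorem phiSum_ratio {n : ℕ} (x : Fin n → R) :
    1 - X * phiSum x = (1 + X * phiSum x) * ratioSeries (fun i => - x i) x := by
  let φ : Fin n → R⟦X⟧ := fun i => PowerSeries.mk fun k => phiSeq x k i
  let P : ℕ → R⟦X⟧ := fun m => ∑ i : Fin n, if (i : ℕ) < m then C (x i) * φ i else 0
  have hS : phiSum x = ∑ i, C (x i) * φ i := by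
    ext k
    simp [phiSum, φ]
  have hP : ∀ j : Fin n, P (j + 1) = P j + C (x j) * φ j := fun j => sum_lt_succ _ j
  have hφ : ∀ j, φ j = 1 + X * (phiSum x - P j - P (j + 1)) := by
    intro j
    rw [hS, ← sum_ordSign (fun i => C (x i) * φ i)]
    ext k
    rcases k with _ | k
    · simp [φ, phiSeq]
    · rw [map_add, coeff_one, if_neg (Nat.succ_ne_zero k), zero_add, coeff_succ_X_mul, map_sum,
        coeff_mk, phiSeq]
      refine Finset.sum_congr rfl fun i _ => ?_
      have h : ordSign R⟦X⟧ i j = C (ordSign R i j) := by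
        rw [ordSign, ordSign]
        split_ifs <;> simp
      rw [h, coeff_C_mul, coeff_C_mul, coeff_mk]
  have h := eq_mul_ratioSeries (w := fun i => - x i) (y := x)
    (V := fun m => 1 + X * (phiSum x - 2 * P m)) (fun j => by
      have h1 := hφ j
      rw [hP] at h1
      rw [hP, map_neg]
      linear_combination (-2 * X * C (x j)) * h1)
  have h0 : P 0 = 0 := by simp [P]
  have hn : P n = phiSum x := by simp [P, hS]
  rw [h0, hn] at h
  linear_combination h

theorem ratioSeries_mul {n : ℕ} (w y : Fin n → R) :
    ratioSeries w y * ∏ k, (1 - C (w k) * X) = ∏ k, (1 - C (y k) * X) := by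
  rw [ratioSeries, ← Finset.prod_mul_distrib]
  refine Finset.prod_congr rfl fun k _ => ?_
  linear_combination (1 - C (y k) * X) * geomSeries_mul (w k)

theorem phiSum_prod {n : ℕ} (x : Fin n → R) :
    (1 - X * phiSum x) * ∏ k, (1 + C (x k) * X) = (1 + X * phiSum x) * ∏ k, (1 - C (x k) * X) := by
  have h := ratioSeries_mul (fun i => - x i) x
  simp only [map_neg, neg_mul, sub_neg_eq_add] at h
  rw [phiSum_ratio, mul_assoc, h]

variable [Algebra ℂ R]

/-- The power series with coefficients in a subalgebra. -/
def coeffSubring (A : Subalgebra ℂ R) : Subring R⟦X⟧ where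
  carrier := {F | ∀ j, coeff j F ∈ A}
  mul_mem' := fun {F G} hF hG j => by
    rw [coeff_mul]
    exact sum_mem fun p _ => mul_mem (hF _) (hG _)
  one_mem' := fun j => by
    rw [coeff_one]
    split_ifs
    · exact one_mem _
    · exact zero_mem _
  add_mem' := fun {F G} hF hG j => by rw [map_add]; exact add_mem (hF j) (hG j)
  zero_mem' := fun j => by rw [map_zero]; exact zero_mem _
  neg_mem' := fun {F} hF j => by rw [map_neg]; exact neg_mem (hF j)

theorem mem_coeffSubring_of_mul {A : Subalgebra ℂ R} {H G : R⟦X⟧} {c : ℂ} (hc : c ≠ 0)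
    (hG0 : coeff 0 G = algebraMap ℂ R c) (hG : G ∈ coeffSubring A)
    (hHG : H * G ∈ coeffSubring A) : H ∈ coeffSubring A := by
  intro j
  induction j using Nat.strong_induction_on with
  | _ j ih =>
    have h := hHG j
    rw [coeff_mul, Finset.Nat.sum_antidiagonal_eq_sum_range_succ_mk, Finset.sum_range_succ,
      Nat.sub_self, hG0] at h
    have h1 : ∑ k ∈ Finset.range j, coeff k H * coeff (j - k) G ∈ A :=
      sum_mem fun k hk => mul_mem (ih k (Finset.mem_range.1 hk)) (hG _)
    have h2 := sub_mem h h1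
    rw [add_sub_cancel_left] at h2
    have h3 := A.smul_mem h2 c⁻¹
    rwa [mul_comm, ← Algebra.smul_def, smul_smul, inv_mul_cancel₀ hc, one_smul] at h3

/-- The equation `F' = F D` determines the coefficients of `F` recursively, with division by
positive integers only. -/
theorem mem_coeffSubring_of_derivative {A : Subalgebra ℂ R} {F D : R⟦X⟧}
    (hF : derivative R F = F * D) (hF0 : coeff 0 F = 1) (hD : D ∈ coeffSubring A) :
    F ∈ coeffSubring A := by
  intro j
  induction j using Nat.strong_induction_on with
  | _ j ih =>
    rcases j with _ | j
    · rw [hF0]; exact one_mem _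
    · have h := congrArg (coeff j) hF
      rw [coeff_derivative, coeff_mul] at h
      have h1 : coeff (j + 1) F * ((j : R) + 1) ∈ A := by
        rw [h]
        refine sum_mem fun p hp => mul_mem (ih _ ?_) (hD _)
        have := Finset.HasAntidiagonal.mem_antidiagonal.1 hp
        omega
      have h2 := A.smul_mem h1 ((j + 1 : ℂ)⁻¹)
      have h3 : ((j : R) + 1) = algebraMap ℂ R (j + 1) := by simp
      rwa [h3, mul_comm, ← Algebra.smul_def, smul_smul,
        inv_mul_cancel₀ (Nat.cast_add_one_ne_zero j), one_smul] at h2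

theorem derivative_mem_coeffSubring {A : Subalgebra ℂ R} {F : R⟦X⟧} (hF : F ∈ coeffSubring A) :
    derivative R F ∈ coeffSubring A := by
  intro j
  rw [coeff_derivative]
  have h3 : ((j : R) + 1) = algebraMap ℂ R (j + 1) := by simp
  rw [h3]
  exact mul_mem (hF _) (A.algebraMap_mem _)

/-- The difference `(x² - x)^(r+1) - (x² + x)^(r+1)` contains only odd powers of `x`, with leading
term `-2 (r + 1) x^(2r+1)`. The given sums are therefore triangular in the odd power sums. -/
theorem odd_psum_mem {A : Subalgebra ℂ R} {n : ℕ} (x : Fin n → R)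
    (h : ∀ j : ℕ, ∑ k, ((x k ^ 2 - x k) ^ (j + 1) - (x k ^ 2 + x k) ^ (j + 1)) ∈ A) (r : ℕ) :
    ∑ k, x k ^ (2 * r + 1) ∈ A := by
  induction r using Nat.strong_induction_on with
  | _ r ih =>
    have e : ∀ y : R, (y ^ 2 - y) ^ (r + 1) - (y ^ 2 + y) ^ (r + 1)
        = ∑ t ∈ Finset.range (r + 1 + 1),
          (((-1) ^ (r + 1 - t) - 1 : ℂ) * ((r + 1).choose t : ℂ)) • y ^ (r + 1 + t) := by
      intro y
      rw [sub_eq_add_neg (y ^ 2), show y ^ 2 + -y = y * (y + (-1)) by ring,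
        show y ^ 2 + y = y * (y + 1) by ring, mul_pow, mul_pow, add_pow, add_pow, ← mul_sub,
        ← Finset.sum_sub_distrib, Finset.mul_sum]
      refine Finset.sum_congr rfl fun t _ => ?_
      rw [Algebra.smul_def, map_mul, map_sub, map_pow, map_neg, map_one, map_natCast]
      ring
    have h1 := h r
    simp only [e] at h1
    rw [Finset.sum_comm, Finset.sum_range_succ, Finset.sum_range_succ] at h1
    simp only [Nat.sub_self, pow_zero, sub_self, zero_mul, zero_smul, Finset.sum_const_zero,
      add_zero, add_tsub_cancel_left, pow_one, ← Finset.smul_sum] at h1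
    have h2 : ∑ t ∈ Finset.range r, (((-1) ^ (r + 1 - t) - 1 : ℂ) * ((r + 1).choose t : ℂ))
        • ∑ k, x k ^ (r + 1 + t) ∈ A := by
      refine sum_mem fun t ht => ?_
      rw [Finset.mem_range] at ht
      rcases Nat.even_or_odd (r + 1 - t) with hev | hodd
      · rw [hev.neg_one_pow, sub_self, zero_mul, zero_smul]
        exact zero_mem _
      · obtain ⟨q, hq⟩ := hodd
        refine A.smul_mem ?_ _
        have := ih (t + q) (by omega)
        rwa [show 2 * (t + q) + 1 = r + 1 + t by omega] at this
    have h3 := sub_mem h1 h2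
    rw [add_sub_cancel_left, show r + 1 + r = 2 * r + 1 by ring] at h3
    have hc : (((-1 : ℂ) - 1) * ((r + 1).choose r : ℂ)) ≠ 0 := by
      rw [Nat.choose_succ_self_right]
      refine mul_ne_zero (by norm_num) ?_
      exact_mod_cast Nat.succ_ne_zero r
    have h4 := A.smul_mem h3 (((-1 : ℂ) - 1) * ((r + 1).choose r : ℂ))⁻¹
    rwa [smul_smul, inv_mul_cancel₀ hc, one_smul] at h4

/-- The generating function of the partial sums of the Harish-Chandra images of the central
elements gives the odd power sums. -/
theorem odd_psum_mem_of_recursion {A : Subalgebra ℂ R} {n : ℕ} (x : Fin n → R) (G : ℕ → Fin n → R)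
    (h0 : ∀ k, G 0 k = 1)
    (hG : ∀ r k, G (r + 1) k = (x k ^ 2 - x k) * G r k
      - 2 * ∑ a : Fin n, if a < k then x a * G r a else 0)
    (hA : ∀ r, ∑ k, x k * G r k ∈ A) (r : ℕ) : ∑ k, x k ^ (2 * r + 1) ∈ A := by
  let T : ℕ → R⟦X⟧ := fun m => PowerSeries.mk fun r =>
    ∑ a : Fin n, if (a : ℕ) < m then x a * G r a else 0
  let V : ℕ → R⟦X⟧ := fun m => 1 - 2 * (X * T m)
  have hT : ∀ k : Fin n, T (k + 1) = T k + C (x k) * PowerSeries.mk fun r => G r k := by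
    intro k
    ext r
    rw [map_add, coeff_C_mul, coeff_mk, coeff_mk, coeff_mk]
    exact sum_lt_succ (fun a => x a * G r a) k
  have hGk : ∀ k : Fin n, (PowerSeries.mk fun r => G r k)
      = 1 + X * (C (x k ^ 2 - x k) * (PowerSeries.mk fun r => G r k) - 2 * T k) := by
    intro k
    ext r
    rcases r with _ | r
    · simp [h0]
    · rw [coeff_mk, hG, map_add, coeff_one, if_neg (Nat.succ_ne_zero r), zero_add,
        coeff_succ_X_mul, map_sub, coeff_C_mul, coeff_mk, two_mul, two_mul, map_add, coeff_mk]
      rfl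
  have hV : ∀ k : Fin n, V (k + 1) * (1 - C (x k ^ 2 - x k) * X)
      = V k * (1 - C (x k ^ 2 + x k) * X) := by
    intro k
    have h1 := hGk k
    have h2 : C (x k ^ 2 + x k) = C (x k ^ 2 - x k) + 2 * C (x k) := by
      rw [two_mul, ← map_add, ← map_add]
      congr 1
      ring
    change (1 - 2 * (X * T (k + 1))) * _ = (1 - 2 * (X * T k)) * _
    rw [hT, h2]
    linear_combination (-2 * X * C (x k)) * h1
  -- The series `1 - 2 X ∑ x_k G_k(X)` is the product of the `(1 - (x_k² + x_k) X) / (1 - (x_k² -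
  -- x_k) X)`. Its logarithmic derivative has the sums of `odd_psum_mem` as coefficients.
  have hF := eq_mul_ratioSeries (n := n) hV
  have hV0 : V 0 = 1 := by
    have : T 0 = 0 := by ext r; simp [T]
    change 1 - 2 * (X * T 0) = 1
    rw [this]; ring
  rw [hV0, one_mul] at hF
  have hVn : V n ∈ coeffSubring A := by
    have hTn : T n ∈ coeffSubring A := by
      intro r
      simp only [T, coeff_mk, Fin.is_lt, if_true]
      exact hA r
    have hX : (X : R⟦X⟧) ∈ coeffSubring A := by
      intro j
      rw [coeff_X]
      split_ifs
      · exact one_mem _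
      · exact zero_mem _
    change 1 - 2 * (X * T n) ∈ coeffSubring A
    rw [two_mul]
    exact sub_mem (one_mem _) (add_mem (mul_mem hX hTn) (mul_mem hX hTn))
  rw [hF] at hVn
  have hD : logSeries (fun k => x k ^ 2 - x k) (fun k => x k ^ 2 + x k) ∈ coeffSubring A := by
    refine mem_coeffSubring_of_mul (c := 1) one_ne_zero
      (by rw [map_one]; exact coeff_zero_ratioSeries _ _) hVn ?_
    rw [mul_comm, ← derivative_ratioSeries]
    exact derivative_mem_coeffSubring hVn
  refine odd_psum_mem x (fun j => ?_) r
  have := hD j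
  rwa [logSeries, coeff_mk] at this

/-- By symmetry and skew-adjointness the form equals `(-1)^N` times itself. -/
theorem phiForm_odd {n : ℕ} (x : Fin n → R) {N : ℕ} (hN : Odd N) :
    phiForm x (phiSeq x 0) (phiSeq x N) = 0 := by
  have h := phiForm_eq x N 0
  rw [phiForm_symm, hN.neg_one_pow, add_zero, neg_one_mul, eq_neg_iff_add_eq_zero, ← two_smul ℂ]
    at h
  have h2 := congrArg ((2 : ℂ)⁻¹ • ·) h
  simpa [smul_smul] using h2

/-- Even power sums cancel in the logarithmic derivative of `F = ∏ (1 - x_i X) / (1 + x_i X)`, so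
`F` has coefficients in `A`. The generating function is then recovered from `X S (1 + F) = 1 - F`,
where `1 + F` has constant term `2`. -/
theorem phiSum_mem {A : Subalgebra ℂ R} {n : ℕ} (x : Fin n → R)
    (h : ∀ r : ℕ, ∑ k, x k ^ (2 * r + 1) ∈ A) (k : ℕ) : ∑ i, x i * phiSeq x k i ∈ A := by
  have hD : logSeries (fun i => - x i) x ∈ coeffSubring A := by
    intro j
    rw [logSeries, coeff_mk]
    rcases Nat.even_or_odd (j + 1) with hj | hj
    · simp only [hj.neg_pow, sub_self, Finset.sum_const_zero]
      exact zero_mem _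
    · obtain ⟨r, hr⟩ := hj
      simp only [Odd.neg_pow ⟨r, hr⟩]
      rw [Finset.sum_sub_distrib, Finset.sum_neg_distrib, hr]
      exact sub_mem (neg_mem (h r)) (h r)
  have hF := mem_coeffSubring_of_derivative (derivative_ratioSeries _ _)
    (coeff_zero_ratioSeries (fun i => - x i) x) hD
  have h1 : phiSum x * (1 + ratioSeries (fun i => - x i) x) ∈ coeffSubring A := by
    intro j
    have h2 := phiSum_ratio x
    have h3 : X * (phiSum x * (1 + ratioSeries (fun i => - x i) x))
        = 1 - ratioSeries (fun i => - x i) x := by linear_combination -h2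
    have h4 := (sub_mem (one_mem _) hF : 1 - ratioSeries (fun i => - x i) x ∈ coeffSubring A) (j + 1)
    rwa [← h3, coeff_succ_X_mul] at h4
  have h2 := mem_coeffSubring_of_mul (c := 2) two_ne_zero (by
    rw [map_add, coeff_zero_ratioSeries, coeff_one, if_pos rfl, map_ofNat]
    norm_num) (add_mem (one_mem _) hF) h1 k
  rwa [phiSum, coeff_mk] at h2

end PowerSeries

end

section

/-! ### Algebraic independence of the leading terms -/

section Leading

open PowerSeries

variable {R : Type*} [CommRing R]

/-- The complete symmetric functions `h_s(x_0, …, x_k)`. -/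
def hSeq {n : ℕ} (x : Fin n → R) : ℕ → Fin n → R
  | 0, _ => 1
  | s + 1, k => ∑ a, if a ≤ k then x a * hSeq x s a else 0

/-- The recursion over `a ≤ k` telescopes to `∏ 1 / (1 - x_k X)`, identifying `hSeq` in the last row
with the complete symmetric functions. -/
theorem hSeq_series {n : ℕ} [NeZero n] (x : Fin n → R) :
    (PowerSeries.mk fun s => hSeq x s (lastIdx n)) * ∏ k, (1 - C (x k) * X) = 1 := by
  let H : Fin n → R⟦X⟧ := fun k => PowerSeries.mk fun s => hSeq x s k
  let V : ℕ → R⟦X⟧ := fun m => 1 + X * ∑ a : Fin n, if (a : ℕ) < m then C (x a) * H a else 0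
  have hH : ∀ k : Fin n, H k = V (k + 1) := by
    intro k
    ext s
    rcases s with _ | s
    · simp [H, V, hSeq]
    · rw [coeff_mk, hSeq, map_add, coeff_one, if_neg (Nat.succ_ne_zero s), zero_add,
        coeff_succ_X_mul, map_sum]
      refine Finset.sum_congr rfl fun a _ => ?_
      by_cases h : a ≤ k
      · rw [if_pos h, if_pos (by rw [Fin.le_def] at h; omega), coeff_C_mul, coeff_mk]
      · rw [if_neg h, if_neg (by rw [Fin.le_def] at h; omega), map_zero]
  have hV : ∀ k : Fin n, V (k + 1) * (1 - C (x k) * X) = V k * (1 - C ((0 : Fin n → R) k) * X) := by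
    intro k
    have h1 : V (k + 1) = V k + X * (C (x k) * H k) := by
      change 1 + X * (∑ a : Fin n, if (a : ℕ) < (k : ℕ) + 1 then C (x a) * H a else 0)
        = 1 + X * (∑ a : Fin n, if (a : ℕ) < k then C (x a) * H a else 0) + X * (C (x k) * H k)
      rw [sum_lt_succ (fun a => C (x a) * H a) k, mul_add, add_assoc]
    rw [hH] at h1
    rw [Pi.zero_apply, map_zero]
    linear_combination h1
  have h1 := eq_mul_ratioSeries hV
  have h2 : V 0 = 1 := by simp [V]
  have h3 := ratioSeries_mul x 0
  simp only [Pi.zero_apply, map_zero, zero_mul, sub_zero, Finset.prod_const_one] at h3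
  have h4 : H (lastIdx n) = V n := by
    rw [hH]
    congr 1
    change n - 1 + 1 = n
    have := NeZero.pos n
    omega
  change H (lastIdx n) * _ = 1
  rw [h4, h1, h2, one_mul, h3]

theorem coeff_prod_neg {n : ℕ} (x : Fin n → R) (m : ℕ) :
    coeff m (∏ k, (1 - C (x k) * X)) = (-1) ^ m * coeff m (∏ k, (1 + C (x k) * X)) := by
  have key : ∀ (y : Fin n → R) (m : ℕ), coeff m (∏ k, (1 + C (y k) * X))
      = ∑ t ∈ Finset.univ.powerset, if t.card = m then ∏ i ∈ t, y i else 0 := by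
    intro y m
    rw [Finset.prod_one_add, map_sum]
    refine Finset.sum_congr rfl fun t _ => ?_
    rw [Finset.prod_mul_distrib, Finset.prod_const, ← map_prod, coeff_C_mul, coeff_X_pow]
    simp only [eq_comm (a := m), mul_ite, mul_one, mul_zero]
  have h := key (fun k => - x k) m
  simp only [map_neg, neg_mul, ← sub_eq_add_neg] at h
  rw [h, key, Finset.mul_sum]
  refine Finset.sum_congr rfl fun t _ => ?_
  split_ifs with ht
  · rw [Finset.prod_neg, ht]
  · rw [mul_zero]

theorem coeff_prod_eq_esymm {n : ℕ} (m : ℕ) :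
    coeff m (∏ k, (1 + C (MvPolynomial.X k : MvPolynomial (Fin n) ℂ) * X))
      = MvPolynomial.esymm (Fin n) ℂ m := by
  rw [Finset.prod_one_add, map_sum, MvPolynomial.esymm, Finset.powersetCard_eq_filter,
    Finset.sum_filter]
  refine Finset.sum_congr rfl fun t _ => ?_
  rw [Finset.prod_mul_distrib, Finset.prod_const, ← map_prod, coeff_C_mul, coeff_X_pow]
  simp only [eq_comm (a := m), mul_ite, mul_one, mul_zero]

variable [Algebra ℂ R]

/-- The elementary symmetric functions are obtained from the `∑ x_i φ_i` and the complete symmetric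
functions of even degree. -/
theorem esymm_mem {n : ℕ} [NeZero n] {B : Subalgebra ℂ R} (x : Fin n → R)
    (hS : ∀ k, Even k → k < n → ∑ i, x i * phiSeq x k i ∈ B)
    (hH : ∀ k, Even k → k ≤ n → hSeq x k (lastIdx n) ∈ B) (m : ℕ) (hm : m ≤ n) :
    coeff m (∏ k, (1 + C (x k) * X)) ∈ B ∧ hSeq x m (lastIdx n) ∈ B := by
  induction m using Nat.strong_induction_on with
  | _ m ih =>
    have hneg : ∀ j, coeff j (∏ k, (1 + C (x k) * X)) ∈ B →
        coeff j (∏ k, (1 - C (x k) * X)) ∈ B := by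
      intro j hj
      rw [coeff_prod_neg]
      exact mul_mem (pow_mem (neg_mem (one_mem _)) _) hj
    have h0 : coeff 0 (∏ k, (1 - C (x k) * X)) = 1 := by
      rw [coeff_zero_eq_constantCoeff_apply, map_prod]
      exact Finset.prod_eq_one fun k _ => by simp
    have hrel := congrArg (coeff m) (hSeq_series x)
    rw [coeff_mul, Finset.Nat.sum_antidiagonal_eq_sum_range_succ_mk] at hrel
    simp only [coeff_mk] at hrel
    -- Even `m`: the complete function is given, and the relation between complete and elementary
    -- functions yields the elementary one. Odd `m`: the elementary function comes first, and the
    -- same relation then yields the complete one.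
    rcases Nat.even_or_odd m with hev | hodd
    · rcases Nat.eq_zero_or_pos m with rfl | hpos
      · refine ⟨?_, hH 0 hev (Nat.zero_le _)⟩
        rw [coeff_zero_eq_constantCoeff_apply, map_prod,
          Finset.prod_eq_one fun k _ => by simp]
        exact one_mem _
      · refine ⟨?_, hH m hev hm⟩
        rw [Finset.sum_range_succ', coeff_one, if_neg hpos.ne', hSeq, one_mul, Nat.sub_zero] at hrel
        have h1 : coeff m (∏ k, (1 - C (x k) * X)) ∈ B := by
          rw [eq_neg_of_add_eq_zero_right hrel]
          refine neg_mem (sum_mem fun i hi => ?_)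
          rw [Finset.mem_range] at hi
          refine mul_mem ?_ (hneg _ (ih _ (by omega) (by omega)).1)
          rcases Nat.lt_or_ge (i + 1) m with h | h
          · exact (ih _ h (by omega)).2
          · rw [show i + 1 = m by omega]; exact hH m hev hm
        rwa [coeff_prod_neg, hev.neg_one_pow, one_mul] at h1
    · have he : coeff m (∏ k, (1 + C (x k) * X)) ∈ B := by
        obtain ⟨q, rfl⟩ := hodd
        -- With `E(X) = ∏ (1 + x_k X)`, the product formula becomes `X S(X) (E(X) + E(-X)) = E(X) -
        -- E(-X)`. The coefficient in the odd degree `2q + 1` is twice the elementary function,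
        -- expressed by earlier data.
        have h1 : X * (phiSum x * (∏ k, (1 + C (x k) * X) + ∏ k, (1 - C (x k) * X)))
            = ∏ k, (1 + C (x k) * X) - ∏ k, (1 - C (x k) * X) := by
          linear_combination -phiSum_prod x
        have h2 := congrArg (coeff (2 * q + 1)) h1
        rw [coeff_succ_X_mul, map_sub, coeff_prod_neg, Odd.neg_one_pow ⟨q, rfl⟩, neg_one_mul,
          sub_neg_eq_add, ← two_smul ℂ] at h2
        have h3 : coeff (2 * q)
            (phiSum x * (∏ k, (1 + C (x k) * X) + ∏ k, (1 - C (x k) * X))) ∈ B := by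
          rw [coeff_mul]
          refine sum_mem fun p hp => ?_
          have hp := Finset.HasAntidiagonal.mem_antidiagonal.1 hp
          have h4 := (ih p.2 (by omega) (by omega)).1
          refine mul_mem ?_ (by rw [map_add]; exact add_mem h4 (hneg _ h4))
          rw [phiSum, coeff_mk]
          rcases Nat.even_or_odd p.1 with h | h
          · exact hS _ h (by omega)
          · rw [← phiForm_zero, phiForm_odd x h]
            exact zero_mem _
        rw [h2] at h3
        have h5 := B.smul_mem h3 (2 : ℂ)⁻¹
        rwa [smul_smul, inv_mul_cancel₀ two_ne_zero, one_smul] at h5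
      refine ⟨he, ?_⟩
      have hpos : m ≠ 0 := by rintro rfl; simp at hodd
      rw [Finset.sum_range_succ, Nat.sub_self, h0, mul_one, coeff_one, if_neg hpos] at hrel
      rw [eq_neg_of_add_eq_zero_right hrel]
      refine neg_mem (sum_mem fun i hi => ?_)
      rw [Finset.mem_range] at hi
      refine mul_mem (ih i hi (by omega)).2 (hneg _ ?_)
      rcases Nat.eq_zero_or_pos i with rfl | h
      · exact he
      · exact (ih _ (by omega) (by omega)).1

end Leading

/-- The leading terms of the Harish-Chandra images of the `z_i`. -/
def zLead (n : ℕ) [NeZero n] (i : ℕ) : MvPolynomial (Fin n) ℂ :=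
  if Even i then (2 : ℂ) • ∑ j, MvPolynomial.X j * phiSeq MvPolynomial.X i j
  else hSeq MvPolynomial.X (i + 1) (lastIdx n)

/-- The subalgebra generated by the `n` leading terms contains the elementary symmetric functions,
so the polynomial ring is integral over it. As the transcendence degree is `n`, these `n` generators
form a transcendence basis. -/
theorem algebraicIndependent_zLead (n : ℕ) [NeZero n] :
    AlgebraicIndependent ℂ fun i : Fin n => zLead n i := by
  let B := Algebra.adjoin ℂ (Set.range fun i : Fin n => zLead n i)
  have hmem : ∀ i, i < n → zLead n i ∈ B := fun i hi =>
    Algebra.subset_adjoin ⟨⟨i, hi⟩, rfl⟩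
  have he : ∀ m, m ≤ n → MvPolynomial.esymm (Fin n) ℂ m ∈ B := by
    intro m hm
    rw [← coeff_prod_eq_esymm]
    refine (esymm_mem (B := B) MvPolynomial.X (fun k hk hkn => ?_) (fun k hk hkn => ?_) m hm).1
    · have h := B.smul_mem (hmem k hkn) (2 : ℂ)⁻¹
      rwa [zLead, if_pos hk, smul_smul, inv_mul_cancel₀ two_ne_zero, one_smul] at h
    · rcases k with _ | k
      · exact one_mem _
      · have h := hmem k (by omega)
        rwa [zLead, if_neg (by rwa [Nat.even_add_one] at hk)] at h
  have hint : ∀ i : Fin n, IsIntegral B (MvPolynomial.X i : MvPolynomial (Fin n) ℂ) := by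
    intro i
    let p : Polynomial (MvPolynomial (Fin n) ℂ) :=
      ∏ i : Fin n, (Polynomial.X + Polynomial.C (MvPolynomial.X i))
    have hp : p.Monic := Polynomial.monic_prod_of_monic _ _ fun i _ => Polynomial.monic_X_add_C _
    have hdeg : p.natDegree = n := by
      rw [Polynomial.natDegree_prod_of_monic _ _ fun i _ => Polynomial.monic_X_add_C _]
      simp
    have hlift : p ∈ Polynomial.lifts (algebraMap B (MvPolynomial (Fin n) ℂ)) := by
      rw [Polynomial.lifts_iff_coeff_lifts]
      intro k
      rcases Nat.lt_or_ge n k with h | h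
      · rw [Polynomial.coeff_eq_zero_of_natDegree_lt (by omega)]
        exact ⟨0, map_zero _⟩
      · have h1 := MvPolynomial.prod_X_add_C_coeff ℂ (Fin n) k (by simpa using h)
        exact ⟨⟨_, he (Fintype.card (Fin n) - k) (by rw [Fintype.card_fin]; omega)⟩, h1.symm⟩
    obtain ⟨q, hq, -, hqm⟩ := Polynomial.lifts_and_natDegree_eq_and_monic hlift hp
    have h1 : IsIntegral B (- MvPolynomial.X i : MvPolynomial (Fin n) ℂ) := by
      refine ⟨q, hqm, ?_⟩
      rw [← Polynomial.eval_map, hq, Polynomial.eval_prod]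
      exact Finset.prod_eq_zero (Finset.mem_univ i) (by simp)
    simpa using h1.neg
  have hall : Algebra.IsIntegral B (MvPolynomial (Fin n) ℂ) := by
    refine ⟨fun p => ?_⟩
    induction p using MvPolynomial.induction_on with
    | C a => exact isIntegral_algebraMap (x := algebraMap ℂ B a)
    | add p q hp hq => exact hp.add hq
    | mul_X p i hp => exact hp.mul (hint i)
  have halg : Algebra.IsAlgebraic B (MvPolynomial (Fin n) ℂ) := hall.isAlgebraic
  have htr : (Cardinal.mk (Fin n)) ≤ Algebra.trdeg ℂ (MvPolynomial (Fin n) ℂ) := by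
    rw [MvPolynomial.trdeg_of_isDomain]
    simp
  exact (Algebra.IsAlgebraic.isTranscendenceBasis_of_le_trdeg_of_finite ℂ _ htr).1

end

/-! ### Harish-Chandra images of the generators -/

/-- The element `∑ v_j ξ_j`. -/
def cVec {n : ℕ} (v : Fin n → MvPolynomial (Fin n) ℂ) : Cliff n := ∑ j, cScal n (v j) * cXi j

theorem scal_mul_scal_mul {n : ℕ} (r s : MvPolynomial (Fin n) ℂ) (T U : Cliff n) :
    (cScal n r * T) * (cScal n s * U) = cScal n (r * s) * (T * U) := by
  rw [mul_assoc, ← mul_assoc T, ← cScal_comm, map_mul, mul_assoc, mul_assoc]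

theorem cVec_anticomm {n : ℕ} (v w : Fin n → MvPolynomial (Fin n) ℂ) :
    cVec v * cVec w + cVec w * cVec v
      = cScal n ((2 : ℂ) • phiForm MvPolynomial.X v w) := by
  have h1 : cVec w * cVec v = ∑ i, ∑ j, (cScal n (w j) * cXi j) * (cScal n (v i) * cXi i) := by
    rw [cVec, cVec, Finset.sum_mul_sum, Finset.sum_comm]
  have h2 : ∀ i j : Fin n, (cScal n (v i) * cXi i) * (cScal n (w j) * cXi j)
      + (cScal n (w j) * cXi j) * (cScal n (v i) * cXi i)
      = if i = j then cScal n ((2 : ℂ) • (MvPolynomial.X i * v i * w i)) else 0 := by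
    intro i j
    rw [scal_mul_scal_mul, scal_mul_scal_mul, mul_comm (w j), ← mul_add, cXi_anticomm]
    split_ifs with h
    · subst h
      rw [mul_smul_comm, ← map_mul, ← map_smul]
      congr 2
      ring
    · rw [mul_zero]
  rw [h1, cVec, cVec, Finset.sum_mul_sum, ← Finset.sum_add_distrib]
  simp only [← Finset.sum_add_distrib, h2, Finset.sum_ite_eq, Finset.mem_univ, if_true]
  rw [← map_sum, phiForm, Finset.smul_sum]

theorem le_lastIdx {n : ℕ} [NeZero n] (a : Fin n) : a ≤ lastIdx n := by
  rw [Fin.le_def]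
  change (a : ℕ) ≤ n - 1
  have := a.2
  omega

theorem hcCol_one {n : ℕ} (k : Fin n) : hcCol n 1 k
    = (cScal n (∑ a, if a ≤ k then MvPolynomial.X a else 0), ∑ a, if a ≤ k then cXi a else 0) := by
  rw [hcCol]
  simp only [hcCol, mul_one, mul_zero, smul_zero, add_zero, pow_zero, one_smul, zero_add]
  rw [map_sum]
  congr 1
  refine Finset.sum_congr rfl fun a _ => ?_
  split_ifs
  · rfl
  · rw [map_zero]

theorem cXi_mul_comm {n : ℕ} (k a i : Fin n) :
    cXi k * cXi a * cXi i - cXi i * (cXi k * cXi a)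
      = (if a = i then (2 : ℂ) • (cScal n (MvPolynomial.X i) * cXi k) else 0)
        - (if k = i then (2 : ℂ) • (cScal n (MvPolynomial.X i) * cXi a) else 0) := by
  have h1 := cXi_anticomm a i
  have h2 := cXi_anticomm k i
  have e : cXi k * cXi a * cXi i - cXi i * (cXi k * cXi a)
      = cXi k * (cXi a * cXi i + cXi i * cXi a) - (cXi k * cXi i + cXi i * cXi k) * cXi a := by
    rw [mul_add, add_mul]
    simp only [mul_assoc]
    abel
  rw [e, h1, h2]
  congr 1
  · split_ifs with h
    · subst h; rw [mul_smul_comm, cScal_comm]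
    · rw [mul_zero]
  · split_ifs with h
    · subst h; rw [smul_mul_assoc]
    · rw [zero_mul]

/-- The image of `e_{n,1}^{(n+1)}` is a scalar minus `∑_{a ≤ k} ξ_k ξ_a`. In the commutator with
`ξ_i`, the terms with `a = i` contribute `ξ_j` for `j ≥ i` and those with `k = i` contribute `ξ_j`
for `j ≤ i`, with opposite signs; this produces `sgn(i - j)`. -/
theorem hcCol_two_comm {n : ℕ} [NeZero n] (i : Fin n) :
    (1 / 2 : ℂ) • ((hcCol n 2 (lastIdx n)).1 * cXi i - cXi i * (hcCol n 2 (lastIdx n)).1)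
      = ∑ j, cScal n (ordSign (MvPolynomial (Fin n) ℂ) i j * MvPolynomial.X i) * cXi j := by
  have h0 : (hcCol n 2 (lastIdx n)).1 = cScal n (∑ k : Fin n, MvPolynomial.X k
        * ∑ a, if a ≤ k then MvPolynomial.X a else 0)
      - ∑ k : Fin n, ∑ a : Fin n, if a ≤ k then cXi k * cXi a else 0 := by
    rw [hcCol]
    simp only [le_lastIdx, if_true, hcCol_one, Finset.sum_add_distrib, pow_one, neg_one_smul_cliff,
      Finset.sum_neg_distrib, Finset.mul_sum, mul_ite, mul_zero]
    rw [← sub_eq_add_neg]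
    congr 1
    rw [map_sum]
    refine Finset.sum_congr rfl fun k _ => ?_
    rw [← map_mul, Finset.mul_sum]
    simp only [mul_ite, mul_zero]
  have h1 : (hcCol n 2 (lastIdx n)).1 * cXi i - cXi i * (hcCol n 2 (lastIdx n)).1
      = - ∑ k : Fin n, ∑ a : Fin n, if a ≤ k then
          (if a = i then (2 : ℂ) • (cScal n (MvPolynomial.X i) * cXi k) else 0)
        - (if k = i then (2 : ℂ) • (cScal n (MvPolynomial.X i) * cXi a) else 0) else 0 := by
    rw [h0, sub_mul, mul_sub, cScal_comm, sub_sub_sub_cancel_left, ← neg_sub]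
    congr 1
    rw [Finset.sum_mul, Finset.mul_sum, ← Finset.sum_sub_distrib]
    refine Finset.sum_congr rfl fun k _ => ?_
    rw [Finset.sum_mul, Finset.mul_sum, ← Finset.sum_sub_distrib]
    refine Finset.sum_congr rfl fun a _ => ?_
    rw [← cXi_mul_comm]
    split_ifs
    · rfl
    · rw [zero_mul, mul_zero, sub_zero]
  have h2 : ∀ k a : Fin n, (if a ≤ k then
          (if a = i then (2 : ℂ) • (cScal n (MvPolynomial.X i) * cXi k) else 0)
        - (if k = i then (2 : ℂ) • (cScal n (MvPolynomial.X i) * cXi a) else 0) else 0)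
      = (if a = i then if i ≤ k then (2 : ℂ) • (cScal n (MvPolynomial.X i) * cXi k) else 0 else 0)
        - (if k = i then if a ≤ i then (2 : ℂ) • (cScal n (MvPolynomial.X i) * cXi a) else 0
          else 0) := by
    intro k a
    split_ifs <;> simp_all
  simp only [h2, Finset.sum_sub_distrib, Finset.sum_ite_eq', Finset.mem_univ, if_true] at h1
  rw [Finset.sum_comm (f := fun k a => if k = i then if a ≤ i then
    (2 : ℂ) • (cScal n (MvPolynomial.X i) * cXi a) else 0 else 0)] at h1
  simp only [Finset.sum_ite_eq', Finset.mem_univ, if_true] at h1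
  rw [h1, ← Finset.sum_sub_distrib, ← Finset.sum_neg_distrib, Finset.smul_sum]
  refine Finset.sum_congr rfl fun j _ => ?_
  rw [map_mul]
  generalize hU : cScal n (MvPolynomial.X i) * cXi j = U
  rw [mul_assoc, hU]
  rcases lt_trichotomy i j with h | rfl | h
  · rw [ordSign, if_neg h.not_gt, if_pos h, if_pos h.le, if_neg h.not_ge, map_neg, map_one]
    refine Eq.trans ?_ (neg_one_mul U).symm
    module
  · simp [ordSign]
  · rw [ordSign, if_pos h, if_pos h.le, if_neg h.not_ge, map_one, one_mul]
    module

theorem hcCol_two_comm_cVec {n : ℕ} [NeZero n] (v : Fin n → MvPolynomial (Fin n) ℂ) :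
    (1 / 2 : ℂ) • ((hcCol n 2 (lastIdx n)).1 * cVec v - cVec v * (hcCol n 2 (lastIdx n)).1)
      = cVec fun j => ∑ i, ordSign (MvPolynomial (Fin n) ℂ) i j * (MvPolynomial.X i * v i) := by
  have h := hcCol_two_comm (n := n)
  generalize (hcCol n 2 (lastIdx n)).1 = T at h ⊢
  rw [cVec, Finset.mul_sum, Finset.sum_mul, ← Finset.sum_sub_distrib, Finset.smul_sum]
  have h1 : ∀ i, (1 / 2 : ℂ) • (T * (cScal n (v i) * cXi i) - cScal n (v i) * cXi i * T)
      = ∑ j, cScal n (ordSign (MvPolynomial (Fin n) ℂ) i j * (MvPolynomial.X i * v i)) * cXi j := by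
    intro i
    rw [← mul_assoc, ← cScal_comm, mul_assoc, mul_assoc, ← mul_sub, ← mul_smul_comm, h,
      Finset.mul_sum]
    refine Finset.sum_congr rfl fun j _ => ?_
    rw [← mul_assoc, ← map_mul]
    congr 2
    ring
  simp only [h1]
  rw [Finset.sum_comm, cVec]
  refine Finset.sum_congr rfl fun j _ => ?_
  rw [map_sum, Finset.sum_mul]

theorem hcW_Phi {n : ℕ} [NeZero n] (k : ℕ) :
    hcW n (Phi n k) = cVec (phiSeq MvPolynomial.X k) := by
  induction k with
  | zero =>
    rw [Phi_zero, hcW_wGen, if_pos rfl, hcCol_one, cVec]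
    change ∑ a : Fin n, (if a ≤ lastIdx n then cXi a else 0) = _
    refine Finset.sum_congr rfl fun a _ => ?_
    rw [if_pos (le_lastIdx a), phiSeq, map_one, one_mul]
  | succ k ih =>
    rw [Phi_succ, map_smul, map_sub, map_mul, map_mul, ih, hcW_wGen, if_neg Bool.false_ne_true,
      hcCol_two_comm_cVec]
    rfl

theorem hcW_Phi_anticomm {n : ℕ} [NeZero n] (m p : ℕ) :
    hcW n (Phi n m * Phi n p + Phi n p * Phi n m)
      = cScal n ((2 : ℂ) • phiForm MvPolynomial.X (phiSeq MvPolynomial.X m)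
        (phiSeq MvPolynomial.X p)) := by
  rw [map_add, map_mul, map_mul, hcW_Phi, hcW_Phi, cVec_anticomm]

theorem hcW_zElt_even {n : ℕ} [NeZero n] {i : ℕ} (h : Even i) :
    hcW n (zElt n i) = cScal n (zLead n i) := by
  rw [zElt_even h, hcW_Phi_anticomm, phiForm_zero, zLead, if_pos h]

/-! ### Independence of the products of the `Φ_k` -/

theorem map_phiSeq {n : ℕ} {R S : Type*} [CommRing R] [CommRing S] (f : R →+* S) (x : Fin n → R)
    (k : ℕ) : ∀ j, f (phiSeq x k j) = phiSeq (fun i => f (x i)) k j := by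
  induction k with
  | zero => intro j; exact map_one f
  | succ k ih =>
    intro j
    rw [phiSeq, phiSeq, map_sum]
    refine Finset.sum_congr rfl fun i _ => ?_
    rw [map_mul, map_mul, ih]
    congr 1
    rw [ordSign, ordSign]
    split_ifs <;> simp

/-- The iterated differences of a double sequence. -/
def iterDiff (f : ℕ → ℕ → ℂ) : ℕ → ℕ → ℕ → ℂ
  | 0, k, j => f k j
  | r + 1, k, j => iterDiff f r k j - iterDiff f r k (j + 1)

/-- Differences in `j` lower the row index `k` by one and double the leading value. The `r`-th
difference therefore kills the rows `k < r` and takes the value `2^r` on row `r`. -/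
theorem iterDiff_eq {n : ℕ} {f : ℕ → ℕ → ℂ} (h0 : ∀ j, j < n → f 0 j = 1)
    (hf : ∀ k j, j + 1 < n → f (k + 1) j - f (k + 1) (j + 1) = f k j + f k (j + 1)) (r : ℕ) :
    (∀ k j, j + r + 1 < n → iterDiff f r (k + 1) j - iterDiff f r (k + 1) (j + 1)
      = iterDiff f r k j + iterDiff f r k (j + 1)) ∧
    ∀ j, j + r < n → (∀ k, k < r → iterDiff f r k j = 0) ∧ iterDiff f r r j = 2 ^ r := by
  induction r with
  | zero => exact ⟨fun k j h => hf k j h, fun j h => ⟨fun k hk => absurd hk (Nat.not_lt_zero _),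
      by rw [iterDiff, h0 j h, pow_zero]⟩⟩
  | succ r ih =>
    obtain ⟨h1, h2⟩ := ih
    refine ⟨fun k j h => ?_, fun j h => ⟨fun k hk => ?_, ?_⟩⟩
    · simp only [iterDiff]
      linear_combination h1 k j (by omega) - h1 k (j + 1) (by omega)
    · rcases k with _ | k
      · rw [iterDiff]
        rcases r with _ | r
        · rw [iterDiff, iterDiff, h0 _ (by omega), h0 _ (by omega), sub_self]
        · rw [(h2 j (by omega)).1 0 (by omega), (h2 (j + 1) (by omega)).1 0 (by omega), sub_self]
      · rw [iterDiff, h1 k j (by omega), (h2 j (by omega)).1 k (by omega),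
          (h2 (j + 1) (by omega)).1 k (by omega), add_zero]
    · rw [iterDiff, h1 r j (by omega), (h2 j (by omega)).2, (h2 (j + 1) (by omega)).2, pow_succ]
      ring

/-- The matrix of the coefficients of `Φ_0, …, Φ_{n-1}`. -/
def phiMat (n : ℕ) : Matrix (Fin n) (Fin n) (MvPolynomial (Fin n) ℂ) :=
  Matrix.of fun k j => phiSeq MvPolynomial.X k j

theorem phiSeq_one_sub {n : ℕ} (k : ℕ) {i j : Fin n} (h : (i : ℕ) + 1 = j) :
    phiSeq (fun _ : Fin n => (1 : ℂ)) (k + 1) i - phiSeq (fun _ => 1) (k + 1) j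
      = phiSeq (fun _ => 1) k i + phiSeq (fun _ => 1) k j := by
  rw [phiSeq, phiSeq, sum_ordSign, sum_ordSign, ← h, sum_lt_succ, h, sum_lt_succ, ← h, sum_lt_succ]
  ring

/-- At `x = (1, …, 1)`, taking iterated differences is a right multiplication which turns the matrix
into a triangular one with diagonal entries `2^r`. -/
theorem det_phiMat_ne_zero (n : ℕ) : (phiMat n).det ≠ 0 := by
  intro hdet
  let φ : MvPolynomial (Fin n) ℂ →+* ℂ := MvPolynomial.eval fun _ => 1
  let M : Matrix (Fin n) (Fin n) ℂ := Matrix.of fun k j => phiSeq (fun _ => (1 : ℂ)) k j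
  have hM : M = φ.mapMatrix (phiMat n) := by
    ext k j
    rw [RingHom.mapMatrix_apply, Matrix.map_apply, phiMat, Matrix.of_apply, map_phiSeq]
    simp [M, φ]
  have hM0 : M.det = 0 := by rw [hM, ← RingHom.map_det, hdet, map_zero]
  let f : ℕ → ℕ → ℂ := fun k j => if h : j < n then phiSeq (fun _ => (1 : ℂ)) k (⟨j, h⟩ : Fin n) else 0
  have hf := iterDiff_eq (n := n) (f := f) (fun j hj => by simp [f, hj, phiSeq]) (fun k j hj => by
    simp only [f, hj, show j < n by omega, dif_pos]
    exact phiSeq_one_sub k rfl)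
  have hb : ∀ r j, j + r < n → ∃ b : Fin n → ℂ, ∀ k : Fin n, iterDiff f r k j = ∑ i, M k i * b i := by
    intro r
    induction r with
    | zero =>
      intro j hj
      refine ⟨Pi.single ⟨j, hj⟩ 1, fun k => ?_⟩
      simp only [add_zero] at hj
      simp [iterDiff, f, hj, M, Pi.single_apply]
    | succ r ih =>
      intro j hj
      obtain ⟨b, hb⟩ := ih j (by omega)
      obtain ⟨b', hb'⟩ := ih (j + 1) (by omega)
      refine ⟨fun i => b i - b' i, fun k => ?_⟩
      rw [iterDiff, hb, hb', ← Finset.sum_sub_distrib]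
      exact Finset.sum_congr rfl fun i _ => by ring
  choose b hb using fun r : Fin n => hb r 0 (by rw [zero_add]; exact r.2)
  have hL : M * Matrix.of (fun i r => b r i) = Matrix.of fun k r : Fin n => iterDiff f r k 0 := by
    ext k r
    rw [Matrix.mul_apply, Matrix.of_apply, hb]
    rfl
  have h2 : (Matrix.of fun k r : Fin n => iterDiff f r k 0).det = ∏ r : Fin n, (2 : ℂ) ^ (r : ℕ) := by
    rw [Matrix.det_of_isLowerTriangular]
    · refine Finset.prod_congr rfl fun r _ => ?_
      rw [Matrix.of_apply]
      exact ((hf r).2 0 (by omega)).2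
    · intro k r hkr
      rw [Matrix.of_apply]
      exact ((hf r).2 0 (by omega)).1 k hkr
  have h3 := congrArg Matrix.det hL
  rw [Matrix.det_mul, hM0, zero_mul, h2] at h3
  exact Finset.prod_ne_zero_iff.2 (fun r _ => pow_ne_zero _ two_ne_zero) h3.symm

theorem cAn_anticomm_cXi {n : ℕ} (j i : Fin n) :
    cAn j * cXi i + cXi i * cAn j = if j = i then 1 else 0 := by
  have h1 : cAn j * cAn i + cAn i * cAn j = 0 := fan_fan j i
  have h2 : cAn j * cCr i + cCr i * cAn j = if j = i then 1 else 0 := fan_fcr j i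
  rw [cXi, mul_add, add_mul, ← mul_assoc (cAn j), ← cScal_comm, mul_assoc, mul_assoc, ← h2]
  have h3 : cScal n (MvPolynomial.X i) * (cAn j * cAn i) + cScal n (MvPolynomial.X i) * (cAn i * cAn j)
      = 0 := by rw [← mul_add, h1, mul_zero]
  linear_combination (norm := abel) h3

/-- The annihilation operators dual to the `Φ_k`. -/
def phiDual {n : ℕ} (k : Fin n) : Cliff n := ∑ j, cScal n ((phiMat n).adjugate j k) * cAn j

/-- Using the adjugate in place of the inverse keeps the coefficients polynomial; duality then holds
up to the factor `det`. -/
theorem phiDual_anticomm {n : ℕ} (k l : Fin n) :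
    phiDual k * cVec (phiSeq MvPolynomial.X l) + cVec (phiSeq MvPolynomial.X l) * phiDual k
      = if l = k then cScal n (phiMat n).det else 0 := by
  have h1 : cVec (phiSeq MvPolynomial.X l) * phiDual k = ∑ j, ∑ i,
      (cScal n (phiSeq MvPolynomial.X l i) * cXi i) * (cScal n ((phiMat n).adjugate j k) * cAn j) := by
    rw [cVec, phiDual, Finset.sum_mul_sum, Finset.sum_comm]
  have h2 : ∀ j i : Fin n, (cScal n ((phiMat n).adjugate j k) * cAn j)
        * (cScal n (phiSeq MvPolynomial.X l i) * cXi i)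
      + (cScal n (phiSeq MvPolynomial.X l i) * cXi i) * (cScal n ((phiMat n).adjugate j k) * cAn j)
      = if j = i then cScal n (phiMat n l i * (phiMat n).adjugate i k) else 0 := by
    intro j i
    rw [scal_mul_scal_mul, scal_mul_scal_mul, mul_comm (phiSeq MvPolynomial.X l i), ← mul_add,
      cAn_anticomm_cXi]
    split_ifs with h
    · subst h
      rw [mul_one, mul_comm]
      rfl
    · rw [mul_zero]
  rw [h1, phiDual, cVec, Finset.sum_mul_sum, ← Finset.sum_add_distrib]
  simp only [← Finset.sum_add_distrib, h2, Finset.sum_ite_eq, Finset.mem_univ, if_true]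
  rw [← map_sum, ← Matrix.mul_apply, Matrix.mul_adjugate, Matrix.smul_apply, Matrix.one_apply]
  split_ifs
  · rw [smul_eq_mul, mul_one]
  · rw [smul_zero, map_zero]

/-- The vacuum vector. -/
def vac (n : ℕ) : Finset (Fin n) → MvPolynomial (Fin n) ℂ := Pi.single ∅ 1

theorem phiDual_vac {n : ℕ} (k : Fin n) : phiDual k (vac n) = 0 := by
  rw [phiDual, LinearMap.sum_apply]
  refine Finset.sum_eq_zero fun j _ => ?_
  rw [Module.End.mul_apply]
  have : cAn j (vac n) = 0 := by
    refine funext fun S => ?_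
    change fan (MvPolynomial (Fin n) ℂ) _ j (vac n) S = 0
    rw [fan_apply, vac, Pi.single_eq_of_ne (Finset.insert_ne_empty j S), smul_zero, ite_self]
  rw [this, map_zero]

/-- The product of the `Φ_k`, `k ∈ β`. -/
def phiProd {n : ℕ} (β : Finset (Fin n)) : Cliff n :=
  ((β.sort (· ≤ ·)).map fun k : Fin n => cVec (phiSeq MvPolynomial.X k)).prod

theorem phiDual_phiProd {n : ℕ} (k : Fin n) (l : List (Fin n)) (hk : k ∉ l) :
    phiDual k ((l.map fun k : Fin n => cVec (phiSeq MvPolynomial.X k)).prod (vac n)) = 0 := by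
  induction l with
  | nil => exact phiDual_vac k
  | cons a l ih =>
    rw [List.mem_cons, not_or] at hk
    rw [List.map_cons, List.prod_cons, Module.End.mul_apply, ← Module.End.mul_apply,
      eq_neg_of_add_eq_zero_left ((phiDual_anticomm k a).trans (if_neg fun h => hk.1 h.symm)),
      LinearMap.neg_apply, Module.End.mul_apply, ih hk.2, map_zero, neg_zero]

theorem phiProd_insert {n : ℕ} {a : Fin n} {s : Finset (Fin n)} (h : ∀ x ∈ s, a < x) :
    phiProd (insert a s) = cVec (phiSeq MvPolynomial.X a) * phiProd s := by
  rw [phiProd, Finset.sort_insert (r := (· ≤ ·)) (fun b hb => (h b hb).le)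
    (fun ha => lt_irrefl _ (h a ha)), List.map_cons, List.prod_cons]
  rfl

theorem linearIndependent_phiProd (n : ℕ) : LinearIndependent (MvPolynomial (Fin n) ℂ)
    fun β : Finset (Fin n) => phiProd β (vac n) := by
  have key : ∀ (s : Finset (Fin n)) (r : Finset (Fin n) → MvPolynomial (Fin n) ℂ),
      ∑ β ∈ s.powerset, r β • phiProd β (vac n) = 0 → ∀ β ∈ s.powerset, r β = 0 := by
    intro s
    induction s using Finset.induction_on_min with
    | empty =>
      intro r h β hβ
      rw [Finset.powerset_empty, Finset.mem_singleton] at hβ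
      subst hβ
      rw [Finset.powerset_empty, Finset.sum_singleton] at h
      have h1 := congrFun h ∅
      simpa [phiProd, vac] using h1
    | insert a s ha ih =>
      intro r h
      have has : a ∉ s := fun h' => lt_irrefl _ (ha a h')
      rw [Finset.sum_powerset_insert has] at h
      have hlt : ∀ t ∈ s.powerset, ∀ x ∈ t, a < x := fun t ht x hx =>
        ha x (Finset.mem_powerset.1 ht hx)
      have hz : ∀ t ∈ s.powerset, phiDual a (phiProd t (vac n)) = 0 := by
        intro t ht
        refine phiDual_phiProd a _ ?_
        rw [Finset.mem_sort]
        exact fun h' => has (Finset.mem_powerset.1 ht h')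
      -- The dual operator of the smallest index `a` annihilates the products without `Φ_a` and
      -- strips `Φ_a` from the others, up to the nonzero factor `det`. The induction hypothesis then
      -- applies to both groups of coefficients.
      have h1 := congrArg (phiDual a) h
      rw [map_add, map_zero, map_sum, map_sum, Finset.sum_eq_zero fun t ht => by
        rw [map_smul, hz t ht, smul_zero], zero_add] at h1
      have h2 : ∀ t ∈ s.powerset, phiDual a (r (insert a t) • phiProd (insert a t) (vac n))
          = ((phiMat n).det * r (insert a t)) • phiProd t (vac n) := by
        intro t ht
        have h3 := congrArg (fun T : Cliff n => T (phiProd t (vac n))) (phiDual_anticomm a a)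
        rw [if_pos rfl] at h3
        simp only [LinearMap.add_apply, Module.End.mul_apply, hz t ht, map_zero, add_zero] at h3
        rw [map_smul, phiProd_insert (hlt t ht), Module.End.mul_apply, h3, mul_comm, mul_smul]
        rfl
      rw [Finset.sum_congr rfl h2] at h1
      have h4 := ih (fun t => (phiMat n).det * r (insert a t)) h1
      have h5 : ∀ t ∈ s.powerset, r (insert a t) = 0 := fun t ht =>
        (mul_eq_zero.1 (h4 t ht)).resolve_left (det_phiMat_ne_zero n)
      have h6 := ih r (by
        rw [← h, eq_comm]
        refine add_eq_left.2 (Finset.sum_eq_zero fun t ht => ?_)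
        rw [h5 t ht, zero_smul])
      intro β hβ
      by_cases haβ : a ∈ β
      · have := h5 (β.erase a) (Finset.mem_powerset.2 (by
          exact Finset.subset_insert_iff.1 (Finset.mem_powerset.1 hβ)))
        rwa [Finset.insert_erase haβ] at this
      · refine h6 β (Finset.mem_powerset.2 ?_)
        exact (Finset.subset_insert_iff_of_notMem haβ).1 (Finset.mem_powerset.1 hβ)
  rw [Fintype.linearIndependent_iff]
  intro g hg β
  refine key Finset.univ g ?_ β (by simp)
  rw [Finset.powerset_univ]
  exact hg

section

/-! ### The weight filtration on the Clifford module -/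

theorem exists_coeff_of_coeff_mul {σ R : Type*} [CommSemiring R] {p q : MvPolynomial σ R}
    {m : σ →₀ ℕ} (h : (p * q).coeff m ≠ 0) : ∃ a b, a + b = m ∧ p.coeff a ≠ 0 ∧ q.coeff b ≠ 0 := by
  classical
  rw [MvPolynomial.coeff_mul] at h
  obtain ⟨x, hx, hne⟩ := Finset.exists_ne_zero_of_sum_ne_zero h
  exact ⟨x.1, x.2, Finset.HasAntidiagonal.mem_antidiagonal.1 hx, left_ne_zero_of_mul hne,
    right_ne_zero_of_mul hne⟩

/-- The vectors all of whose weights satisfy `P`; the variables have weight `2`, the exterior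
generators have weight `1`. -/
def wSupp (n : ℕ) (P : ℤ → Prop) : Submodule ℂ (Finset (Fin n) → MvPolynomial (Fin n) ℂ) where
  carrier := {v | ∀ S m, (v S).coeff m ≠ 0 → P (2 * (m.degree : ℤ) + S.card)}
  zero_mem' := fun S m h => absurd (MvPolynomial.coeff_zero m) h
  add_mem' := fun {v w} hv hw S m h => by
    rw [Pi.add_apply, MvPolynomial.coeff_add] at h
    by_cases hv0 : (v S).coeff m = 0
    · exact hw S m fun hw0 => h (by rw [hv0, hw0, add_zero])
    · exact hv S m hv0
  smul_mem' := fun c v hv S m h => hv S m fun h0 => h (by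
    rw [Pi.smul_apply, MvPolynomial.coeff_smul, h0, smul_zero])

variable {n : ℕ}

theorem wSupp_mono {P Q : ℤ → Prop} (h : ∀ d, P d → Q d) : wSupp n P ≤ wSupp n Q :=
  fun _ hv S m hm => h _ (hv S m hm)

theorem eq_zero_of_mem_wSupp {P Q : ℤ → Prop} (h : ∀ d, P d → ¬ Q d)
    {v : Finset (Fin n) → MvPolynomial (Fin n) ℂ} (hP : v ∈ wSupp n P) (hQ : v ∈ wSupp n Q) :
    v = 0 := by
  funext S
  ext m
  by_contra hm
  exact h _ (hP S m hm) (hQ S m hm)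

/-- The operators homogeneous of degree `k`. -/
def opHom (n : ℕ) (k : ℤ) : Submodule ℂ (Cliff n) where
  carrier := {T | ∀ P : ℤ → Prop, ∀ v ∈ wSupp n fun d => P (d + k), T v ∈ wSupp n P}
  zero_mem' := fun _ _ _ => zero_mem _
  add_mem' := fun hT hU P v hv => add_mem (hT P v hv) (hU P v hv)
  smul_mem' := fun c _ hT P v hv => (wSupp n P).smul_mem c (hT P v hv)

/-- The operators that raise the weights by at most `k`. -/
def opLe (n : ℕ) (k : ℤ) : Submodule ℂ (Cliff n) where
  carrier := {T | ∀ d : ℤ, ∀ v ∈ wSupp n (· < d), T v ∈ wSupp n (· < d + k)}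
  zero_mem' := fun _ _ _ => zero_mem _
  add_mem' := fun hT hU P v hv => add_mem (hT P v hv) (hU P v hv)
  smul_mem' := fun c _ hT d v hv => (wSupp n (· < d + k)).smul_mem c (hT d v hv)

theorem opHom_le_opLe (k : ℤ) : opHom n k ≤ opLe n k := fun T hT d v hv =>
  hT (· < d + k) v (wSupp_mono (fun e (he : e < d) => by linarith) hv)

theorem opLe_mono {k l : ℤ} (h : k ≤ l) : opLe n k ≤ opLe n l := fun T hT d v hv =>
  wSupp_mono (fun e (he : e < d + k) => by linarith) (hT d v hv)

theorem opLe_mul {k l m : ℤ} (hm : k + l = m) {T U : Cliff n} (hT : T ∈ opLe n k)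
    (hU : U ∈ opLe n l) : T * U ∈ opLe n m := fun d v hv =>
  wSupp_mono (fun e (he : e < d + l + k) => by linarith) (hT _ _ (hU d v hv))

theorem opHom_one : (1 : Cliff n) ∈ opHom n 0 := fun P v hv =>
  wSupp_mono (fun e (he : P (e + 0)) => by rwa [add_zero] at he) hv

theorem opHom_mul {k l m : ℤ} (hm : k + l = m) {T U : Cliff n} (hT : T ∈ opHom n k)
    (hU : U ∈ opHom n l) : T * U ∈ opHom n m := fun P v hv =>
  hT P _ (hU (fun d => P (d + k)) v (wSupp_mono (fun e (he : P (e + m)) => by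
    rwa [show e + l + k = e + m by linarith]) hv))

theorem cScal_mem_opHom {p : MvPolynomial (Fin n) ℂ} {k : ℕ} (hp : p.IsHomogeneous k) {l : ℤ}
    (hl : 2 * (k : ℤ) = l) : cScal n p ∈ opHom n l := by
  intro P v hv S m hm
  obtain ⟨a, b, rfl, ha, hb⟩ := exists_coeff_of_coeff_mul (p := p) (q := v S) hm
  have h1 := hv S b hb
  have h2 : a.degree = k := by rw [Finsupp.degree_eq_weight_one]; exact hp ha
  rwa [map_add, h2, Nat.cast_add, show 2 * ((k : ℤ) + (b.degree : ℤ)) + (S.card : ℤ)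
    = 2 * (b.degree : ℤ) + S.card + l by linarith]

theorem coeff_fsgn_smul (i : Fin n) (S : Finset (Fin n)) (p : MvPolynomial (Fin n) ℂ)
    {m : Fin n →₀ ℕ} (h : (fsgn (MvPolynomial (Fin n) ℂ) i S • p).coeff m ≠ 0) :
    p.coeff m ≠ 0 := by
  rw [fsgn, smul_eq_mul] at h
  rcases neg_one_pow_eq_or (MvPolynomial (Fin n) ℂ) ((S.filter (· < i)).card) with h1 | h1
  · rwa [h1, one_mul] at h
  · rwa [h1, neg_one_mul, MvPolynomial.coeff_neg, neg_ne_zero] at h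

theorem cXi_mem_opHom (i : Fin n) : cXi i ∈ opHom n 1 := by
  refine add_mem (fun P v hv S m hm => ?_) (fun P v hv S m hm => ?_)
  · rw [cCr, fcr_apply] at hm
    by_cases hi : i ∈ S
    · rw [if_pos hi] at hm
      have h1 := hv _ m (coeff_fsgn_smul _ _ _ hm)
      have h2 := Finset.card_erase_add_one hi
      change P _ at h1
      rwa [add_assoc, show (((S.erase i).card : ℤ) + 1) = S.card by exact_mod_cast h2] at h1
    · rw [if_neg hi] at hm
      exact absurd (MvPolynomial.coeff_zero m) hm
  · obtain ⟨a, b, rfl, ha, hb⟩ := exists_coeff_of_coeff_mul (p := MvPolynomial.X i)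
      (q := cAn i v S) hm
    have h2 : a.degree = 1 := by
      rw [Finsupp.degree_eq_weight_one]; exact MvPolynomial.isHomogeneous_X ℂ i ha
    rw [cAn, fan_apply] at hb
    by_cases hi : i ∈ S
    · rw [if_pos hi] at hb
      exact absurd (MvPolynomial.coeff_zero b) hb
    · rw [if_neg hi] at hb
      have h1 := hv _ b (coeff_fsgn_smul _ _ _ hb)
      rw [Finset.card_insert_of_notMem hi] at h1
      rw [map_add, h2]
      convert h1 using 1
      push_cast
      ring

/-! ### Weights of the leading terms -/

theorem phiSeq_isHomogeneous (k : ℕ) : ∀ j : Fin n,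
    (phiSeq (MvPolynomial.X : Fin n → MvPolynomial (Fin n) ℂ) k j).IsHomogeneous k := by
  induction k with
  | zero => exact fun j => MvPolynomial.isHomogeneous_one _ _
  | succ k ih =>
    intro j
    refine MvPolynomial.IsHomogeneous.sum _ _ _ fun i _ => ?_
    have h := (MvPolynomial.isHomogeneous_X ℂ i).mul (ih i)
    rw [add_comm] at h
    rw [ordSign]
    split_ifs
    · rwa [one_mul]
    · rw [neg_one_mul]
      exact h.neg
    · rw [zero_mul]
      exact MvPolynomial.isHomogeneous_zero _ _ _

theorem hSeq_isHomogeneous (s : ℕ) : ∀ k : Fin n,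
    (hSeq (MvPolynomial.X : Fin n → MvPolynomial (Fin n) ℂ) s k).IsHomogeneous s := by
  induction s with
  | zero => exact fun j => MvPolynomial.isHomogeneous_one _ _
  | succ s ih =>
    intro k
    refine MvPolynomial.IsHomogeneous.sum _ _ _ fun i _ => ?_
    have h := (MvPolynomial.isHomogeneous_X ℂ i).mul (ih i)
    rw [add_comm] at h
    split_ifs
    · exact h
    · exact MvPolynomial.isHomogeneous_zero _ _ _

theorem zLead_isHomogeneous [NeZero n] (i : ℕ) : (zLead n i).IsHomogeneous (i + 1) := by
  rw [zLead]
  split_ifs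
  · rw [MvPolynomial.smul_eq_C_mul, ← zero_add (i + 1)]
    refine (MvPolynomial.isHomogeneous_C _ _).mul (MvPolynomial.IsHomogeneous.sum _ _ _ ?_)
    intro j _
    have h := (MvPolynomial.isHomogeneous_X ℂ j).mul (phiSeq_isHomogeneous i j)
    rwa [add_comm] at h
  · exact hSeq_isHomogeneous _ _

theorem cVec_phiSeq_mem (k : ℕ) :
    cVec (phiSeq (MvPolynomial.X : Fin n → MvPolynomial (Fin n) ℂ) k) ∈ opHom n (2 * k + 1) :=
  sum_mem fun j _ => opHom_mul rfl (cScal_mem_opHom (phiSeq_isHomogeneous k j) rfl)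
    (cXi_mem_opHom j)

/-- A factor `x` has weight `2` and a factor `ξ` weight `1`. The even component reaches the top
weight `2s` only through factors `x`, where it follows the recursion of `hSeq`; the odd component
stays one below. -/
theorem hcCol_lead (s : ℕ) : ∀ k : Fin n,
    (hcCol n s k).1 - cScal n (hSeq MvPolynomial.X s k) ∈ opLe n (2 * s - 1) ∧
    (hcCol n s k).2 ∈ opLe n (2 * s - 1) := by
  induction s with
  | zero =>
    intro k
    rw [hcCol, hSeq, map_one, sub_self]
    exact ⟨zero_mem _, zero_mem _⟩
  | succ s ih =>
    intro k
    have hX : ∀ a : Fin n, cScal n (MvPolynomial.X a) ∈ opLe n 2 := fun a =>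
      opHom_le_opLe _ (cScal_mem_opHom (MvPolynomial.isHomogeneous_X ℂ a) (by norm_num))
    have hxi : ∀ a : Fin n, cXi a ∈ opLe n 1 := fun a => opHom_le_opLe _ (cXi_mem_opHom a)
    have h1 : ∀ a : Fin n, (hcCol n s a).1 ∈ opLe n (2 * s) := fun a => by
      have h := add_mem (opLe_mono (by linarith) (ih a).1) (opHom_le_opLe _
        (cScal_mem_opHom (hSeq_isHomogeneous s a) rfl))
      rwa [sub_add_cancel] at h
    rw [hcCol, hSeq, map_sum, ← Finset.sum_sub_distrib]
    refine ⟨sum_mem fun a _ => ?_, ?_⟩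
    · split_ifs
      · rw [map_mul, add_sub_right_comm, ← mul_sub]
        refine add_mem (opLe_mul ?_ (hX a) (ih a).1) (Submodule.smul_mem _ _
          (opLe_mono ?_ (opLe_mul rfl (hxi a) (ih a).2)))
        · push_cast; ring
        · push_cast; linarith
      · rw [map_zero, sub_zero]
        exact zero_mem _
    · refine Submodule.sum_mem (opLe n _) fun a _ => ?_
      split_ifs
      · refine add_mem (opLe_mul ?_ (hX a) (ih a).2) (Submodule.smul_mem _ _
          (opLe_mul ?_ (hxi a) (h1 a)))
        · push_cast; ring
        · push_cast; ring
      · exact zero_mem _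

theorem hcW_zElt_lead [NeZero n] (i : ℕ) :
    hcW n (zElt n i) - cScal n (zLead n i) ∈ opLe n (2 * (i + 1) - 1) := by
  by_cases hi : Even i
  · rw [hcW_zElt_even hi, sub_self]
    exact zero_mem _
  · rw [zElt_odd hi, hcW_wGen, zLead, if_neg hi]
    have h := (hcCol_lead (i + 1) (lastIdx n)).1
    push_cast at h
    exact h

theorem list_prod_lead {ι : Type*} (f g : ι → Cliff n) (d : ι → ℤ) (l : List ι)
    (hg : ∀ i, g i ∈ opLe n (d i)) (h : ∀ i, f i - g i ∈ opLe n (d i - 1)) :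
    (l.map g).prod ∈ opLe n (l.map d).sum ∧
    (l.map f).prod - (l.map g).prod ∈ opLe n ((l.map d).sum - 1) := by
  induction l with
  | nil =>
    simp only [List.map_nil, List.prod_nil, List.sum_nil, sub_self]
    exact ⟨opHom_le_opLe _ opHom_one, zero_mem _⟩
  | cons i l ih =>
    simp only [List.map_cons, List.prod_cons, List.sum_cons]
    refine ⟨opLe_mul rfl (hg i) ih.1, ?_⟩
    have e : f i * (l.map f).prod - g i * (l.map g).prod
        = (f i - g i) * ((l.map f).prod - (l.map g).prod) + (f i - g i) * (l.map g).prod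
          + g i * ((l.map f).prod - (l.map g).prod) := by
      rw [← mul_add, sub_add_cancel, sub_mul, mul_sub]
      abel
    rw [e]
    refine add_mem (add_mem ?_ ?_) ?_
    · exact opLe_mono (by linarith) (opLe_mul rfl (h i) ih.2)
    · exact opLe_mul (by ring) (h i) ih.1
    · exact opLe_mul (by ring) (hg i) ih.2

theorem vac_mem : vac n ∈ wSupp n (· = 0) := by
  intro S m hm
  rw [vac, Pi.single_apply] at hm
  split_ifs at hm with hS
  · subst hS
    rw [MvPolynomial.coeff_one] at hm
    split_ifs at hm with h0
    · subst h0; simp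
    · exact absurd rfl hm
  · exact absurd (MvPolynomial.coeff_zero m) hm

theorem list_prod_hom {ι : Type*} (f : ι → Cliff n) (d : ι → ℤ) (l : List ι)
    (h : ∀ i, f i ∈ opHom n (d i)) : (l.map f).prod ∈ opHom n (l.map d).sum := by
  induction l with
  | nil => exact opHom_one
  | cons i l ih =>
    simp only [List.map_cons, List.prod_cons, List.sum_cons]
    exact opHom_mul rfl (h i) ih

/-- Vectors with independent leading terms are independent. -/
theorem linearIndependent_of_lead {ι : Type*}
    (u t : ι → Finset (Fin n) → MvPolynomial (Fin n) ℂ) (d : ι → ℤ)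
    (ht : ∀ i, t i ∈ wSupp n (· = d i)) (hu : ∀ i, u i - t i ∈ wSupp n (· < d i))
    (hli : LinearIndependent ℂ t) : LinearIndependent ℂ u := by
  classical
  rw [linearIndependent_iff']
  intro s g hg
  by_contra! hne
  obtain ⟨i₁, hi₁, hgi₁⟩ := hne
  obtain ⟨i₀, hi₀, hmax⟩ := (s.filter fun i => g i ≠ 0).exists_max_image d
    ⟨i₁, Finset.mem_filter.2 ⟨hi₁, hgi₁⟩⟩
  rw [Finset.mem_filter] at hi₀
  let s' := s.filter fun i => d i = d i₀
  -- In a relation, the leading terms of maximal weight `d i₀` equal minus a sum of vectors of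
  -- smaller weight, so they form a relation among themselves.
  have h1 : ∑ i ∈ s', g i • t i = -∑ i ∈ s, g i • (if d i = d i₀ then u i - t i else u i) := by
    rw [Finset.sum_filter, eq_neg_iff_add_eq_zero, ← Finset.sum_add_distrib]
    refine Eq.trans ?_ hg
    refine Finset.sum_congr rfl fun i _ => ?_
    split_ifs
    · rw [← smul_add, add_sub_cancel]
    · rw [zero_add]
  have h2 : ∑ i ∈ s', g i • t i ∈ wSupp n (· = d i₀) := by
    refine sum_mem fun i hi => Submodule.smul_mem _ _ ?_
    rw [← (Finset.mem_filter.1 hi).2]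
    exact ht i
  have h3 : ∑ i ∈ s', g i • t i ∈ wSupp n (· < d i₀) := by
    rw [h1]
    refine neg_mem (sum_mem fun i hi => ?_)
    by_cases hgi : g i = 0
    · rw [hgi, zero_smul]
      exact zero_mem _
    refine Submodule.smul_mem _ _ ?_
    have hle := hmax i (Finset.mem_filter.2 ⟨hi, hgi⟩)
    split_ifs with hd
    · rw [← hd]
      exact hu i
    · have hlt := lt_of_le_of_ne hle hd
      have h4 := add_mem (wSupp_mono (fun e (he : e < d i) => (he.trans hlt : e < d i₀)) (hu i))
        (wSupp_mono (fun e (he : e = d i) => (he.trans_lt hlt : e < d i₀)) (ht i))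
      rwa [sub_add_cancel] at h4
  have h5 := eq_zero_of_mem_wSupp (fun e he => by
    change e = d i₀ at he
    exact not_lt.2 he.ge) h2 h3
  exact hi₀.2 ((linearIndependent_iff'.1 hli) s' g h5 i₀ (Finset.mem_filter.2 ⟨hi₀.1, rfl⟩))

/-! ### Independence of the ordered monomials -/

theorem linearIndependent_prod_of_algebraicIndependent {ι A : Type*} [CommRing A] [Algebra ℂ A]
    {x : ι → A} (hx : AlgebraicIndependent ℂ x) :
    LinearIndependent ℂ fun α : Multiset ι => (α.map x).prod := by
  classical
  have h1 := (MvPolynomial.basisMonomials ι ℂ).linearIndependent.map'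
    (MvPolynomial.aeval x).toLinearMap (LinearMap.ker_eq_bot.2 hx)
  have h2 := h1.comp _ (Multiset.toFinsupp (α := ι)).injective
  suffices h : (fun α : Multiset ι => (α.map x).prod) = ((MvPolynomial.aeval x).toLinearMap ∘
      MvPolynomial.basisMonomials ι ℂ) ∘ Multiset.toFinsupp by
    rw [h]
    exact h2
  funext α
  change _ = MvPolynomial.aeval x (MvPolynomial.basisMonomials ι ℂ (Multiset.toFinsupp α))
  rw [MvPolynomial.coe_basisMonomials]
  rw [MvPolynomial.aeval_monomial, map_one, one_mul]
  induction α using Multiset.induction_on with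
  | empty => simp
  | cons a α ih =>
    rw [Multiset.map_cons, Multiset.prod_cons, ih, ← Multiset.singleton_add, map_add,
      Finsupp.prod_add_index' (by simp) (by intros; rw [pow_add]), Multiset.toFinsupp_singleton,
      Finsupp.prod_single_index (by simp), pow_one]

/-- The weight of `∏ z_i` over `i ∈ α`. -/
def zWeight (α : Multiset (Fin n)) : ℤ :=
  ((α.sort (· ≤ ·)).map fun i : Fin n => (2 * ((i : ℕ) + 1) : ℤ)).sum

/-- The weight of `∏ Φ_k` over `k ∈ β`. -/
def phiWeight (β : Finset (Fin n)) : ℤ :=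
  ((β.sort (· ≤ ·)).map fun k : Fin n => (2 * (k : ℕ) + 1 : ℤ)).sum

theorem phiProd_mem_opHom (β : Finset (Fin n)) : phiProd β ∈ opHom n (phiWeight β) :=
  list_prod_hom _ _ _ fun k => cVec_phiSeq_mem (k : ℕ)

theorem cScal_prod_zLead [NeZero n] (α : Multiset (Fin n)) :
    cScal n (α.map fun i : Fin n => zLead n i).prod
      = ((α.sort (· ≤ ·)).map fun i : Fin n => cScal n (zLead n i)).prod := by
  conv_lhs => rw [← Multiset.sort_eq α (· ≤ ·)]
  rw [Multiset.map_coe, Multiset.prod_coe, map_list_prod, List.map_map]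
  rfl

theorem cScal_zLead_mem_opHom [NeZero n] (i : Fin n) :
    cScal n (zLead n i) ∈ opHom n (2 * ((i : ℕ) + 1)) :=
  cScal_mem_opHom (zLead_isHomogeneous i) (by push_cast; rfl)

theorem hcW_gMon [NeZero n] (α : Multiset (Fin n)) (β : Finset (Fin n)) : hcW n (gMon α β)
    = ((α.sort (· ≤ ·)).map fun i : Fin n => hcW n (zElt n i)).prod * phiProd β := by
  rw [gMon, map_mul, map_list_prod, map_list_prod, List.map_map, List.map_map, phiProd]
  congr 3
  exact funext fun k => hcW_Phi (k : ℕ)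

theorem gMon_lead_mem [NeZero n] (α : Multiset (Fin n)) (β : Finset (Fin n)) :
    (α.map fun i : Fin n => zLead n i).prod • phiProd β (vac n)
      ∈ wSupp n (· = zWeight α + phiWeight β) := by
  have h := opHom_mul rfl (list_prod_hom _ _ (α.sort (· ≤ ·)) cScal_zLead_mem_opHom)
    (phiProd_mem_opHom β) (· = zWeight α + phiWeight β) (vac n)
    (wSupp_mono (fun e (he : e = 0) => by rw [he, zero_add, zWeight]) vac_mem)
  rwa [← cScal_prod_zLead, cScal_mul] at h

theorem gMon_sub_lead_mem [NeZero n] (α : Multiset (Fin n)) (β : Finset (Fin n)) :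
    hcW n (gMon α β) (vac n) - (α.map fun i : Fin n => zLead n i).prod • phiProd β (vac n)
      ∈ wSupp n (· < zWeight α + phiWeight β) := by
  have h1 := (list_prod_lead (fun i : Fin n => hcW n (zElt n i)) _ _ (α.sort (· ≤ ·))
    (fun i => opHom_le_opLe _ (cScal_zLead_mem_opHom i)) (fun i => hcW_zElt_lead (i : ℕ))).2
  have h2 := opLe_mul rfl h1 (opHom_le_opLe _ (phiProd_mem_opHom β)) 1 (vac n)
    (wSupp_mono (fun e (he : e = 0) => by rw [he]; exact one_pos) vac_mem)
  rw [sub_mul, ← hcW_gMon, ← cScal_prod_zLead, cScal_mul] at h2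
  refine wSupp_mono (fun e (he : e < 1 + (zWeight α - 1 + phiWeight β)) => ?_) h2
  linarith

/-- Evaluation at the vacuum. -/
def evalVac (n : ℕ) : Cliff n →ₗ[ℂ] (Finset (Fin n) → MvPolynomial (Fin n) ℂ) where
  toFun T := T (vac n)
  map_add' _ _ := rfl
  map_smul' _ _ := rfl

/-- On the vacuum the leading terms are `∏ zLead` times `phiProd`. The first factors are independent
over `ℂ` and the second over the polynomial ring, hence so are the products over `ℂ`, and leading
terms suffice. -/
theorem linearIndependent_hcW_gMon (n : ℕ) [NeZero n] : LinearIndependent ℂ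
    fun x : Multiset (Fin n) × Finset (Fin n) => hcW n (gMon x.1 x.2) := by
  have h0 : LinearIndependent ℂ fun x : Multiset (Fin n) × Finset (Fin n) =>
      (x.1.map fun i : Fin n => zLead n i).prod • phiProd x.2 (vac n) :=
    linearIndependent_smul (S := MvPolynomial (Fin n) ℂ)
      (b := fun α : Multiset (Fin n) => (α.map fun i : Fin n => zLead n i).prod)
      (c := fun β : Finset (Fin n) => phiProd β (vac n))
      (linearIndependent_prod_of_algebraicIndependent (algebraicIndependent_zLead n))
      (linearIndependent_phiProd n)
  refine LinearIndependent.of_comp (evalVac n) ?_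
  exact linearIndependent_of_lead _ _ (fun x => zWeight x.1 + phiWeight x.2)
    (fun x => gMon_lead_mem x.1 x.2) (fun x => gMon_sub_lead_mem x.1 x.2) h0

theorem linearIndependent_gMon (n : ℕ) [NeZero n] : LinearIndependent ℂ
    fun x : Multiset (Fin n) × Finset (Fin n) => gMon x.1 x.2 :=
  LinearIndependent.of_comp (hcW n).toLinearMap (linearIndependent_hcW_gMon n)

theorem injective_of_linearIndependent_comp {ι V V' : Type*} [AddCommGroup V] [AddCommGroup V']
    [Module ℂ V] [Module ℂ V'] {f : V →ₗ[ℂ] V'} {v : ι → V} (hv : Submodule.span ℂ (Set.range v) = ⊤)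
    (h : LinearIndependent ℂ fun i => f (v i)) : Function.Injective f := by
  rw [injective_iff_map_eq_zero]
  intro w hw
  obtain ⟨c, rfl⟩ := Finsupp.mem_span_range_iff_exists_finsupp.1 (Submodule.eq_top_iff'.1 hv w)
  rw [linearIndependent_iff.1 h c (by
    rw [← hw, map_finsuppSum, Finsupp.linearCombination_apply]
    exact Finsupp.sum_congr fun x _ => (map_smul f _ _).symm), Finsupp.sum_zero_index]

/-- The ordered monomials span `W_χ` and have independent images: the upper and the lower bound
meet. -/
theorem hcW_injective (n : ℕ) [NeZero n] : Function.Injective (hcW n) :=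
  injective_of_linearIndependent_comp (f := (hcW n).toLinearMap) span_gMon_eq_top
    (linearIndependent_hcW_gMon n)

end

section

/-! ### Parities -/

variable {n : ℕ}

theorem one_mem_envPart : (1 : Env n) ∈ envPart n 0 :=
  Submodule.subset_span ⟨[], by simp, by simp, by simp⟩

theorem envι_mem_envPart {p : ZMod 2} {x : queer n} (hx : x ∈ queerPart n p) :
    envι n x ∈ envPart n p :=
  Submodule.subset_span ⟨[(p, x)], by simpa using hx, by simp, by simp⟩

theorem mul_mem_envPart {p q r : ZMod 2} (hr : p + q = r) {u v : Env n} (hu : u ∈ envPart n p)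
    (hv : v ∈ envPart n q) : u * v ∈ envPart n r := by
  subst hr
  have h := Submodule.mul_mem_mul hu hv
  rw [envPart, envPart, Submodule.span_mul_span] at h
  refine Submodule.span_mono ?_ h
  rintro _ ⟨_, ⟨l, h1, rfl, rfl⟩, _, ⟨l', h1', rfl, rfl⟩, rfl⟩
  refine ⟨l ++ l', fun t ht => ?_, by simp, by simp⟩
  rcases List.mem_append.1 ht with ht | ht
  · exact h1 t ht
  · exact h1' t ht

theorem sergeev_mem_envPart (m : ℕ) : ∀ i j : Fin n,
    sE m i j ∈ envPart n 0 ∧ sF m i j ∈ envPart n 1 := by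
  induction m with
  | zero =>
    intro i j
    have h1 : sE 0 i j = if i = j then 1 else 0 := rfl
    have h2 : sF 0 i j = 0 := rfl
    rw [h1, h2]
    refine ⟨?_, zero_mem _⟩
    split_ifs
    · exact one_mem_envPart
    · exact zero_mem _
  | succ m ih =>
    intro i j
    have he : ∀ k, envι n (qe i k) ∈ envPart n 0 := fun k => envι_mem_envPart (qe_even i k)
    have hf : ∀ k, envι n (qf i k) ∈ envPart n 1 := fun k => envι_mem_envPart (qf_odd i k)
    have h11 : (1 : ZMod 2) + 1 = 0 := by decide
    rw [sE_succ, sF_succ]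
    constructor
    · exact (envPart n 0).add_mem
        ((envPart n 0).sum_mem fun k _ => mul_mem_envPart (zero_add 0) (he k) (ih k j).1)
        ((envPart n 0).smul_mem _
          ((envPart n 0).sum_mem fun k _ => mul_mem_envPart h11 (hf k) (ih k j).2))
    · exact (envPart n 1).add_mem
        ((envPart n 1).sum_mem fun k _ => mul_mem_envPart (zero_add 1) (he k) (ih k j).2)
        ((envPart n 1).smul_mem _
          ((envPart n 1).sum_mem fun k _ => mul_mem_envPart (add_zero 1) (hf k) (ih k j).1))

theorem HasParity.mul {p q r : ZMod 2} (hr : p + q = r) {w w' : W n} (hw : HasParity p w)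
    (hw' : HasParity q w') : HasParity r (w * w') := by
  obtain ⟨y, hy, h⟩ := hw
  obtain ⟨y', hy', h'⟩ := hw'
  refine ⟨y * y', mul_mem_envPart hr hy hy', ?_⟩
  rw [toWhit_mul (h.trans (proj_eq y)), h', ← map_smul, smul_eq_mul]

theorem HasParity.add {p : ZMod 2} {w w' : W n} (hw : HasParity p w) (hw' : HasParity p w') :
    HasParity p (w + w') := by
  obtain ⟨y, hy, h⟩ := hw
  obtain ⟨y', hy', h'⟩ := hw'
  refine ⟨y + y', add_mem hy hy', ?_⟩
  rw [map_add, ← h, ← h']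
  exact map_add (toWhitL n) w w'

theorem HasParity.smul {p : ZMod 2} (c : ℂ) {w : W n} (hw : HasParity p w) :
    HasParity p (c • w) := by
  obtain ⟨y, hy, h⟩ := hw
  refine ⟨c • y, Submodule.smul_mem _ c hy, ?_⟩
  rw [proj_eq, smul_assoc, ← proj_eq, ← h]
  exact map_smul (toWhitL n) c w

theorem wE_hasParity [NeZero n] (m : ℕ) : HasParity 0 (wE n m) :=
  ⟨_, (sergeev_mem_envPart m _ _).1, toWhit_ofInvariant _ _⟩

theorem wF_hasParity [NeZero n] (m : ℕ) : HasParity 1 (wF n m) :=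
  ⟨_, (sergeev_mem_envPart m _ _).2, toWhit_ofInvariant _ _⟩

theorem Phi_hasParity [NeZero n] (k : ℕ) : HasParity 1 (Phi n k) := by
  induction k with
  | zero => exact wF_hasParity n
  | succ k ih =>
    have h : Phi n (k + 1) = (1 / 2 : ℂ) • (wE n (n + 1) * Phi n k)
        + (-(1 / 2) : ℂ) • (Phi n k * wE n (n + 1)) := by
      change (1 / 2 : ℂ) • (wE n (n + 1) * Phi n k - Phi n k * wE n (n + 1)) = _
      module
    rw [h]
    exact (((wE_hasParity _).mul (zero_add 1) ih).smul _).add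
      ((ih.mul (add_zero 1) (wE_hasParity _)).smul _)

theorem zElt_hasParity [NeZero n] (i : ℕ) : HasParity 0 (zElt n i) := by
  rw [zElt]
  split_ifs
  · exact ((Phi_hasParity 0).mul (by decide) (Phi_hasParity i)).add
      ((Phi_hasParity i).mul (by decide) (Phi_hasParity 0))
  · exact wE_hasParity _

/-! ### Commutation relations and central elements -/

theorem mem_center_of_hcW [NeZero n] {w : W n} {r : MvPolynomial (Fin n) ℂ}
    (h : hcW n w = cScal n r) : w ∈ Subalgebra.center ℂ (W n) := by
  rw [Subalgebra.mem_center_iff]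
  intro w'
  apply hcW_injective n
  rw [map_mul, map_mul, h, cScal_comm]

/-- For even index the image is a scalar and the element is central; two elements of odd index
commute by the computation in `U`. -/
theorem zElt_comm [NeZero n] (i j : ℕ) : zElt n i * zElt n j = zElt n j * zElt n i := by
  by_cases hi : Even i
  · exact ((Subalgebra.mem_center_iff.1 (mem_center_of_hcW (hcW_zElt_even hi))) _).symm
  by_cases hj : Even j
  · exact (Subalgebra.mem_center_iff.1 (mem_center_of_hcW (hcW_zElt_even hj))) _
  · exact zElt_odd_comm hi hj

theorem two_smul_phiForm_eq (m p : ℕ) :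
    (2 : ℂ) • phiForm (MvPolynomial.X : Fin n → MvPolynomial (Fin n) ℂ)
      (phiSeq MvPolynomial.X m) (phiSeq MvPolynomial.X p)
    = (-1 : ℂ) ^ m • (2 : ℂ) • ∑ i, MvPolynomial.X i * phiSeq MvPolynomial.X (m + p) i := by
  rw [phiForm_eq, phiForm_zero]
  rcases m.even_or_odd with hm | hm
  · rw [hm.neg_one_pow, hm.neg_one_pow, one_mul, one_smul]
  · rw [hm.neg_one_pow, hm.neg_one_pow, neg_one_mul, smul_neg, neg_one_smul]

theorem Phi_anticomm [NeZero n] (m p : ℕ) : Phi n m * Phi n p + Phi n p * Phi n m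
    = if Even (m + p) then (-1 : ℂ) ^ m • zElt n (m + p) else 0 := by
  apply hcW_injective n
  rw [hcW_Phi_anticomm]
  split_ifs with h
  · rw [map_smul (hcW n), hcW_zElt_even h, zLead, if_pos h, two_smul_phiForm_eq, map_smul (cScal n)]
  · rw [phiForm_eq, phiForm_odd _ (Nat.not_even_iff_odd.1 h), mul_zero, smul_zero, map_zero,
      map_zero]

theorem whit_invariant_of_central {c : Env n} (hc : c ∈ Subalgebra.center ℂ (Env n))
    {u : Env n} (hu : u ∈ whitIdeal n) : u * c ∈ whitIdeal n := by
  rw [Subalgebra.mem_center_iff.1 hc u]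
  exact (whitIdeal n).smul_mem c hu

theorem shiftLetter_mem_whitIdeal (x : Bool × Fin n × Fin n) (hx : x.2.2 < x.2.1) :
    shiftLetter x ∈ whitIdeal n := by
  have h := shiftLetter_smul_whitOne x hx
  rw [← proj_eq] at h
  exact (Submodule.Quotient.mk_eq_zero _).1 h

/-- The polynomials that are Harish-Chandra images of even central elements. -/
def centralImage (n : ℕ) : Subalgebra ℂ (MvPolynomial (Fin n) ℂ) where
  carrier := {r | ∃ c ∈ Subalgebra.center ℂ (Env n), c ∈ envPart n 0 ∧ hc n c = cScal n r}
  mul_mem' := by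
    rintro r s ⟨c, h1, h2, h3⟩ ⟨d, k1, k2, k3⟩
    refine ⟨c * d, mul_mem h1 k1, mul_mem_envPart (zero_add 0) h2 k2, ?_⟩
    -- A central element is invariant, so the projection is multiplicative on central elements.
    rw [hc_mul c fun x hx => whit_invariant_of_central k1 (shiftLetter_mem_whitIdeal x hx), h3, k3,
      map_mul]
  add_mem' := by
    rintro r s ⟨c, h1, h2, h3⟩ ⟨d, k1, k2, k3⟩
    exact ⟨c + d, add_mem h1 k1, add_mem h2 k2, by rw [map_add, map_add, h3, k3]⟩
  algebraMap_mem' := fun a => by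
    refine ⟨algebraMap ℂ _ a, Subalgebra.algebraMap_mem _ a, ?_, ?_⟩
    · rw [Algebra.algebraMap_eq_smul_one]
      exact Submodule.smul_mem _ a one_mem_envPart
    · rw [Algebra.algebraMap_eq_smul_one, map_smul, hc_one, Algebra.algebraMap_eq_smul_one,
        map_smul, map_one]

/-- The images of `∑_k e_{k,k}^{(2r+1)}` generate the odd power sums, and these generate the
coefficients of the generating function. -/
theorem sum_phiSeq_mem_centralImage (k : ℕ) :
    ∑ i : Fin n, MvPolynomial.X i * phiSeq MvPolynomial.X k i ∈ centralImage n := by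
  refine phiSum_mem _ (fun r => odd_psum_mem_of_recursion _ (hcG n) (fun _ => rfl)
    (fun _ _ => rfl) (fun r => ?_) r) k
  exact ⟨_, sum_sE_mem_center r, sum_mem fun k _ => (sergeev_mem_envPart _ _ _).1, hc_sum_sE r⟩

/-- The central element defines an invariant with the same image as `w`, so injectivity of `hcW`
identifies the two. -/
theorem exists_central_preimage [NeZero n] {w : W n} {r : MvPolynomial (Fin n) ℂ}
    (hr : r ∈ centralImage n) (h : hcW n w = cScal n r) :
    ∃ c ∈ Subalgebra.center ℂ (Env n), c ∈ envPart n 0 ∧ toWhit w = proj n c := by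
  obtain ⟨c, h1, h2, h3⟩ := hr
  refine ⟨c, h1, h2, ?_⟩
  have hy : ∀ a ∈ nilp n, (envι n a - algebraMap ℂ (Env n) (chi n a)) * c ∈ whitIdeal n :=
    fun a ha => whit_invariant_of_central h1 (Submodule.subset_span ⟨a, ha, rfl⟩)
  have h4 : ofInvariant c hy = w := by
    apply hcW_injective n
    rw [hcW_eq (toWhit_ofInvariant c hy), h3, h]
  rw [← h4, toWhit_ofInvariant]

/-! ### Algebraic independence -/

open scoped IsMulCommutative in
-- Polynomial evaluation requires a commutative target, so it is performed in the commutative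
-- subalgebra generated by the `x i`.
theorem exists_algHom_of_commute {ι A : Type*} [Ring A] [Algebra ℂ A] (x : ι → A)
    (hx : ∀ i j, x i * x j = x j * x i) :
    ∃ F : MvPolynomial ι ℂ →ₐ[ℂ] A, ∀ i, F (MvPolynomial.X i) = x i := by
  have : IsMulCommutative (Algebra.adjoin ℂ (Set.range x)) := Algebra.isMulCommutative_adjoin ℂ (by
    rintro _ ⟨i, rfl⟩ _ ⟨j, rfl⟩
    exact hx i j)
  let y : ι → Algebra.adjoin ℂ (Set.range x) := fun i => ⟨x i, Algebra.subset_adjoin ⟨i, rfl⟩⟩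
  refine ⟨(Algebra.adjoin ℂ (Set.range x)).val.comp (MvPolynomial.aeval y), fun i => ?_⟩
  rw [AlgHom.comp_apply, MvPolynomial.aeval_X]
  rfl

theorem algHom_monomial_eq_gMon [NeZero n] (F : MvPolynomial (Fin n) ℂ →ₐ[ℂ] W n)
    (hF : ∀ i : Fin n, F (MvPolynomial.X i) = zElt n i) (α : Multiset (Fin n)) :
    F (α.map MvPolynomial.X).prod = gMon α ∅ := by
  rw [gMon, Finset.sort_empty, List.map_nil, List.prod_nil, mul_one]
  conv_lhs => rw [← Multiset.sort_eq α (· ≤ ·)]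
  rw [Multiset.map_coe, Multiset.prod_coe, map_list_prod, List.map_map]
  congr 2
  exact funext hF

theorem span_X_prod_eq_top {ι : Type*} : Submodule.span ℂ (Set.range fun α : Multiset ι =>
    (α.map (MvPolynomial.X : ι → MvPolynomial ι ℂ)).prod) = ⊤ := by
  rw [eq_top_iff]
  intro p _
  induction p using MvPolynomial.induction_on with
  | C a =>
    rw [← mul_one (MvPolynomial.C a), ← MvPolynomial.smul_eq_C_mul]
    exact Submodule.smul_mem _ _ (Submodule.subset_span ⟨0, by simp⟩)
  | add p q hp hq => exact add_mem (hp trivial) (hq trivial)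
  | mul_X p i hp =>
    replace hp := hp trivial
    clear * - hp
    induction hp using Submodule.span_induction with
    | mem q hq =>
      obtain ⟨α, rfl⟩ := hq
      exact Submodule.subset_span ⟨i ::ₘ α, by simp [mul_comm]⟩
    | zero => rw [zero_mul]; exact zero_mem _
    | add q q' _ _ hq hq' => rw [add_mul]; exact add_mem hq hq'
    | smul c q _ hq => rw [smul_mul_assoc]; exact Submodule.smul_mem _ _ hq

/-- Monomials are sent to the ordered monomials with `β = ∅`, which are part of an independent
family. -/
theorem exists_injective_zElt (n : ℕ) [NeZero n] : ∃ F : MvPolynomial (Fin n) ℂ →ₐ[ℂ] W n,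
    (∀ i : Fin n, F (MvPolynomial.X i) = zElt n i) ∧ Function.Injective F := by
  obtain ⟨F, hF⟩ := exists_algHom_of_commute (fun i : Fin n => zElt n i) fun i j => zElt_comm _ _
  refine ⟨F, hF, injective_of_linearIndependent_comp (f := F.toLinearMap) span_X_prod_eq_top ?_⟩
  have h := (linearIndependent_gMon n).comp (fun α : Multiset (Fin n) => (α, ∅))
    fun α α' h => (Prod.ext_iff.1 h).1
  suffices e : (fun α : Multiset (Fin n) => F.toLinearMap (α.map MvPolynomial.X).prod)
      = fun α => gMon α ∅ by
    rw [e]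
    exact h
  exact funext fun α => algHom_monomial_eq_gMon F hF α

end

end

end QueerW

theorem mainTheorem7 (n : ℕ) [NeZero n] :
    -- the `z_i` are even, the `Φ_k` are odd
    (∀ i : ℕ, HasParity 0 (zElt n i)) ∧ (∀ k : ℕ, HasParity 1 (Phi n k)) ∧
    -- `z_0, …, z_{n-1}` are algebraically independent
    (∃ F : MvPolynomial (Fin n) ℂ →ₐ[ℂ] W n,
      (∀ i : Fin n, F (MvPolynomial.X i) = zElt n i) ∧ Function.Injective F) ∧
    -- together with `Φ_0, …, Φ_{n-1}` they generate `W_χ`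
    Algebra.adjoin ℂ (Set.range (fun i : Fin n => zElt n i) ∪
      Set.range (fun k : Fin n => Phi n k)) = ⊤ ∧
    -- the even elements `z_i` commute
    (∀ i j : ℕ, zElt n i * zElt n j = zElt n j * zElt n i) ∧
    -- the supercommutators of the odd elements
    (∀ m p : ℕ, Phi n m * Phi n p + Phi n p * Phi n m =
      if Even (m + p) then (-1 : ℂ) ^ m • zElt n (m + p) else 0) ∧
    -- they lie in the center of `W_χ`
    (∀ m p : ℕ, Phi n m * Phi n p + Phi n p * Phi n m ∈ Subalgebra.center ℂ (W n)) ∧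
    -- and are images of even central elements of the enveloping algebra
    (∀ m p : ℕ, ∃ c ∈ Subalgebra.center ℂ (Env n), c ∈ envPart n 0 ∧
      toWhit (Phi n m * Phi n p + Phi n p * Phi n m) = proj n c) := by
  refine ⟨zElt_hasParity, Phi_hasParity, exists_injective_zElt n, adjoin_gens_eq_top, zElt_comm,
    Phi_anticomm, fun m p => mem_center_of_hcW (hcW_Phi_anticomm m p), fun m p => ?_⟩
  refine exists_central_preimage ?_ (hcW_Phi_anticomm m p)
  rw [two_smul_phiForm_eq]
  exact Subalgebra.smul_mem _ (Subalgebra.smul_mem _ (sum_phiSeq_mem_centralImage _) _) _
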